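/- **Data.** Let $p_\pm\in\mathbb N_0$, $p=p_-+p_+-1\ge 1$, let $E_0,\dots,E_{2p+1}\in\mathbb C\setminus\{0\}$ be pairwise distinct, and $c_{0,\pm}\in\mathbb C\setminus\{0\}$ with $c_{0,-}^2=c_{0,+}^2\prod_m E_m$; fix the root $(\prod_{m}E_m)^{1/2}:=(-1)^{p+1}c_{0,-}/c_{0,+}$. Put $R(z)=\big(\tfrac{c_{0,+}}{2z^{p_-}}\big)^2\prod_{m=0}^{2p+1}(z-E_m)$ and let $\mathcal K_p$ be the compactification of $y^2=\prod_m(z-E_m)$ by $P_{\infty_\pm}$, with $y=\mp\zeta^{-p-1}(1+O(\zeta))$, $\zeta=1/z$, near $P_{\infty_\pm}$; let $P_{0,\pm}=(0,\pm c_{0,-}/c_{0,+})$. Let $c_k(\underline E^{\pm1})$ and $\hat c_k(\underline E^{\pm1})$ be the coefficients of $\eta^k$ in $\prod_m(1-E_m^{\pm1}\eta)^{1/2}$ and $\prod_m(1-E_m^{\pm1}\eta)^{-1/2}$, and $c_{\ell,\pm}=c_{0,\pm}c_\ell(\underline E^{\pm1})$. Let $r_\pm\in\mathbb N_0$, $\tilde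 c_{\ell,\pm}\in\mathbb C$ ($\ell\ge 0$), $n_0\in\mathbb Z$, $t_0\in\mathbb R$, $T_0>0$, $I=(t_0-T_0,t_0+T_0)$. A superscript $\pm$ on a sequence is the shift $n\mapsto n\pm1$. **Ablowitz–Ladik expressions of sequences $\alpha,\beta:\mathbb Z\to\mathbb C$.** Let $\hat g_{0,\pm}=\tfrac12$, $\hat f_{0,+}=-\alpha^+$, $\hat h_{0,+}=\beta$, $\hat f_{0,-}=\alpha$, $\hat h_{0,-}=-\beta^+$ and $$\hat g_{\ell+1,+}=\sum_{k=0}^{\ell}\hat f_{\ell-k,+}\hat h_{k,+}-\sum_{k=1}^{\ell}\hat g_{\ell+1-k,+}\hat g_{k,+},\quad \hat f^-_{\ell+1,+}=\hat f_{\ell,+}-\alpha(\hat g_{\ell+1,+}+\hat g^-_{\ell+1,+}),\quad \hat h_{\ell+1,+}=\hat h^-_{\ell,+}+\beta(\hat g_{\ell+1,+}+\hat g^-_{\ell+1,+});$$ $\hat f_{\ell,-},\hat g_{\ell,-},\hat h_{\ell,-}$ are obtained from $\hat h_{\ell,+},\hat g_{\ell,+},\hat f_{\ell,+}$ by exchanging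 $\alpha$ and $\beta$. (They satisfy $\hat g_{\ell+1,+}-\hat g^-_{\ell+1,+}=\alpha\hat h^-_{\ell,+}+\beta\hat f_{\ell,+}$ and $\hat g_{\ell+1,-}-\hat g_{\ell+1,-}^-=\alpha\hat h_{\ell,-}+\beta\hat f_{\ell,-}^-$.) Put $f_{\ell,\pm}=\sum_{k=0}^\ell c_{\ell-k,\pm}\hat f_{k,\pm}$, similarly $g_{\ell,\pm},h_{\ell,\pm}$, and $\tilde f_{\ell,\pm},\tilde g_{\ell,\pm},\tilde h_{\ell,\pm}$ with $\tilde c$ in place of $c$; quantities with negative index are $0$. For coefficients $f,g,h$ let $$F_{\underline p}=\sum_{\ell=1}^{p_-}f_{p_--\ell,-}z^{-\ell}+\sum_{\ell=0}^{p_+-1}f_{p_+-1-\ell,+}z^\ell,\quad G_{\underline p}=\sum_{\ell=1}^{p_-}g_{p_--\ell,-}z^{-\ell}+\sum_{\ell=0}^{p_+}g_{p_+-\ell,+}z^\ell,$$ $$H_{\underline p}=\sum_{\ell=0}^{p_--1}h_{p_--1-\ell,-}z^{-\ell}+\sum_{\ell=1}^{p_+}h_{p_+-\ell,+}z^\ell,$$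 and let $\widetilde F_{\underline r},\widetilde G_{\underline r},\widetilde H_{\underline r}$ be formed in the same way with $r_\pm$ and the tilde coefficients, $\widetilde K_{\underline r}=\sum_{\ell=0}^{r_-}\tilde g_{r_--\ell,-}z^{-\ell}+\sum_{\ell=1}^{r_+}\tilde g_{r_+-\ell,+}z^\ell$. For $z\in\mathbb C\setminus\{0\}$ put $$U=\begin{pmatrix}z&\alpha\\z\beta&1\end{pmatrix},\quad V_{\underline p}=i\begin{pmatrix}G_{\underline p}^-&-F_{\underline p}^-\\H_{\underline p}^-&-G_{\underline p}^-\end{pmatrix},\quad \widetilde V_{\underline r}=i\begin{pmatrix}\widetilde G_{\underline r}^-&-\widetilde F_{\underline r}^-\\\widetilde H_{\underline r}^-&-\widetilde K_{\underline r}^-\end{pmatrix}.$$ Call $(\alpha,\beta)$ a *stationary solution* if for all $n$: $\alpha\beta\notin\{0,1\}$, $g_{p_+,+}=g_{p_-,-}$, $G_{\underline p}^2-F_{\underline p}H_{\underline p}=R$ and $$\mathrm{s\text{-}AL}_{\underline p}(\alpha,\beta)=\begin{pmatrix}-\alpha(g_{p_+,+}+g_{p_-,-}^-)+f_{p_+-1,+}-f_{p_--1,-}^-\\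 \beta(g_{p_+,+}^-+g_{p_-,-})-h_{p_--1,-}+h^-_{p_+-1,+}\end{pmatrix}=0 .$$ **Divisors.** A nonnegative divisor $\mathcal D$ of degree $p$ on $\mathcal K_p$ is *admissible* if it contains none of $P_{\infty_\pm},P_{0,\pm}$. $\mathcal M_0$ is the set of such $\mathcal D$ for which, for every $n\in\mathbb Z$, all nonnegative degree-$p$ divisors linearly equivalent to $\mathcal D+n(P_{\infty_+}-P_{0,-})$ or to $\mathcal D+P_{\infty_-}-P_{0,-}+n(P_{\infty_+}-P_{0,-})$ are admissible. $\mathcal D=\sum_k p_k\hat\mu_k$ ($\hat\mu_1,\dots,\hat\mu_q$ distinct, $\hat\mu_k=(\mu_k,y(\hat\mu_k))$) is the *Dirichlet divisor* of $(F,G)$ if $F=a\,z^{-p_-}\prod_k(z-\mu_k)^{p_k}$ with $a\neq0$, all $\mu_k$ finite and nonzero, and $y(\hat\mu_k)=\tfrac{2}{c_{0,+}}\mu_k^{p_-}G(\mu_k)$. Given $a\ne0$ and such a $\mathcal D$, the *stationary data* of $(a,\mathcal D)$ are the Laurent polynomials $F,G,H$ with, for $a^+=a(\prod_mE_m)^{1/2}\prod_k\mu_k^{-p_k}$,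 $$F(z)=-c_{0,+}a^+z^{-p_-}\prod_{k}(z-\mu_k)^{p_k},\qquad G^2-R=FH,$$ $$G(z)=\frac12\Big(\frac1a-\frac z{a^+}\Big)F(z)-\frac{z}{2a^+}F(z)\sum_{k=1}^{q}\sum_{\ell=0}^{p_k-1}\frac{\big(d^\ell(\zeta^{-1}y(P))/d\zeta^\ell\big)\big|_{P=(\zeta,\eta)=\hat\mu_k}}{\ell!\,(p_k-\ell-1)!}\,\frac{d^{p_k-\ell-1}}{d\zeta^{p_k-\ell-1}}\Big(\frac1{z-\zeta}\prod_{k'\ne k}(\zeta-\mu_{k'})^{-p_{k'}}\Big)\Big|_{\zeta=\mu_k}$$ for $z\in\mathbb C\setminus\{0\}$, $z\ne\mu_1,\dots,\mu_q$. **The autonomous system.** Let $f_{\ell,\pm},h_{\ell,\pm}$ $(0\le\ell\le p_\pm-1)$ and $g_{\ell,\pm}$ $(0\le\ell\le p_\pm)$ be functions of $t\in I$ and let $F,G,H$ be the Laurent polynomials with these coefficients; write $[X]_j$ for the coefficient of $z^j$ in $X$. In the following system, put $$\hat f_{\ell,+}=\tfrac1{c_{0,+}}\sum_{k=0}^\ell\hat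 c_{\ell-k}(\underline E)[F]_{p_+-1-k},\quad \hat g_{\ell,+}=\tfrac1{c_{0,+}}\sum_{k=0}^\ell\hat c_{\ell-k}(\underline E)[G]_{p_+-k},\quad \hat h_{\ell,+}=\tfrac1{c_{0,+}}\sum_{k=0}^\ell\hat c_{\ell-k}(\underline E)[H]_{p_+-k},$$ $$\hat f_{\ell,-}=\tfrac1{c_{0,-}}\sum_{k=0}^\ell\hat c_{\ell-k}(\underline E^{-1})[F]_{k-p_-},\quad \hat g_{\ell,-}=\tfrac1{c_{0,-}}\sum_{k=0}^\ell\hat c_{\ell-k}(\underline E^{-1})[G]_{k-p_-},\quad \hat h_{\ell,-}=\tfrac1{c_{0,-}}\sum_{k=0}^\ell\hat c_{\ell-k}(\underline E^{-1})[H]_{k+1-p_-},$$ and $\tilde f_{j,\pm}=\sum_{k=0}^j\tilde c_{j-k,\pm}\hat f_{k,\pm}$ for $j\ge0$, $\tilde f_{j,\pm}=0$ for $j<0$, similarly $\tilde g,\tilde h$. The system is, on $I$, $$\dot f_{\ell,\pm}=i f_{\ell,\pm}(\tilde g_{r_\pm,\pm}-\tilde g_{r_\mp,\mp})+2i\sum_{k=0}^{\ell}\big(f_{k,\pm}(\tilde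 g_{r_\mp-\ell+k,\mp}-\tilde g_{r_\pm+\ell-k,\pm})+g_{k,\pm}(\tilde f_{r_\pm+\ell-k,\pm}-\tilde f_{r_\mp-1-\ell+k,\mp})\big),\quad 0\le\ell\le p_\pm-1,$$ $$\dot g_{\ell,\pm}=i\sum_{k=0}^{\ell-1}\big(f_{k,\pm}(\tilde h_{r_\mp-\ell+k,\mp}-\tilde h_{r_\pm-1+\ell-k,\pm})+h_{k,\pm}(\tilde f_{r_\pm-1+\ell-k,\pm}-\tilde f_{r_\mp-\ell+k,\mp})\big),\quad 0\le\ell\le p_\pm,$$ $$\dot h_{\ell,\pm}=i h_{\ell,\pm}(\tilde g_{r_\mp,\mp}-\tilde g_{r_\pm,\pm})+2i\sum_{k=0}^{\ell}\big(g_{k,\pm}(\tilde h_{r_\mp-1-\ell+k,\mp}-\tilde h_{r_\pm+\ell-k,\pm})+h_{k,\pm}(\tilde g_{r_\pm+\ell-k,\pm}-\tilde g_{r_\mp-\ell+k,\mp})\big),\quad 0\le\ell\le p_\pm-1.$$ **Stationary algorithm.** From $(F,G,H)$ at a lattice point read off $\alpha=[F]_{-p_-}/c_{0,-}$, $\beta=[H]_{p_+}/c_{0,+}$,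 $\alpha^+=-[F]_{p_+-1}/c_{0,+}$, $\beta^+=-[H]_{1-p_-}/c_{0,-}$, $\gamma=1-\alpha\beta$, $\gamma^+=1-\alpha^+\beta^+$, and pass to the neighbouring points by $$F^+=\frac{(\alpha^+)^2H+2\alpha^+zG+z^2F}{z\gamma^+},\quad G^+=\frac{(1+\alpha^+\beta^+)zG+\alpha^+H+\beta^+z^2F}{z\gamma^+},\quad H^+=\frac{(\beta^+z)^2F+2\beta^+zG+H}{z\gamma^+},$$ $$F^-=\frac{\alpha^2H-2\alpha G+F}{z\gamma},\quad G^-=\frac{(1+\alpha\beta)G-\alpha H-\beta F}{\gamma},\quad H^-=\frac{z(\beta^2F-2\beta G+H)}{\gamma}.$$ **Theorem.** Suppose that $f_{\ell,\pm}(n_0,\cdot),g_{\ell,\pm}(n_0,\cdot),h_{\ell,\pm}(n_0,\cdot)$ satisfy the autonomous system on $I$, that for every $t\in I$ the pair $(F,G)(\cdot,n_0,t)$ has a Dirichlet divisor $\mathcal D(t)$ and $\mathcal D(t)\in\mathcal M_0$, and that the initial values are those determined by the initial divisor: for some $a_0\ne0$, $(F,G,H)(\cdot,n_0,t_0)$ are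 the stationary data of $(a_0,\mathcal D(t_0))$, and $g_{p_-,-}(n_0,t_0)=g_{p_+,+}(n_0,t_0)$. Let $F_{\underline p},G_{\underline p},H_{\underline p}(z,n,t)$ and $\alpha(n,t),\beta(n,t)$, $n\in\mathbb Z$, $t\in I$, be produced by the stationary algorithm from $n_0$ at each fixed $t$. Then the following holds on $\mathbb Z\times I$ (and for all $z\in\mathbb C\setminus\{0\}$). 1. $U$ and $V_{\underline p}$ are differentiable in $t$ and $$U_t+U\widetilde V_{\underline r}-\widetilde V_{\underline r}^+U=0,\qquad UV_{\underline p}-V_{\underline p}^+U=0,\qquad V_{\underline p,t}-[\widetilde V_{\underline r},V_{\underline p}]=0,$$ where $V_{\underline p}$ is built from the constructed $F_{\underline p},G_{\underline p},H_{\underline p}$, and $\widetilde V_{\underline r}$ is built from the constructed $\alpha(\cdot,t),\beta(\cdot,t)$. 2. $\alpha(n,\cdot),\beta(n,\cdot)\in C^1(I)$, $\alpha\beta\notin\{0,1\}$, and $$\begin{pmatrix}-i\alpha_t-\alpha(\tilde g_{r_+,+}+\tilde g_{r_-,-}^-)+\tilde f_{r_+-1,+}-\tilde f_{r_--1,-}^-\\-i\beta_t+\beta(\tilde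 g_{r_+,+}^-+\tilde g_{r_-,-})-\tilde h_{r_--1,-}+\tilde h_{r_+-1,+}^-\end{pmatrix}=0 .$$ 3. For every $t\in I$, in particular for $t=t_0$, $(\alpha(\cdot,t),\beta(\cdot,t))$ is a stationary solution, and the constructed $F_{\underline p},G_{\underline p},H_{\underline p}$ are the Laurent polynomials attached to it. The initial condition holds: $\alpha(n_0,t_0)=a_0$, and every stationary solution $(\alpha^{(0)},\beta^{(0)})$ with $\alpha^{(0)}(n_0)=a_0$ whose Dirichlet divisor at $n_0$ is $\mathcal D(t_0)$ equals $(\alpha,\beta)(\cdot,t_0)$. 4. At every $(n,t)$ the pair $(F_{\underline p},G_{\underline p})$ has a Dirichlet divisor $\sum_k p_k\hat\mu_k$ (depending on $(n,t)$), $(F_{\underline p},G_{\underline p},H_{\underline p})$ are the stationary data of $\alpha(n,t)$ and this divisor, and $$\alpha^+=\alpha\Big(\prod_{m=0}^{2p+1}E_m\Big)^{1/2}\prod_{k=1}^q\mu_k^{-p_k},$$ $$\alpha^+\beta=-\frac12\sum_{k=1}^{q}\frac1{(p_k-1)!}\frac{d^{p_k-1}}{d\zeta^{p_k-1}}\Big(\zeta^{-1}y(P)\prod_{k'\neq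 k}(\zeta-\mu_{k'})^{-p_{k'}}\Big)\Big|_{P=(\zeta,\eta)=\hat\mu_k}+\frac12\bigg(\Big(\prod_{m=0}^{2p+1}E_m\Big)^{1/2}\prod_{k=1}^q\mu_k^{-p_k}+\sum_{k=1}^qp_k\mu_k-\frac12\sum_{m=0}^{2p+1}E_m\bigg).$$ -/

import Mathlib

open scoped LaurentPolynomial

noncomputable section

namespace AblowitzLadik

open Classical in
/-- Extension of a sequence by zero to negative indices. -/
def ext0 (a : ℕ → ℂ) (j : ℤ) : ℂ := if 0 ≤ j then a j.toNat else 0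

/-- Discrete convolution `∑_{k=0}^{ℓ} c_{ℓ-k} a_k`. -/
def conv (c a : ℕ → ℂ) (ℓ : ℕ) : ℂ := ∑ k ∈ Finset.range (ℓ + 1), c (ℓ - k) * a k

/-! ### Homogeneous Ablowitz-Ladik coefficients on the lattice

Throughout, a superscript sign is encoded by a Boolean: `true` is `+`, `false` is `-`. -/

/-- The triple `(f̂_{ℓ,+}, ĝ_{ℓ,+}, ĥ_{ℓ,+})` attached to `α, β`.  The `f̂` and `ĥ` recursions are
`f̂⁻_{ℓ+1} = f̂_ℓ - α (ĝ_{ℓ+1} + ĝ⁻_{ℓ+1})`, `ĥ_{ℓ+1} = ĥ⁻_ℓ + β (ĝ_{ℓ+1} + ĝ⁻_{ℓ+1})`.  The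
first-order difference equation `ĝ_{ℓ+1} - ĝ⁻_{ℓ+1} = α ĥ⁻_ℓ + β f̂_ℓ` is solved by the local
expression without constant term (vanishing summation constants) that is written out below;
that it solves the difference equation is `hat_plus_recursion`. -/
def hatPlus (α β : ℤ → ℂ) : ℕ → (ℤ → ℂ) × (ℤ → ℂ) × (ℤ → ℂ)
  | 0 => (fun n => -α (n + 1), fun _ => 1 / 2, β)
  | ℓ + 1 =>
    let g : ℤ → ℂ := fun n =>
      ∑ k : Fin (ℓ + 1), (hatPlus α β (ℓ - k.1)).1 n * (hatPlus α β k.1).2.2 n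
        - ∑ k : Fin ℓ, (hatPlus α β (ℓ - k.1)).2.1 n * (hatPlus α β (k.1 + 1)).2.1 n
    (fun n => (hatPlus α β ℓ).1 (n + 1) - α (n + 1) * (g (n + 1) + g n),
     g,
     fun n => (hatPlus α β ℓ).2.2 (n - 1) + β n * (g n + g (n - 1)))
  termination_by ℓ => ℓ
  decreasing_by all_goals omega

/-- `f̂_{ℓ,±}(n)`.  The `-` coefficients arise from the `+` ones by the symmetry
`(α, f, h) ↔ (β, h, f)`; see `hat_minus_recursion`. -/
def fHat (α β : ℤ → ℂ) (s : Bool) (ℓ : ℕ) (n : ℤ) : ℂ :=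
  if s then (hatPlus α β ℓ).1 n else (hatPlus β α ℓ).2.2 n

/-- `ĝ_{ℓ,±}(n)`. -/
def gHat (α β : ℤ → ℂ) (s : Bool) (ℓ : ℕ) (n : ℤ) : ℂ :=
  if s then (hatPlus α β ℓ).2.1 n else (hatPlus β α ℓ).2.1 n

/-- `ĥ_{ℓ,±}(n)`. -/
def hHat (α β : ℤ → ℂ) (s : Bool) (ℓ : ℕ) (n : ℤ) : ℂ :=
  if s then (hatPlus α β ℓ).2.2 n else (hatPlus β α ℓ).1 n

theorem hatPlus_zero (α β : ℤ → ℂ) :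
    hatPlus α β 0 = (fun n => -α (n + 1), fun _ => 1 / 2, β) := by
  rw [hatPlus]

theorem hatPlus_g_succ (α β : ℤ → ℂ) (ℓ : ℕ) (n : ℤ) :
    (hatPlus α β (ℓ + 1)).2.1 n =
      ∑ k ∈ Finset.range (ℓ + 1), (hatPlus α β (ℓ - k)).1 n * (hatPlus α β k).2.2 n
        - ∑ k ∈ Finset.range ℓ, (hatPlus α β (ℓ - k)).2.1 n * (hatPlus α β (k + 1)).2.1 n := by
  rw [hatPlus]
  simp only
  rw [Finset.sum_range, Finset.sum_range]

theorem hatPlus_f_succ (α β : ℤ → ℂ) (ℓ : ℕ) (n : ℤ) :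
    (hatPlus α β (ℓ + 1)).1 n = (hatPlus α β ℓ).1 (n + 1)
      - α (n + 1) * ((hatPlus α β (ℓ + 1)).2.1 (n + 1) + (hatPlus α β (ℓ + 1)).2.1 n) := by
  rw [hatPlus_g_succ, hatPlus_g_succ, Finset.sum_range, Finset.sum_range, Finset.sum_range,
    Finset.sum_range]
  conv_lhs => rw [hatPlus]

theorem hatPlus_h_succ (α β : ℤ → ℂ) (ℓ : ℕ) (n : ℤ) :
    (hatPlus α β (ℓ + 1)).2.2 n = (hatPlus α β ℓ).2.2 (n - 1)
      + β n * ((hatPlus α β (ℓ + 1)).2.1 n + (hatPlus α β (ℓ + 1)).2.1 (n - 1)) := by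
  rw [hatPlus_g_succ, hatPlus_g_succ, Finset.sum_range, Finset.sum_range, Finset.sum_range,
    Finset.sum_range]
  conv_lhs => rw [hatPlus]

theorem hatPlus_g_diff (α β : ℤ → ℂ) (ℓ : ℕ) (n : ℤ) :
    (hatPlus α β (ℓ + 1)).2.1 n - (hatPlus α β (ℓ + 1)).2.1 (n - 1)
      = α n * (hatPlus α β ℓ).2.2 (n - 1) + β n * (hatPlus α β ℓ).1 n := by
  let F : ℤ → PowerSeries ℂ := fun m => PowerSeries.mk fun k => (hatPlus α β k).1 m
  let G : ℤ → PowerSeries ℂ := fun m => PowerSeries.mk fun k => (hatPlus α β k).2.1 m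
  let H : ℤ → PowerSeries ℂ := fun m => PowerSeries.mk fun k => (hatPlus α β k).2.2 m
  have h1 : F (n - 1) = PowerSeries.X * F n - PowerSeries.C (α n) * (G n + G (n - 1)) := by
    ext k
    cases k with
    | zero => simp [F, G, hatPlus_zero]; ring
    | succ k =>
      simp [F, G, PowerSeries.coeff_succ_X_mul, hatPlus_f_succ]
  have h2 : H n = PowerSeries.X * H (n - 1) + PowerSeries.C (β n) * (G n + G (n - 1)) := by
    ext k
    cases k with
    | zero => simp [H, G, hatPlus_zero]; ring
    | succ k =>
      simp [H, G, PowerSeries.coeff_succ_X_mul, hatPlus_h_succ]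
  have h3 : ∀ m, G m ^ 2 = PowerSeries.X * (F m * H m) + PowerSeries.C (1 / 4) := by
    intro m
    ext k
    cases k with
    | zero => simp [G, hatPlus_zero, sq, PowerSeries.coeff_mul]; norm_num
    | succ k =>
      rw [map_add, PowerSeries.coeff_succ_X_mul, sq, PowerSeries.coeff_mul, PowerSeries.coeff_mul,
        Finset.Nat.sum_antidiagonal_eq_sum_range_succ_mk,
        ← Finset.Nat.sum_antidiagonal_swap, Finset.Nat.sum_antidiagonal_eq_sum_range_succ_mk]
      simp only [F, G, H, PowerSeries.coeff_mk, Prod.swap, PowerSeries.coeff_C, Nat.succ_ne_zero,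
        if_false, add_zero]
      rw [Finset.sum_range_succ', Finset.sum_range_succ]
      have hg := hatPlus_g_succ α β k m
      have hs : ∑ i ∈ Finset.range k, (hatPlus α β (i + 1)).2.1 m
            * (hatPlus α β (k + 1 - (i + 1))).2.1 m
          = ∑ i ∈ Finset.range k, (hatPlus α β (k - i)).2.1 m * (hatPlus α β (i + 1)).2.1 m := by
        refine Finset.sum_congr rfl fun i _ => ?_
        rw [Nat.add_sub_add_right, mul_comm]
      rw [hs]
      simp only [hatPlus_zero, Nat.sub_self, Nat.sub_zero] at hg ⊢
      linear_combination hg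
  have h4 : (G n + G (n - 1)) * (G n - G (n - 1)) = (G n + G (n - 1)) *
      (PowerSeries.X * (PowerSeries.C (α n) * H (n - 1) + PowerSeries.C (β n) * F n)) := by
    have a1 := h3 n
    have a2 := h3 (n - 1)
    rw [h2] at a1
    rw [h1] at a2
    linear_combination a1 - a2
  have h5 : G n + G (n - 1) ≠ 0 := by
    intro h
    have := congrArg (PowerSeries.coeff 0) h
    simp [G, hatPlus_zero] at this
  have h6 := congrArg (PowerSeries.coeff (ℓ + 1)) (mul_left_cancel₀ h5 h4)
  simpa [F, G, H, PowerSeries.coeff_succ_X_mul] using h6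

/-- The `+` coefficients satisfy the defining linear recursion. -/
theorem hat_plus_recursion (α β : ℤ → ℂ) (ℓ : ℕ) (n : ℤ) :
    fHat α β true 0 n = -α (n + 1) ∧ gHat α β true 0 n = 1 / 2 ∧ hHat α β true 0 n = β n ∧
    gHat α β true (ℓ + 1) n - gHat α β true (ℓ + 1) (n - 1)
      = α n * hHat α β true ℓ (n - 1) + β n * fHat α β true ℓ n ∧
    fHat α β true (ℓ + 1) (n - 1) = fHat α β true ℓ n
      - α n * (gHat α β true (ℓ + 1) n + gHat α β true (ℓ + 1) (n - 1)) ∧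
    hHat α β true (ℓ + 1) n = hHat α β true ℓ (n - 1)
      + β n * (gHat α β true (ℓ + 1) n + gHat α β true (ℓ + 1) (n - 1)) := by
  refine ⟨by simp [fHat, hatPlus_zero], by simp [gHat, hatPlus_zero],
    by simp [hHat, hatPlus_zero], ?_, ?_, ?_⟩
  · simpa [fHat, gHat, hHat] using hatPlus_g_diff α β ℓ n
  · simpa [fHat, gHat, hHat] using hatPlus_f_succ α β ℓ (n - 1)
  · simpa [fHat, gHat, hHat] using hatPlus_h_succ α β ℓ n

/-- The `-` coefficients satisfy the defining linear recursion. -/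
theorem hat_minus_recursion (α β : ℤ → ℂ) (ℓ : ℕ) (n : ℤ) :
    fHat α β false 0 n = α n ∧ gHat α β false 0 n = 1 / 2 ∧
    hHat α β false 0 n = -β (n + 1) ∧
    gHat α β false (ℓ + 1) n - gHat α β false (ℓ + 1) (n - 1)
      = α n * hHat α β false ℓ n + β n * fHat α β false ℓ (n - 1) ∧
    fHat α β false (ℓ + 1) n = fHat α β false ℓ (n - 1)
      + α n * (gHat α β false (ℓ + 1) n + gHat α β false (ℓ + 1) (n - 1)) ∧
    hHat α β false (ℓ + 1) (n - 1) = hHat α β false ℓ n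
      - β n * (gHat α β false (ℓ + 1) n + gHat α β false (ℓ + 1) (n - 1)) := by
  refine ⟨by simp [fHat, hatPlus_zero], by simp [gHat, hatPlus_zero],
    by simp [hHat, hatPlus_zero], ?_, ?_, ?_⟩
  · simpa [fHat, gHat, hHat, add_comm] using hatPlus_g_diff β α ℓ n
  · simpa [fHat, gHat, hHat] using hatPlus_h_succ β α ℓ n
  · simpa [fHat, gHat, hHat] using hatPlus_f_succ β α ℓ (n - 1)

/-! ### The Laurent polynomials `F, G, H, K` built from coefficients -/

section Laurent

variable (d : Bool → ℕ)

/-- `F(z) = ∑_{ℓ=1}^{d₋} f_{d₋-ℓ,-} z^{-ℓ} + ∑_{ℓ=0}^{d₊-1} f_{d₊-1-ℓ,+} z^ℓ`. -/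
def laurentF (f : Bool → ℕ → ℂ) : ℂ[T;T⁻¹] :=
  ∑ ℓ ∈ Finset.Icc 1 (d false),
      LaurentPolynomial.C (f false (d false - ℓ)) * LaurentPolynomial.T (-(ℓ : ℤ))
    + ∑ ℓ ∈ Finset.range (d true),
      LaurentPolynomial.C (f true (d true - 1 - ℓ)) * LaurentPolynomial.T (ℓ : ℤ)

/-- `G(z) = ∑_{ℓ=1}^{d₋} g_{d₋-ℓ,-} z^{-ℓ} + ∑_{ℓ=0}^{d₊} g_{d₊-ℓ,+} z^ℓ`. -/
def laurentG (g : Bool → ℕ → ℂ) : ℂ[T;T⁻¹] :=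
  ∑ ℓ ∈ Finset.Icc 1 (d false),
      LaurentPolynomial.C (g false (d false - ℓ)) * LaurentPolynomial.T (-(ℓ : ℤ))
    + ∑ ℓ ∈ Finset.range (d true + 1),
      LaurentPolynomial.C (g true (d true - ℓ)) * LaurentPolynomial.T (ℓ : ℤ)

/-- `H(z) = ∑_{ℓ=0}^{d₋-1} h_{d₋-1-ℓ,-} z^{-ℓ} + ∑_{ℓ=1}^{d₊} h_{d₊-ℓ,+} z^ℓ`. -/
def laurentH (h : Bool → ℕ → ℂ) : ℂ[T;T⁻¹] :=
  ∑ ℓ ∈ Finset.range (d false),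
      LaurentPolynomial.C (h false (d false - 1 - ℓ)) * LaurentPolynomial.T (-(ℓ : ℤ))
    + ∑ ℓ ∈ Finset.Icc 1 (d true),
      LaurentPolynomial.C (h true (d true - ℓ)) * LaurentPolynomial.T (ℓ : ℤ)

/-- `K(z) = ∑_{ℓ=0}^{d₋} g_{d₋-ℓ,-} z^{-ℓ} + ∑_{ℓ=1}^{d₊} g_{d₊-ℓ,+} z^ℓ`. -/
def laurentK (g : Bool → ℕ → ℂ) : ℂ[T;T⁻¹] :=
  ∑ ℓ ∈ Finset.range (d false + 1),
      LaurentPolynomial.C (g false (d false - ℓ)) * LaurentPolynomial.T (-(ℓ : ℤ))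
    + ∑ ℓ ∈ Finset.Icc 1 (d true),
      LaurentPolynomial.C (g true (d true - ℓ)) * LaurentPolynomial.T (ℓ : ℤ)

end Laurent

/-- Value of a Laurent polynomial at `z ∈ ℂ \ {0}`. -/
def lval (z : ℂˣ) (F : ℂ[T;T⁻¹]) : ℂ := LaurentPolynomial.eval₂ (RingHom.id ℂ) z F

/-! ### Ablowitz-Ladik expressions for prescribed summation constants -/

section Lattice

variable (c : Bool → ℕ → ℂ) (α β : ℤ → ℂ)

/-- `f_{ℓ,±}(n) = ∑_{k=0}^{ℓ} c_{ℓ-k,±} f̂_{k,±}(n)`. -/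
def fCoef (s : Bool) (ℓ : ℕ) (n : ℤ) : ℂ := conv (c s) (fun k => fHat α β s k n) ℓ

/-- `g_{ℓ,±}(n)`. -/
def gCoef (s : Bool) (ℓ : ℕ) (n : ℤ) : ℂ := conv (c s) (fun k => gHat α β s k n) ℓ

/-- `h_{ℓ,±}(n)`. -/
def hCoef (s : Bool) (ℓ : ℕ) (n : ℤ) : ℂ := conv (c s) (fun k => hHat α β s k n) ℓ

variable (d : Bool → ℕ)

/-- The Laurent polynomial `F_d(·, n)` of `α, β` with summation constants `c`. -/
def Fpoly (n : ℤ) : ℂ[T;T⁻¹] := laurentF d fun s ℓ => fCoef c α β s ℓ n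

/-- The Laurent polynomial `G_d(·, n)`. -/
def Gpoly (n : ℤ) : ℂ[T;T⁻¹] := laurentG d fun s ℓ => gCoef c α β s ℓ n

/-- The Laurent polynomial `H_d(·, n)`. -/
def Hpoly (n : ℤ) : ℂ[T;T⁻¹] := laurentH d fun s ℓ => hCoef c α β s ℓ n

/-- The Laurent polynomial `K_d(·, n)`. -/
def Kpoly (n : ℤ) : ℂ[T;T⁻¹] := laurentK d fun s ℓ => gCoef c α β s ℓ n

/-- First component of the stationary Ablowitz-Ladik expression,
`-α (g_{d₊,+} + g⁻_{d₋,-}) + f_{d₊-1,+} - f⁻_{d₋-1,-}` (with `f_{-1,±} = 0`). -/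
def sAL₁ (n : ℤ) : ℂ :=
  -α n * (gCoef c α β true (d true) n + gCoef c α β false (d false) (n - 1))
    + ext0 (fun ℓ => fCoef c α β true ℓ n) ((d true : ℤ) - 1)
    - ext0 (fun ℓ => fCoef c α β false ℓ (n - 1)) ((d false : ℤ) - 1)

/-- Second component of the stationary Ablowitz-Ladik expression,
`β (g⁻_{d₊,+} + g_{d₋,-}) + h⁻_{d₊-1,+} - h_{d₋-1,-}` (with `h_{-1,±} = 0`). -/
def sAL₂ (n : ℤ) : ℂ :=
  β n * (gCoef c α β true (d true) (n - 1) + gCoef c α β false (d false) n)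
    + ext0 (fun ℓ => hCoef c α β true ℓ (n - 1)) ((d true : ℤ) - 1)
    - ext0 (fun ℓ => hCoef c α β false ℓ n) ((d false : ℤ) - 1)

end Lattice

/-! ### Zero-curvature matrices (evaluated at `z ∈ ℂ \ {0}`) -/

/-- `U(z)` at a lattice point where the coefficients take the values `a, b`. -/
def Umat (z : ℂˣ) (a b : ℂ) : Matrix (Fin 2) (Fin 2) ℂ := !![(z : ℂ), a; (z : ℂ) * b, 1]

/-- `i (G⁻, -F⁻; H⁻, -K⁻)` at the lattice point `n`. -/
def Vmat (z : ℂˣ) (F G H K : ℤ → ℂ[T;T⁻¹]) (n : ℤ) : Matrix (Fin 2) (Fin 2) ℂ :=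
  Complex.I • !![lval z (G (n - 1)), -lval z (F (n - 1)); lval z (H (n - 1)), -lval z (K (n - 1))]

/-! ### The spectral data and the hyperelliptic curve -/

/-- The fixed data: degrees `p₋, p₊` with `p = p₋ + p₊ - 1 ≥ 1`, pairwise distinct nonzero
`E_0, …, E_{2p+1}`, and nonzero constants `c_{0,±}` with `c_{0,-}² = c_{0,+}² ∏ E_m`. -/
structure SpectralData where
  /-- the genus `p` -/
  p : ℕ
  /-- the degrees: `deg true = p₊`, `deg false = p₋` -/
  deg : Bool → ℕ
  one_le_p : 1 ≤ p
  deg_add : deg false + deg true = p + 1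
  /-- the branch points -/
  E : Fin (2 * p + 2) → ℂ
  E_ne_zero : ∀ m, E m ≠ 0
  E_injective : Function.Injective E
  /-- the constants `c_{0,±}` -/
  c0 : Bool → ℂ
  c0_ne_zero : ∀ s, c0 s ≠ 0
  c0_sq : c0 false ^ 2 = c0 true ^ 2 * ∏ m, E m

namespace SpectralData

variable (S : SpectralData)

/-- The square root of `∏ E_m` that belongs to the choice of `c_{0,-}`. -/
def sqrtProdE : ℂ := (-1) ^ (S.p + 1) * (S.c0 false / S.c0 true)

/-- `E_m^{±1}`. -/
def Epow (s : Bool) (m : Fin (2 * S.p + 2)) : ℂ := if s then S.E m else (S.E m)⁻¹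

/-- The power series of `∏ (1 - E_m^{±1} η)^{1/2}`, whose coefficients are `c_k(E^{±1})`. -/
def sqrtSeries (s : Bool) : PowerSeries ℂ :=
  ∏ m, PowerSeries.mk fun j : ℕ =>
    -(((2 * j).factorial : ℂ) / (2 ^ (2 * j) * (j.factorial : ℂ) ^ 2 * (2 * (j : ℂ) - 1)))
      * S.Epow s m ^ j

/-- The power series of `∏ (1 - E_m^{±1} η)^{-1/2}`. -/
def invSqrtSeries (s : Bool) : PowerSeries ℂ :=
  ∏ m, PowerSeries.mk fun j : ℕ =>
    (((2 * j).factorial : ℂ) / (2 ^ (2 * j) * (j.factorial : ℂ) ^ 2)) * S.Epow s m ^ j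

/-- The summation constants `c_{ℓ,±} = c_{0,±} c_ℓ(E^{±1})` determined by the curve. -/
def summ (s : Bool) (ℓ : ℕ) : ℂ := S.c0 s * PowerSeries.coeff ℓ (S.sqrtSeries s)

/-- `R(z) = (c_{0,+} / (2 z^{p₋}))² ∏ (z - E_m)`. -/
def R : ℂ[T;T⁻¹] :=
  LaurentPolynomial.C (S.c0 true ^ 2 / 4) * LaurentPolynomial.T (-2 * (S.deg false : ℤ))
    * ∏ m, (LaurentPolynomial.T 1 - LaurentPolynomial.C (S.E m))

/-- The compactified curve `y² = ∏ (z - E_m)` with the two points at infinity. -/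
inductive Point : Type
  | aff (z y : ℂ) (h : y ^ 2 = ∏ m, (z - S.E m)) : Point
  | infPlus : Point
  | infMinus : Point

end SpectralData

/-- The principal square root. -/
def csqrt (x : ℂ) : ℂ := x ^ (((2 : ℕ) : ℂ)⁻¹)

theorem csqrt_sq (x : ℂ) : csqrt x ^ 2 = x := Complex.cpow_nat_inv_pow x two_ne_zero

namespace SpectralData

variable (S : SpectralData)

/-- The branch of `ζ ↦ y` through the point `(z₀, y₀)` of the curve, holomorphic near `z₀`
if `y₀ ≠ 0`. -/
def yBranch (z₀ y₀ ζ : ℂ) : ℂ := y₀ * ∏ m, csqrt ((ζ - S.E m) / (z₀ - S.E m))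

theorem yBranch_sq {z₀ y₀ : ℂ} (h : y₀ ^ 2 = ∏ m, (z₀ - S.E m)) (hy : y₀ ≠ 0) (ζ : ℂ) :
    S.yBranch z₀ y₀ ζ ^ 2 = ∏ m, (ζ - S.E m) := by
  have h0 : ∏ m, (z₀ - S.E m) ≠ 0 := by rw [← h]; exact pow_ne_zero 2 hy
  rw [yBranch, mul_pow, ← Finset.prod_pow]
  simp only [csqrt_sq]
  rw [Finset.prod_div_distrib, h, mul_div_cancel₀ _ h0]

open Classical in
/-- The function `y` in the local coordinate `ζ = (z - z₀)^{1/2}` at a branch point `(z₀, 0)`. -/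
def yRamified (z₀ ζ : ℂ) : ℂ :=
  ζ * csqrt (∏ m ∈ Finset.univ.filter (fun m => S.E m ≠ z₀), (z₀ - S.E m))
    * ∏ m ∈ Finset.univ.filter (fun m => S.E m ≠ z₀),
        csqrt ((z₀ + ζ ^ 2 - S.E m) / (z₀ - S.E m))

theorem yRamified_sq {z₀ : ℂ} (h : (0 : ℂ) ^ 2 = ∏ m, (z₀ - S.E m)) (ζ : ℂ) :
    S.yRamified z₀ ζ ^ 2 = ∏ m, (z₀ + ζ ^ 2 - S.E m) := by
  classical
  obtain ⟨m₀, -, hm₀⟩ := Finset.prod_eq_zero_iff.1 (h.symm.trans (by simp))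
  have hz : z₀ = S.E m₀ := sub_eq_zero.1 hm₀
  have hf : Finset.univ.filter (fun m => S.E m ≠ z₀) = Finset.univ.erase m₀ := by
    ext m
    simp [hz, S.E_injective.eq_iff]
  have h0 : ∏ m ∈ Finset.univ.erase m₀, (z₀ - S.E m) ≠ 0 := by
    refine Finset.prod_ne_zero_iff.2 fun m hm => sub_ne_zero.2 ?_
    rw [hz]
    exact fun h' => (Finset.ne_of_mem_erase hm) (S.E_injective h').symm
  rw [yRamified, hf, mul_pow, mul_pow, csqrt_sq, ← Finset.prod_pow]
  simp only [csqrt_sq]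
  rw [Finset.prod_div_distrib, mul_assoc, mul_div_cancel₀ _ h0,
    ← Finset.mul_prod_erase Finset.univ _ (Finset.mem_univ m₀), hz]
  ring

/-- The function `y` in the local coordinate `ζ = 1/z` at `P_{∞₋}`; at `P_{∞₊}` it is the
negative of this. -/
def yInf (ζ : ℂ) : ℂ := (ζ⁻¹) ^ (S.p + 1) * ∏ m, csqrt (1 - S.E m * ζ)

theorem yInf_sq {ζ : ℂ} (hζ : ζ ≠ 0) : S.yInf ζ ^ 2 = ∏ m, (ζ⁻¹ - S.E m) := by
  have : ∀ m, ζ⁻¹ - S.E m = ζ⁻¹ * (1 - S.E m * ζ) := fun m => by field_simp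
  rw [yInf, mul_pow, ← Finset.prod_pow]
  simp only [csqrt_sq, this, Finset.prod_mul_distrib, Finset.prod_const, Finset.card_univ,
    Fintype.card_fin]
  rw [← pow_mul, add_mul, one_mul, mul_comm S.p 2]

variable {S} in
open Classical in
/-- The standard local parametrization of the curve near a point, centred at `ζ = 0`:
`z = z₀ + ζ` at ordinary points, `z = z₀ + ζ²` at branch points, `z = 1/ζ` at infinity, where
`y = ∓ζ^{-p-1} (1 + O(ζ))` at `P_{∞±}`. -/
def chart : S.Point → ℂ → S.Point
  | .aff z y h, ζ =>
    if hy : y = 0 then .aff (z + ζ ^ 2) (S.yRamified z ζ) (S.yRamified_sq (hy ▸ h) ζ)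
    else .aff (z + ζ) (S.yBranch z y (z + ζ)) (S.yBranch_sq h hy _)
  | .infPlus, ζ =>
    if hζ : ζ = 0 then .infPlus
    else .aff ζ⁻¹ (-S.yInf ζ) (by rw [neg_sq]; exact S.yInf_sq hζ)
  | .infMinus, ζ =>
    if hζ : ζ = 0 then .infMinus else .aff ζ⁻¹ (S.yInf ζ) (S.yInf_sq hζ)

variable {S}

/-- `f` is a meromorphic function on the compact curve with divisor `D`. -/
def HasDivisor (f : S.Point → ℂ) (D : S.Point → ℤ) : Prop :=
  ∀ P, MeromorphicAt (fun ζ => f (chart P ζ)) 0 ∧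
    meromorphicOrderAt (fun ζ => f (chart P ζ)) 0 = ((D P : ℤ) : WithTop ℤ)

/-- Linear equivalence of divisors: the difference is the divisor of a meromorphic function.
For divisors of equal degree this is equality in the Jacobi variety (as the group of divisor
classes of degree zero) of their images under the Abel map. -/
def LinEquiv (D D' : S.Point → ℤ) : Prop :=
  ∃ f : S.Point → ℂ, HasDivisor f fun P => D P - D' P

open Classical in
/-- The divisor of a single point. -/
def single (P : S.Point) : S.Point → ℤ := Pi.single P 1

open Classical in
/-- The nonnegative divisor of degree `p` given by an unordered `p`-tuple of points. -/
def divisor (D : Sym S.Point S.p) : S.Point → ℤ := fun P => ((D : Multiset S.Point).count P : ℤ)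

variable (S) in
theorem zero_mem (s : ℤˣ) :
    (((s : ℤ) : ℂ) * (S.c0 false / S.c0 true)) ^ 2 = ∏ m, ((0 : ℂ) - S.E m) := by
  have hs : (((s : ℤ) : ℂ)) ^ 2 = 1 := by
    rcases Int.units_eq_one_or s with rfl | rfl <;> simp
  have h1 : ∏ m, ((0 : ℂ) - S.E m) = ∏ m, S.E m := by
    simp only [zero_sub, Finset.prod_neg, Finset.card_univ, Fintype.card_fin]
    rw [Even.neg_one_pow ⟨S.p + 1, by ring⟩, one_mul]
  rw [mul_pow, hs, one_mul, div_pow, S.c0_sq, h1,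
    mul_div_cancel_left₀ _ (pow_ne_zero 2 (S.c0_ne_zero true))]

variable (S) in
/-- `P_{0,±} = (0, ±c_{0,-}/c_{0,+})`. -/
def zeroPt (s : ℤˣ) : S.Point := .aff 0 (((s : ℤ) : ℂ) * (S.c0 false / S.c0 true)) (S.zero_mem s)

/-- A nonnegative divisor of degree `p` is admissible if it contains none of
`P_{∞±}`, `P_{0,±}`. -/
def Admissible (D : Sym S.Point S.p) : Prop :=
  Point.infPlus ∉ D ∧ Point.infMinus ∉ D ∧ S.zeroPt 1 ∉ D ∧ S.zeroPt (-1) ∉ D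

variable (S) in
/-- The set `M₀` of initial Dirichlet divisors `D` all of whose iterates are admissible: for every
`n ∈ ℤ`, the nonnegative divisors of degree `p` equivalent to `D + n (P_{∞₊} - P_{0,-})`
(Dirichlet divisors) or to `D + (P_{∞₋} - P_{0,-}) + n (P_{∞₊} - P_{0,-})` (Neumann divisors)
are admissible. -/
def M₀ : Set (Sym S.Point S.p) :=
  {D | ∀ (n : ℤ) (D' : Sym S.Point S.p),
    (LinEquiv (divisor D')
        (divisor D + n • (single Point.infPlus - single (S.zeroPt (-1)))) ∨
      LinEquiv (divisor D')
        (divisor D + (single Point.infMinus - single (S.zeroPt (-1)))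
          + n • (single Point.infPlus - single (S.zeroPt (-1))))) →
    Admissible D'}

/-- The `z`-coordinate (used at finite points only). -/
def Point.z : S.Point → ℂ
  | .aff z _ _ => z
  | .infPlus => 0
  | .infMinus => 0

/-- The `y`-coordinate (used at finite points only). -/
def Point.y : S.Point → ℂ
  | .aff _ y _ => y
  | .infPlus => 0
  | .infMinus => 0

variable (S)

/-! ### The stationary construction at one lattice point -/

/-- `D = {μ̂_1, …, μ̂_p}` is the Dirichlet divisor of `(F, G)`: `F = a z^{-p₋} ∏ (z - μ_j)` with
`a ≠ 0`, all `μ_j` finite and nonzero, and `μ̂_j = (μ_j, (2/c_{0,+}) μ_j^{p₋} G(μ_j))`. -/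
def IsDirichletDivisor (F G : ℂ[T;T⁻¹]) (D : Sym S.Point S.p) : Prop :=
  (∃ a : ℂ, a ≠ 0 ∧ F = LaurentPolynomial.C a * LaurentPolynomial.T (-(S.deg false : ℤ))
    * ((D : Multiset S.Point).map fun P =>
        LaurentPolynomial.T 1 - LaurentPolynomial.C P.z).prod) ∧
  ∀ P ∈ D, ∃ (μ : ℂˣ) (y : ℂ) (h : y ^ 2 = ∏ m, ((μ : ℂ) - S.E m)),
    P = .aff μ y h ∧ y = 2 / S.c0 true * (μ : ℂ) ^ S.deg false * lval μ G

/-- `α⁺ = α (∏ E_m)^{1/2} ∏ μ_k^{-p_k}`. -/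
def alphaNext (a : ℂ) (D : Sym S.Point S.p) : ℂ :=
  a * S.sqrtProdE * ((D : Multiset S.Point).map fun P => P.z⁻¹).prod

open Classical in
/-- The Hermite interpolation sum
`∑_k ∑_{ℓ<p_k} (d^ℓ(ζ^{-1}y)/dζ^ℓ)(μ̂_k) / (ℓ! (p_k-ℓ-1)!)
  · d^{p_k-ℓ-1}/dζ^{p_k-ℓ-1} ((z-ζ)^{-1} ∏_{k'≠k} (ζ-μ_{k'})^{-p_{k'}})|_{ζ=μ_k}`,
where `p_k` is the multiplicity of `μ̂_k` in `D`. -/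
def hermiteSum (D : Sym S.Point S.p) (z : ℂ) : ℂ :=
  ∑ P ∈ (D : Multiset S.Point).toFinset,
    ∑ ℓ ∈ Finset.range ((D : Multiset S.Point).count P),
      iteratedDeriv ℓ (fun ζ => ζ⁻¹ * S.yBranch P.z P.y ζ) P.z
        / ((ℓ.factorial : ℂ) * (((D : Multiset S.Point).count P - ℓ - 1).factorial : ℂ))
      * iteratedDeriv ((D : Multiset S.Point).count P - ℓ - 1)
          (fun ζ => (z - ζ)⁻¹ * ∏ Q ∈ (D : Multiset S.Point).toFinset.erase P,
            ((ζ - Q.z) ^ (D : Multiset S.Point).count Q)⁻¹) P.z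

/-- `F, G, H` are the Laurent polynomials attached at one lattice point to the value `a ≠ 0`
of `α` there and to the divisor `D`:
`F = -c_{0,+} α⁺ z^{-p₋} ∏ (z - μ_k)^{p_k}`,
`G = (1/2)(1/α - z/α⁺) F - (z/(2α⁺)) F · hermiteSum` and `G² - R = F H`.
(The formula for `G` has removable singularities at the `μ_k`.) -/
def IsStationaryData (a : ℂ) (D : Sym S.Point S.p) (F G H : ℂ[T;T⁻¹]) : Prop :=
  F = LaurentPolynomial.C (-S.c0 true * S.alphaNext a D)
      * LaurentPolynomial.T (-(S.deg false : ℤ))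
      * ((D : Multiset S.Point).map fun P =>
          LaurentPolynomial.T 1 - LaurentPolynomial.C P.z).prod ∧
  (∀ z : ℂˣ, (∀ P ∈ D, P.z ≠ (z : ℂ)) →
    lval z G = 1 / 2 * (1 / a - z / S.alphaNext a D) * lval z F
      - z / (2 * S.alphaNext a D) * lval z F * S.hermiteSum D z) ∧
  G ^ 2 - S.R = F * H

open Classical in
/-- The right-hand side of the formula for `α⁺ β` in terms of the Dirichlet divisor:
`-(1/2) ∑_k (1/(p_k-1)!) d^{p_k-1}/dζ^{p_k-1} (ζ^{-1} y ∏_{k'≠k} (ζ-μ_{k'})^{-p_{k'}})|_{μ̂_k}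
  + (1/2) ((∏ E_m)^{1/2} ∏ μ_k^{-p_k} + ∑ p_k μ_k - (1/2) ∑ E_m)`. -/
def alphaNextBeta (D : Sym S.Point S.p) : ℂ :=
  -(1 / 2) * ∑ P ∈ (D : Multiset S.Point).toFinset,
      iteratedDeriv ((D : Multiset S.Point).count P - 1)
          (fun ζ => ζ⁻¹ * S.yBranch P.z P.y ζ
            * ∏ Q ∈ (D : Multiset S.Point).toFinset.erase P,
                ((ζ - Q.z) ^ (D : Multiset S.Point).count Q)⁻¹) P.z
        / (((D : Multiset S.Point).count P - 1).factorial : ℂ)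
    + 1 / 2 * (S.sqrtProdE * ((D : Multiset S.Point).map fun P => P.z⁻¹).prod
        + ((D : Multiset S.Point).map fun P => P.z).sum - 1 / 2 * ∑ m, S.E m)

/-! ### The stationary algorithm -/

/-- `α = c_{0,-}^{-1} · (coefficient of z^{-p₋} in F)`. -/
def alphaOf (X : ℂ[T;T⁻¹] × ℂ[T;T⁻¹] × ℂ[T;T⁻¹]) : ℂ :=
  (S.c0 false)⁻¹ * X.1.coeff (-(S.deg false : ℤ))

/-- `β = c_{0,+}^{-1} · (coefficient of z^{p₊} in H)`. -/
def betaOf (X : ℂ[T;T⁻¹] × ℂ[T;T⁻¹] × ℂ[T;T⁻¹]) : ℂ :=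
  (S.c0 true)⁻¹ * X.2.2.coeff (S.deg true : ℤ)

/-- `α⁺ = -c_{0,+}^{-1} · (coefficient of z^{p₊-1} in F)`. -/
def alphaPlusOf (X : ℂ[T;T⁻¹] × ℂ[T;T⁻¹] × ℂ[T;T⁻¹]) : ℂ :=
  -(S.c0 true)⁻¹ * X.1.coeff ((S.deg true : ℤ) - 1)

/-- `β⁺ = -c_{0,-}^{-1} · (coefficient of z^{-p₋+1} in H)`. -/
def betaPlusOf (X : ℂ[T;T⁻¹] × ℂ[T;T⁻¹] × ℂ[T;T⁻¹]) : ℂ :=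
  -(S.c0 false)⁻¹ * X.2.2.coeff (-(S.deg false : ℤ) + 1)

/-- One step `n → n + 1` of the stationary algorithm on triples `(F, G, H)`:
`F⁺ = ((α⁺)² H + 2 α⁺ z G + z² F) / (z γ⁺)`,
`G⁺ = ((1 + α⁺ β⁺) z G + α⁺ H + β⁺ z² F) / (z γ⁺)`,
`H⁺ = ((β⁺ z)² F + 2 β⁺ z G + H) / (z γ⁺)`, where `γ⁺ = 1 - α⁺ β⁺`. -/
def stepUp (X : ℂ[T;T⁻¹] × ℂ[T;T⁻¹] × ℂ[T;T⁻¹]) : ℂ[T;T⁻¹] × ℂ[T;T⁻¹] × ℂ[T;T⁻¹] :=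
  let F := X.1
  let G := X.2.1
  let H := X.2.2
  let a := S.alphaPlusOf X
  let b := S.betaPlusOf X
  let w : ℂ[T;T⁻¹] := LaurentPolynomial.C (1 - a * b)⁻¹ * LaurentPolynomial.T (-1)
  let z : ℂ[T;T⁻¹] := LaurentPolynomial.T 1
  (w * (LaurentPolynomial.C (a ^ 2) * H + LaurentPolynomial.C (2 * a) * z * G + z ^ 2 * F),
   w * (LaurentPolynomial.C (1 + a * b) * z * G + LaurentPolynomial.C a * H
      + LaurentPolynomial.C b * z ^ 2 * F),
   w * (LaurentPolynomial.C (b ^ 2) * z ^ 2 * F + LaurentPolynomial.C (2 * b) * z * G + H))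

/-- One step `n → n - 1` of the stationary algorithm:
`F⁻ = (α² H - 2 α G + F) / (z γ)`, `G⁻ = ((1 + α β) G - α H - β F) / γ`,
`H⁻ = z (β² F - 2 β G + H) / γ`, where `γ = 1 - α β`. -/
def stepDown (X : ℂ[T;T⁻¹] × ℂ[T;T⁻¹] × ℂ[T;T⁻¹]) : ℂ[T;T⁻¹] × ℂ[T;T⁻¹] × ℂ[T;T⁻¹] :=
  let F := X.1
  let G := X.2.1
  let H := X.2.2
  let a := S.alphaOf X
  let b := S.betaOf X
  let w : ℂ[T;T⁻¹] := LaurentPolynomial.C (1 - a * b)⁻¹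
  (w * LaurentPolynomial.T (-1)
      * (LaurentPolynomial.C (a ^ 2) * H - LaurentPolynomial.C (2 * a) * G + F),
   w * (LaurentPolynomial.C (1 + a * b) * G - LaurentPolynomial.C a * H
      - LaurentPolynomial.C b * F),
   w * LaurentPolynomial.T 1
      * (LaurentPolynomial.C (b ^ 2) * F - LaurentPolynomial.C (2 * b) * G + H))

/-- Extension of `(F, G, H)` from the lattice point `n₀` to the lattice point `n`. -/
def algorithm (X : ℂ[T;T⁻¹] × ℂ[T;T⁻¹] × ℂ[T;T⁻¹]) (n₀ n : ℤ) :
    ℂ[T;T⁻¹] × ℂ[T;T⁻¹] × ℂ[T;T⁻¹] :=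
  if n₀ ≤ n then S.stepUp^[(n - n₀).toNat] X else S.stepDown^[(n₀ - n).toNat] X

/-! ### Stationary solutions -/

/-- `α, β` is a solution of the stationary Ablowitz-Ladik system of index `(p₋, p₊)` with
`α β ∉ {0, 1}` whose associated curve is the given one. -/
structure IsStationarySolution (α β : ℤ → ℂ) : Prop where
  ne_zero : ∀ n, α n * β n ≠ 0
  ne_one : ∀ n, α n * β n ≠ 1
  sAL : ∀ n, sAL₁ S.summ α β S.deg n = 0 ∧ sAL₂ S.summ α β S.deg n = 0
  gg : ∀ n, gCoef S.summ α β true (S.deg true) n = gCoef S.summ α β false (S.deg false) n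
  curve : ∀ n, Gpoly S.summ α β S.deg n ^ 2
    - Fpoly S.summ α β S.deg n * Hpoly S.summ α β S.deg n = S.R

/-! ### The autonomous first-order system -/

/-- The homogeneous coefficients `f̂_{ℓ,±}` as linear functions of the coefficients of `F`: the
expansion coefficients of `z^{p₋} F / (c_{0,+} y)` at `P_{∞₋}` (for `+`, in `1/z`, starting with
`(1/z)^1`) and at `P_{0,+}` (for `-`, in `z`). -/
def fHatOf (F : ℂ[T;T⁻¹]) (s : Bool) (ℓ : ℕ) : ℂ :=
  (S.c0 s)⁻¹ * conv (fun k => PowerSeries.coeff k (S.invSqrtSeries s))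
    (fun k => if s then F.coeff ((S.deg true : ℤ) - 1 - k) else F.coeff (-(S.deg false : ℤ) + k)) ℓ

/-- The homogeneous coefficients `ĝ_{ℓ,±}` as linear functions of the coefficients of `G`. -/
def gHatOf (G : ℂ[T;T⁻¹]) (s : Bool) (ℓ : ℕ) : ℂ :=
  (S.c0 s)⁻¹ * conv (fun k => PowerSeries.coeff k (S.invSqrtSeries s))
    (fun k => if s then G.coeff ((S.deg true : ℤ) - k) else G.coeff (-(S.deg false : ℤ) + k)) ℓ

/-- The homogeneous coefficients `ĥ_{ℓ,±}` as linear functions of the coefficients of `H`. -/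
def hHatOf (H : ℂ[T;T⁻¹]) (s : Bool) (ℓ : ℕ) : ℂ :=
  (S.c0 s)⁻¹ * conv (fun k => PowerSeries.coeff k (S.invSqrtSeries s))
    (fun k => if s then H.coeff ((S.deg true : ℤ) - k)
      else H.coeff (-(S.deg false : ℤ) + 1 + k)) ℓ

section Flow

variable (r : Bool → ℕ) (ct : Bool → ℕ → ℂ) (f g h : Bool → ℕ → ℂ)

/-- `f̃_{j,±} = ∑_k c̃_{j-k,±} f̂_{k,±}` as a function of the state; zero for `j < 0`. -/
def fTilde (s : Bool) (j : ℤ) : ℂ := ext0 (conv (ct s) (S.fHatOf (laurentF S.deg f) s)) j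

/-- `g̃_{j,±}` as a function of the state; zero for `j < 0`. -/
def gTilde (s : Bool) (j : ℤ) : ℂ := ext0 (conv (ct s) (S.gHatOf (laurentG S.deg g) s)) j

/-- `h̃_{j,±}` as a function of the state; zero for `j < 0`. -/
def hTilde (s : Bool) (j : ℤ) : ℂ := ext0 (conv (ct s) (S.hHatOf (laurentH S.deg h) s)) j

/-- The right-hand side for `f_{ℓ,±}`:
`i f_{ℓ,±} (g̃_{r±,±} - g̃_{r∓,∓}) + 2i ∑_{k=0}^{ℓ} (f_{k,±} (g̃_{r∓-ℓ+k,∓} - g̃_{r±+ℓ-k,±})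
  + g_{k,±} (f̃_{r±+ℓ-k,±} - f̃_{r∓-1-ℓ+k,∓}))`. -/
def odeF (s : Bool) (ℓ : ℕ) : ℂ :=
  Complex.I * f s ℓ * (S.gTilde ct g s (r s) - S.gTilde ct g (!s) (r !s))
    + 2 * Complex.I * ∑ k ∈ Finset.range (ℓ + 1),
      (f s k * (S.gTilde ct g (!s) ((r !s : ℤ) - ℓ + k) - S.gTilde ct g s ((r s : ℤ) + ℓ - k))
        + g s k * (S.fTilde ct f s ((r s : ℤ) + ℓ - k)
            - S.fTilde ct f (!s) ((r !s : ℤ) - 1 - ℓ + k)))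

/-- The right-hand side for `g_{ℓ,±}`:
`i ∑_{k=0}^{ℓ-1} (f_{k,±} (h̃_{r∓-ℓ+k,∓} - h̃_{r±-1+ℓ-k,±})
  + h_{k,±} (f̃_{r±-1+ℓ-k,±} - f̃_{r∓-ℓ+k,∓}))`. -/
def odeG (s : Bool) (ℓ : ℕ) : ℂ :=
  Complex.I * ∑ k ∈ Finset.range ℓ,
      (f s k * (S.hTilde ct h (!s) ((r !s : ℤ) - ℓ + k)
            - S.hTilde ct h s ((r s : ℤ) - 1 + ℓ - k))
        + h s k * (S.fTilde ct f s ((r s : ℤ) - 1 + ℓ - k)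
            - S.fTilde ct f (!s) ((r !s : ℤ) - ℓ + k)))

/-- The right-hand side for `h_{ℓ,±}`:
`i h_{ℓ,±} (g̃_{r∓,∓} - g̃_{r±,±}) + 2i ∑_{k=0}^{ℓ} (g_{k,±} (h̃_{r∓-1-ℓ+k,∓} - h̃_{r±+ℓ-k,±})
  + h_{k,±} (g̃_{r±+ℓ-k,±} - g̃_{r∓-ℓ+k,∓}))`. -/
def odeH (s : Bool) (ℓ : ℕ) : ℂ :=
  Complex.I * h s ℓ * (S.gTilde ct g (!s) (r !s) - S.gTilde ct g s (r s))
    + 2 * Complex.I * ∑ k ∈ Finset.range (ℓ + 1),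
      (g s k * (S.hTilde ct h (!s) ((r !s : ℤ) - 1 - ℓ + k)
            - S.hTilde ct h s ((r s : ℤ) + ℓ - k))
        + h s k * (S.gTilde ct g s ((r s : ℤ) + ℓ - k)
            - S.gTilde ct g (!s) ((r !s : ℤ) - ℓ + k)))

end Flow

/-! ### The time-dependent construction -/

section Construction

variable (f g h : Bool → ℕ → ℝ → ℂ) (n₀ : ℤ)

/-- The Laurent polynomial `F(·, n₀, t)` with coefficients `f_{ℓ,±}(t)`. -/
def initF (t : ℝ) : ℂ[T;T⁻¹] := laurentF S.deg fun s ℓ => f s ℓ t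

/-- The Laurent polynomial `G(·, n₀, t)` with coefficients `g_{ℓ,±}(t)`. -/
def initG (t : ℝ) : ℂ[T;T⁻¹] := laurentG S.deg fun s ℓ => g s ℓ t

/-- The Laurent polynomial `H(·, n₀, t)` with coefficients `h_{ℓ,±}(t)`. -/
def initH (t : ℝ) : ℂ[T;T⁻¹] := laurentH S.deg fun s ℓ => h s ℓ t

/-- `(F, G, H)(·, n, t)`: the stationary algorithm applied at fixed time `t` to
`(F, G, H)(·, n₀, t)`. -/
def extFGH (t : ℝ) (n : ℤ) : ℂ[T;T⁻¹] × ℂ[T;T⁻¹] × ℂ[T;T⁻¹] :=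
  S.algorithm (S.initF f t, S.initG g t, S.initH h t) n₀ n

/-- `F(·, n, t)`. -/
def extF (t : ℝ) (n : ℤ) : ℂ[T;T⁻¹] := (S.extFGH f g h n₀ t n).1

/-- `G(·, n, t)`. -/
def extG (t : ℝ) (n : ℤ) : ℂ[T;T⁻¹] := (S.extFGH f g h n₀ t n).2.1

/-- `H(·, n, t)`. -/
def extH (t : ℝ) (n : ℤ) : ℂ[T;T⁻¹] := (S.extFGH f g h n₀ t n).2.2

/-- `α(n, t)`. -/
def solA (t : ℝ) (n : ℤ) : ℂ := S.alphaOf (S.extFGH f g h n₀ t n)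

/-- `β(n, t)`. -/
def solB (t : ℝ) (n : ℤ) : ℂ := S.betaOf (S.extFGH f g h n₀ t n)

/-- `U(z, n, t)`. -/
def matU (z : ℂˣ) (n : ℤ) (t : ℝ) : Matrix (Fin 2) (Fin 2) ℂ :=
  Umat z (S.solA f g h n₀ t n) (S.solB f g h n₀ t n)

/-- `V_p(z, n, t)`, where `K_p = G_p`. -/
def matV (z : ℂˣ) (n : ℤ) (t : ℝ) : Matrix (Fin 2) (Fin 2) ℂ :=
  Vmat z (S.extF f g h n₀ t) (S.extG f g h n₀ t) (S.extH f g h n₀ t) (S.extG f g h n₀ t) n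

/-- `Ṽ_r(z, n, t)`, built from `α(·, t), β(·, t)` with the summation constants `c̃`. -/
def matVt (r : Bool → ℕ) (ct : Bool → ℕ → ℂ) (z : ℂˣ) (n : ℤ) (t : ℝ) :
    Matrix (Fin 2) (Fin 2) ℂ :=
  Vmat z (Fpoly ct (S.solA f g h n₀ t) (S.solB f g h n₀ t) r)
    (Gpoly ct (S.solA f g h n₀ t) (S.solB f g h n₀ t) r)
    (Hpoly ct (S.solA f g h n₀ t) (S.solB f g h n₀ t) r)
    (Kpoly ct (S.solA f g h n₀ t) (S.solB f g h n₀ t) r) n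

end Construction

end SpectralData

end AblowitzLadik

end

open AblowitzLadik

/-! The matrix `V` is transported in two directions. Along the lattice, `U V = V⁺ U` says that `V`
is conjugated by `U`; in time, the autonomous system says that `V_t` is the commutator of `Ṽ` with
`V`. The proof makes each transport precise and then shows that the two are compatible.

Lattice, at fixed time. After multiplication by powers of `z`, the data at a point are three
polynomials (`PolyTriple`). One step of the algorithm is conjugation by `U`, so it keeps the
determinant `G² - F H = R` and the end coefficients of `G`; it fails only if `1 - α β` vanishes.
This is excluded by divisors. If `B² - ∏ (z - E_m) = k z A N`, then the function `(y + B) / A` on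
the curve shows that the divisor on the graph of `-B` over the zeros of `N` differs, up to linear
equivalence, from the one on the graph of `B` over the zeros of `A` by one point at infinity minus
one point over `0` (`linEquiv_graph`). With suitable `B` this identifies the next, the previous and
the Neumann divisor with classes in the definition of `M₀`; admissibility forces the end
coefficients of `F⁺`, `F⁻` and `H` to be nonzero, and these contain the factors `1 - α β`, `α` and
`β` (`IsRegular.up`, `IsRegular.down`, `IsRegular.coeffH_ne_zero`).

The homogeneous coefficients `f̂, ĝ, ĥ` have generating series fixed by one quadratic and two linear
relations. The expansions of `F / y`, `G / y`, `H / y` at infinity and at `0` satisfy the same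
relations, so the coefficients are linear functions of the triple at one point (`IsOrbit.hats`).
Hence an orbit is a stationary solution, and the tilde coefficients of the autonomous system are
those of the constructed `α, β`. The explicit formulas for `G` and `α⁺ β` are residue sums: at the
points of the divisor `y` agrees to the required order with a polynomial.

Time. The tilde coefficients arise from `F, G, H` by multiplication with one common series, so `g̃ F
= f̃ G` and similarly for the other pairs. This turns the truncated sums of the autonomous system
into full products, that is, into Lax equations at `n₀` (`odeF_eq`, `odeG_eq`, `odeH_eq`). They
preserve `G² - F H` and the ends of `G`, so the normalization at `t₀` holds at all times.

Compatibility. The end coefficients of the Lax equations at `n` are the Ablowitz-Ladik equations at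
`n` and at `n + 1` (`IsOrbit.coeff_lax_end`). Differentiating the relations between neighbouring
points gives a linear system for the derivatives at the neighbour. The Lax right-hand sides solve it
as well, and its determinant is a unit since `1 - α β ≠ 0`. So the Lax equations pass from one point
to both neighbours (`IsLax.succ`, `IsLax.pred`), and induction over the lattice gives the
zero-curvature equations everywhere. -/

noncomputable section

/-! ### Polynomial triples and the algebra of one lattice step -/

open Polynomial

namespace AblowitzLadik

/-! ### Polynomial triples -/

/-- Three polynomials; they encode the Laurent polynomials `z^{-p₋} F`, `z^{-p₋} G`,
`z^{1-p₋} H`. -/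
@[ext]
structure PolyTriple where
  /-- the polynomial `z^{p₋} F` -/
  F : ℂ[X]
  /-- the polynomial `z^{p₋} G` -/
  G : ℂ[X]
  /-- the polynomial `z^{p₋-1} H` -/
  H : ℂ[X]

/-- The relations between the triples at two neighbouring lattice points that express
`U V = V⁺ U`. -/
structure PolyTriple.Link (a b : ℂ) (X Y : PolyTriple) : Prop where
  rel₁₁ : X.G - Y.G + C a * X.H + C b * Y.F = 0
  rel₁₂ : Y.F - Polynomial.X * X.F - C a * (Y.G + X.G) = 0
  rel₂₁ : C b * (Y.G + X.G) + X.H - Polynomial.X * Y.H = 0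
  rel₂₂ : -(Polynomial.X * C b * X.F) - X.G - C a * Polynomial.X * Y.H + Y.G = 0

namespace SpectralData

variable (S : SpectralData)

/-- The polynomial `∏ (z - E_m)`. -/
def curvePoly : ℂ[X] := ∏ m, (X - C (S.E m))

/-- The Laurent polynomials encoded by a polynomial triple. -/
def laurentTriple (X : PolyTriple) : ℂ[T;T⁻¹] × ℂ[T;T⁻¹] × ℂ[T;T⁻¹] :=
  (LaurentPolynomial.T (-(S.deg false : ℤ)) * X.F.toLaurent,
   LaurentPolynomial.T (-(S.deg false : ℤ)) * X.G.toLaurent,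
   LaurentPolynomial.T (1 - (S.deg false : ℤ)) * X.H.toLaurent)

/-- A normalized triple with `G² - F H = R`. -/
structure IsCurveTriple (X : PolyTriple) : Prop where
  degF : ∀ N, S.p < N → X.F.coeff N = 0
  degG : ∀ N, S.p + 1 < N → X.G.coeff N = 0
  degH : ∀ N, S.p < N → X.H.coeff N = 0
  topG : X.G.coeff (S.p + 1) = S.c0 true / 2
  botG : X.G.coeff 0 = S.c0 false / 2
  curve : X.G ^ 2 - Polynomial.X * (X.F * X.H) = C (S.c0 true ^ 2 / 4) * S.curvePoly

/-- The value of `α` encoded in a triple. -/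
def tripleAlpha (X : PolyTriple) : ℂ := (S.c0 false)⁻¹ * X.F.coeff 0

/-- The value of `β` encoded in a triple. -/
def tripleBeta (X : PolyTriple) : ℂ := (S.c0 true)⁻¹ * X.H.coeff S.p

/-- The value of `α⁺` encoded in a triple. -/
def tripleAlphaNext (X : PolyTriple) : ℂ := -(S.c0 true)⁻¹ * X.F.coeff S.p

/-- The value of `β⁺` encoded in a triple. -/
def tripleBetaNext (X : PolyTriple) : ℂ := -(S.c0 false)⁻¹ * X.H.coeff 0

/-- The unnormalized first component of the next triple. -/
def upF (X : PolyTriple) : ℂ[X] :=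
  C (S.tripleAlphaNext X ^ 2) * X.H + C (2 * S.tripleAlphaNext X) * X.G + Polynomial.X * X.F

/-- The unnormalized first component of the previous triple, multiplied by `z`. -/
def downF (X : PolyTriple) : ℂ[X] :=
  C (S.tripleAlpha X ^ 2) * Polynomial.X * X.H - C (2 * S.tripleAlpha X) * X.G + X.F

/-- One step upwards of the stationary algorithm. -/
def up (X : PolyTriple) : PolyTriple where
  F := C (1 - S.tripleAlphaNext X * S.tripleBetaNext X)⁻¹ * S.upF X
  G := C (1 - S.tripleAlphaNext X * S.tripleBetaNext X)⁻¹ *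
    (C (1 + S.tripleAlphaNext X * S.tripleBetaNext X) * X.G + C (S.tripleAlphaNext X) * X.H
      + C (S.tripleBetaNext X) * Polynomial.X * X.F)
  H := C (1 - S.tripleAlphaNext X * S.tripleBetaNext X)⁻¹ *
    divX (C (S.tripleBetaNext X ^ 2) * Polynomial.X * X.F + C (2 * S.tripleBetaNext X) * X.G + X.H)

/-- One step downwards of the stationary algorithm. -/
def down (X : PolyTriple) : PolyTriple where
  F := C (1 - S.tripleAlpha X * S.tripleBeta X)⁻¹ * divX (S.downF X)
  G := C (1 - S.tripleAlpha X * S.tripleBeta X)⁻¹ *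
    (C (1 + S.tripleAlpha X * S.tripleBeta X) * X.G
      - C (S.tripleAlpha X) * Polynomial.X * X.H - C (S.tripleBeta X) * X.F)
  H := C (1 - S.tripleAlpha X * S.tripleBeta X)⁻¹ *
    (C (S.tripleBeta X ^ 2) * X.F - C (2 * S.tripleBeta X) * X.G + Polynomial.X * X.H)

variable {S}

section Relations

variable {X Y : PolyTriple}

theorem IsCurveTriple.coeffF_zero (_hX : S.IsCurveTriple X) :
    X.F.coeff 0 = S.c0 false * S.tripleAlpha X := by
  rw [tripleAlpha, mul_inv_cancel_left₀ (S.c0_ne_zero _)]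

theorem IsCurveTriple.coeffF_top (_hX : S.IsCurveTriple X) :
    X.F.coeff S.p = -(S.c0 true * S.tripleAlphaNext X) := by
  rw [tripleAlphaNext, neg_mul, mul_neg, mul_inv_cancel_left₀ (S.c0_ne_zero _), neg_neg]

theorem IsCurveTriple.coeffH_top (_hX : S.IsCurveTriple X) :
    X.H.coeff S.p = S.c0 true * S.tripleBeta X := by
  rw [tripleBeta, mul_inv_cancel_left₀ (S.c0_ne_zero _)]

theorem IsCurveTriple.coeffH_zero (_hX : S.IsCurveTriple X) :
    X.H.coeff 0 = -(S.c0 false * S.tripleBetaNext X) := by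
  rw [tripleBetaNext, neg_mul, mul_neg, mul_inv_cancel_left₀ (S.c0_ne_zero _), neg_neg]

/-- The factor `1 - α⁺ β⁺` is the point: once a divisor argument shows that this coefficient is
nonzero, the upward step is nondegenerate. -/
theorem IsCurveTriple.upF_coeff_zero (hX : S.IsCurveTriple X) :
    (S.upF X).coeff 0 = S.c0 false * S.tripleAlphaNext X *
      (1 - S.tripleAlphaNext X * S.tripleBetaNext X) := by
  simp only [upF, coeff_add, coeff_C_mul, coeff_X_mul_zero, hX.coeffH_zero, hX.botG]
  ring

/-- At `z^{p+1}` the terms `2 α⁺ G` and `z F` cancel, because `α⁺` is read off from the leading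
coefficient of `F` and `G` has leading coefficient `c_{0,+} / 2`. -/
theorem IsCurveTriple.upF_coeff_eq_zero (hX : S.IsCurveTriple X) {N : ℕ} (hN : S.p < N) :
    (S.upF X).coeff N = 0 := by
  obtain ⟨M, rfl⟩ : ∃ M, N = M + 1 := ⟨N - 1, by omega⟩
  simp only [upF, coeff_add, coeff_C_mul, coeff_X_mul, hX.degH _ hN]
  rcases (Nat.lt_succ_iff.1 hN).eq_or_lt with h | h
  · subst h
    rw [hX.topG, hX.coeffF_top]; ring
  · rw [hX.degG _ (by omega), hX.degF _ h]; ring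

/-- The cancellation of `2 α G` against `F` at `z = 0` is what makes `divX` an honest division in
`down`. -/
theorem IsCurveTriple.downF_coeff_zero (hX : S.IsCurveTriple X) : (S.downF X).coeff 0 = 0 := by
  simp only [downF, coeff_add, coeff_sub, mul_assoc, coeff_C_mul, coeff_X_mul_zero,
    hX.coeffF_zero, hX.botG]
  ring

theorem IsCurveTriple.downF_coeff_succ_eq_zero (hX : S.IsCurveTriple X) {N : ℕ} (hN : S.p < N) :
    (S.downF X).coeff (N + 1) = 0 := by
  simp only [downF, coeff_add, coeff_sub, mul_assoc, coeff_C_mul, coeff_X_mul, hX.degH _ hN,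
    hX.degF _ (hN.trans N.lt_succ_self), hX.degG (N + 1) (by omega)]
  ring

/-- Counterpart of `upF_coeff_zero`: for the downward step the factor `1 - α β` sits in the leading
coefficient. -/
theorem IsCurveTriple.downF_coeff_top (hX : S.IsCurveTriple X) :
    (S.downF X).coeff (S.p + 1) = -(S.c0 true * S.tripleAlpha X *
      (1 - S.tripleAlpha X * S.tripleBeta X)) := by
  simp only [downF, coeff_add, coeff_sub, mul_assoc, coeff_C_mul, coeff_X_mul, hX.coeffH_top,
    hX.degF _ S.p.lt_succ_self, hX.topG]
  ring

theorem C_inv_mul_C {γ : ℂ} (h : γ ≠ 0) : (C γ⁻¹ : ℂ[X]) * C γ = 1 := by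
  rw [← C_mul, inv_mul_cancel₀ h, C_1]

theorem C_inv_mul_one_sub {a b : ℂ} (h : 1 - a * b ≠ 0) :
    (C (1 - a * b)⁻¹ : ℂ[X]) * (1 - C a * C b) = 1 := by
  have := C_inv_mul_C h
  rwa [C_sub, C_mul, C_1] at this

/-- The polynomial under `divX` has no constant term, by the normalization of `G` at `0` and the
choice of `β⁺`. All later computations with `(up X).H` go through this identity. -/
theorem IsCurveTriple.up_H (hX : S.IsCurveTriple X) :
    Polynomial.X * (S.up X).H = C (1 - S.tripleAlphaNext X * S.tripleBetaNext X)⁻¹ *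
      (C (S.tripleBetaNext X ^ 2) * Polynomial.X * X.F + C (2 * S.tripleBetaNext X) * X.G
        + X.H) := by
  rw [up, mul_left_comm]
  congr 1
  conv_rhs => rw [← X_mul_divX_add (C (S.tripleBetaNext X ^ 2) * Polynomial.X * X.F
    + C (2 * S.tripleBetaNext X) * X.G + X.H)]
  rw [left_eq_add, C_eq_zero]
  simp only [coeff_add, mul_assoc, coeff_C_mul, coeff_X_mul_zero, hX.coeffH_zero, hX.botG]
  ring

theorem IsCurveTriple.down_F (hX : S.IsCurveTriple X) :
    Polynomial.X * (S.down X).F = C (1 - S.tripleAlpha X * S.tripleBeta X)⁻¹ * S.downF X := by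
  rw [down, mul_left_comm]
  congr 1
  conv_rhs => rw [← X_mul_divX_add (S.downF X)]
  rw [left_eq_add, C_eq_zero, hX.downF_coeff_zero]

/-- The step formulas are the entries of `U V U⁻¹` with `det U = z (1 - α β)`. Written out, each
relation is a polynomial identity modulo `γ⁻¹ γ = 1`. -/
theorem IsCurveTriple.link_up (hX : S.IsCurveTriple X)
    (h : 1 - S.tripleAlphaNext X * S.tripleBetaNext X ≠ 0) :
    PolyTriple.Link (S.tripleAlphaNext X) (S.tripleBetaNext X) X (S.up X) := by
  have h1 := C_inv_mul_one_sub h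
  have h2 := hX.up_H
  constructor
  · simp only [up, upF, map_mul, map_add, map_pow, map_one]
    simp only [map_ofNat]
    linear_combination (-X.G - C (S.tripleAlphaNext X) * X.H) * h1
  · simp only [up, upF, map_mul, map_add, map_pow, map_one]
    simp only [map_ofNat]
    linear_combination (Polynomial.X * X.F + C (S.tripleAlphaNext X) * X.G) * h1
  · rw [h2]
    simp only [up, upF, map_mul, map_add, map_pow, map_one]
    simp only [map_ofNat]
    linear_combination (-C (S.tripleBetaNext X) * X.G - X.H) * h1
  · rw [mul_assoc (C _), h2]
    simp only [up, upF, map_mul, map_add, map_pow, map_one]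
    simp only [map_ofNat]
    linear_combination (C (S.tripleBetaNext X) * Polynomial.X * X.F + X.G) * h1

theorem IsCurveTriple.up (hX : S.IsCurveTriple X)
    (h : 1 - S.tripleAlphaNext X * S.tripleBetaNext X ≠ 0) : S.IsCurveTriple (S.up X) where
  degF N hN := by
    rw [SpectralData.up, coeff_C_mul, hX.upF_coeff_eq_zero hN, mul_zero]
  degG N hN := by
    obtain ⟨M, rfl⟩ : ∃ M, N = M + 1 := ⟨N - 1, by omega⟩
    simp only [SpectralData.up, coeff_C_mul, coeff_add, mul_assoc, coeff_X_mul, hX.degG _ hN,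
      hX.degH _ (show S.p < M + 1 by omega), hX.degF _ (show S.p < M by omega)]
    ring
  degH N hN := by
    simp only [SpectralData.up, coeff_C_mul, coeff_divX, coeff_add, mul_assoc, coeff_X_mul,
      hX.degF _ hN, hX.degG (N + 1) (by omega), hX.degH (N + 1) (by omega)]
    ring
  topG := by
    simp only [SpectralData.up, coeff_C_mul, coeff_add, mul_assoc, coeff_X_mul, hX.topG,
      hX.coeffF_top, hX.degH _ S.p.lt_succ_self]
    field_simp
    ring
  botG := by
    simp only [SpectralData.up, coeff_C_mul, coeff_add, mul_assoc, coeff_X_mul_zero, hX.botG,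
      hX.coeffH_zero]
    field_simp
    ring
  -- Conjugation keeps the determinant: the unnormalized discriminant is `γ²` times the old one. The
  -- multiplier of `h1` comes from `x² - 1 = (x + 1) (x - 1)` with `x = γ⁻¹ γ`.
  curve := by
    rw [← hX.curve, mul_left_comm, hX.up_H]
    have h1 := C_inv_mul_one_sub h
    simp only [SpectralData.up, upF, map_mul, map_add, map_pow, map_one]
    simp only [map_ofNat]
    linear_combination ((C (1 - S.tripleAlphaNext X * S.tripleBetaNext X)⁻¹ *
      (1 - C (S.tripleAlphaNext X) * C (S.tripleBetaNext X)) + 1) *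
        (X.G ^ 2 - Polynomial.X * X.F * X.H)) * h1

theorem IsCurveTriple.link_down (hX : S.IsCurveTriple X)
    (h : 1 - S.tripleAlpha X * S.tripleBeta X ≠ 0) :
    PolyTriple.Link (S.tripleAlpha X) (S.tripleBeta X) (S.down X) X := by
  have h1 := C_inv_mul_one_sub h
  have h2 := hX.down_F
  constructor
  · simp only [down, map_mul, map_add, map_pow, map_one]
    simp only [map_ofNat]
    linear_combination (X.G - C (S.tripleBeta X) * X.F) * h1
  · rw [h2]
    simp only [down, downF, map_mul, map_add, map_pow, map_one]
    simp only [map_ofNat]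
    linear_combination (-X.F + C (S.tripleAlpha X) * X.G) * h1
  · simp only [down, map_mul, map_add, map_pow, map_one]
    simp only [map_ofNat]
    linear_combination (-C (S.tripleBeta X) * X.G + Polynomial.X * X.H) * h1
  · rw [mul_comm Polynomial.X, mul_assoc (C _), h2]
    simp only [down, downF, map_mul, map_add, map_pow, map_one]
    simp only [map_ofNat]
    linear_combination (C (S.tripleAlpha X) * Polynomial.X * X.H - X.G) * h1

theorem IsCurveTriple.down (hX : S.IsCurveTriple X)
    (h : 1 - S.tripleAlpha X * S.tripleBeta X ≠ 0) : S.IsCurveTriple (S.down X) where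
  degF N hN := by
    rw [SpectralData.down, coeff_C_mul, coeff_divX, hX.downF_coeff_succ_eq_zero hN, mul_zero]
  degG N hN := by
    obtain ⟨M, rfl⟩ : ∃ M, N = M + 1 := ⟨N - 1, by omega⟩
    simp only [SpectralData.down, coeff_C_mul, coeff_add, coeff_sub, mul_assoc, coeff_X_mul,
      hX.degG _ hN, hX.degF _ (show S.p < M + 1 by omega), hX.degH _ (show S.p < M by omega)]
    ring
  degH N hN := by
    obtain ⟨M, rfl⟩ : ∃ M, N = M + 1 := ⟨N - 1, by omega⟩
    simp only [SpectralData.down, coeff_C_mul, coeff_add, coeff_sub, coeff_X_mul, hX.degF _ hN]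
    rcases (Nat.lt_succ_iff.1 hN).eq_or_lt with h' | h'
    · subst h'
      rw [hX.topG, hX.coeffH_top]; ring
    · rw [hX.degG _ (by omega), hX.degH _ h']; ring
  topG := by
    simp only [SpectralData.down, coeff_C_mul, coeff_add, coeff_sub, mul_assoc, coeff_X_mul,
      hX.topG, hX.coeffH_top, hX.degF _ S.p.lt_succ_self]
    field_simp
    ring
  botG := by
    simp only [SpectralData.down, coeff_C_mul, coeff_add, coeff_sub, mul_assoc, coeff_X_mul_zero,
      hX.botG, hX.coeffF_zero]
    field_simp
    ring
  curve := by
    rw [← hX.curve, ← mul_assoc, hX.down_F]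
    have h1 := C_inv_mul_one_sub h
    simp only [SpectralData.down, downF, map_mul, map_add, map_pow, map_one]
    simp only [map_ofNat]
    linear_combination ((C (1 - S.tripleAlpha X * S.tripleBeta X)⁻¹ *
      (1 - C (S.tripleAlpha X) * C (S.tripleBeta X)) + 1) *
        (X.G ^ 2 - Polynomial.X * X.F * X.H)) * h1

/-- In linked triples, the constants of the link are the encoded values of `α` and `β`. -/
theorem IsCurveTriple.link_values (hX : S.IsCurveTriple X) (hY : S.IsCurveTriple Y) {a b : ℂ}
    (h : PolyTriple.Link a b X Y) : S.tripleAlpha Y = a ∧ S.tripleBeta Y = b ∧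
      S.tripleAlphaNext X = a ∧ S.tripleBetaNext X = b := by
  have c1 := S.c0_ne_zero true
  have c2 := S.c0_ne_zero false
  refine ⟨?_, ?_, ?_, ?_⟩
  -- In both triples the end coefficients of `G` are `c_{0,±} / 2`, so their sum is `c_{0,±}`. The
  -- lowest and the highest coefficients of `rel₁₂` and `rel₂₁` therefore isolate `a` and `b`.
  · have := congrArg (fun P => P.coeff 0) h.rel₁₂
    simp only [coeff_add, coeff_sub, coeff_C_mul, coeff_X_mul_zero, coeff_zero, hY.coeffF_zero,
      hY.botG, hX.botG] at this
    apply mul_left_cancel₀ c2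
    linear_combination this
  · have := congrArg (fun P => P.coeff (S.p + 1)) h.rel₂₁
    simp only [coeff_add, coeff_sub, coeff_C_mul, coeff_X_mul, coeff_zero, hY.coeffH_top,
      hY.topG, hX.topG, hX.degH _ S.p.lt_succ_self] at this
    apply mul_left_cancel₀ c1
    linear_combination -this
  · have := congrArg (fun P => P.coeff (S.p + 1)) h.rel₁₂
    simp only [coeff_add, coeff_sub, coeff_C_mul, coeff_X_mul, coeff_zero, hX.coeffF_top,
      hY.topG, hX.topG, hY.degF _ S.p.lt_succ_self] at this
    apply mul_left_cancel₀ c1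
    linear_combination this
  · have := congrArg (fun P => P.coeff 0) h.rel₂₁
    simp only [coeff_add, coeff_sub, coeff_C_mul, coeff_X_mul_zero, coeff_zero, hX.coeffH_zero,
      hY.botG, hX.botG] at this
    apply mul_left_cancel₀ c2
    linear_combination -this

/-- Elimination in the four relations expresses `1 - a b` times each component of `Y` through `X`,
so the link determines `Y`. This gives the uniqueness of orbits. -/
theorem IsCurveTriple.up_eq_of_link (hX : S.IsCurveTriple X) (hY : S.IsCurveTriple Y) {a b : ℂ}
    (h : PolyTriple.Link a b X Y) (hab : 1 - a * b ≠ 0) : S.up X = Y := by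
  obtain ⟨-, -, h3, h4⟩ := hX.link_values hY h
  have h1 := C_inv_mul_one_sub hab
  have hH := hX.up_H
  obtain ⟨r1, r2, r3, r4⟩ := h
  ext1
  · simp only [SpectralData.up, upF, h3, h4, map_mul, map_pow]
    simp only [map_ofNat]
    linear_combination Y.F * h1 + C (1 - a * b)⁻¹ * (- r2 + C a * r1)
  · simp only [SpectralData.up, h3, h4, map_mul, map_add, map_one]
    linear_combination Y.G * h1 + C (1 - a * b)⁻¹ * (r1 - C b * r2)
  · apply mul_left_cancel₀ (X_ne_zero (R := ℂ))
    rw [hH]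
    simp only [h3, h4, map_mul, map_pow]
    simp only [map_ofNat]
    linear_combination Polynomial.X * Y.H * h1 + C (1 - a * b)⁻¹ * (r3 - C b * r4)

theorem IsCurveTriple.down_eq_of_link (hX : S.IsCurveTriple X) (hY : S.IsCurveTriple Y) {a b : ℂ}
    (h : PolyTriple.Link a b X Y) (hab : 1 - a * b ≠ 0) : S.down Y = X := by
  obtain ⟨h3, h4, -, -⟩ := hX.link_values hY h
  have h1 := C_inv_mul_one_sub hab
  have hF := hY.down_F
  obtain ⟨r1, r2, r3, r4⟩ := h
  ext1
  · apply mul_left_cancel₀ (X_ne_zero (R := ℂ))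
    rw [hF]
    simp only [downF, h3, h4, map_mul, map_pow]
    simp only [map_ofNat]
    linear_combination Polynomial.X * X.F * h1 + C (1 - a * b)⁻¹ * (r2 - C a * r4)
  · simp only [SpectralData.down, h3, h4, map_mul, map_add, map_one]
    linear_combination X.G * h1 + C (1 - a * b)⁻¹ * (- r1 + C a * r3)
  · simp only [SpectralData.down, h3, h4, map_mul, map_pow]
    simp only [map_ofNat]
    linear_combination X.H * h1 + C (1 - a * b)⁻¹ * (- r3 + C b * r1)

end Relations

end SpectralData

end AblowitzLadik

end

/-! ### Binomial series, and Laurent polynomials as shifted polynomials -/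

noncomputable section

open Polynomial

namespace AblowitzLadik

/-! ### Binomial series -/

section Binomial

/-- The coefficients of `(1 - η)^{-1/2}`. -/
def invSqrtCoeff (j : ℕ) : ℂ := ((2 * j).factorial : ℂ) / (2 ^ (2 * j) * (j.factorial : ℂ) ^ 2)

theorem invSqrtCoeff_succ (j : ℕ) :
    2 * ((j : ℂ) + 1) * invSqrtCoeff (j + 1) = (2 * j + 1) * invSqrtCoeff j := by
  have h1 : ((j : ℂ) + 1) ≠ 0 := Nat.cast_add_one_ne_zero j
  have h2 : (j.factorial : ℂ) ≠ 0 := Nat.cast_ne_zero.2 j.factorial_ne_zero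
  have h3 : ((2 * (j + 1)).factorial : ℂ) = (2 * j + 2) * (2 * j + 1) * (2 * j).factorial := by
    rw [show 2 * (j + 1) = 2 * j + 1 + 1 by ring, Nat.factorial_succ, Nat.factorial_succ]
    push_cast
    ring
  rw [invSqrtCoeff, invSqrtCoeff, h3, Nat.factorial_succ]
  push_cast
  field_simp
  ring

/-- The two-term recursion of the coefficients is the differential equation `2 (1 - x) b' = b`. It
makes `b² (1 - x)` have derivative zero, and its constant term is one. -/
theorem invSqrt_mk_sq :
    (PowerSeries.mk invSqrtCoeff) ^ 2 * (1 - PowerSeries.X) = 1 := by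
  set b := PowerSeries.mk invSqrtCoeff
  have hb : 2 * ((1 - PowerSeries.X) * PowerSeries.derivative ℂ b) = b := by
    ext k
    have h2 : (2 : PowerSeries ℂ) = PowerSeries.C 2 := (map_ofNat PowerSeries.C 2).symm
    rw [h2, PowerSeries.coeff_C_mul, sub_mul, one_mul, map_sub, PowerSeries.coeff_derivative]
    cases k with
    | zero =>
      rw [PowerSeries.coeff_zero_X_mul]
      have := invSqrtCoeff_succ 0
      simp only [b, PowerSeries.coeff_mk]
      push_cast at this ⊢
      linear_combination this
    | succ k =>
      rw [PowerSeries.coeff_succ_X_mul, PowerSeries.coeff_derivative]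
      have := invSqrtCoeff_succ (k + 1)
      simp only [b, PowerSeries.coeff_mk]
      push_cast at this ⊢
      linear_combination this
  apply PowerSeries.derivative.ext
  · rw [PowerSeries.derivative_one, Derivation.leibniz, Derivation.leibniz_pow, map_sub,
      PowerSeries.derivative_one, PowerSeries.derivative_X]
    simp only [smul_eq_mul, nsmul_eq_mul]
    push_cast
    linear_combination b * hb
  · simp [b, invSqrtCoeff, PowerSeries.constantCoeff_mk]

/-- Writing the square root as `(1 - x)` times the inverse square root reduces everything about the
first series to the identity for the second. -/
theorem sqrt_mk_eq : (PowerSeries.mk fun j : ℕ => -(((2 * j).factorial : ℂ)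
      / (2 ^ (2 * j) * (j.factorial : ℂ) ^ 2 * (2 * (j : ℂ) - 1))))
    = (1 - PowerSeries.X) * PowerSeries.mk invSqrtCoeff := by
  ext k
  rw [sub_mul, one_mul, map_sub, PowerSeries.coeff_mk, PowerSeries.coeff_mk]
  have e : ∀ j : ℕ, -(((2 * j).factorial : ℂ)
      / (2 ^ (2 * j) * (j.factorial : ℂ) ^ 2 * (2 * (j : ℂ) - 1)))
      = -(invSqrtCoeff j / (2 * (j : ℂ) - 1)) := fun j => by
    rw [invSqrtCoeff, div_div]
  rw [e]
  cases k with
  | zero =>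
    rw [PowerSeries.coeff_zero_X_mul]
    push_cast
    ring
  | succ k =>
    rw [PowerSeries.coeff_succ_X_mul, PowerSeries.coeff_mk]
    have h := invSqrtCoeff_succ k
    have h1 : (2 * (k : ℂ) + 1) ≠ 0 := by exact_mod_cast (by omega : 2 * k + 1 ≠ 0)
    have h2 : 2 * ((k + 1 : ℕ) : ℂ) - 1 = 2 * (k : ℂ) + 1 := by push_cast; ring
    rw [h2]
    field_simp
    linear_combination -h

end Binomial

/-- Convolutions become products of power series; associativity and commutativity of these products
replace all manipulations of double sums. -/
theorem conv_eq_coeff (c a : ℕ → ℂ) (ℓ : ℕ) :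
    conv c a ℓ = PowerSeries.coeff ℓ (PowerSeries.mk c * PowerSeries.mk a) := by
  rw [mul_comm, PowerSeries.coeff_mul, Finset.Nat.sum_antidiagonal_eq_sum_range_succ_mk, conv]
  simp [mul_comm]

theorem mk_conv (c a : ℕ → ℂ) :
    PowerSeries.mk (conv c a) = PowerSeries.mk c * PowerSeries.mk a := by
  ext ℓ
  rw [PowerSeries.coeff_mk, conv_eq_coeff]

namespace SpectralData

variable (S : SpectralData)

/-- Each factor is the basic series with `η` rescaled by `E_m^{±1}`, and rescaling is a ring
homomorphism. -/
theorem invSqrtSeries_sq (s : Bool) :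
    S.invSqrtSeries s ^ 2 * ∏ m, (1 - PowerSeries.C (S.Epow s m) * PowerSeries.X) = 1 := by
  rw [invSqrtSeries, ← Finset.prod_pow, ← Finset.prod_mul_distrib]
  refine Finset.prod_eq_one fun m _ => ?_
  have h := congrArg (PowerSeries.rescale (S.Epow s m)) invSqrt_mk_sq
  rw [map_mul, map_pow, map_one, map_sub, map_one, PowerSeries.rescale_X,
    PowerSeries.rescale_mk] at h
  rw [← h]
  congr 3
  ext j
  rw [invSqrtCoeff, mul_comm]

theorem sqrtSeries_eq (s : Bool) :
    S.sqrtSeries s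
      = (∏ m, (1 - PowerSeries.C (S.Epow s m) * PowerSeries.X)) * S.invSqrtSeries s := by
  rw [invSqrtSeries, sqrtSeries, ← Finset.prod_mul_distrib]
  refine Finset.prod_congr rfl fun m _ => ?_
  have h := congrArg (PowerSeries.rescale (S.Epow s m)) sqrt_mk_eq
  rw [map_mul, map_sub, map_one, PowerSeries.rescale_X,
    PowerSeries.rescale_mk, PowerSeries.rescale_mk] at h
  convert h using 2
  · ext j; rw [mul_comm]
  · congr 1; ext j; rw [invSqrtCoeff, mul_comm]

theorem sqrtSeries_mul_invSqrtSeries (s : Bool) : S.sqrtSeries s * S.invSqrtSeries s = 1 := by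
  rw [sqrtSeries_eq, mul_assoc, ← sq, mul_comm, invSqrtSeries_sq]

theorem constantCoeff_invSqrtSeries (s : Bool) :
    PowerSeries.constantCoeff (S.invSqrtSeries s) = 1 := by
  rw [invSqrtSeries, map_prod]
  exact Finset.prod_eq_one fun m _ => by simp

theorem mk_summ (s : Bool) :
    PowerSeries.mk (S.summ s) = PowerSeries.C (S.c0 s) * S.sqrtSeries s := by
  ext k
  rw [PowerSeries.coeff_mk, PowerSeries.coeff_C_mul, summ]

/-! ### Laurent polynomials attached to triples -/

theorem coeff_toLaurent_natCast (P : ℂ[X]) (k : ℕ) : P.toLaurent.coeff (k : ℤ) = P.coeff k := by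
  rw [LaurentPolynomial.coeff_toLaurent]
  exact Finsupp.mapDomain_apply Nat.castEmbedding.injective _ _

theorem coeff_toLaurent_neg (P : ℂ[X]) {j : ℤ} (hj : j < 0) : P.toLaurent.coeff j = 0 := by
  rw [LaurentPolynomial.coeff_toLaurent]
  refine Finsupp.mapDomain_of_notMem_range _ _ ?_
  rintro ⟨k, hk⟩
  have : (k : ℤ) = j := hk
  omega

theorem coeff_T_mul (k j : ℤ) (F : ℂ[T;T⁻¹]) :
    (LaurentPolynomial.T k * F).coeff j = F.coeff (j - k) := by
  rw [LaurentPolynomial.T, AddMonoidAlgebra.coeff_single_mul_eq_mul_coeff (j - k)]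
  · rw [one_mul]
  · intro m _; omega

theorem coeff_C_mul_laurent (c : ℂ) (j : ℤ) (F : ℂ[T;T⁻¹]) :
    (LaurentPolynomial.C c * F).coeff j = c * F.coeff j := by
  rw [← LaurentPolynomial.smul_eq_C_mul]; rfl

theorem coeff_shift_of_eq (P : ℂ[X]) {j k : ℤ} {N : ℕ} (h : j = k + N) :
    (LaurentPolynomial.T k * P.toLaurent).coeff j = P.coeff N := by
  rw [coeff_T_mul, h, add_sub_cancel_left, coeff_toLaurent_natCast]

theorem coeff_shift_of_lt (P : ℂ[X]) {j k : ℤ} (h : j < k) :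
    (LaurentPolynomial.T k * P.toLaurent).coeff j = 0 := by
  rw [coeff_T_mul, coeff_toLaurent_neg _ (by omega)]

theorem deg_add_int : (S.deg false : ℤ) + S.deg true = S.p + 1 := by exact_mod_cast S.deg_add

theorem alphaOf_laurentTriple (X : PolyTriple) :
    S.alphaOf (S.laurentTriple X) = S.tripleAlpha X := by
  rw [alphaOf, tripleAlpha, laurentTriple, coeff_shift_of_eq (N := 0)]; simp

theorem betaOf_laurentTriple (X : PolyTriple) :
    S.betaOf (S.laurentTriple X) = S.tripleBeta X := by
  have := S.deg_add_int
  rw [betaOf, tripleBeta, laurentTriple, coeff_shift_of_eq (N := S.p)]; omega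

theorem alphaPlusOf_laurentTriple (X : PolyTriple) :
    S.alphaPlusOf (S.laurentTriple X) = S.tripleAlphaNext X := by
  have := S.deg_add_int
  rw [alphaPlusOf, tripleAlphaNext, laurentTriple, coeff_shift_of_eq (N := S.p)]; omega

theorem betaPlusOf_laurentTriple (X : PolyTriple) :
    S.betaPlusOf (S.laurentTriple X) = S.tripleBetaNext X := by
  rw [betaPlusOf, tripleBetaNext, laurentTriple, coeff_shift_of_eq (N := 0)]
  push_cast; ring

variable {S}

/-- Transfers the algorithm from Laurent polynomials to polynomials. Only the third component needs
the curve relations, through `up_H`; the first two use just `z⁻¹ z = 1`. -/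
theorem IsCurveTriple.stepUp_laurentTriple {X : PolyTriple} (hX : S.IsCurveTriple X) :
    S.stepUp (S.laurentTriple X) = S.laurentTriple (S.up X) := by
  have h1 : (LaurentPolynomial.T (1 - (S.deg false : ℤ)) : ℂ[T;T⁻¹])
      = LaurentPolynomial.T 1 * LaurentPolynomial.T (-(S.deg false : ℤ)) := by
    rw [← LaurentPolynomial.T_add]; rfl
  have h2 : (LaurentPolynomial.T (-1) : ℂ[T;T⁻¹]) * LaurentPolynomial.T 1 = 1 := by
    rw [← LaurentPolynomial.T_add]; rfl
  have h3 := congrArg Polynomial.toLaurent hX.up_H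
  rw [stepUp, alphaPlusOf_laurentTriple, betaPlusOf_laurentTriple]
  simp only [laurentTriple, h1]
  refine Prod.ext ?_ (Prod.ext ?_ ?_) <;> dsimp only
  · simp only [SpectralData.up, upF, map_mul, map_add, Polynomial.toLaurent_C,
      Polynomial.toLaurent_X]
    linear_combination LaurentPolynomial.T (-(S.deg false : ℤ)) *
      (LaurentPolynomial.C (1 - S.tripleAlphaNext X * S.tripleBetaNext X)⁻¹ *
        (LaurentPolynomial.C (S.tripleAlphaNext X ^ 2) * X.H.toLaurent
          + LaurentPolynomial.C 2 * LaurentPolynomial.C (S.tripleAlphaNext X) * X.G.toLaurent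
          + LaurentPolynomial.T 1 * X.F.toLaurent)) * h2
  · simp only [SpectralData.up, upF, map_mul, map_add, Polynomial.toLaurent_C,
      Polynomial.toLaurent_X]
    linear_combination LaurentPolynomial.T (-(S.deg false : ℤ)) *
      (LaurentPolynomial.C (1 - S.tripleAlphaNext X * S.tripleBetaNext X)⁻¹ *
        ((LaurentPolynomial.C 1 + LaurentPolynomial.C (S.tripleAlphaNext X) *
          LaurentPolynomial.C (S.tripleBetaNext X)) * X.G.toLaurent
          + LaurentPolynomial.C (S.tripleAlphaNext X) * X.H.toLaurent
          + LaurentPolynomial.C (S.tripleBetaNext X) * LaurentPolynomial.T 1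
            * X.F.toLaurent)) * h2
  · simp only [map_mul, map_add, Polynomial.toLaurent_C, Polynomial.toLaurent_X] at h3 ⊢
    linear_combination LaurentPolynomial.T (-(S.deg false : ℤ)) *
      (LaurentPolynomial.C (1 - S.tripleAlphaNext X * S.tripleBetaNext X)⁻¹ *
        (LaurentPolynomial.C (S.tripleBetaNext X ^ 2) * LaurentPolynomial.T 1 * X.F.toLaurent
          + LaurentPolynomial.C 2 * LaurentPolynomial.C (S.tripleBetaNext X) * X.G.toLaurent
          + X.H.toLaurent)) * h2 - LaurentPolynomial.T (-(S.deg false : ℤ)) * h3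

theorem IsCurveTriple.stepDown_laurentTriple {X : PolyTriple} (hX : S.IsCurveTriple X) :
    S.stepDown (S.laurentTriple X) = S.laurentTriple (S.down X) := by
  have h1 : (LaurentPolynomial.T (1 - (S.deg false : ℤ)) : ℂ[T;T⁻¹])
      = LaurentPolynomial.T 1 * LaurentPolynomial.T (-(S.deg false : ℤ)) := by
    rw [← LaurentPolynomial.T_add]; rfl
  have h2 : (LaurentPolynomial.T (-1) : ℂ[T;T⁻¹]) * LaurentPolynomial.T 1 = 1 := by
    rw [← LaurentPolynomial.T_add]; rfl
  have h3 := congrArg Polynomial.toLaurent hX.down_F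
  rw [stepDown, alphaOf_laurentTriple, betaOf_laurentTriple]
  simp only [laurentTriple, h1]
  refine Prod.ext ?_ (Prod.ext ?_ ?_) <;> dsimp only
  · simp only [downF, map_mul, map_add, map_sub, Polynomial.toLaurent_C,
      Polynomial.toLaurent_X] at h3 ⊢
    linear_combination -LaurentPolynomial.T (-1) * LaurentPolynomial.T (-(S.deg false : ℤ)) * h3
      + LaurentPolynomial.T (-(S.deg false : ℤ)) * (S.down X).F.toLaurent * h2
  · simp only [SpectralData.down, map_mul, map_add, map_sub, Polynomial.toLaurent_C,
      Polynomial.toLaurent_X]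
    ring
  · simp only [SpectralData.down, map_mul, map_add, map_sub, Polynomial.toLaurent_C,
      Polynomial.toLaurent_X]
    ring

variable (S)

/-! ### Coefficients of the Laurent polynomials `F, G, H, K` -/

/-- A common form of `laurentF`, `laurentG`, `laurentH` and `laurentK`, which differ only in the
index sets and in which half owns the exponent zero. -/
theorem coeff_laurent_split (u v : ℕ → ℂ) (s t : Finset ℕ) (j : ℤ) :
    (∑ ℓ ∈ s, LaurentPolynomial.C (u ℓ) * LaurentPolynomial.T (-(ℓ : ℤ))
      + ∑ ℓ ∈ t, LaurentPolynomial.C (v ℓ) * LaurentPolynomial.T (ℓ : ℤ)).coeff j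
    = (if -j ∈ s.image ((↑) : ℕ → ℤ) then u (-j).toNat else 0)
      + (if j ∈ t.image ((↑) : ℕ → ℤ) then v j.toNat else 0) := by
  rw [AddMonoidAlgebra.coeff_add, AddMonoidAlgebra.coeff_sum, AddMonoidAlgebra.coeff_sum,
    Finsupp.add_apply, Finsupp.finsetSum_apply, Finsupp.finsetSum_apply]
  simp only [coeff_C_mul_laurent, LaurentPolynomial.T_apply]
  congr 1
  · split_ifs with h
    · obtain ⟨k, hk, hj⟩ := Finset.mem_image.1 h
      rw [Finset.sum_eq_single_of_mem k hk]
      · rw [if_pos (by omega), ← hj, Int.toNat_natCast, mul_one]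
      · intro b _ hb
        rw [if_neg (by omega), mul_zero]
    · refine Finset.sum_eq_zero fun k hk => ?_
      rw [if_neg, mul_zero]
      intro hj
      exact h (Finset.mem_image.2 ⟨k, hk, by omega⟩)
  · split_ifs with h
    · obtain ⟨k, hk, hj⟩ := Finset.mem_image.1 h
      rw [Finset.sum_eq_single_of_mem k hk]
      · rw [if_pos (by omega), ← hj, Int.toNat_natCast, mul_one]
      · intro b _ hb
        rw [if_neg (by omega), mul_zero]
    · refine Finset.sum_eq_zero fun k hk => ?_
      rw [if_neg, mul_zero]
      intro hj
      exact h (Finset.mem_image.2 ⟨k, hk, by omega⟩)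

theorem mem_image_cast (s : Finset ℕ) (j : ℤ) :
    j ∈ s.image ((↑) : ℕ → ℤ) ↔ 0 ≤ j ∧ j.toNat ∈ s := by
  rw [Finset.mem_image]
  constructor
  · rintro ⟨k, hk, rfl⟩
    simpa using hk
  · rintro ⟨h0, h⟩
    exact ⟨_, h, Int.toNat_of_nonneg h0⟩

variable (d : Bool → ℕ) (f : Bool → ℕ → ℂ) (j : ℤ)

/-- Exponents out of range need no extra case: the argument of `ext0` is then negative. -/
theorem coeff_laurentF : (laurentF d f).coeff j =
    if 0 ≤ j then ext0 (f true) (d true - 1 - j) else ext0 (f false) (d false + j) := by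
  rw [laurentF, coeff_laurent_split]
  simp only [mem_image_cast, Finset.mem_Icc, Finset.mem_range, ext0]
  rcases le_or_gt 0 j with h | h
  · rw [if_neg (by omega), if_pos h, zero_add]
    split_ifs with h1 h2 h2 <;> first | omega | (congr 1; omega) | rfl
  · rw [if_neg (c := 0 ≤ j ∧ _) (by omega), if_neg (c := 0 ≤ j) (by omega), add_zero]
    split_ifs with h1 h2 h2 <;> first | omega | (congr 1; omega) | rfl

theorem coeff_laurentG : (laurentG d f).coeff j =
    if 0 ≤ j then ext0 (f true) (d true - j) else ext0 (f false) (d false + j) := by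
  rw [laurentG, coeff_laurent_split]
  simp only [mem_image_cast, Finset.mem_Icc, Finset.mem_range, ext0]
  rcases le_or_gt 0 j with h | h
  · rw [if_neg (by omega), if_pos h, zero_add]
    split_ifs with h1 h2 h2 <;> first | omega | (congr 1; omega) | rfl
  · rw [if_neg (c := 0 ≤ j ∧ _) (by omega), if_neg (c := 0 ≤ j) (by omega), add_zero]
    split_ifs with h1 h2 h2 <;> first | omega | (congr 1; omega) | rfl

theorem coeff_laurentH : (laurentH d f).coeff j =
    if 1 ≤ j then ext0 (f true) (d true - j) else ext0 (f false) (d false - 1 + j) := by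
  rw [laurentH, coeff_laurent_split]
  simp only [mem_image_cast, Finset.mem_Icc, Finset.mem_range, ext0]
  rcases le_or_gt 1 j with h | h
  · rw [if_neg (by omega), if_pos h, zero_add]
    split_ifs with h1 h2 h2 <;> first | omega | (congr 1; omega) | rfl
  · rw [if_neg (c := 0 ≤ j ∧ _) (by omega), if_neg (c := 1 ≤ j) (by omega), add_zero]
    split_ifs with h1 h2 h2 <;> first | omega | (congr 1; omega) | rfl

theorem coeff_laurentK : (laurentK d f).coeff j =
    if 1 ≤ j then ext0 (f true) (d true - j) else ext0 (f false) (d false + j) := by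
  rw [laurentK, coeff_laurent_split]
  simp only [mem_image_cast, Finset.mem_Icc, Finset.mem_range, ext0]
  rcases le_or_gt 1 j with h | h
  · rw [if_neg (by omega), if_pos h, zero_add]
    split_ifs with h1 h2 h2 <;> first | omega | (congr 1; omega) | rfl
  · rw [if_neg (c := 0 ≤ j ∧ _) (by omega), if_neg (c := 1 ≤ j) (by omega), add_zero]
    split_ifs with h1 h2 h2 <;> first | omega | (congr 1; omega) | rfl

end SpectralData

end AblowitzLadik

end

/-! ### Expansions at infinity and at zero: homogeneous coefficients as functions of a triple -/

noncomputable section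

open Polynomial

namespace AblowitzLadik

/-- The homogeneous coefficients are characterized by their generating series. -/
theorem hatPlus_eq_coeff {α β : ℤ → ℂ} {f g h : ℤ → PowerSeries ℂ}
    (g0 : ∀ n, PowerSeries.coeff 0 (g n) = 1 / 2)
    (hg : ∀ n, g n ^ 2 = PowerSeries.X * (f n * h n) + PowerSeries.C (1 / 4))
    (hf : ∀ n, f (n - 1) = PowerSeries.X * f n - PowerSeries.C (α n) * (g n + g (n - 1)))
    (hh : ∀ n, h n = PowerSeries.X * h (n - 1) + PowerSeries.C (β n) * (g n + g (n - 1)))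
    (ℓ : ℕ) : ∀ n, (hatPlus α β ℓ).1 n = PowerSeries.coeff ℓ (f n) ∧
      (hatPlus α β ℓ).2.1 n = PowerSeries.coeff ℓ (g n) ∧
      (hatPlus α β ℓ).2.2 n = PowerSeries.coeff ℓ (h n) := by
  induction ℓ using Nat.strong_induction_on with
  | _ ℓ ih =>
  have hf' : ∀ n, f n = PowerSeries.X * f (n + 1)
      - PowerSeries.C (α (n + 1)) * (g (n + 1) + g n) := fun n => by
    have := hf (n + 1)
    rwa [add_sub_cancel_right] at this
  cases ℓ with
  | zero =>
    intro n
    rw [hatPlus_zero, hf', hh]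
    simp only [map_sub, map_add, PowerSeries.coeff_zero_X_mul, PowerSeries.coeff_C_mul, g0]
    refine ⟨by ring, trivial, by ring⟩
  | succ ℓ =>
    -- In coefficient `ℓ + 1` of `g²` the two extreme products contribute `2 · (1/2) · g_{ℓ+1}`. The
    -- remaining products are those subtracted in the recursion that defines `ĝ`.
    have key : ∀ n, (hatPlus α β (ℓ + 1)).2.1 n = PowerSeries.coeff (ℓ + 1) (g n) := by
      intro n
      have e := congrArg (PowerSeries.coeff (ℓ + 1)) (hg n)
      rw [map_add, PowerSeries.coeff_succ_X_mul, sq, PowerSeries.coeff_mul, PowerSeries.coeff_mul,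
        Finset.Nat.sum_antidiagonal_eq_sum_range_succ_mk,
        ← Finset.Nat.sum_antidiagonal_swap, Finset.Nat.sum_antidiagonal_eq_sum_range_succ_mk,
        PowerSeries.coeff_C, if_neg ℓ.succ_ne_zero, add_zero, Finset.sum_range_succ',
        Finset.sum_range_succ] at e
      simp only [Prod.swap, Nat.sub_self, Nat.sub_zero, g0] at e
      rw [hatPlus_g_succ]
      have e1 : ∑ k ∈ Finset.range (ℓ + 1), (hatPlus α β (ℓ - k)).1 n * (hatPlus α β k).2.2 n
          = ∑ k ∈ Finset.range (ℓ + 1), PowerSeries.coeff (ℓ - k) (f n)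
            * PowerSeries.coeff k (h n) := by
        refine Finset.sum_congr rfl fun k hk => ?_
        rw [(ih (ℓ - k) (by omega) n).1,
          (ih k (Finset.mem_range.1 hk) n).2.2]
      have e2 : ∑ k ∈ Finset.range ℓ, (hatPlus α β (ℓ - k)).2.1 n * (hatPlus α β (k + 1)).2.1 n
          = ∑ k ∈ Finset.range ℓ, PowerSeries.coeff (k + 1) (g n)
            * PowerSeries.coeff (ℓ + 1 - (k + 1)) (g n) := by
        refine Finset.sum_congr rfl fun k hk => ?_
        rw [(ih (ℓ - k) (by omega) n).2.1,
          (ih (k + 1) (by have := Finset.mem_range.1 hk; omega) n).2.1, Nat.add_sub_add_right,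
          mul_comm]
      rw [e1, e2]
      linear_combination -e
    intro n
    refine ⟨?_, key n, ?_⟩
    · rw [hatPlus_f_succ, key, key, (ih ℓ (by omega) (n + 1)).1, hf' n, map_sub,
        PowerSeries.coeff_succ_X_mul, PowerSeries.coeff_C_mul, map_add]
    · rw [hatPlus_h_succ, key, key, (ih ℓ (by omega) (n - 1)).2.2, hh n, map_add,
        PowerSeries.coeff_succ_X_mul, PowerSeries.coeff_C_mul, map_add]

namespace SpectralData

variable (S : SpectralData)

/-! ### Expansions at infinity and at zero -/

/-- The coefficients of a polynomial of degree at most `N`, from the top for `+` and from the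
bottom for `-`, as a power series. -/
def endSeries (s : Bool) (N : ℕ) (P : ℂ[X]) : PowerSeries ℂ :=
  if s then (reflect N P : ℂ[X]) else P

theorem coeff_reflect_of_degree_le {N : ℕ} {P : ℂ[X]} (hP : ∀ M, N < M → P.coeff M = 0) (k : ℕ) :
    (reflect N P).coeff k = if k ≤ N then P.coeff (N - k) else 0 := by
  rw [coeff_reflect]
  split_ifs with h
  · rw [revAt_le h]
  · rw [revAt_eq_self_of_lt (by omega), hP _ (by omega)]

/-- The series of `f̂_{ℓ,±}`, as functions of a triple. -/
def hatSeries (s : Bool) (N : ℕ) (P : ℂ[X]) : PowerSeries ℂ :=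
  PowerSeries.C (S.c0 s)⁻¹ * S.invSqrtSeries s * endSeries s N P

variable {S}

/-- Coefficients are listed from the top power downwards at infinity and from the bottom upwards at
zero. Reflection turns the first kind into the second, so both ends can be treated by the same power
series identities. -/
theorem IsCurveTriple.mk_F {X : PolyTriple} (hX : S.IsCurveTriple X) (s : Bool) :
    (PowerSeries.mk fun k : ℕ => if s then (S.laurentTriple X).1.coeff ((S.deg true : ℤ) - 1 - k)
      else (S.laurentTriple X).1.coeff (-(S.deg false : ℤ) + k)) = endSeries s S.p X.F := by
  have hd := S.deg_add_int
  ext k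
  rw [PowerSeries.coeff_mk, endSeries]
  cases s
  · simp only [Bool.false_eq_true, if_false, Polynomial.coeff_coe]
    rw [laurentTriple, coeff_shift_of_eq X.F (N := k) (by ring)]
  · simp only [if_true, Polynomial.coeff_coe]
    rw [coeff_reflect_of_degree_le hX.degF, laurentTriple]
    split_ifs with h
    · rw [coeff_shift_of_eq X.F (N := S.p - k) (by omega)]
    · rw [coeff_shift_of_lt _ (by omega)]

theorem IsCurveTriple.mk_G {X : PolyTriple} (hX : S.IsCurveTriple X) (s : Bool) :
    (PowerSeries.mk fun k : ℕ => if s then (S.laurentTriple X).2.1.coeff ((S.deg true : ℤ) - k)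
      else (S.laurentTriple X).2.1.coeff (-(S.deg false : ℤ) + k))
        = endSeries s (S.p + 1) X.G := by
  have hd := S.deg_add_int
  ext k
  rw [PowerSeries.coeff_mk, endSeries]
  cases s
  · simp only [Bool.false_eq_true, if_false, Polynomial.coeff_coe]
    rw [laurentTriple, coeff_shift_of_eq X.G (N := k) (by ring)]
  · simp only [if_true, Polynomial.coeff_coe]
    rw [coeff_reflect_of_degree_le hX.degG, laurentTriple]
    split_ifs with h
    · rw [coeff_shift_of_eq X.G (N := S.p + 1 - k) (by omega)]
    · rw [coeff_shift_of_lt _ (by omega)]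

theorem IsCurveTriple.mk_H {X : PolyTriple} (hX : S.IsCurveTriple X) (s : Bool) :
    (PowerSeries.mk fun k : ℕ => if s then (S.laurentTriple X).2.2.coeff ((S.deg true : ℤ) - k)
      else (S.laurentTriple X).2.2.coeff (-(S.deg false : ℤ) + 1 + k)) = endSeries s S.p X.H := by
  have hd := S.deg_add_int
  ext k
  rw [PowerSeries.coeff_mk, endSeries]
  cases s
  · simp only [Bool.false_eq_true, if_false, Polynomial.coeff_coe]
    rw [laurentTriple, coeff_shift_of_eq X.H (N := k) (by ring)]
  · simp only [if_true, Polynomial.coeff_coe]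
    rw [coeff_reflect_of_degree_le hX.degH, laurentTriple]
    split_ifs with h
    · rw [coeff_shift_of_eq X.H (N := S.p - k) (by omega)]
    · rw [coeff_shift_of_lt _ (by omega)]

theorem mk_coeff (P : PowerSeries ℂ) : (PowerSeries.mk fun k => PowerSeries.coeff k P) = P := by
  ext; simp

theorem IsCurveTriple.fHatOf_eq {X : PolyTriple} (hX : S.IsCurveTriple X) (s : Bool) (ℓ : ℕ) :
    S.fHatOf (S.laurentTriple X).1 s ℓ = PowerSeries.coeff ℓ (S.hatSeries s S.p X.F) := by
  rw [fHatOf, conv_eq_coeff, hX.mk_F, mk_coeff, hatSeries, mul_assoc, PowerSeries.coeff_C_mul]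

theorem IsCurveTriple.gHatOf_eq {X : PolyTriple} (hX : S.IsCurveTriple X) (s : Bool) (ℓ : ℕ) :
    S.gHatOf (S.laurentTriple X).2.1 s ℓ
      = PowerSeries.coeff ℓ (S.hatSeries s (S.p + 1) X.G) := by
  rw [gHatOf, conv_eq_coeff, hX.mk_G, mk_coeff, hatSeries, mul_assoc, PowerSeries.coeff_C_mul]

theorem IsCurveTriple.hHatOf_eq {X : PolyTriple} (hX : S.IsCurveTriple X) (s : Bool) (ℓ : ℕ) :
    S.hHatOf (S.laurentTriple X).2.2 s ℓ = PowerSeries.coeff ℓ (S.hatSeries s S.p X.H) := by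
  rw [hHatOf, conv_eq_coeff, hX.mk_H, mk_coeff, hatSeries, mul_assoc, PowerSeries.coeff_C_mul]

/-- The summation constants of the curve have the generating series `c_{0,±} ∏ (1 - E_m^{±1}
η)^{1/2}`, which is inverse to the prefactor of `hatSeries`. Hence the inhomogeneous coefficients
are plain coefficients of `F, G, H`. -/
theorem mk_summ_mul_hatSeries (s : Bool) (N : ℕ) (P : ℂ[X]) :
    PowerSeries.mk (S.summ s) * S.hatSeries s N P = endSeries s N P := by
  have h1 : PowerSeries.C (S.c0 s) * PowerSeries.C (S.c0 s)⁻¹ = 1 := by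
    rw [← map_mul, mul_inv_cancel₀ (S.c0_ne_zero s), map_one]
  have h2 := S.sqrtSeries_mul_invSqrtSeries s
  rw [mk_summ, hatSeries]
  linear_combination (S.sqrtSeries s * S.invSqrtSeries s * endSeries s N P) * h1
    + endSeries s N P * h2

theorem natDegree_le_of_coeff {P : ℂ[X]} {N : ℕ} (h : ∀ M, N < M → P.coeff M = 0) :
    P.natDegree ≤ N :=
  natDegree_le_iff_coeff_eq_zero.2 h

theorem reflect_one_sub_C_mul (e : ℂ) : reflect 1 (X - C e) = 1 - C e * X := by
  rw [sub_eq_add_neg, ← C_neg, reflect_add, reflect_one_X, reflect_C, C_neg]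
  ring

theorem reflect_prod {ι : Type*} (s : Finset ι) (e : ι → ℂ) :
    reflect s.card (∏ i ∈ s, (X - C (e i))) = ∏ i ∈ s, (1 - C (e i) * X) := by
  classical
  induction s using Finset.induction with
  | empty => simp
  | insert a s ha ih =>
    rw [Finset.prod_insert ha, Finset.prod_insert ha, Finset.card_insert_of_notMem ha, add_comm,
      reflect_mul _ _ (natDegree_X_sub_C_le _), ih, reflect_one_sub_C_mul]
    refine (natDegree_prod_le _ _).trans ?_
    exact (Finset.sum_le_card_nsmul _ _ 1 fun i _ => natDegree_X_sub_C_le _).trans (by simp)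

theorem reflect_curvePoly :
    reflect (2 * S.p + 2) S.curvePoly = ∏ m, (1 - C (S.E m) * X) := by
  have := reflect_prod Finset.univ S.E
  rwa [Finset.card_univ, Fintype.card_fin] at this

/-- This is where `c_{0,-}² = c_{0,+}² ∏ E_m` enters: it gives the curve equation the same shape at
zero as at infinity. The number of factors is even, so no sign remains. -/
theorem curvePoly_eq_low :
    C (S.c0 true ^ 2 / 4) * S.curvePoly
      = C (S.c0 false ^ 2 / 4) * ∏ m, (1 - C (S.E m)⁻¹ * X) := by
  have h : ∀ m, (X - C (S.E m) : ℂ[X]) = -(C (S.E m) * (1 - C (S.E m)⁻¹ * X)) := fun m => by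
    have : (C (S.E m) * C (S.E m)⁻¹ : ℂ[X]) = 1 := by
      rw [← C_mul, mul_inv_cancel₀ (S.E_ne_zero m), C_1]
    linear_combination -X * this
  rw [curvePoly, Finset.prod_congr rfl fun m _ => h m, Finset.prod_neg, Finset.card_univ,
    Fintype.card_fin, Even.neg_one_pow ⟨S.p + 1, by ring⟩, one_mul, Finset.prod_mul_distrib,
    ← mul_assoc]
  congr 1
  rw [← map_prod, ← C_mul, S.c0_sq]
  congr 1
  ring

theorem IsCurveTriple.endSeries_curve {X : PolyTriple} (hX : S.IsCurveTriple X) (s : Bool) :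
    endSeries s (S.p + 1) X.G ^ 2
      - PowerSeries.X * (endSeries s S.p X.F * endSeries s S.p X.H)
      = PowerSeries.C (S.c0 s ^ 2 / 4) *
        ∏ m, (1 - PowerSeries.C (S.Epow s m) * PowerSeries.X) := by
  have dF := natDegree_le_of_coeff hX.degF
  have dG := natDegree_le_of_coeff hX.degG
  have dH := natDegree_le_of_coeff hX.degH
  cases s
  · have h := hX.curve
    rw [curvePoly_eq_low] at h
    have h' := congrArg (fun P : ℂ[X] => (P : PowerSeries ℂ)) h
    simp only [endSeries, Bool.false_eq_true, if_false, Epow]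
    simp only [sq, sub_eq_add_neg, Polynomial.coe_mul, Polynomial.coe_add,
      Polynomial.coe_C] at h' ⊢
    rw [show ((-(Polynomial.X * (X.F * X.H)) : ℂ[X]) : PowerSeries ℂ)
      = -(PowerSeries.X * ((X.F : PowerSeries ℂ) * (X.H : PowerSeries ℂ))) by
        rw [← Polynomial.coeToPowerSeries.ringHom_apply, map_neg, map_mul, map_mul]; simp] at h'
    rw [h']
    congr 1
    rw [← Polynomial.coeToPowerSeries.ringHom_apply, map_prod]
    refine Finset.prod_congr rfl fun m _ => ?_
    rw [map_add, map_neg, map_mul]; simp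
  · have e1 : reflect (2 * S.p + 2) (X.G * X.G)
        = reflect (S.p + 1) X.G * reflect (S.p + 1) X.G := by
      rw [← reflect_mul _ _ dG dG]
      congr 1; ring
    have e2 : reflect (2 * S.p + 2) (Polynomial.X * (X.F * X.H))
        = Polynomial.X * (reflect S.p X.F * reflect S.p X.H) := by
      -- The degree budget of `z F H` is `2p + 2`, with `2p` spent on `F H`. The factor `z` is the
      -- middle power of the remaining budget `2` and is fixed by reflection.
      have e3 : reflect (1 + 1) (Polynomial.X : ℂ[X]) = Polynomial.X := by
        have := reflect_monomial (R := ℂ) 2 1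
        rw [revAt_le (by omega), pow_one] at this
        exact this
      rw [← reflect_mul _ _ dF dH]
      conv_rhs => rw [← e3]
      rw [← reflect_mul _ _ (by simp) (natDegree_mul_le_of_le dF dH)]
      congr 1; ring
    have h := congrArg (reflect (2 * S.p + 2)) hX.curve
    rw [reflect_C_mul, reflect_curvePoly, sub_eq_add_neg, ← neg_one_mul, ← C_1, ← C_neg,
      reflect_add, reflect_C_mul, sq, e1, e2] at h
    have h' := congrArg (Polynomial.coeToPowerSeries.ringHom (R := ℂ)) h
    rw [map_mul, map_prod, map_add, map_mul, map_mul, map_mul, map_mul] at h'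
    simp only [map_sub, map_mul, map_one, Polynomial.coeToPowerSeries.ringHom_apply,
      Polynomial.coe_C, Polynomial.coe_X] at h'
    simp only [endSeries, if_true, Epow]
    rw [← h', map_neg, map_one]
    ring

/-- Dividing the curve equation by `y²` and by the constants leaves the universal relation of the
homogeneous coefficients, in which the branch points no longer appear. -/
theorem IsCurveTriple.hatSeries_curve {X : PolyTriple} (hX : S.IsCurveTriple X) (s : Bool) :
    S.hatSeries s (S.p + 1) X.G ^ 2
      = PowerSeries.X * (S.hatSeries s S.p X.F * S.hatSeries s S.p X.H)
        + PowerSeries.C (1 / 4) := by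
  have h1 := hX.endSeries_curve s
  have h2 := S.invSqrtSeries_sq s
  have h3 : PowerSeries.C (S.c0 s)⁻¹ ^ 2 * PowerSeries.C (S.c0 s ^ 2 / 4)
      = PowerSeries.C (1 / 4) := by
    rw [← map_pow, ← map_mul]
    congr 1
    have := S.c0_ne_zero s
    field_simp
  simp only [hatSeries]
  linear_combination PowerSeries.C (S.c0 s)⁻¹ ^ 2 * S.invSqrtSeries s ^ 2 * h1
    + PowerSeries.C (S.c0 s)⁻¹ ^ 2 * PowerSeries.C (S.c0 s ^ 2 / 4) * h2 + h3

/-- The quadratic relation determines the series of `G` only up to sign; the normalized end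
coefficients of `G` select the root with value `1/2`. -/
theorem IsCurveTriple.hatSeries_G_zero {X : PolyTriple} (hX : S.IsCurveTriple X) (s : Bool) :
    PowerSeries.coeff 0 (S.hatSeries s (S.p + 1) X.G) = 1 / 2 := by
  have h : PowerSeries.coeff 0 (endSeries s (S.p + 1) X.G) = S.c0 s / 2 := by
    cases s
    · simp only [endSeries, Bool.false_eq_true, if_false, Polynomial.coeff_coe, hX.botG]
    · simp only [endSeries, if_true, Polynomial.coeff_coe]
      rw [coeff_reflect_of_degree_le hX.degG, if_pos (Nat.zero_le _), Nat.sub_zero, hX.topG]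
  rw [PowerSeries.coeff_zero_eq_constantCoeff_apply] at h ⊢
  rw [hatSeries, map_mul, map_mul, h, constantCoeff_invSqrtSeries, PowerSeries.constantCoeff_C]
  have := S.c0_ne_zero s
  field_simp

/-- Reflection moves the factor `z` in `rel₁₂` to the other triple, so `F` is recursive from right
to left, while `H` is recursive from left to right. The cases of `k` below, at and above `p` are the
interior, the last, and the vanishing coefficients. -/
theorem endSeries_link_true {X Y : PolyTriple} (hX : S.IsCurveTriple X) (hY : S.IsCurveTriple Y)
    {a b : ℂ} (h : PolyTriple.Link a b X Y) :
    (endSeries true S.p X.F = PowerSeries.X * endSeries true S.p Y.F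
      - PowerSeries.C a * (endSeries true (S.p + 1) Y.G + endSeries true (S.p + 1) X.G)) ∧
    (endSeries true S.p Y.H = PowerSeries.X * endSeries true S.p X.H
      + PowerSeries.C b * (endSeries true (S.p + 1) Y.G + endSeries true (S.p + 1) X.G)) := by
  constructor <;> ext k
  · have h1 := fun j => congrArg (fun P => P.coeff j) h.rel₁₂
    simp only [endSeries, if_true, map_sub, PowerSeries.coeff_C_mul, map_add,
      Polynomial.coeff_coe, coeff_reflect_of_degree_le hY.degG,
      coeff_reflect_of_degree_le hX.degG, coeff_reflect_of_degree_le hX.degF]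
    simp only [coeff_sub, coeff_C_mul, coeff_add, coeff_zero] at h1
    cases k with
    | zero =>
      have := h1 (S.p + 1)
      rw [coeff_X_mul, hY.degF _ S.p.lt_succ_self] at this
      simp only [PowerSeries.coeff_zero_X_mul, Nat.zero_le, if_true, Nat.sub_zero]
      linear_combination -this
    | succ k =>
      rw [PowerSeries.coeff_succ_X_mul, Polynomial.coeff_coe,
        coeff_reflect_of_degree_le hY.degF]
      rcases lt_trichotomy k S.p with hk | hk | hk
      · have := h1 (S.p - k)
        rw [show S.p - k = (S.p - (k + 1)) + 1 by omega, coeff_X_mul] at this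
        rw [if_pos (by omega), if_pos (by omega), if_pos (by omega), if_pos (by omega),
          show S.p - k = (S.p - (k + 1)) + 1 by omega,
          show S.p + 1 - (k + 1) = (S.p - (k + 1)) + 1 by omega]
        linear_combination -this
      · have := h1 0
        rw [coeff_X_mul_zero] at this
        rw [if_neg (by omega), if_pos (by omega), if_pos (by omega), if_pos (by omega),
          show S.p + 1 - (k + 1) = 0 by omega, show S.p - k = 0 by omega]
        linear_combination -this
      · rw [if_neg (by omega), if_neg (by omega), if_neg (by omega), if_neg (by omega)]
        ring
  · have h1 := fun j => congrArg (fun P => P.coeff j) h.rel₂₁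
    simp only [endSeries, if_true, PowerSeries.coeff_C_mul, map_add,
      Polynomial.coeff_coe, coeff_reflect_of_degree_le hY.degG,
      coeff_reflect_of_degree_le hX.degG, coeff_reflect_of_degree_le hY.degH]
    simp only [coeff_sub, coeff_C_mul, coeff_add, coeff_zero] at h1
    cases k with
    | zero =>
      have := h1 (S.p + 1)
      rw [coeff_X_mul, hX.degH _ S.p.lt_succ_self] at this
      simp only [PowerSeries.coeff_zero_X_mul, Nat.zero_le, if_true, Nat.sub_zero]
      linear_combination -this
    | succ k =>
      rw [PowerSeries.coeff_succ_X_mul, Polynomial.coeff_coe,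
        coeff_reflect_of_degree_le hX.degH]
      rcases lt_trichotomy k S.p with hk | hk | hk
      · have := h1 (S.p - k)
        rw [show S.p - k = (S.p - (k + 1)) + 1 by omega, coeff_X_mul] at this
        rw [if_pos (by omega), if_pos (by omega), if_pos (by omega), if_pos (by omega),
          show S.p - k = (S.p - (k + 1)) + 1 by omega,
          show S.p + 1 - (k + 1) = (S.p - (k + 1)) + 1 by omega]
        linear_combination -this
      · have := h1 0
        rw [coeff_X_mul_zero] at this
        rw [if_neg (by omega), if_pos (by omega), if_pos (by omega), if_pos (by omega),
          show S.p + 1 - (k + 1) = 0 by omega, show S.p - k = 0 by omega]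
        linear_combination -this
      · rw [if_neg (by omega), if_neg (by omega), if_neg (by omega), if_neg (by omega)]
        ring

theorem endSeries_link_false {X Y : PolyTriple} {a b : ℂ} (h : PolyTriple.Link a b X Y) :
    (endSeries false S.p Y.F = PowerSeries.X * endSeries false S.p X.F
      + PowerSeries.C a * (endSeries false (S.p + 1) Y.G + endSeries false (S.p + 1) X.G)) ∧
    (endSeries false S.p X.H = PowerSeries.X * endSeries false S.p Y.H
      - PowerSeries.C b * (endSeries false (S.p + 1) Y.G + endSeries false (S.p + 1) X.G)) := by
  simp only [endSeries, Bool.false_eq_true, if_false, ← Polynomial.coe_C, ← Polynomial.coe_X,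
    ← Polynomial.coeToPowerSeries.ringHom_apply, ← map_add, ← map_mul, ← map_sub]
  refine ⟨congrArg _ ?_, congrArg _ ?_⟩
  · linear_combination h.rel₁₂
  · linear_combination h.rel₂₁

/-- A sequence of curve triples linked by `α, β`. -/
structure IsOrbit (S : SpectralData) (α β : ℤ → ℂ) (X : ℤ → PolyTriple) : Prop where
  triple : ∀ n, S.IsCurveTriple (X n)
  link : ∀ n, PolyTriple.Link (α n) (β n) (X (n - 1)) (X n)

/-- The bridge between the two descriptions: by `hatPlus_eq_coeff` the series of the triple are the
generating series of the recursion, since they satisfy the same quadratic and linear relations. At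
zero the roles of `α, β` and of `F, H` are exchanged. -/
theorem IsOrbit.hats {α β : ℤ → ℂ} {X : ℤ → PolyTriple} (h : S.IsOrbit α β X) (s : Bool) (ℓ : ℕ)
    (n : ℤ) :
    fHat α β s ℓ n = PowerSeries.coeff ℓ (S.hatSeries s S.p (X n).F) ∧
    gHat α β s ℓ n = PowerSeries.coeff ℓ (S.hatSeries s (S.p + 1) (X n).G) ∧
    hHat α β s ℓ n = PowerSeries.coeff ℓ (S.hatSeries s S.p (X n).H) := by
  cases s
  · have := hatPlus_eq_coeff (α := β) (β := α)
      (f := fun n => S.hatSeries false S.p (X n).H)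
      (g := fun n => S.hatSeries false (S.p + 1) (X n).G)
      (h := fun n => S.hatSeries false S.p (X n).F)
      (fun n => (h.triple n).hatSeries_G_zero false)
      (fun n => by rw [(h.triple n).hatSeries_curve false, mul_comm (S.hatSeries false S.p _)])
      (fun n => by
        simp only [hatSeries]
        rw [(endSeries_link_false (S := S) (h.link n)).2]; ring)
      (fun n => by
        simp only [hatSeries]
        rw [(endSeries_link_false (S := S) (h.link n)).1]; ring) ℓ n
    exact ⟨this.2.2, this.2.1, this.1⟩
  · exact hatPlus_eq_coeff
      (f := fun n => S.hatSeries true S.p (X n).F)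
      (g := fun n => S.hatSeries true (S.p + 1) (X n).G)
      (h := fun n => S.hatSeries true S.p (X n).H)
      (fun n => (h.triple n).hatSeries_G_zero true)
      (fun n => by rw [(h.triple n).hatSeries_curve true])
      (fun n => by
        simp only [hatSeries]
        rw [(endSeries_link_true (h.triple (n - 1)) (h.triple n) (h.link n)).1]; ring)
      (fun n => by
        simp only [hatSeries]
        rw [(endSeries_link_true (h.triple (n - 1)) (h.triple n) (h.link n)).2]; ring) ℓ n

section Orbit

variable {α β : ℤ → ℂ} {X : ℤ → PolyTriple}

/-- Hence the state functions in the autonomous system are the homogeneous coefficients of the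
lattice solution. -/
theorem IsOrbit.fHatOf_eq (h : S.IsOrbit α β X) (n : ℤ) (s : Bool) :
    S.fHatOf (S.laurentTriple (X n)).1 s = fun ℓ => fHat α β s ℓ n := by
  funext ℓ; rw [(h.triple n).fHatOf_eq, (h.hats s ℓ n).1]

theorem IsOrbit.gHatOf_eq (h : S.IsOrbit α β X) (n : ℤ) (s : Bool) :
    S.gHatOf (S.laurentTriple (X n)).2.1 s = fun ℓ => gHat α β s ℓ n := by
  funext ℓ; rw [(h.triple n).gHatOf_eq, (h.hats s ℓ n).2.1]

theorem IsOrbit.hHatOf_eq (h : S.IsOrbit α β X) (n : ℤ) (s : Bool) :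
    S.hHatOf (S.laurentTriple (X n)).2.2 s = fun ℓ => hHat α β s ℓ n := by
  funext ℓ; rw [(h.triple n).hHatOf_eq, (h.hats s ℓ n).2.2]

theorem IsOrbit.fCoef_eq (h : S.IsOrbit α β X) (n : ℤ) (s : Bool) (ℓ : ℕ) :
    fCoef S.summ α β s ℓ n = PowerSeries.coeff ℓ (endSeries s S.p (X n).F) := by
  rw [fCoef, conv_eq_coeff, ← mk_summ_mul_hatSeries (S := S)]
  congr 2
  ext k
  rw [PowerSeries.coeff_mk, (h.hats s k n).1]

theorem IsOrbit.gCoef_eq (h : S.IsOrbit α β X) (n : ℤ) (s : Bool) (ℓ : ℕ) :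
    gCoef S.summ α β s ℓ n = PowerSeries.coeff ℓ (endSeries s (S.p + 1) (X n).G) := by
  rw [gCoef, conv_eq_coeff, ← mk_summ_mul_hatSeries (S := S)]
  congr 2
  ext k
  rw [PowerSeries.coeff_mk, (h.hats s k n).2.1]

theorem IsOrbit.hCoef_eq (h : S.IsOrbit α β X) (n : ℤ) (s : Bool) (ℓ : ℕ) :
    hCoef S.summ α β s ℓ n = PowerSeries.coeff ℓ (endSeries s S.p (X n).H) := by
  rw [hCoef, conv_eq_coeff, ← mk_summ_mul_hatSeries (S := S)]
  congr 2
  ext k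
  rw [PowerSeries.coeff_mk, (h.hats s k n).2.2]

theorem IsOrbit.fCoef_coeff (h : S.IsOrbit α β X) (n : ℤ) (s : Bool) (ℓ : ℕ) :
    fCoef S.summ α β s ℓ n = if s then (S.laurentTriple (X n)).1.coeff ((S.deg true : ℤ) - 1 - ℓ)
      else (S.laurentTriple (X n)).1.coeff (-(S.deg false : ℤ) + ℓ) := by
  rw [h.fCoef_eq, ← (h.triple n).mk_F, PowerSeries.coeff_mk]

theorem IsOrbit.gCoef_coeff (h : S.IsOrbit α β X) (n : ℤ) (s : Bool) (ℓ : ℕ) :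
    gCoef S.summ α β s ℓ n = if s then (S.laurentTriple (X n)).2.1.coeff ((S.deg true : ℤ) - ℓ)
      else (S.laurentTriple (X n)).2.1.coeff (-(S.deg false : ℤ) + ℓ) := by
  rw [h.gCoef_eq, ← (h.triple n).mk_G, PowerSeries.coeff_mk]

theorem IsOrbit.hCoef_coeff (h : S.IsOrbit α β X) (n : ℤ) (s : Bool) (ℓ : ℕ) :
    hCoef S.summ α β s ℓ n = if s then (S.laurentTriple (X n)).2.2.coeff ((S.deg true : ℤ) - ℓ)
      else (S.laurentTriple (X n)).2.2.coeff (-(S.deg false : ℤ) + 1 + ℓ) := by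
  rw [h.hCoef_eq, ← (h.triple n).mk_H, PowerSeries.coeff_mk]

end Orbit

variable (S) in
/-- The Laurent polynomials of a triple satisfying degree bounds have the expected range. -/
theorem IsCurveTriple.coeff_laurent {X : PolyTriple} (hX : S.IsCurveTriple X) (j : ℤ) :
    ((j < -(S.deg false : ℤ) ∨ (S.deg true : ℤ) - 1 < j) → (S.laurentTriple X).1.coeff j = 0) ∧
    ((j < -(S.deg false : ℤ) ∨ (S.deg true : ℤ) < j) → (S.laurentTriple X).2.1.coeff j = 0) ∧
    ((j < 1 - (S.deg false : ℤ) ∨ (S.deg true : ℤ) < j) →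
      (S.laurentTriple X).2.2.coeff j = 0) := by
  have hd := S.deg_add_int
  refine ⟨?_, ?_, ?_⟩ <;> rintro (h | h) <;> rw [laurentTriple]
  · exact coeff_shift_of_lt _ h
  · rw [coeff_shift_of_eq (N := (j + S.deg false).toNat) _ (by omega), hX.degF _ (by omega)]
  · exact coeff_shift_of_lt _ h
  · rw [coeff_shift_of_eq (N := (j + S.deg false).toNat) _ (by omega), hX.degG _ (by omega)]
  · exact coeff_shift_of_lt _ h
  · rw [coeff_shift_of_eq (N := (j + S.deg false - 1).toNat) _ (by omega), hX.degH _ (by omega)]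

section Orbit

variable {α β : ℤ → ℂ} {X : ℤ → PolyTriple}

theorem IsOrbit.Fpoly_eq (h : S.IsOrbit α β X) (n : ℤ) :
    Fpoly S.summ α β S.deg n = (S.laurentTriple (X n)).1 := by
  ext j
  have := (IsCurveTriple.coeff_laurent S (h.triple n) j).1
  rw [Fpoly, coeff_laurentF]
  simp only [ext0, h.fCoef_coeff]
  split_ifs with h1 h2 h2
  · congr 1; omega
  · rw [this (by omega)]
  · simp at *
  · congr 1; omega
  · rw [this (by omega)]

theorem IsOrbit.Gpoly_eq (h : S.IsOrbit α β X) (n : ℤ) :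
    Gpoly S.summ α β S.deg n = (S.laurentTriple (X n)).2.1 := by
  ext j
  have := (IsCurveTriple.coeff_laurent S (h.triple n) j).2.1
  rw [Gpoly, coeff_laurentG]
  simp only [ext0, h.gCoef_coeff]
  split_ifs with h1 h2 h2
  · congr 1; omega
  · rw [this (by omega)]
  · simp at *
  · congr 1; omega
  · rw [this (by omega)]

theorem IsOrbit.Hpoly_eq (h : S.IsOrbit α β X) (n : ℤ) :
    Hpoly S.summ α β S.deg n = (S.laurentTriple (X n)).2.2 := by
  ext j
  have := (IsCurveTriple.coeff_laurent S (h.triple n) j).2.2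
  rw [Hpoly, coeff_laurentH]
  simp only [ext0, h.hCoef_coeff]
  split_ifs with h1 h2 h2
  · congr 1; omega
  · rw [this (by omega)]
  · simp at *
  · congr 1; omega
  · rw [this (by omega)]

theorem R_eq : S.R = LaurentPolynomial.T (-(S.deg false : ℤ)) ^ 2 *
    (C (S.c0 true ^ 2 / 4) * S.curvePoly).toLaurent := by
  rw [R, curvePoly, map_mul, map_prod, LaurentPolynomial.T_pow, Polynomial.toLaurent_C]
  simp only [map_sub, Polynomial.toLaurent_X, Polynomial.toLaurent_C]
  rw [show -2 * (S.deg false : ℤ) = ((2 : ℕ) : ℤ) * -(S.deg false : ℤ) by push_cast; ring]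
  ring

theorem IsCurveTriple.laurent_curve {X : PolyTriple} (hX : S.IsCurveTriple X) :
    (S.laurentTriple X).2.1 ^ 2 - (S.laurentTriple X).1 * (S.laurentTriple X).2.2 = S.R := by
  rw [R_eq, ← hX.curve, laurentTriple]
  have h1 : (LaurentPolynomial.T (1 - (S.deg false : ℤ)) : ℂ[T;T⁻¹])
      = LaurentPolynomial.T 1 * LaurentPolynomial.T (-(S.deg false : ℤ)) := by
    rw [← LaurentPolynomial.T_add]; rfl
  simp only [h1, map_sub, map_pow, map_mul, Polynomial.toLaurent_X]
  ring

/-- An orbit of the stationary algorithm with `α β ∉ {0, 1}` is a stationary solution. -/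
theorem IsOrbit.isStationarySolution (h : S.IsOrbit α β X) (h0 : ∀ n, α n * β n ≠ 0)
    (h1 : ∀ n, α n * β n ≠ 1) : S.IsStationarySolution α β := by
  refine ⟨h0, h1, fun n => ?_, fun n => ?_, fun n => ?_⟩
  · have hX := h.triple (n - 1)
    have hY := h.triple n
    constructor
    -- The polynomial coefficient `p₋` is the Laurent coefficient of `z⁰`, where the `+` half and
    -- the `-` half meet; there `rel₁₂` is the stationary equation.
    · have r := congrArg (fun P => P.coeff (S.deg false)) (h.link n).rel₁₂
      simp only [coeff_sub, coeff_C_mul, coeff_add, coeff_zero] at r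
      rw [sAL₁, h.gCoef_coeff, h.gCoef_coeff]
      simp only [ext0, h.fCoef_coeff, if_true, Bool.false_eq_true, if_false]
      have a1 : (S.laurentTriple (X n)).2.1.coeff ((S.deg true : ℤ) - (S.deg true : ℕ))
          = (X n).G.coeff (S.deg false) := coeff_shift_of_eq _ (by omega)
      have a2 : (S.laurentTriple (X (n - 1))).2.1.coeff (-(S.deg false : ℤ) + (S.deg false : ℕ))
          = (X (n - 1)).G.coeff (S.deg false) := coeff_shift_of_eq _ (by omega)
      -- If `p₊ = 0` then `p₋ = p + 1` exceeds the degree bound of `F`, in agreement with `f_{-1,+}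
      -- = 0`.
      have a3 : (if 0 ≤ (S.deg true : ℤ) - 1 then (S.laurentTriple (X n)).1.coeff
          ((S.deg true : ℤ) - 1 - ((S.deg true : ℤ) - 1).toNat) else 0)
          = (X n).F.coeff (S.deg false) := by
        split_ifs with h3
        · exact coeff_shift_of_eq _ (by omega)
        · rw [hY.degF _ (by have := S.deg_add; omega)]
      have a4 : (if 0 ≤ (S.deg false : ℤ) - 1 then (S.laurentTriple (X (n - 1))).1.coeff
          (-(S.deg false : ℤ) + ((S.deg false : ℤ) - 1).toNat) else 0)
          = (Polynomial.X * (X (n - 1)).F).coeff (S.deg false) := by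
        split_ifs with h3
        · obtain ⟨q, hq⟩ : ∃ q, S.deg false = q + 1 := ⟨S.deg false - 1, by omega⟩
          rw [hq, coeff_X_mul]
          exact coeff_shift_of_eq _ (by omega)
        · rw [show S.deg false = 0 by omega, coeff_X_mul_zero]
      rw [a1, a2, a3, a4]
      linear_combination r
    · have r := congrArg (fun P => P.coeff (S.deg false)) (h.link n).rel₂₁
      simp only [coeff_sub, coeff_C_mul, coeff_add, coeff_zero] at r
      rw [sAL₂, h.gCoef_coeff, h.gCoef_coeff]
      simp only [ext0, h.hCoef_coeff, if_true, Bool.false_eq_true, if_false]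
      have a1 : (S.laurentTriple (X (n - 1))).2.1.coeff ((S.deg true : ℤ) - (S.deg true : ℕ))
          = (X (n - 1)).G.coeff (S.deg false) := coeff_shift_of_eq _ (by omega)
      have a2 : (S.laurentTriple (X n)).2.1.coeff (-(S.deg false : ℤ) + (S.deg false : ℕ))
          = (X n).G.coeff (S.deg false) := coeff_shift_of_eq _ (by omega)
      have a3 : (if 0 ≤ (S.deg true : ℤ) - 1 then (S.laurentTriple (X (n - 1))).2.2.coeff
          ((S.deg true : ℤ) - ((S.deg true : ℤ) - 1).toNat) else 0)
          = (X (n - 1)).H.coeff (S.deg false) := by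
        split_ifs with h3
        · exact coeff_shift_of_eq _ (by omega)
        · rw [hX.degH _ (by have := S.deg_add; omega)]
      have a4 : (if 0 ≤ (S.deg false : ℤ) - 1 then (S.laurentTriple (X n)).2.2.coeff
          (-(S.deg false : ℤ) + 1 + ((S.deg false : ℤ) - 1).toNat) else 0)
          = (Polynomial.X * (X n).H).coeff (S.deg false) := by
        split_ifs with h3
        · obtain ⟨q, hq⟩ : ∃ q, S.deg false = q + 1 := ⟨S.deg false - 1, by omega⟩
          rw [hq, coeff_X_mul]
          exact coeff_shift_of_eq _ (by omega)
        · rw [show S.deg false = 0 by omega, coeff_X_mul_zero]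
      rw [a1, a2, a3, a4]
      linear_combination r
  -- Counted from the top and from the bottom, both sides are the coefficient of `z⁰` in the same
  -- polynomial.
  · rw [h.gCoef_coeff, h.gCoef_coeff]
    simp only [if_true, Bool.false_eq_true, if_false]
    congr 1
    omega
  · rw [h.Fpoly_eq, h.Gpoly_eq, h.Hpoly_eq, (h.triple n).laurent_curve]

end Orbit

end SpectralData

end AblowitzLadik

end

/-! ### Orders of functions in the local charts of the curve -/

noncomputable section

open Polynomial

namespace AblowitzLadik

open Filter Topology

/-! ### Orders of vanishing at the origin -/

/-- `f` is meromorphic of order `n` at the origin. -/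
def HasOrd (f : ℂ → ℂ) (n : ℤ) : Prop :=
  ∃ g : ℂ → ℂ, AnalyticAt ℂ g 0 ∧ g 0 ≠ 0 ∧ ∀ᶠ ζ in 𝓝[≠] (0 : ℂ), f ζ = ζ ^ n * g ζ

theorem hasOrd_iff {f : ℂ → ℂ} {n : ℤ} :
    HasOrd f n ↔ MeromorphicAt f 0 ∧ meromorphicOrderAt f 0 = ((n : ℤ) : WithTop ℤ) := by
  constructor
  · rintro ⟨g, h1, h2, h3⟩
    have hm : MeromorphicAt f 0 := by
      refine MeromorphicAt.congr (f := fun ζ => ζ ^ n * g ζ) ?_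
        (h3.mono fun ζ hζ => hζ.symm)
      exact (MeromorphicAt.zpow (MeromorphicAt.id 0) n).mul h1.meromorphicAt
    refine ⟨hm, (meromorphicOrderAt_eq_int_iff hm).2 ⟨g, h1, h2, ?_⟩⟩
    simpa using h3
  · rintro ⟨hm, h⟩
    obtain ⟨g, h1, h2, h3⟩ := (meromorphicOrderAt_eq_int_iff hm).1 h
    exact ⟨g, h1, h2, by simpa using h3⟩

theorem HasOrd.mul {f g : ℂ → ℂ} {m n : ℤ} (hf : HasOrd f m) (hg : HasOrd g n) :
    HasOrd (fun ζ => f ζ * g ζ) (m + n) := by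
  obtain ⟨u, h1, h2, h3⟩ := hf
  obtain ⟨v, k1, k2, k3⟩ := hg
  refine ⟨fun ζ => u ζ * v ζ, h1.mul k1, mul_ne_zero h2 k2, ?_⟩
  filter_upwards [h3, k3, self_mem_nhdsWithin] with ζ a b c
  rw [a, b, zpow_add₀ c]
  ring

theorem HasOrd.div {f g : ℂ → ℂ} {m n : ℤ} (hf : HasOrd f m) (hg : HasOrd g n) :
    HasOrd (fun ζ => f ζ / g ζ) (m - n) := by
  obtain ⟨u, h1, h2, h3⟩ := hf
  obtain ⟨v, k1, k2, k3⟩ := hg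
  refine ⟨fun ζ => u ζ / v ζ, h1.div k1 k2, div_ne_zero h2 k2, ?_⟩
  filter_upwards [h3, k3, self_mem_nhdsWithin] with ζ a b c
  rw [a, b, zpow_sub₀ c, mul_div_mul_comm]

theorem HasOrd.congr {f g : ℂ → ℂ} {n : ℤ} (hf : HasOrd f n)
    (h : ∀ᶠ ζ in 𝓝[≠] (0 : ℂ), f ζ = g ζ) : HasOrd g n := by
  obtain ⟨u, h1, h2, h3⟩ := hf
  refine ⟨u, h1, h2, ?_⟩
  filter_upwards [h3, h] with ζ a b
  rw [← b, a]

theorem HasOrd.eventually_ne {f : ℂ → ℂ} {n : ℤ} (hf : HasOrd f n) :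
    ∀ᶠ ζ in 𝓝[≠] (0 : ℂ), f ζ ≠ 0 := by
  obtain ⟨u, h1, h2, h3⟩ := hf
  have h4 : ∀ᶠ ζ in 𝓝[≠] (0 : ℂ), u ζ ≠ 0 :=
    (h1.continuousAt.eventually_ne h2).filter_mono nhdsWithin_le_nhds
  filter_upwards [h3, h4, self_mem_nhdsWithin] with ζ a b c
  rw [a]
  exact mul_ne_zero (zpow_ne_zero _ c) b

/-- Used for `y + B`: its order is not visible directly where it vanishes, but its product with `B -
y` is a polynomial. -/
theorem HasOrd.of_mul {f g : ℂ → ℂ} {m n : ℤ} (h : HasOrd (fun ζ => f ζ * g ζ) m)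
    (hg : HasOrd g n) : HasOrd f (m - n) := by
  refine (h.div hg).congr ?_
  filter_upwards [hg.eventually_ne] with ζ hζ
  rw [mul_div_cancel_right₀ _ hζ]

theorem HasOrd.pow {f : ℂ → ℂ} {n : ℤ} (hf : HasOrd f n) (k : ℕ) :
    HasOrd (fun ζ => f ζ ^ k) (k * n) := by
  induction k with
  | zero => exact ⟨1, analyticAt_const, one_ne_zero, by simp⟩
  | succ k ih =>
    have := ih.mul hf
    simp only [pow_succ]
    convert this using 1
    push_cast
    ring

theorem hasOrd_of_ne {f : ℂ → ℂ} (hf : AnalyticAt ℂ f 0) (h : f 0 ≠ 0) : HasOrd f 0 :=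
  ⟨f, hf, h, by simp⟩

theorem hasOrd_id : HasOrd (fun ζ => ζ) 1 := ⟨1, analyticAt_const, one_ne_zero, by simp⟩

theorem hasOrd_zpow_mul {f : ℂ → ℂ} (n : ℤ) (hf : AnalyticAt ℂ f 0) (h : f 0 ≠ 0) :
    HasOrd (fun ζ => ζ ^ n * f ζ) n := ⟨f, hf, h, by simp⟩

theorem analyticAt_eval (P : ℂ[X]) {u : ℂ → ℂ} (hu : AnalyticAt ℂ u 0) :
    AnalyticAt ℂ (fun ζ => P.eval (u ζ)) 0 := by
  have := hu.aeval_polynomial P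
  simpa [Polynomial.coe_aeval_eq_eval] using this

/-- The order of a polynomial along a local parametrization. -/
theorem HasOrd.eval {u : ℂ → ℂ} {e : ℤ} {z₀ : ℂ} (hu : AnalyticAt ℂ u 0) (h0 : u 0 = z₀)
    (he : HasOrd (fun ζ => u ζ - z₀) e) {P : ℂ[X]} (hP : P ≠ 0) :
    HasOrd (fun ζ => P.eval (u ζ)) (P.rootMultiplicity z₀ * e) := by
  obtain ⟨Q, h1, h2⟩ := exists_eq_pow_rootMultiplicity_mul_and_not_dvd P hP z₀
  have h3 : Q.eval z₀ ≠ 0 := fun h => h2 (dvd_iff_isRoot.2 h)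
  have h4 := (he.pow (P.rootMultiplicity z₀)).mul
    (hasOrd_of_ne (analyticAt_eval Q hu) (by rw [h0]; exact h3))
  rw [add_zero] at h4
  refine h4.congr (Eventually.of_forall fun ζ => ?_)
  conv_rhs => rw [h1]
  simp

theorem csqrt_ne_zero {x : ℂ} (hx : x ≠ 0) : csqrt x ≠ 0 := fun h => hx (by
  rw [← csqrt_sq x, h]; simp)

theorem csqrt_one : csqrt 1 = 1 := by simp [csqrt]

theorem analyticAt_csqrt {u : ℂ → ℂ} {x : ℂ} (hu : AnalyticAt ℂ u x) (h : u x = 1) :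
    AnalyticAt ℂ (fun ζ => csqrt (u ζ)) x :=
  hu.cpow analyticAt_const (by rw [h]; exact Complex.one_mem_slitPlane)

theorem eval_inv_eq {P : ℂ[X]} {N : ℕ} (hP : P.natDegree ≤ N) {ζ : ℂ} (hζ : ζ ≠ 0) :
    P.eval ζ⁻¹ = ζ ^ (-(N : ℤ)) * (reflect N P).eval ζ := by
  have := invertibleOfNonzero (inv_ne_zero hζ)
  have h := eval₂_reflect_mul_pow (RingHom.id ℂ) ζ⁻¹ N P hP
  rw [invOf_eq_inv, inv_inv] at h
  rw [Polynomial.eval, Polynomial.eval, ← h, mul_comm, zpow_neg, zpow_natCast, inv_pow]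

/-- The order of a polynomial at infinity. -/
theorem hasOrd_eval_inv {P : ℂ[X]} (hP : P ≠ 0) :
    HasOrd (fun ζ => P.eval ζ⁻¹) (-(P.natDegree : ℤ)) := by
  have h := hasOrd_zpow_mul (-(P.natDegree : ℤ))
    (analyticAt_eval (reflect P.natDegree P) (analyticAt_id (𝕜 := ℂ))) (by
      rw [id, ← coeff_zero_eq_eval_zero, coeff_reflect, revAt_zero]
      exact leadingCoeff_ne_zero.2 hP)
  refine h.congr ?_
  filter_upwards [self_mem_nhdsWithin] with ζ hζ
  rw [eval_inv_eq le_rfl hζ, id]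

namespace SpectralData

variable {S : SpectralData}

theorem hasDivisor_iff {f : S.Point → ℂ} {D : S.Point → ℤ} :
    HasDivisor f D ↔ ∀ P, HasOrd (fun ζ => f (chart P ζ)) (D P) :=
  forall_congr' fun _ => hasOrd_iff.symm

theorem HasDivisor.mul {f g : S.Point → ℂ} {D D' : S.Point → ℤ} (hf : HasDivisor f D)
    (hg : HasDivisor g D') : HasDivisor (fun P => f P * g P) (fun P => D P + D' P) :=
  hasDivisor_iff.2 fun P => (hasDivisor_iff.1 hf P).mul (hasDivisor_iff.1 hg P)

theorem HasDivisor.div {f g : S.Point → ℂ} {D D' : S.Point → ℤ} (hf : HasDivisor f D)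
    (hg : HasDivisor g D') : HasDivisor (fun P => f P / g P) (fun P => D P - D' P) :=
  hasDivisor_iff.2 fun P => (hasDivisor_iff.1 hf P).div (hasDivisor_iff.1 hg P)

theorem LinEquiv.trans {D D' D'' : S.Point → ℤ} (h : LinEquiv D D') (h' : LinEquiv D' D'') :
    LinEquiv D D'' := by
  obtain ⟨f, hf⟩ := h
  obtain ⟨g, hg⟩ := h'
  refine ⟨_, (show (fun P => D P - D'' P) = fun P => (D P - D' P) + (D' P - D'' P) by
    funext P; ring) ▸ hf.mul hg⟩

theorem LinEquiv.add_right {D D' : S.Point → ℤ} (h : LinEquiv D D') (A : S.Point → ℤ) :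
    LinEquiv (D + A) (D' + A) := by
  obtain ⟨f, hf⟩ := h
  refine ⟨f, ?_⟩
  simpa using hf

variable (S) in
theorem curvePoly_eval (z : ℂ) : S.curvePoly.eval z = ∏ m, (z - S.E m) := by
  rw [curvePoly, eval_prod]; simp

/-- The zeros of `∏ (z - E_m)` are simple. -/
theorem exists_curvePoly_eq {z₀ : ℂ} (h : S.curvePoly.eval z₀ = 0) :
    ∃ Q : ℂ[X], S.curvePoly = (X - C z₀) * Q ∧ Q.eval z₀ ≠ 0 := by
  classical
  rw [curvePoly_eval, Finset.prod_eq_zero_iff] at h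
  obtain ⟨m₀, -, hm⟩ := h
  rw [sub_eq_zero] at hm
  refine ⟨∏ m ∈ Finset.univ.erase m₀, (X - C (S.E m)), ?_, ?_⟩
  · rw [curvePoly, ← Finset.mul_prod_erase _ _ (Finset.mem_univ m₀), hm]
  · rw [eval_prod]
    refine Finset.prod_ne_zero_iff.2 fun m hm' => ?_
    rw [eval_sub, eval_X, eval_C, hm, sub_ne_zero]
    exact fun h' => (Finset.mem_erase.1 hm').1 (S.E_injective h').symm

/-! ### Local parametrizations -/

theorem E_ne_of_curve {z₀ y₀ : ℂ} (h : y₀ ^ 2 = ∏ m, (z₀ - S.E m)) (hy : y₀ ≠ 0)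
    (m : Fin (2 * S.p + 2)) : z₀ - S.E m ≠ 0 := by
  have h0 : ∏ m, (z₀ - S.E m) ≠ 0 := by rw [← h]; exact pow_ne_zero 2 hy
  exact Finset.prod_ne_zero_iff.1 h0 m (Finset.mem_univ m)

theorem yBranch_self {z₀ y₀ : ℂ} (h : y₀ ^ 2 = ∏ m, (z₀ - S.E m)) (hy : y₀ ≠ 0) :
    S.yBranch z₀ y₀ z₀ = y₀ := by
  rw [yBranch, Finset.prod_eq_one fun m _ => ?_, mul_one]
  rw [div_self (E_ne_of_curve h hy m), csqrt_one]

theorem analyticAt_yBranch {z₀ y₀ : ℂ} (h : y₀ ^ 2 = ∏ m, (z₀ - S.E m)) (hy : y₀ ≠ 0) :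
    AnalyticAt ℂ (S.yBranch z₀ y₀) z₀ := by
  unfold yBranch
  refine analyticAt_const.mul ?_
  have : ∀ m ∈ Finset.univ, AnalyticAt ℂ (fun ζ => csqrt ((ζ - S.E m) / (z₀ - S.E m))) z₀ :=
    fun m _ => analyticAt_csqrt (x := z₀)
      ((analyticAt_id.sub analyticAt_const).div analyticAt_const (E_ne_of_curve h hy m))
      (div_self (E_ne_of_curve h hy m))
  exact Finset.analyticAt_fun_prod Finset.univ this

theorem chart_aff_of_ne {z y : ℂ} (h : y ^ 2 = ∏ m, (z - S.E m)) (hy : y ≠ 0) (ζ : ℂ) :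
    chart (.aff z y h) ζ
      = .aff (z + ζ) (S.yBranch z y (z + ζ)) (S.yBranch_sq h hy _) := by
  rw [chart, dif_neg hy]

theorem chart_aff_zero {z : ℂ} (h : (0 : ℂ) ^ 2 = ∏ m, (z - S.E m)) (ζ : ℂ) :
    chart (.aff z 0 h) ζ = .aff (z + ζ ^ 2) (S.yRamified z ζ) (S.yRamified_sq h ζ) := by
  rw [chart, dif_pos rfl]

/-- At a branch point `y` is exactly the local coordinate times a unit, so it has a simple zero
there. -/
theorem exists_yRamified_eq {z₀ : ℂ} : ∃ u : ℂ → ℂ, AnalyticAt ℂ u 0 ∧ u 0 ≠ 0 ∧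
    ∀ ζ, S.yRamified z₀ ζ = ζ * u ζ := by
  classical
  refine ⟨fun ζ => csqrt (∏ m ∈ Finset.univ.filter (fun m => S.E m ≠ z₀), (z₀ - S.E m))
    * ∏ m ∈ Finset.univ.filter (fun m => S.E m ≠ z₀),
        csqrt ((z₀ + ζ ^ 2 - S.E m) / (z₀ - S.E m)), ?_, ?_, fun ζ => ?_⟩
  · refine analyticAt_const.mul (Finset.analyticAt_fun_prod _ fun m hm => ?_)
    have hm' : z₀ - S.E m ≠ 0 := sub_ne_zero.2 (Finset.mem_filter.1 hm).2.symm
    refine analyticAt_csqrt (x := 0) ?_ (by simp [div_self hm'])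
    exact ((analyticAt_const.add (analyticAt_id.pow 2)).sub analyticAt_const).div
      analyticAt_const hm'
  · refine mul_ne_zero (csqrt_ne_zero (Finset.prod_ne_zero_iff.2 fun m hm => ?_))
      (Finset.prod_ne_zero_iff.2 fun m hm => ?_)
    · exact sub_ne_zero.2 (Finset.mem_filter.1 hm).2.symm
    · have hm' : z₀ - S.E m ≠ 0 := sub_ne_zero.2 (Finset.mem_filter.1 hm).2.symm
      rw [zero_pow two_ne_zero, add_zero, div_self hm', csqrt_one]
      exact one_ne_zero
  · rw [yRamified, mul_assoc]

/-- The order of `y + B` and of polynomials at a finite point. -/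
theorem hasOrd_chart_aff {z₀ y₀ : ℂ} (h : y₀ ^ 2 = ∏ m, (z₀ - S.E m)) {B Q A : ℂ[X]}
    (hQ : B ^ 2 - S.curvePoly = Q) (hQ0 : Q ≠ 0) (hA : A ≠ 0) (f : S.Point → ℂ)
    (hf : ∀ z y (h : y ^ 2 = ∏ m, (z - S.E m)), f (.aff z y h) = (y + B.eval z) / A.eval z) :
    HasOrd (fun ζ => f (chart (.aff z₀ y₀ h) ζ))
      ((if B.eval z₀ = -y₀ then (Q.rootMultiplicity z₀ : ℤ) else 0)
        - (if y₀ = 0 then 2 else 1) * A.rootMultiplicity z₀) := by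
  -- On the curve `(y + B) (B - y)` is the polynomial `Q = B² - y²`. Where `B - y` does not vanish,
  -- the order of `y + B` is that of `Q`.
  have hcurve : ∀ z y : ℂ, y ^ 2 = ∏ m, (z - S.E m) →
      (y + B.eval z) * (B.eval z - y) = Q.eval z := by
    intro z y hy
    rw [← hQ, eval_sub, eval_pow, curvePoly_eval, ← hy]; ring
  by_cases hy : y₀ = 0
  · subst hy
    simp only [chart_aff_zero, hf, if_true, neg_zero]
    have hu : AnalyticAt ℂ (fun ζ : ℂ => z₀ + ζ ^ 2) 0 :=
      analyticAt_const.add (analyticAt_id.pow 2)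
    have he : HasOrd (fun ζ : ℂ => z₀ + ζ ^ 2 - z₀) 2 :=
      (hasOrd_id.pow 2).congr (Eventually.of_forall fun ζ => by ring)
    have hAo := HasOrd.eval hu (by simp) he hA
    rw [mul_comm] at hAo
    refine HasOrd.div ?_ hAo
    obtain ⟨w, w1, w2, w3⟩ := exists_yRamified_eq (S := S) (z₀ := z₀)
    simp only [w3]
    -- At a branch point both factors vanish together, so `of_mul` does not apply. If `B` vanishes
    -- too, then `Q` has a simple zero because `∏ (z - E_m)` has one, and `y + B = ζ (w + ζ B₁)`
    -- also has order one.
    split_ifs with hB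
    · obtain ⟨B₁, rfl⟩ := dvd_iff_isRoot.2 hB
      have hP0 : S.curvePoly.eval z₀ = 0 := by rw [curvePoly_eval, ← h]; simp
      obtain ⟨P₁, hP₁, hP₁0⟩ := exists_curvePoly_eq hP0
      have hQ1 : Q = (X - C z₀) * ((X - C z₀) * B₁ ^ 2 - P₁) := by
        rw [← hQ, hP₁]; ring
      have hQ2 : ((X - C z₀) * B₁ ^ 2 - P₁).eval z₀ ≠ 0 := by
        simpa using hP₁0
      have hQ3 : Q.rootMultiplicity z₀ = 1 := by
        rw [hQ1, rootMultiplicity_mul (by rw [← hQ1]; exact hQ0),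
          rootMultiplicity_X_sub_C_self, rootMultiplicity_eq_zero hQ2]
      rw [hQ3]
      have : HasOrd (fun ζ : ℂ => ζ * (w ζ + ζ * B₁.eval (z₀ + ζ ^ 2))) (1 + 0) :=
        hasOrd_id.mul (hasOrd_of_ne (w1.add (analyticAt_id.mul (analyticAt_eval B₁ hu)))
          (by simpa using w2))
      refine this.congr (Eventually.of_forall fun ζ => ?_)
      simp only [eval_mul, eval_sub, eval_X, eval_C]
      ring
    · exact hasOrd_of_ne ((analyticAt_id.mul w1).add (analyticAt_eval B hu)) (by simpa using hB)
  · simp only [chart_aff_of_ne h hy, hf, if_neg hy]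
    have hu : AnalyticAt ℂ (fun ζ : ℂ => z₀ + ζ) 0 := analyticAt_const.add analyticAt_id
    have he : HasOrd (fun ζ : ℂ => z₀ + ζ - z₀) 1 :=
      hasOrd_id.congr (Eventually.of_forall fun ζ => by ring)
    have hAo := HasOrd.eval hu (by simp) he hA
    rw [mul_comm] at hAo
    have hya : AnalyticAt ℂ (fun ζ : ℂ => S.yBranch z₀ y₀ (z₀ + ζ)) 0 :=
      AnalyticAt.fun_comp (by rw [add_zero]; exact analyticAt_yBranch h hy) hu
    have hy0 : S.yBranch z₀ y₀ (z₀ + 0) = y₀ := by rw [add_zero, yBranch_self h hy]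
    refine HasOrd.div ?_ hAo
    split_ifs with hB
    · have hQo := HasOrd.eval hu (by simp) he hQ0
      rw [mul_one] at hQo
      -- At the point itself `B - y` has the value `-2 y₀`, which is nonzero off the branch points.
      have h2 : HasOrd (fun ζ => B.eval (z₀ + ζ) - S.yBranch z₀ y₀ (z₀ + ζ)) 0 := by
        refine hasOrd_of_ne ((analyticAt_eval B hu).sub hya) ?_
        rw [hy0, add_zero, hB, ← neg_add', neg_ne_zero, ← two_mul]
        exact mul_ne_zero two_ne_zero hy
      have h3 : HasOrd (fun ζ => (S.yBranch z₀ y₀ (z₀ + ζ) + B.eval (z₀ + ζ))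
          * (B.eval (z₀ + ζ) - S.yBranch z₀ y₀ (z₀ + ζ))) (Q.rootMultiplicity z₀) :=
        hQo.congr (Eventually.of_forall fun ζ => by
          rw [hcurve _ _ (S.yBranch_sq h hy _)])
      simpa using h3.of_mul h2
    · refine hasOrd_of_ne (hya.add (analyticAt_eval B hu)) ?_
      rw [hy0, add_zero]
      intro h0
      exact hB (by linear_combination h0)

/-- `P_{∞₊}` and `P_{∞₋}`. -/
def infPt (ε : ℤˣ) : S.Point := if ε = 1 then .infPlus else .infMinus

theorem chart_infPt (ε : ℤˣ) {ζ : ℂ} (hζ : ζ ≠ 0) : ∃ h,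
    chart (infPt ε : S.Point) ζ = .aff ζ⁻¹ (-((ε : ℤ) : ℂ) * S.yInf ζ) h := by
  rcases Int.units_eq_one_or ε with rfl | rfl
  · refine ⟨by simpa using S.yInf_sq hζ, ?_⟩
    rw [infPt, if_pos rfl, chart, dif_neg hζ]
    simp
  · refine ⟨by simpa using S.yInf_sq hζ, ?_⟩
    rw [infPt, if_neg (by decide), chart, dif_neg hζ]
    simp

/-- Since `y ∼ ∓ z^{p+1}` at `P_{∞±}`, the leading terms of `y` and of `B ∼ ε z^{p+1}` add up at one
point at infinity and cancel at the other. At the latter the order follows from the degree of `(y +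
B) (B - y) = Q`. -/
theorem hasOrd_chart_inf {B Q A : ℂ[X]} (hQ : B ^ 2 - S.curvePoly = Q) (hQ0 : Q ≠ 0) (hA : A ≠ 0)
    (hB : B.natDegree ≤ S.p + 1) (ε : ℤˣ) (hε : B.coeff (S.p + 1) = ((ε : ℤ) : ℂ))
    (f : S.Point → ℂ)
    (hf : ∀ z y (h : y ^ 2 = ∏ m, (z - S.E m)), f (.aff z y h) = (y + B.eval z) / A.eval z) :
    HasOrd (fun ζ => f (chart (infPt (-ε)) ζ)) (-((S.p : ℤ) + 1) + A.natDegree) ∧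
    HasOrd (fun ζ => f (chart (infPt ε) ζ)) ((S.p : ℤ) + 1 - Q.natDegree + A.natDegree) := by
  set u : ℂ → ℂ := fun ζ => ∏ m, csqrt (1 - S.E m * ζ) with hu_def
  have hu : AnalyticAt ℂ u 0 := Finset.analyticAt_fun_prod _ fun m _ =>
    analyticAt_csqrt (x := 0) (analyticAt_const.sub (analyticAt_const.mul analyticAt_id))
      (by simp)
  have hu0 : u 0 = 1 := by simp [hu_def, csqrt_one]
  have hy : ∀ ζ, S.yInf ζ = ζ ^ (-((S.p + 1 : ℕ) : ℤ)) * u ζ := fun ζ => by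
    rw [yInf, zpow_neg, zpow_natCast, inv_pow]
  have hεsq : ((ε : ℤ) : ℂ) * ((ε : ℤ) : ℂ) = 1 := by
    rw [← Int.cast_mul, Int.units_coe_mul_self, Int.cast_one]
  have hε0 : ((ε : ℤ) : ℂ) ≠ 0 := fun h => by simp [h] at hεsq
  have hb : (reflect (S.p + 1) B).eval 0 = ((ε : ℤ) : ℂ) := by
    rw [← coeff_zero_eq_eval_zero, coeff_reflect, revAt_zero, hε]
  have key : HasOrd (fun ζ => ((ε : ℤ) : ℂ) * S.yInf ζ + B.eval ζ⁻¹)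
      (-((S.p + 1 : ℕ) : ℤ)) := by
    refine (hasOrd_zpow_mul (-((S.p + 1 : ℕ) : ℤ))
      (f := fun ζ => ((ε : ℤ) : ℂ) * u ζ + (reflect (S.p + 1) B).eval ζ)
      ((analyticAt_const.mul hu).add (analyticAt_eval _ analyticAt_id)) ?_).congr ?_
    · rw [hu0, hb, mul_one, ← two_mul]
      exact mul_ne_zero two_ne_zero hε0
    · filter_upwards [self_mem_nhdsWithin] with ζ hζ
      rw [hy, eval_inv_eq hB hζ]
      ring
  have hQi := hasOrd_eval_inv hQ0
  have hAi := hasOrd_eval_inv hA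
  constructor
  · refine ((key.div hAi).congr ?_ : HasOrd _ (_ - _)) |> fun h => by
      convert h using 1
      push_cast; ring
    filter_upwards [self_mem_nhdsWithin] with ζ hζ
    obtain ⟨h, hc⟩ := chart_infPt (S := S) (-ε) hζ
    rw [hc, hf]
    simp
  · have h2 : HasOrd (fun ζ => (-((ε : ℤ) : ℂ) * S.yInf ζ + B.eval ζ⁻¹)
        * (((ε : ℤ) : ℂ) * S.yInf ζ + B.eval ζ⁻¹)) (-(Q.natDegree : ℤ)) := by
      refine hQi.congr ?_
      filter_upwards [self_mem_nhdsWithin] with ζ hζ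
      have := S.yInf_sq hζ
      rw [← hQ, eval_sub, eval_pow, curvePoly_eval, ← this]
      linear_combination S.yInf ζ ^ 2 * hεsq
    refine (((h2.of_mul key).div hAi).congr ?_ : HasOrd _ (_ - _)) |> fun h => by
      convert h using 1
      push_cast; ring
    filter_upwards [self_mem_nhdsWithin] with ζ hζ
    obtain ⟨h, hc⟩ := chart_infPt (S := S) ε hζ
    rw [hc, hf]

end SpectralData

end AblowitzLadik

end

/-! ### Divisors on graphs and their linear equivalences -/

noncomputable section

open Polynomial

namespace AblowitzLadik

open Filter Topology

namespace SpectralData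

variable (S : SpectralData)

/-! ### Divisors cut out on the curve by a graph `y = B(z)` -/

open Classical in
/-- The point `(μ, B(μ))` of the curve. -/
def graphPoint (B : ℂ[X]) (μ : ℂ) : S.Point :=
  if h : B.eval μ ^ 2 = ∏ m, (μ - S.E m) then .aff μ (B.eval μ) h else .infPlus

variable {S}

theorem graphPoint_of_curve {B : ℂ[X]} {μ : ℂ} (h : B.eval μ ^ 2 = ∏ m, (μ - S.E m)) :
    S.graphPoint B μ = .aff μ (B.eval μ) h := dif_pos h

theorem graphPoint_congr {B B' : ℂ[X]} {μ : ℂ} (h : B.eval μ = B'.eval μ) :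
    S.graphPoint B μ = S.graphPoint B' μ := by
  unfold graphPoint
  simp only [h]

theorem infPt_one : (infPt 1 : S.Point) = .infPlus := if_pos rfl

theorem infPt_neg_one : (infPt (-1) : S.Point) = .infMinus := if_neg (by decide)

theorem curve_of_dvd {A B : ℂ[X]} (h : A ∣ B ^ 2 - S.curvePoly) {μ : ℂ} (hμ : A.eval μ = 0) :
    B.eval μ ^ 2 = ∏ m, (μ - S.E m) := by
  have := eval_eq_zero_of_dvd_of_eval_eq_zero h hμ
  rwa [eval_sub, eval_pow, curvePoly_eval, sub_eq_zero] at this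

-- The map `μ ↦ (μ, B(μ))` is injective on the roots of `A`, and all its values there are points of
-- the curve, so the default value of `graphPoint` never occurs.
open Classical in
theorem count_graph_aff {A B : ℂ[X]} (hA : A ≠ 0) (h : A ∣ B ^ 2 - S.curvePoly) {z₀ y₀ : ℂ}
    (hz : y₀ ^ 2 = ∏ m, (z₀ - S.E m)) :
    (A.roots.map (S.graphPoint B)).count (.aff z₀ y₀ hz)
      = if B.eval z₀ = y₀ then A.rootMultiplicity z₀ else 0 := by
  have hmem : ∀ μ ∈ A.roots, B.eval μ ^ 2 = ∏ m, (μ - S.E m) := fun μ hμ =>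
    curve_of_dvd h (isRoot_of_mem_roots hμ)
  split_ifs with hy
  · subst hy
    by_cases hroot : z₀ ∈ A.roots
    · rw [← graphPoint_of_curve hz, Multiset.count_map_eq_count _ _ _ _ hroot, count_roots]
      intro μ hμ ν hν hμν
      rw [graphPoint_of_curve (hmem μ hμ), graphPoint_of_curve (hmem ν hν)] at hμν
      injection hμν
    · rw [rootMultiplicity_eq_zero (fun h => hroot ((mem_roots hA).2 h)),
        Multiset.count_eq_zero]
      intro hc
      obtain ⟨μ, hμ, hc⟩ := Multiset.mem_map.1 hc
      rw [graphPoint_of_curve (hmem μ hμ)] at hc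
      injection hc with h1
      exact hroot (h1 ▸ hμ)
  · rw [Multiset.count_eq_zero]
    intro hc
    obtain ⟨μ, hμ, hc⟩ := Multiset.mem_map.1 hc
    rw [graphPoint_of_curve (hmem μ hμ)] at hc
    injection hc with h1 h2
    exact hy (h1 ▸ h2)

theorem infPt_notMem_graph {A B : ℂ[X]} (h : A ∣ B ^ 2 - S.curvePoly) (ε : ℤˣ) :
    infPt ε ∉ A.roots.map (S.graphPoint B) := by
  intro hc
  obtain ⟨μ, hμ, hc⟩ := Multiset.mem_map.1 hc
  rw [graphPoint_of_curve (curve_of_dvd h (isRoot_of_mem_roots hμ))] at hc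
  unfold infPt at hc
  split_ifs at hc

theorem single_apply' (P Q : S.Point) [Decidable (Q = P)] :
    single P Q = if Q = P then 1 else 0 := by
  classical
  unfold single
  rw [Pi.single_apply]
  congr

theorem infPt_ne_neg (ε : ℤˣ) : (infPt ε : S.Point) ≠ infPt (-ε) := by
  rcases Int.units_eq_one_or ε with rfl | rfl
  · rw [infPt_one, infPt_neg_one]; exact fun h => by injection h
  · rw [neg_neg, infPt_one, infPt_neg_one]; exact fun h => by injection h

theorem infPt_ne_aff (ε : ℤˣ) {z y : ℂ} (h : y ^ 2 = ∏ m, (z - S.E m)) :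
    (infPt ε : S.Point) ≠ .aff z y h := by
  unfold infPt
  split_ifs <;> exact fun h => by injection h

/-- The divisor of the function `(y + B) / A`. -/
theorem linEquiv_graph {A N B : ℂ[X]} {k : ℂ} (hk : k ≠ 0)
    (hQ : B ^ 2 - S.curvePoly = C k * X * (A * N)) (hA0 : A ≠ 0) (hA : A.natDegree = S.p)
    (hN0 : N ≠ 0) (hN : N.natDegree ≤ S.p) (hB : B.natDegree ≤ S.p + 1) {ε : ℤˣ}
    (hε : B.coeff (S.p + 1) = ((ε : ℤ) : ℂ)) {D D' : Sym S.Point S.p}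
    (hD : (D : Multiset S.Point) = A.roots.map (S.graphPoint B))
    (hD' : (D' : Multiset S.Point) = N.roots.map (S.graphPoint (-B))
      + Multiset.replicate (S.p - N.natDegree) (infPt ε))
    (hZ : (-B.eval 0) ^ 2 = ∏ m, (0 - S.E m)) :
    LinEquiv (divisor D')
      (divisor D + single (infPt (-ε)) - single (.aff 0 (-B.eval 0) hZ)) := by
  classical
  have hQ0 : C k * X * (A * N) ≠ 0 :=
    mul_ne_zero (mul_ne_zero (C_ne_zero.2 hk) X_ne_zero) (mul_ne_zero hA0 hN0)
  have dA : A ∣ B ^ 2 - S.curvePoly := hQ ▸ ⟨C k * X * N, by ring⟩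
  have dN : N ∣ (-B) ^ 2 - S.curvePoly := by
    rw [neg_sq, hQ]; exact ⟨C k * X * A, by ring⟩
  -- The function `y + B` vanishes on the graph of `-B` over the zeros of `z A N`, and `A` vanishes
  -- on the graphs of both `B` and `-B`. In the quotient the contributions of `A` on the graph of
  -- `-B` cancel, leaving `N`, the point over `0`, and `-D`. The values at infinity are irrelevant,
  -- since only punctured neighbourhoods matter.
  let f : S.Point → ℂ := fun P => match P with
    | .aff z y _ => (y + B.eval z) / A.eval z
    | _ => 0
  have hf : ∀ z y (h : y ^ 2 = ∏ m, (z - S.E m)), f (.aff z y h) = (y + B.eval z) / A.eval z :=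
    fun _ _ _ => rfl
  obtain ⟨inf1, inf2⟩ := hasOrd_chart_inf hQ hQ0 hA0 hB ε hε f hf
  have degQ : (C k * X * (A * N)).natDegree = S.p + 1 + N.natDegree := by
    rw [natDegree_mul (mul_ne_zero (C_ne_zero.2 hk) X_ne_zero) (mul_ne_zero hA0 hN0),
      natDegree_C_mul_X _ hk, natDegree_mul hA0 hN0, hA]
    ring
  have cD : ∀ δ, divisor D (infPt δ) = 0 := fun δ => by
    rw [divisor, hD, Multiset.count_eq_zero.2]
    · rfl
    · exact infPt_notMem_graph dA δ
  have cN : ∀ δ, (N.roots.map (S.graphPoint (-B))).count (infPt δ) = 0 := fun δ =>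
    Multiset.count_eq_zero.2 (infPt_notMem_graph dN δ)
  have c1 : divisor D' (infPt ε) = S.p - N.natDegree := by
    have : divisor D' (infPt ε) = ((D' : Multiset S.Point).count (infPt ε) : ℤ) := rfl
    rw [this, hD', Multiset.count_add, cN, Multiset.count_replicate_self, zero_add, Nat.cast_sub hN]
  have c2 : divisor D' (infPt (-ε)) = 0 := by
    have : divisor D' (infPt (-ε)) = ((D' : Multiset S.Point).count (infPt (-ε)) : ℤ) := rfl
    rw [this, hD', Multiset.count_add, cN, zero_add, Multiset.count_replicate,
      if_neg (infPt_ne_neg ε)]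
    rfl
  -- Any point that is not finite is one of the two ends of the curve, in the labelling chosen by
  -- the leading coefficient of `B`.
  have hinf : ∀ P : S.Point, (∀ z y h, P ≠ .aff z y h) → P = infPt ε ∨ P = infPt (-ε) := by
    intro P hP
    rcases Int.units_eq_one_or ε with rfl | rfl
    · rw [infPt_one, infPt_neg_one]
      cases P with
      | aff z y h => exact absurd rfl (hP z y h)
      | infPlus => exact Or.inl rfl
      | infMinus => exact Or.inr rfl
    · rw [neg_neg, infPt_one, infPt_neg_one]
      cases P with
      | aff z y h => exact absurd rfl (hP z y h)
      | infPlus => exact Or.inr rfl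
      | infMinus => exact Or.inl rfl
  refine ⟨f, hasDivisor_iff.2 fun P => ?_⟩
  simp only [Pi.sub_apply, Pi.add_apply, single_apply']
  by_cases hP : ∃ z y h, P = .aff z y h
  · obtain ⟨z, y, h, rfl⟩ := hP
    have key := hasOrd_chart_aff h hQ hQ0 hA0 f hf
    have e1 : divisor D (.aff z y h) = if B.eval z = y then (A.rootMultiplicity z : ℤ) else 0 := by
      have : divisor D (.aff z y h) = ((D : Multiset S.Point).count (.aff z y h) : ℤ) := rfl
      rw [this, hD, count_graph_aff hA0 dA]
      split_ifs <;> rfl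
    have e2 : divisor D' (.aff z y h)
        = if B.eval z = -y then (N.rootMultiplicity z : ℤ) else 0 := by
      have : divisor D' (.aff z y h) = ((D' : Multiset S.Point).count (.aff z y h) : ℤ) := rfl
      rw [this, hD', Multiset.count_add, count_graph_aff hN0 dN, Multiset.count_replicate,
        if_neg (infPt_ne_aff ε h), eval_neg, add_zero]
      simp only [neg_eq_iff_eq_neg]
      split_ifs <;> rfl
    have e3 : (Point.aff z y h = .aff 0 (-B.eval 0) hZ) ↔ z = 0 ∧ B.eval z = -y := by
      constructor
      · intro h'
        injection h' with h1 h2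
        exact ⟨h1, by rw [h1, h2, neg_neg]⟩
      · rintro ⟨rfl, h2⟩
        congr
        rw [h2, neg_neg]
    have e4 : (C k * X * (A * N)).rootMultiplicity z
        = (if z = 0 then 1 else 0) + (A.rootMultiplicity z + N.rootMultiplicity z) := by
      rw [rootMultiplicity_mul hQ0,
        rootMultiplicity_mul (mul_ne_zero (C_ne_zero.2 hk) X_ne_zero),
        rootMultiplicity_mul (mul_ne_zero hA0 hN0), rootMultiplicity_C, zero_add]
      congr 1
      have := rootMultiplicity_X_sub_C (x := z) (y := (0 : ℂ))
      rwa [C_0, sub_zero] at this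
    rw [e1, e2, if_neg (infPt_ne_aff (-ε) h).symm]
    simp only [e3]
    convert key using 1
    rw [e4]
    -- On the graph of `-B` the order is that of `z A N` minus that of `A`, which counts twice at a
    -- branch point, where the graphs of `B` and `-B` meet. Off both graphs nothing vanishes.
    by_cases hB1 : B.eval z = -y
    · simp only [hB1, if_true, and_true]
      by_cases hy : y = 0
      · subst hy
        simp only [neg_zero, if_true]
        push_cast
        ring
      · have : ¬ (-y = y) := fun h => hy (by linear_combination (-1 / 2 : ℂ) * h)
        simp only [if_neg hy, if_neg this]
        push_cast
        ring
    · simp only [hB1, if_false, and_false]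
      by_cases hB2 : B.eval z = y
      · have hy : y ≠ 0 := by
          rintro rfl
          exact hB1 (by rw [hB2, neg_zero])
        simp only [hB2, if_true, if_neg hy]
        ring
      · have : A.rootMultiplicity z = 0 := by
          refine rootMultiplicity_eq_zero fun hr => ?_
          have := curve_of_dvd dA hr
          rw [← h, sq_eq_sq_iff_eq_or_eq_neg] at this
          tauto
        simp [hB2, this]
  · push Not at hP
    rcases hinf P hP with rfl | rfl
    · rw [c1, cD, if_neg (infPt_ne_neg ε), if_neg (infPt_ne_aff ε hZ)]
      convert inf2 using 1
      rw [degQ, hA]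
      push_cast
      ring
    · rw [c2, cD, if_pos rfl, if_neg (infPt_ne_aff (-ε) hZ)]
      convert inf1 using 1
      rw [hA]
      ring

/-- The divisor of the function `z`. -/
theorem hasDivisor_z : HasDivisor (S := S) Point.z
    (fun P => single (S.zeroPt 1) P + single (S.zeroPt (-1)) P
      - single .infPlus P - single .infMinus P) := by
  classical
  refine hasDivisor_iff.2 fun P => ?_
  simp only [single_apply', zeroPt]
  have hc : S.c0 false / S.c0 true ≠ 0 := div_ne_zero (S.c0_ne_zero _) (S.c0_ne_zero _)
  cases P with
  | aff z y h =>
    have h1 : Point.aff z y h ≠ Point.infPlus := fun h => by injection h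
    have h2 : Point.aff z y h ≠ Point.infMinus := fun h => by injection h
    rw [if_neg h1, if_neg h2, sub_zero, sub_zero]
    by_cases hy : y = 0
    · subst hy
      simp only [chart_aff_zero, Point.z]
      have hz : z ≠ 0 := by
        rintro rfl
        have := S.zero_mem 1
        rw [← h] at this
        simp [S.c0_ne_zero] at this
      rw [if_neg (fun h => hz (by injection h)), if_neg (fun h => hz (by injection h)), add_zero]
      exact hasOrd_of_ne (analyticAt_const.add (analyticAt_id.pow 2)) (by simpa using hz)
    · simp only [chart_aff_of_ne h hy, Point.z]
      by_cases hz : z = 0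
      · subst hz
        have hy2 := S.zero_mem 1
        rw [← h, sq_eq_sq_iff_eq_or_eq_neg] at hy2
        have e : ∀ s : ℤˣ, (Point.aff 0 y h = Point.aff 0 (((s : ℤ) : ℂ)
            * (S.c0 false / S.c0 true)) (S.zero_mem s))
            ↔ y = ((s : ℤ) : ℂ) * (S.c0 false / S.c0 true) := fun s =>
          ⟨fun h => by injection h, fun h => by subst h; rfl⟩
        simp only [e, zero_add]
        rcases hy2 with hy2 | hy2
        · rw [if_pos hy2.symm, if_neg, add_zero]
          · exact hasOrd_id
          · rw [← hy2]
            intro h3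
            push_cast at h3
            exact hc (by linear_combination (1 / 2 : ℂ) * h3)
        · have hy3 : y = (((-1 : ℤˣ) : ℤ) : ℂ) * (S.c0 false / S.c0 true) := by
            push_cast at hy2 ⊢
            linear_combination hy2
          rw [if_pos hy3, if_neg, zero_add]
          · exact hasOrd_id
          · rw [hy3]
            intro h3
            push_cast at h3
            exact hc (by linear_combination (-1 / 2 : ℂ) * h3)
      · rw [if_neg (fun h => hz (by injection h)), if_neg (fun h => hz (by injection h)),
          add_zero]
        exact hasOrd_of_ne (analyticAt_const.add analyticAt_id) (by simpa using hz)
  | infPlus =>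
    rw [if_neg (fun h => by injection h), if_neg (fun h => by injection h), if_pos rfl,
      if_neg (fun h => by injection h)]
    refine (hasOrd_zpow_mul (-1) analyticAt_const (one_ne_zero (α := ℂ))).congr ?_
    filter_upwards [self_mem_nhdsWithin] with ζ hζ
    rw [chart, dif_neg (show ¬ ζ = 0 from hζ)]
    simp [Point.z]
  | infMinus =>
    rw [if_neg (fun h => by injection h), if_neg (fun h => by injection h),
      if_neg (fun h => by injection h), if_pos rfl]
    refine (hasOrd_zpow_mul (-1) analyticAt_const (one_ne_zero (α := ℂ))).congr ?_
    filter_upwards [self_mem_nhdsWithin] with ζ hζ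
    rw [chart, dif_neg (show ¬ ζ = 0 from hζ)]
    simp [Point.z]

/-- The set `M₀` is invariant under the shift of the lattice. -/
theorem mem_M₀_of_linEquiv {D D' : Sym S.Point S.p} (hD : D ∈ S.M₀) {m : ℤ}
    (h : LinEquiv (divisor D')
      (divisor D + m • (single Point.infPlus - single (S.zeroPt (-1))))) : D' ∈ S.M₀ := by
  intro n D'' h''
  -- A divisor `n` steps away from `D'` is `n + m` steps away from `D`, for both families in the
  -- definition of `M₀`.
  refine hD (n + m) D'' (h''.imp (fun h1 => h1.trans ?_) fun h1 => h1.trans ?_)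
  · have := h.add_right (n • (single Point.infPlus - single (S.zeroPt (-1))))
    convert this using 1
    module
  · have := h.add_right ((single Point.infMinus - single (S.zeroPt (-1)))
      + n • (single Point.infPlus - single (S.zeroPt (-1))))
    convert this using 1 <;> module

end SpectralData

end AblowitzLadik

end

/-! ### Nondegeneracy of the lattice algorithm on `M₀` -/

noncomputable section

open Polynomial

namespace AblowitzLadik

namespace SpectralData

variable {S : SpectralData}

/-! ### Nondegeneracy along the lattice -/

/-- The zeros of `∏ (z - E_m)` are simple. Applied to `B² - ∏ (z - E_m) = k z A N`, this shows that
`N` is not the zero polynomial. -/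
theorem curvePoly_ne_sq (B : ℂ[X]) : B ^ 2 ≠ S.curvePoly := by
  intro h
  have h0 : S.curvePoly.eval (S.E 0) = 0 := by
    rw [curvePoly_eval, Finset.prod_eq_zero (Finset.mem_univ 0) (sub_self _)]
  obtain ⟨Q, hQ, hQ0⟩ := exists_curvePoly_eq h0
  have hB : B.eval (S.E 0) = 0 := by
    rw [← h, eval_pow] at h0
    exact pow_eq_zero_iff two_ne_zero |>.1 h0
  obtain ⟨B', rfl⟩ := dvd_iff_isRoot.2 hB
  apply hQ0
  rw [← h, mul_pow, sq, mul_assoc] at hQ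
  have := mul_left_cancel₀ (X_sub_C_ne_zero (S.E 0)) hQ
  rw [← this]
  simp

/-- Zeros lost by a drop of the degree are replaced by copies of `P`, in applications a point at
infinity, so that the divisor always has degree `p`. -/
theorem exists_sym_graph (N B : ℂ[X]) (hN : N.natDegree ≤ S.p) (P : S.Point) :
    ∃ D' : Sym S.Point S.p, (D' : Multiset S.Point) = N.roots.map (S.graphPoint B)
      + Multiset.replicate (S.p - N.natDegree) P :=
  ⟨⟨N.roots.map (S.graphPoint B) + Multiset.replicate (S.p - N.natDegree) P, by
    rw [Multiset.card_add, Multiset.card_map, Multiset.card_replicate,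
      IsAlgClosed.card_roots_eq_natDegree]
    omega⟩, rfl⟩

theorem infPt_notMem_of_admissible {D : Sym S.Point S.p} (h : Admissible D) (ε : ℤˣ) :
    infPt ε ∉ D := by
  unfold infPt
  split_ifs
  exacts [h.1, h.2.1]

/-- A degree drop would put a point at infinity into `D'`, and a zero at the origin would put
`P_{0,±}` into it. Admissibility excludes both, so both end coefficients of `N` survive. -/
theorem natDegree_eq_of_admissible {N B : ℂ[X]} (hN0 : N ≠ 0) (hN : N.natDegree ≤ S.p) {ε s : ℤˣ}
    (hB : B.eval 0 = ((s : ℤ) : ℂ) * (S.c0 false / S.c0 true)) {D' : Sym S.Point S.p}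
    (hD' : (D' : Multiset S.Point) = N.roots.map (S.graphPoint B)
      + Multiset.replicate (S.p - N.natDegree) (infPt ε))
    (h : Admissible D') : N.coeff S.p ≠ 0 ∧ N.coeff 0 ≠ 0 ∧
      (D' : Multiset S.Point) = N.roots.map (S.graphPoint B) := by
  have h1 : N.natDegree = S.p := by
    by_contra h1
    apply infPt_notMem_of_admissible h ε
    have : infPt ε ∈ (D' : Multiset S.Point) := by
      rw [hD', Multiset.mem_add]
      exact Or.inr (Multiset.mem_replicate.2 ⟨by omega, rfl⟩)
    exact this
  refine ⟨?_, ?_, ?_⟩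
  · rw [← h1, coeff_natDegree]
    exact leadingCoeff_ne_zero.2 hN0
  · intro h2
    have h3 : (0 : ℂ) ∈ N.roots := (mem_roots hN0).2 (by
      rwa [IsRoot.def, ← coeff_zero_eq_eval_zero])
    have h4 : S.graphPoint B 0 = S.zeroPt s := by
      rw [graphPoint_of_curve (by rw [hB]; exact S.zero_mem s), zeroPt]
      congr
    have h5 : S.zeroPt s ∈ D' := by
      have : S.zeroPt s ∈ (D' : Multiset S.Point) := by
        rw [hD', Multiset.mem_add]
        exact Or.inl (Multiset.mem_map.2 ⟨0, h3, h4⟩)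
      exact this
    rcases Int.units_eq_one_or s with rfl | rfl
    exacts [h.2.2.1 h5, h.2.2.2 h5]
  · rw [hD', h1, Nat.sub_self, Multiset.replicate_zero, add_zero]

variable (S) in
/-- The polynomial `(2/c_{0,+}) z^{p₋} G` whose graph passes through the Dirichlet divisor. -/
def normG (X : PolyTriple) : ℂ[X] := C (2 / S.c0 true) * X.G

variable (S) in
/-- A curve triple with Dirichlet divisor `D` in `M₀`. -/
structure IsRegular (X : PolyTriple) (D : Sym S.Point S.p) : Prop where
  triple : S.IsCurveTriple X
  bot : X.F.coeff 0 ≠ 0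
  top : X.F.coeff S.p ≠ 0
  mem : D ∈ S.M₀
  divisor : (D : Multiset S.Point) = X.F.roots.map (S.graphPoint (S.normG X))

theorem IsRegular.natDegree {X : PolyTriple} {D : Sym S.Point S.p} (h : S.IsRegular X D) :
    X.F.natDegree = S.p :=
  le_antisymm (natDegree_le_of_coeff h.triple.degF) (le_natDegree_of_ne_zero h.top)

theorem IsRegular.F_ne_zero {X : PolyTriple} {D : Sym S.Point S.p} (h : S.IsRegular X D) :
    X.F ≠ 0 := fun h0 => h.bot (by rw [h0, coeff_zero])

theorem normG_sq_of_curve {X : PolyTriple}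
    (h : X.G ^ 2 - Polynomial.X * (X.F * X.H) = C (S.c0 true ^ 2 / 4) * S.curvePoly) :
    S.normG X ^ 2 - S.curvePoly = C (4 / S.c0 true ^ 2) * Polynomial.X * (X.F * X.H) := by
  have h1 : (C (4 / S.c0 true ^ 2) : ℂ[X]) * C (S.c0 true ^ 2 / 4) = 1 := by
    rw [← C_mul, div_mul_div_cancel₀ (pow_ne_zero 2 (S.c0_ne_zero true)),
      div_self (by norm_num), C_1]
  have h2 : (C (2 / S.c0 true) : ℂ[X]) ^ 2 = C (4 / S.c0 true ^ 2) := by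
    rw [← C_pow, div_pow]; norm_num
  rw [normG, mul_pow, h2]
  linear_combination C (4 / S.c0 true ^ 2) * h + S.curvePoly * h1

theorem IsCurveTriple.normG_sq {X : PolyTriple} (h : S.IsCurveTriple X) :
    S.normG X ^ 2 - S.curvePoly
      = C (4 / S.c0 true ^ 2) * Polynomial.X * (X.F * X.H) := normG_sq_of_curve h.curve

theorem IsCurveTriple.normG_natDegree {X : PolyTriple} (h : S.IsCurveTriple X) :
    (S.normG X).natDegree ≤ S.p + 1 :=
  natDegree_le_of_coeff fun N hN => by rw [normG, coeff_C_mul, h.degG N hN, mul_zero]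

theorem IsCurveTriple.normG_coeff_top {X : PolyTriple} (h : S.IsCurveTriple X) :
    (S.normG X).coeff (S.p + 1) = 1 := by
  rw [normG, coeff_C_mul, h.topG, div_mul_div_cancel₀ (S.c0_ne_zero true), div_self two_ne_zero]

theorem IsCurveTriple.normG_eval_zero {X : PolyTriple} (h : S.IsCurveTriple X) :
    (S.normG X).eval 0 = S.c0 false / S.c0 true := by
  rw [← coeff_zero_eq_eval_zero, normG, coeff_C_mul, h.botG]
  field_simp

theorem map_graphPoint_congr {A B B' : ℂ[X]}
    (h : ∀ μ, A.eval μ = 0 → B.eval μ = B'.eval μ) :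
    A.roots.map (S.graphPoint B) = A.roots.map (S.graphPoint B') :=
  Multiset.map_congr rfl fun μ hμ => graphPoint_congr (h μ (isRoot_of_mem_roots hμ))

theorem linEquiv_congr_right {D A A' : S.Point → ℤ} (h : LinEquiv D A) (hA : A = A') :
    LinEquiv D A' := hA ▸ h

/-- With `A = F`, `N = H` and `B` the normalized `G`, the divisor over the zeros of `H` is in the
Neumann class `D + P_{∞₋} - P_{0,-}`. -/
theorem IsRegular.coeffH_ne_zero {X : PolyTriple} {D : Sym S.Point S.p} (h : S.IsRegular X D) :
    X.H.coeff S.p ≠ 0 ∧ X.H.coeff 0 ≠ 0 := by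
  have hc := S.c0_ne_zero true
  have hk : 4 / S.c0 true ^ 2 ≠ 0 := div_ne_zero (by norm_num) (pow_ne_zero 2 hc)
  have hN0 : X.H ≠ 0 := by
    intro h0
    have := h.triple.normG_sq
    rw [h0, mul_zero, mul_zero, sub_eq_zero] at this
    exact curvePoly_ne_sq _ this
  have hN := natDegree_le_of_coeff h.triple.degH
  obtain ⟨D', hD'⟩ := exists_sym_graph X.H (-S.normG X) hN (infPt 1)
  have hB : (-S.normG X).eval 0 = (((-1 : ℤˣ) : ℤ) : ℂ) * (S.c0 false / S.c0 true) := by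
    rw [eval_neg, h.triple.normG_eval_zero]; simp
  have hB' : -(S.normG X).eval 0 = (((-1 : ℤˣ) : ℤ) : ℂ) * (S.c0 false / S.c0 true) := by
    rw [← hB, eval_neg]
  have hlin := linEquiv_graph hk h.triple.normG_sq h.F_ne_zero h.natDegree hN0 hN
    h.triple.normG_natDegree (ε := 1) (by rw [h.triple.normG_coeff_top]; simp) h.divisor hD'
    (by rw [hB']; exact S.zero_mem (-1))
  have hz : Point.aff 0 (-(S.normG X).eval 0) (by rw [hB']; exact S.zero_mem (-1))
      = S.zeroPt (-1) := by
    rw [zeroPt]; congr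
  rw [hz, infPt_neg_one] at hlin
  -- This is the member `n = 0` of the second family in the definition of `M₀`.
  have hadm := h.mem 0 D' (Or.inr (linEquiv_congr_right hlin (by module)))
  have := natDegree_eq_of_admissible hN0 hN hB hD' hadm
  exact ⟨this.1, this.2.1⟩

theorem IsRegular.tripleAlpha_ne_zero {X : PolyTriple} {D : Sym S.Point S.p}
    (h : S.IsRegular X D) : S.tripleAlpha X ≠ 0 :=
  mul_ne_zero (inv_ne_zero (S.c0_ne_zero _)) h.bot

theorem IsRegular.tripleAlphaNext_ne_zero {X : PolyTriple} {D : Sym S.Point S.p}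
    (h : S.IsRegular X D) : S.tripleAlphaNext X ≠ 0 :=
  mul_ne_zero (neg_ne_zero.2 (inv_ne_zero (S.c0_ne_zero _))) h.top

theorem IsRegular.tripleBeta_ne_zero {X : PolyTriple} {D : Sym S.Point S.p}
    (h : S.IsRegular X D) : S.tripleBeta X ≠ 0 :=
  mul_ne_zero (inv_ne_zero (S.c0_ne_zero _)) h.coeffH_ne_zero.1

/-- Regularity propagates upwards. -/
theorem IsRegular.up {X : PolyTriple} {D : Sym S.Point S.p} (h : S.IsRegular X D) :
    1 - S.tripleAlphaNext X * S.tripleBetaNext X ≠ 0 ∧ ∃ D', S.IsRegular (S.up X) D' := by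
  have hX := h.triple
  have hc := S.c0_ne_zero true
  have ha := h.tripleAlphaNext_ne_zero
  set a := S.tripleAlphaNext X with ha'
  set b := S.tripleBetaNext X with hb'
  -- Adding a multiple of `z F` keeps the values on the zeros of `F`. The constant makes `B² - ∏ (z
  -- - E_m)` divisible by `upF` and changes the leading coefficient from `1` to `-1`; so `P_{∞₊}`
  -- appears instead of `P_{∞₋}`.
  set c : ℂ := 2 / (S.c0 true * a) with hcdef
  set B : ℂ[X] := S.normG X + C c * (Polynomial.X * X.F) with hBdef
  have hk : c ^ 2 ≠ 0 := pow_ne_zero 2 (div_ne_zero two_ne_zero (mul_ne_zero hc ha))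
  have hQ : B ^ 2 - S.curvePoly = C (c ^ 2) * Polynomial.X * (X.F * S.upF X) := by
    have e1 : (C (c ^ 2) : ℂ[X]) * C (a ^ 2) = C (4 / S.c0 true ^ 2) := by
      rw [← C_mul, hcdef]; congr 1; field_simp; norm_num
    have e2 : (C (c ^ 2) : ℂ[X]) * C (2 * a) = 2 * C c * C (2 / S.c0 true) := by
      rw [← C_mul, mul_assoc, ← C_mul, show (2 : ℂ[X]) = C 2 from rfl, ← C_mul, hcdef]
      congr 1; field_simp
    have e3 : (C (c ^ 2) : ℂ[X]) = C c ^ 2 := C_pow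
    have e4 := hX.normG_sq
    rw [hBdef, upF, ← ha']
    have e5 : S.normG X = C (2 / S.c0 true) * X.G := rfl
    linear_combination e4 - Polynomial.X * X.F * X.H * e1 - Polynomial.X * X.F * X.G * e2
      - Polynomial.X ^ 2 * X.F ^ 2 * e3 + 2 * C c * Polynomial.X * X.F * e5
  have hN0 : S.upF X ≠ 0 := by
    intro h0
    rw [h0, mul_zero, mul_zero, sub_eq_zero] at hQ
    exact curvePoly_ne_sq _ hQ
  have hN : (S.upF X).natDegree ≤ S.p :=
    natDegree_le_of_coeff fun N hN => hX.upF_coeff_eq_zero hN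
  have hBdeg : B.natDegree ≤ S.p + 1 := natDegree_le_of_coeff fun N hN => by
    obtain ⟨M, rfl⟩ : ∃ M, N = M + 1 := ⟨N - 1, by omega⟩
    rw [hBdef, coeff_add, coeff_C_mul, coeff_X_mul, hX.degF M (by omega), normG, coeff_C_mul,
      hX.degG _ hN]
    ring
  have hBtop : B.coeff (S.p + 1) = (((-1 : ℤˣ) : ℤ) : ℂ) := by
    rw [hBdef, coeff_add, coeff_C_mul, coeff_X_mul, hX.normG_coeff_top, hX.coeffF_top, ← ha', hcdef]
    push_cast
    field_simp
    ring
  obtain ⟨D', hD'⟩ := exists_sym_graph (S.upF X) (-B) hN (infPt (-1))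
  have hB : (-B).eval 0 = (((-1 : ℤˣ) : ℤ) : ℂ) * (S.c0 false / S.c0 true) := by
    rw [eval_neg, hBdef, eval_add, hX.normG_eval_zero]; simp
  have hB' : -B.eval 0 = (((-1 : ℤˣ) : ℤ) : ℂ) * (S.c0 false / S.c0 true) := by
    rw [← hB, eval_neg]
  have hD : (D : Multiset S.Point) = X.F.roots.map (S.graphPoint B) := by
    rw [h.divisor]
    refine map_graphPoint_congr fun μ hμ => ?_
    rw [hBdef, eval_add, eval_mul, eval_mul, hμ, mul_zero, mul_zero, add_zero]
  have hlin := linEquiv_graph hk hQ h.F_ne_zero h.natDegree hN0 hN hBdeg hBtop hD hD'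
    (by rw [hB']; exact S.zero_mem (-1))
  have hz : Point.aff 0 (-B.eval 0) (by rw [hB']; exact S.zero_mem (-1)) = S.zeroPt (-1) := by
    rw [zeroPt]; congr
  rw [hz, neg_neg, infPt_one] at hlin
  have hlin' : LinEquiv (SpectralData.divisor D')
      (SpectralData.divisor D + (1 : ℤ) • (single Point.infPlus - single (S.zeroPt (-1)))) :=
    linEquiv_congr_right hlin (by module)
  -- The divisor over the zeros of `upF` is one step away from `D`, so it is admissible. Its nonzero
  -- constant coefficient carries the factor `1 - α⁺ β⁺`.
  obtain ⟨k1, k2, k3⟩ := natDegree_eq_of_admissible hN0 hN hB hD' (h.mem 1 D' (Or.inl hlin'))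
  have hγ : 1 - a * b ≠ 0 := by
    rw [hX.upF_coeff_zero] at k2
    exact right_ne_zero_of_mul k2
  have hγ' : (1 - a * b)⁻¹ ≠ 0 := inv_ne_zero hγ
  refine ⟨hγ, D', hX.up hγ, ?_, ?_, mem_M₀_of_linEquiv h.mem hlin', ?_⟩
  · rw [SpectralData.up, coeff_C_mul]; exact mul_ne_zero hγ' k2
  · rw [SpectralData.up, coeff_C_mul]; exact mul_ne_zero hγ' k1
  · rw [k3]
    have : (S.up X).F.roots = (S.upF X).roots := roots_C_mul _ hγ'
    rw [this]
    -- The new normalized `G` and `-B` differ by a constant multiple of `upF`, hence agree on its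
    -- zeros; so `D'` is the Dirichlet divisor of the new triple.
    refine map_graphPoint_congr fun μ hμ => ?_
    rw [upF, ← ha'] at hμ
    simp only [eval_add, eval_mul, eval_C, eval_X] at hμ
    simp only [hBdef, normG, SpectralData.up, ← ha', ← hb', eval_neg, eval_add, eval_mul, eval_C,
      eval_X, hcdef]
    generalize X.F.eval μ = u at *
    generalize X.G.eval μ = v at *
    generalize X.H.eval μ = w at *
    rw [← sub_eq_zero]
    have : (-(2 / S.c0 true * v + 2 / (S.c0 true * a) * (μ * u)) -
      2 / S.c0 true * ((1 - a * b)⁻¹ * ((1 + a * b) * v + a * w + b * μ * u)))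
      = -2 / (S.c0 true * a * (1 - a * b)) * (a ^ 2 * w + 2 * a * v + μ * u) := by
      field_simp
      ring
    rw [this, hμ, mul_zero]

/-- Regularity propagates downwards. -/
theorem IsRegular.down {X : PolyTriple} {D : Sym S.Point S.p} (h : S.IsRegular X D) :
    1 - S.tripleAlpha X * S.tripleBeta X ≠ 0 ∧ ∃ D', S.IsRegular (S.down X) D' := by
  have hX := h.triple
  have hc := S.c0_ne_zero true
  have ha := h.tripleAlpha_ne_zero
  set a := S.tripleAlpha X with ha'
  set b := S.tripleBeta X with hb'
  set c : ℂ := 2 / (S.c0 true * a) with hcdef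
  -- A constant multiple of `F` leaves the leading coefficient `1` but changes the sign of the value
  -- at `0`. So the point over zero is now `P_{0,+}`, and `D'` is equivalent to `D + P_{∞₋} -
  -- P_{0,+}`.
  set B : ℂ[X] := S.normG X - C c * X.F with hBdef
  have hdiv : S.downF X = Polynomial.X * divX (S.downF X) := by
    conv_lhs => rw [← X_mul_divX_add (S.downF X), hX.downF_coeff_zero, C_0, add_zero]
  have hk : c ^ 2 ≠ 0 := pow_ne_zero 2 (div_ne_zero two_ne_zero (mul_ne_zero hc ha))
  have hQ : B ^ 2 - S.curvePoly = C (c ^ 2) * Polynomial.X * (X.F * divX (S.downF X)) := by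
    have e1 : (C (c ^ 2) : ℂ[X]) * C (a ^ 2) = C (4 / S.c0 true ^ 2) := by
      rw [← C_mul, hcdef]; congr 1; field_simp; norm_num
    have e2 : (C (c ^ 2) : ℂ[X]) * C (2 * a) = 2 * C c * C (2 / S.c0 true) := by
      rw [← C_mul, mul_assoc, ← C_mul, show (2 : ℂ[X]) = C 2 from rfl, ← C_mul, hcdef]
      congr 1; field_simp
    have e3 : (C (c ^ 2) : ℂ[X]) = C c ^ 2 := C_pow
    have e4 := hX.normG_sq
    have e6 : S.downF X
      = C (a ^ 2) * Polynomial.X * X.H - C (2 * a) * X.G + X.F := rfl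
    rw [hBdef]
    have e5 : S.normG X = C (2 / S.c0 true) * X.G := rfl
    linear_combination e4 - Polynomial.X * X.F * X.H * e1 + X.F * X.G * e2
      - X.F ^ 2 * e3 - 2 * C c * X.F * e5 + C (c ^ 2) * X.F * (hdiv - e6)
  have hN0 : divX (S.downF X) ≠ 0 := by
    intro h0
    rw [h0, mul_zero, mul_zero, sub_eq_zero] at hQ
    exact curvePoly_ne_sq _ hQ
  have hN : (divX (S.downF X)).natDegree ≤ S.p :=
    natDegree_le_of_coeff fun N hN => by
      rw [coeff_divX]; exact hX.downF_coeff_succ_eq_zero hN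
  have hBdeg : B.natDegree ≤ S.p + 1 := natDegree_le_of_coeff fun N hN => by
    rw [hBdef, coeff_sub, coeff_C_mul, hX.degF N (by omega), normG, coeff_C_mul,
      hX.degG _ hN]
    ring
  have hBtop : B.coeff (S.p + 1) = (((1 : ℤˣ) : ℤ) : ℂ) := by
    rw [hBdef, coeff_sub, coeff_C_mul, hX.normG_coeff_top, hX.degF _ S.p.lt_succ_self]
    simp
  obtain ⟨D', hD'⟩ := exists_sym_graph (divX (S.downF X)) (-B) hN (infPt 1)
  have hB : (-B).eval 0 = (((1 : ℤˣ) : ℤ) : ℂ) * (S.c0 false / S.c0 true) := by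
    rw [eval_neg, hBdef, eval_sub, hX.normG_eval_zero, eval_mul, eval_C, ← coeff_zero_eq_eval_zero,
      hX.coeffF_zero, ← ha', hcdef]
    push_cast
    field_simp
    ring
  have hB' : -B.eval 0 = (((1 : ℤˣ) : ℤ) : ℂ) * (S.c0 false / S.c0 true) := by
    rw [← hB, eval_neg]
  have hD : (D : Multiset S.Point) = X.F.roots.map (S.graphPoint B) := by
    rw [h.divisor]
    refine map_graphPoint_congr fun μ hμ => ?_
    rw [hBdef, eval_sub, eval_mul, hμ, mul_zero, sub_zero]
  have hlin := linEquiv_graph hk hQ h.F_ne_zero h.natDegree hN0 hN hBdeg hBtop hD hD'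
    (by rw [hB']; exact S.zero_mem 1)
  have hz : Point.aff 0 (-B.eval 0) (by rw [hB']; exact S.zero_mem 1) = S.zeroPt 1 := by
    rw [zeroPt]; congr
  rw [hz, infPt_neg_one] at hlin
  have hlin' : LinEquiv (SpectralData.divisor D')
      (SpectralData.divisor D + (-1 : ℤ) • (single Point.infPlus - single (S.zeroPt (-1)))) := by
    -- The function is `1 / z`, written with quotients only. Its divisor `P_{∞₊} + P_{∞₋} - P_{0,+}
    -- - P_{0,-}` turns the class into `D - (P_{∞₊} - P_{0,-})`.
    refine hlin.trans ⟨fun P => P.z / P.z / P.z, hasDivisor_iff.2 fun P => ?_⟩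
    convert hasDivisor_iff.1 ((hasDivisor_z.div hasDivisor_z).div hasDivisor_z) P using 1
    simp only [Pi.add_apply, Pi.sub_apply, Pi.smul_apply, smul_eq_mul]
    ring
  obtain ⟨k1, k2, k3⟩ := natDegree_eq_of_admissible hN0 hN hB hD' (h.mem (-1) D' (Or.inl hlin'))
  -- Here the factor `1 - α β` is in the leading coefficient of the new `F`.
  have hγ : 1 - a * b ≠ 0 := by
    rw [coeff_divX, hX.downF_coeff_top, neg_ne_zero] at k1
    exact right_ne_zero_of_mul k1
  have hγ' : (1 - a * b)⁻¹ ≠ 0 := inv_ne_zero hγ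
  refine ⟨hγ, D', hX.down hγ, ?_, ?_, mem_M₀_of_linEquiv h.mem hlin', ?_⟩
  · rw [SpectralData.down, coeff_C_mul]; exact mul_ne_zero hγ' k2
  · rw [SpectralData.down, coeff_C_mul]; exact mul_ne_zero hγ' k1
  · rw [k3]
    have : (S.down X).F.roots = (divX (S.downF X)).roots := roots_C_mul _ hγ'
    rw [this]
    refine map_graphPoint_congr fun μ hμ => ?_
    have hμ' : (S.downF X).eval μ = 0 := by rw [hdiv, eval_mul, hμ, mul_zero]
    rw [downF, ← ha'] at hμ'
    simp only [eval_add, eval_sub, eval_mul, eval_C, eval_X] at hμ'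
    simp only [hBdef, normG, SpectralData.down, ← ha', ← hb', eval_neg, eval_add, eval_sub,
      eval_mul, eval_C, eval_X, hcdef]
    generalize X.F.eval μ = u at *
    generalize X.G.eval μ = v at *
    generalize X.H.eval μ = w at *
    rw [← sub_eq_zero]
    have : (-(2 / S.c0 true * v - 2 / (S.c0 true * a) * u) -
      2 / S.c0 true * ((1 - a * b)⁻¹ * ((1 + a * b) * v - a * μ * w - b * u)))
      = 2 / (S.c0 true * a * (1 - a * b)) * (a ^ 2 * μ * w - 2 * a * v + u) := by
      field_simp
      ring
    rw [this, hμ', mul_zero]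

variable (S) in
/-- The lattice orbit of a triple. -/
def orbit (X : PolyTriple) (n₀ n : ℤ) : PolyTriple :=
  if n₀ ≤ n then S.up^[(n - n₀).toNat] X else S.down^[(n₀ - n).toNat] X

theorem orbit_self (X : PolyTriple) (n₀ : ℤ) : S.orbit X n₀ n₀ = X := by
  simp [orbit]

theorem orbit_add_one (X : PolyTriple) {n₀ n : ℤ} (h : n₀ ≤ n) :
    S.orbit X n₀ (n + 1) = S.up (S.orbit X n₀ n) := by
  rw [orbit, orbit, if_pos h, if_pos (by omega), ← Function.iterate_succ_apply' S.up]
  congr 2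
  omega

theorem orbit_sub_one (X : PolyTriple) {n₀ n : ℤ} (h : n ≤ n₀) :
    S.orbit X n₀ (n - 1) = S.down (S.orbit X n₀ n) := by
  have h1 : S.orbit X n₀ n = S.down^[(n₀ - n).toNat] X := by
    rcases h.eq_or_lt with rfl | h
    · simp [orbit]
    · rw [orbit, if_neg (by omega)]
  rw [h1, orbit, if_neg (by omega), ← Function.iterate_succ_apply' S.down]
  congr 2
  omega

theorem algorithm_self (X) (n₀ : ℤ) : S.algorithm X n₀ n₀ = X := by
  simp [algorithm]

theorem algorithm_add_one (X) {n₀ n : ℤ} (h : n₀ ≤ n) :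
    S.algorithm X n₀ (n + 1) = S.stepUp (S.algorithm X n₀ n) := by
  rw [algorithm, algorithm, if_pos h, if_pos (by omega), ← Function.iterate_succ_apply' S.stepUp]
  congr 2
  omega

theorem algorithm_sub_one (X) {n₀ n : ℤ} (h : n ≤ n₀) :
    S.algorithm X n₀ (n - 1) = S.stepDown (S.algorithm X n₀ n) := by
  have h1 : S.algorithm X n₀ n = S.stepDown^[(n₀ - n).toNat] X := by
    rcases h.eq_or_lt with rfl | h
    · simp [algorithm]
    · rw [algorithm, if_neg (by omega)]
  rw [h1, algorithm, if_neg (by omega), ← Function.iterate_succ_apply' S.stepDown]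
  congr 2
  omega

theorem IsRegular.orbit {X : PolyTriple} {D : Sym S.Point S.p} (h : S.IsRegular X D) (n₀ n : ℤ) :
    ∃ D', S.IsRegular (S.orbit X n₀ n) D' := by
  induction n using Int.inductionOn' (b := n₀) with
  | zero => rw [orbit_self]; exact ⟨D, h⟩
  | succ k hk ih =>
    obtain ⟨D', h'⟩ := ih
    rw [orbit_add_one _ hk]
    exact h'.up.2
  | pred k hk ih =>
    obtain ⟨D', h'⟩ := ih
    rw [orbit_sub_one _ hk]
    exact h'.down.2

theorem IsRegular.laurentTriple_orbit {X : PolyTriple} {D : Sym S.Point S.p} (h : S.IsRegular X D)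
    (n₀ n : ℤ) : S.laurentTriple (S.orbit X n₀ n) = S.algorithm (S.laurentTriple X) n₀ n := by
  induction n using Int.inductionOn' (b := n₀) with
  | zero => rw [orbit_self, algorithm_self]
  | succ k hk ih =>
    obtain ⟨D', h'⟩ := h.orbit n₀ k
    rw [orbit_add_one _ hk, algorithm_add_one _ hk, ← ih, h'.triple.stepUp_laurentTriple]
  | pred k hk ih =>
    obtain ⟨D', h'⟩ := h.orbit n₀ k
    rw [orbit_sub_one _ hk, algorithm_sub_one _ hk, ← ih, h'.triple.stepDown_laurentTriple]

theorem IsRegular.isOrbit {X : PolyTriple} {D : Sym S.Point S.p} (h : S.IsRegular X D) (n₀ : ℤ) :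
    S.IsOrbit (fun n => S.tripleAlpha (S.orbit X n₀ n)) (fun n => S.tripleBeta (S.orbit X n₀ n))
      (S.orbit X n₀) where
  triple n := by
    obtain ⟨D', h'⟩ := h.orbit n₀ n
    exact h'.triple
  link n := by
    obtain ⟨D', h'⟩ := h.orbit n₀ n
    rcases le_or_gt n n₀ with hn | hn
    · rw [orbit_sub_one _ hn]
      exact h'.triple.link_down h'.down.1
    · obtain ⟨D'', h''⟩ := h.orbit n₀ (n - 1)
      have e := orbit_add_one (S := S) X (show n₀ ≤ n - 1 by omega)
      rw [sub_add_cancel] at e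
      have hl := h''.triple.link_up h''.up.1
      rw [← e] at hl
      -- To the right of `n₀` the link comes from the upward step and is labelled by the `α⁺, β⁺` of
      -- the preceding triple; these are the `α, β` of the triple at `n`.
      obtain ⟨e1, e2, -, -⟩ := h''.triple.link_values h'.triple hl
      rw [e1, e2]
      exact hl

end SpectralData

end AblowitzLadik

end

/-! ### Residue sums as sums of Taylor coefficients -/

noncomputable section

open Polynomial

namespace AblowitzLadik

open Filter Topology

/-! ### Sums of Taylor coefficients over the zeros of a polynomial -/

theorem iteratedDeriv_eq_zero_of_pow_mul {f g : ℂ → ℂ} {x : ℂ} {m k : ℕ} (hg : AnalyticAt ℂ g x)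
    (h : ∀ᶠ ζ in 𝓝 x, f ζ = (ζ - x) ^ m * g ζ) (hk : k < m) : iteratedDeriv k f x = 0 := by
  have hf : AnalyticAt ℂ f x := by
    have : AnalyticAt ℂ (fun ζ => (ζ - x) ^ m * g ζ) x := by fun_prop
    exact this.congr (h.mono fun ζ hζ => hζ.symm)
  exact (natCast_le_analyticOrderAt_iff_iteratedDeriv_eq_zero hf).1
    ((natCast_le_analyticOrderAt hf).2 ⟨g, hg, h⟩) k hk

/-- Used to replace the branch of `y` by a polynomial, and to discard terms divisible by the node
polynomial. -/
theorem iteratedDeriv_eq_of_sub {f g h : ℂ → ℂ} {x : ℂ} {m k : ℕ} (hf : AnalyticAt ℂ f x)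
    (hg : AnalyticAt ℂ g x) (hh : AnalyticAt ℂ h x)
    (e : ∀ᶠ ζ in 𝓝 x, f ζ = g ζ + (ζ - x) ^ m * h ζ) (hk : k < m) :
    iteratedDeriv k f x = iteratedDeriv k g x := by
  have h1 := iteratedDeriv_eq_zero_of_pow_mul (f := f - g) hh
    (e.mono fun ζ hζ => by rw [Pi.sub_apply, hζ]; ring) hk
  rwa [iteratedDeriv_sub hf.contDiffAt hg.contDiffAt, sub_eq_zero] at h1

theorem iteratedDeriv_polynomial (P : ℂ[X]) (k : ℕ) :
    iteratedDeriv k (fun ζ => P.eval ζ) = fun ζ => (derivative^[k] P).eval ζ := by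
  induction k with
  | zero => simp
  | succ k ih =>
    rw [iteratedDeriv_succ, ih, Function.iterate_succ_apply']
    funext ζ
    rw [Polynomial.deriv]

theorem iterate_derivative_top {P : ℂ[X]} {k : ℕ} (h : P.natDegree ≤ k) :
    derivative^[k] P = C ((k.factorial : ℂ) * P.coeff k) := by
  ext m
  rw [coeff_iterate_derivative, coeff_C]
  split_ifs with hm
  · subst hm
    rw [zero_add, Nat.descFactorial_self, nsmul_eq_mul]
  · rw [coeff_eq_zero_of_natDegree_lt (by omega), smul_zero]

section TaylorSum

variable {ι : Type*} [DecidableEq ι] (s : Finset ι) (x : ι → ℂ) (m : ι → ℕ)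

/-- The product of the inverses of the other factors of `∏ (ζ - x_i)^{m_i}`. -/
def cofactorInv (i : ι) (ζ : ℂ) : ℂ := ∏ j ∈ s.erase i, ((ζ - x j) ^ m j)⁻¹

/-- The sum of the residues of `φ / ∏ (ζ - x_i)^{m_i}`, as a sum of Taylor coefficients. -/
def taylorSum (φ : ℂ → ℂ) : ℂ :=
  ∑ i ∈ s, iteratedDeriv (m i - 1) (fun ζ => φ ζ * cofactorInv s x m i ζ) (x i)
    / ((m i - 1).factorial : ℂ)

/-- The polynomial `∏ (ζ - x_i)^{m_i}`. -/
def nodePoly : ℂ[X] := ∏ i ∈ s, (X - C (x i)) ^ m i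

variable {s x m}

theorem analyticAt_cofactorInv (hx : Set.InjOn x s) {i : ι} (hi : i ∈ s) :
    AnalyticAt ℂ (cofactorInv s x m i) (x i) := by
  unfold cofactorInv
  refine Finset.analyticAt_fun_prod _ fun j hj => ?_
  have hj' := Finset.mem_erase.1 hj
  exact ((analyticAt_id.sub analyticAt_const).pow _).inv
    (pow_ne_zero _ (sub_ne_zero.2 fun h => hj'.1 (hx hj'.2 hi h.symm)))

theorem eventually_cofactor_ne (hx : Set.InjOn x s) {i : ι} (hi : i ∈ s) :
    ∀ᶠ ζ in 𝓝 (x i), ∏ j ∈ s.erase i, (ζ - x j) ^ m j ≠ 0 := by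
  have hc : Continuous fun ζ => ∏ j ∈ s.erase i, (ζ - x j) ^ m j := by fun_prop
  refine hc.continuousAt.eventually_ne (Finset.prod_ne_zero_iff.2 fun j hj => ?_)
  have hj' := Finset.mem_erase.1 hj
  exact pow_ne_zero _ (sub_ne_zero.2 fun h => hj'.1 (hx hj'.2 hi h.symm))

theorem cofactor_mul_inv {i : ι} {ζ : ℂ} (h : ∏ j ∈ s.erase i, (ζ - x j) ^ m j ≠ 0) :
    (∏ j ∈ s.erase i, (ζ - x j) ^ m j) * cofactorInv s x m i ζ = 1 := by
  rw [cofactorInv, Finset.prod_inv_distrib, mul_inv_cancel₀ h]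

theorem eval_nodePoly {i : ι} (hi : i ∈ s) (ζ : ℂ) : (nodePoly s x m).eval ζ
    = (ζ - x i) ^ m i * ∏ j ∈ s.erase i, (ζ - x j) ^ m j := by
  rw [nodePoly, ← Finset.mul_prod_erase s _ hi, eval_mul, eval_prod]
  simp

/-- A multiple of the node polynomial cancels the poles, so it does not contribute to the residues;
only the values modulo that polynomial matter. -/
theorem taylorSum_congr (hx : Set.InjOn x s) (hm : ∀ i ∈ s, 0 < m i) {φ ψ χ : ℂ → ℂ}
    (hψ : ∀ i ∈ s, AnalyticAt ℂ ψ (x i)) (hχ : ∀ i ∈ s, AnalyticAt ℂ χ (x i))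
    (h : ∀ i ∈ s, ∀ᶠ ζ in 𝓝 (x i), φ ζ = ψ ζ + (nodePoly s x m).eval ζ * χ ζ) :
    taylorSum s x m φ = taylorSum s x m ψ := by
  refine Finset.sum_congr rfl fun i hi => ?_
  congr 1
  have hw := analyticAt_cofactorInv (m := m) hx hi
  have e : ∀ᶠ ζ in 𝓝 (x i), φ ζ * cofactorInv s x m i ζ
      = ψ ζ * cofactorInv s x m i ζ + (ζ - x i) ^ m i * χ ζ := by
    filter_upwards [h i hi, eventually_cofactor_ne (m := m) hx hi] with ζ h1 h2
    rw [h1, eval_nodePoly hi]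
    linear_combination (ζ - x i) ^ m i * χ ζ * cofactor_mul_inv h2
  refine iteratedDeriv_eq_of_sub (m := m i) ?_ ((hψ i hi).mul hw) (hχ i hi) e
    (Nat.sub_lt (hm i hi) one_pos)
  have : AnalyticAt ℂ (fun ζ => ψ ζ * cofactorInv s x m i ζ + (ζ - x i) ^ m i * χ ζ) (x i) := by
    have h1 := hψ i hi
    have h2 := hχ i hi
    fun_prop
  exact this.congr (e.mono fun ζ hζ => hζ.symm)

theorem nodePoly_monic : (nodePoly s x m).Monic :=
  monic_prod_of_monic _ _ fun _ _ => (monic_X_sub_C _).pow _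

theorem natDegree_nodePoly : (nodePoly s x m).natDegree = ∑ i ∈ s, m i := by
  rw [nodePoly, natDegree_prod_of_monic _ _ fun _ _ => (monic_X_sub_C _).pow _]
  simp

/-- The sum of the residues of `r / A` for a polynomial `r` of degree less than `deg A`. -/
theorem taylorSum_polynomial (hx : Set.InjOn x s) (hm : ∀ i ∈ s, 0 < m i) (hs : s.Nonempty)
    {r : ℂ[X]} (hr : r.natDegree < ∑ i ∈ s, m i) :
    taylorSum s x m (fun ζ => r.eval ζ) = r.coeff (∑ i ∈ s, m i - 1) := by
  -- Partial fractions: `r = ∑ c_i ∏_{k ≠ i} (X - x_k)^{m_k}` with `deg c_i < m_i`. The polynomial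
  -- part `q` vanishes by comparison of degrees.
  obtain ⟨q, c, hc, hq⟩ := eq_quo_mul_prod_add_sum_rem_mul_prod (s := s) r
    (g := fun i => (X - C (x i)) ^ m i) (fun i _ => (monic_X_sub_C _).pow _)
    (fun i hi j hj hij => (isCoprime_X_sub_C_of_isUnit_sub
      (sub_ne_zero.2 fun h => hij (hx hi hj h)).isUnit).pow)
  have hcd : ∀ i ∈ s, (c i).natDegree < m i := by
    intro i hi
    have h1 := hc i hi
    rw [degree_pow, degree_X_sub_C, nsmul_eq_mul, mul_one] at h1
    by_cases h0 : c i = 0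
    · rw [h0, natDegree_zero]; exact hm i hi
    · exact (natDegree_lt_iff_degree_lt h0).2 h1
  have hdeg : ∀ i ∈ s, (∏ k ∈ s.erase i, (X - C (x k)) ^ m k).natDegree = ∑ k ∈ s, m k - m i := by
    intro i hi
    have := natDegree_nodePoly (s := s.erase i) (x := x) (m := m)
    rw [nodePoly] at this
    rw [this, ← Finset.add_sum_erase s m hi, Nat.add_sub_cancel_left]
  have hle : ∀ i ∈ s, m i ≤ ∑ k ∈ s, m k := fun i hi =>
    Finset.single_le_sum (f := m) (fun _ _ => Nat.zero_le _) hi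
  have hpos : 0 < ∑ i ∈ s, m i := by
    obtain ⟨i, hi⟩ := hs
    exact (hm i hi).trans_le (hle i hi)
  set R : ℂ[X] := ∑ i ∈ s, c i * ∏ k ∈ s.erase i, (X - C (x k)) ^ m k with hR
  have hRdeg : R.natDegree < ∑ i ∈ s, m i := by
    refine (natDegree_sum_le_of_forall_le s _ (n := ∑ i ∈ s, m i - 1) fun i hi => ?_).trans_lt
      (by omega)
    refine natDegree_mul_le.trans ?_
    rw [hdeg i hi]
    have := hcd i hi
    have := hle i hi
    omega
  have hq0 : q = 0 := by
    by_contra hq0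
    have h1 : (q * nodePoly s x m).natDegree < ∑ i ∈ s, m i := by
      have : q * nodePoly s x m = r - R := by rw [hq, nodePoly]; ring
      rw [this]
      exact (natDegree_sub_le _ _).trans_lt (max_lt hr hRdeg)
    rw [natDegree_mul hq0 nodePoly_monic.ne_zero, natDegree_nodePoly] at h1
    omega
  rw [hq0, zero_mul, zero_add] at hq
  rw [taylorSum, hq, finsetSum_coeff]
  refine Finset.sum_congr rfl fun i hi => ?_
  have hmi := hm i hi
  -- The cofactor is monic of degree `∑ m - m_i`, so the top coefficient of each summand is the
  -- coefficient `m_i - 1` of `c_i`. That same coefficient is the Taylor coefficient at `x_i`, as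
  -- the other summands vanish there to order `m_i`.
  have hcoef : (c i * ∏ k ∈ s.erase i, (X - C (x k)) ^ m k).coeff (∑ i ∈ s, m i - 1)
      = (c i).coeff (m i - 1) := by
    have e : ∑ i ∈ s, m i - 1 = (m i - 1) + (∑ k ∈ s, m k - m i) := by
      have := hle i hi
      omega
    rw [e, coeff_mul_add_eq_of_natDegree_le (by have := hcd i hi; omega) (hdeg i hi).le,
      ← hdeg i hi, coeff_natDegree]
    have : (∏ k ∈ s.erase i, (X - C (x k)) ^ m k).Monic :=
      monic_prod_of_monic _ _ fun _ _ => (monic_X_sub_C _).pow _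
    rw [this.leadingCoeff, mul_one]
  rw [hcoef]
  have hw := analyticAt_cofactorInv (m := m) hx hi
  have key : iteratedDeriv (m i - 1) (fun ζ => R.eval ζ * cofactorInv s x m i ζ) (x i)
      = iteratedDeriv (m i - 1) (fun ζ => (c i).eval ζ) (x i) := by
    refine iteratedDeriv_eq_of_sub (m := m i)
      (h := fun ζ => (∑ j ∈ s.erase i, c j * ∏ k ∈ (s.erase j).erase i,
        (X - C (x k)) ^ m k).eval ζ * cofactorInv s x m i ζ)
      ((AnalyticAt.aeval_polynomial analyticAt_id R).mul hw)
      (AnalyticAt.aeval_polynomial analyticAt_id (c i))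
      ((AnalyticAt.aeval_polynomial analyticAt_id _).mul hw) ?_ (Nat.sub_lt hmi one_pos)
    filter_upwards [eventually_cofactor_ne (m := m) hx hi] with ζ h2
    have e1 : R.eval ζ = (c i).eval ζ * (∏ j ∈ s.erase i, (ζ - x j) ^ m j)
        + (ζ - x i) ^ m i * (∑ j ∈ s.erase i, c j * ∏ k ∈ (s.erase j).erase i,
          (X - C (x k)) ^ m k).eval ζ := by
      rw [hR, ← Finset.add_sum_erase s _ hi, eval_add, eval_mul, eval_prod]
      congr 1
      · simp
      · rw [eval_finsetSum, eval_finsetSum, Finset.mul_sum]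
        refine Finset.sum_congr rfl fun j hj => ?_
        have hij : i ∈ s.erase j := Finset.mem_erase.2 ⟨(Finset.ne_of_mem_erase hj).symm, hi⟩
        rw [← Finset.mul_prod_erase _ _ hij]
        simp only [eval_mul, eval_pow, eval_sub, eval_X, eval_C]
        ring
    rw [e1]
    linear_combination (c i).eval ζ * cofactor_mul_inv h2
  rw [key, iteratedDeriv_polynomial, iterate_derivative_top (by have := hcd i hi; omega)]
  simp only [eval_C]
  rw [mul_div_cancel_left₀ _ (Nat.cast_ne_zero.2 (Nat.factorial_ne_zero _))]

/-- The Leibniz rule for Taylor coefficients. -/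
theorem sum_iteratedDeriv_mul {f h : ℂ → ℂ} {a : ℂ} (hf : AnalyticAt ℂ f a)
    (hh : AnalyticAt ℂ h a) {k : ℕ} (hk : 0 < k) :
    ∑ ℓ ∈ Finset.range k, iteratedDeriv ℓ f a / ((ℓ.factorial : ℂ) * ((k - ℓ - 1).factorial : ℂ))
        * iteratedDeriv (k - ℓ - 1) h a
      = iteratedDeriv (k - 1) (fun ζ => f ζ * h ζ) a / ((k - 1).factorial : ℂ) := by
  obtain ⟨k, rfl⟩ : ∃ j, k = j + 1 := ⟨k - 1, by omega⟩
  have := iteratedDeriv_mul (n := k) (x := a) hf.contDiffAt hh.contDiffAt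
  rw [Nat.add_sub_cancel]
  have e : (fun ζ => f ζ * h ζ) = f * h := rfl
  rw [e, this, Finset.sum_div]
  refine Finset.sum_congr rfl fun ℓ hℓ => ?_
  have hℓ' : ℓ ≤ k := Nat.lt_succ_iff.1 (Finset.mem_range.1 hℓ)
  rw [show k + 1 - ℓ - 1 = k - ℓ by omega, Nat.cast_choose ℂ hℓ']
  have h1 : (k.factorial : ℂ) ≠ 0 := Nat.cast_ne_zero.2 (Nat.factorial_ne_zero _)
  field_simp

/-- The residue sum of `B(ζ) / (ζ (z - ζ) A(ζ))`. -/
theorem taylorSum_interpolation (hx : Set.InjOn x s) (hm : ∀ i ∈ s, 0 < m i) (hs : s.Nonempty)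
    (hx0 : ∀ i ∈ s, x i ≠ 0) {B : ℂ[X]} (hB : B.natDegree ≤ ∑ i ∈ s, m i + 1) {z : ℂ}
    (hz : z ≠ 0) (hzx : ∀ i ∈ s, x i ≠ z) :
    taylorSum s x m (fun ζ => ζ⁻¹ * B.eval ζ * (z - ζ)⁻¹)
      = (B.eval z / (nodePoly s x m).eval z - B.eval 0 / (nodePoly s x m).eval 0) / z
        - B.coeff (∑ i ∈ s, m i + 1) := by
  set A := nodePoly s x m with hA
  set p := ∑ i ∈ s, m i with hp
  have hAz : ∀ w, (∀ i ∈ s, x i ≠ w) → A.eval w ≠ 0 := by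
    intro w hw
    rw [hA, nodePoly, eval_prod]
    refine Finset.prod_ne_zero_iff.2 fun i hi => ?_
    simpa using fun h => absurd (sub_eq_zero.1 h).symm (hw i hi)
  have hA0 := hAz 0 hx0
  have hA1 := hAz z hzx
  have hAd : A.natDegree = p := natDegree_nodePoly
  have hAm : A.Monic := nodePoly_monic
  obtain ⟨i₀, hi₀⟩ := hs
  have hpos : 0 < p := (hm i₀ hi₀).trans_le
    (Finset.single_le_sum (f := m) (fun _ _ => Nat.zero_le _) hi₀)
  -- The constants `κ` and `lam` remove the poles at `z` and at `0`: the polynomial `N` below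
  -- vanishes at both points, so `N = X (X - z) r`, and modulo `A` the function equals `-r`. The
  -- residue sum is then minus the coefficient of `r` at `p - 1`.
  set κ := B.eval z / (z * A.eval z) with hκ
  set lam := B.eval 0 / (z * A.eval 0) with hlam
  set N : ℂ[X] := B - C lam * (C z - X) * A - C κ * X * A with hN
  have hN0 : N.eval 0 = 0 := by
    simp only [hN, eval_sub, eval_mul, eval_C, eval_X, hlam]
    field_simp
    ring
  have hN1 : N.eval z = 0 := by
    simp only [hN, eval_sub, eval_mul, eval_C, eval_X, hκ]
    field_simp
    ring
  obtain ⟨N', hN'⟩ := X_dvd_iff.2 (by rwa [← coeff_zero_eq_eval_zero] at hN0)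
  have hN1' : N'.eval z = 0 := by
    rw [hN', eval_mul, eval_X] at hN1
    exact (mul_eq_zero.1 hN1).resolve_left hz
  obtain ⟨r, hr⟩ := dvd_iff_isRoot.2 hN1'
  have hXA : (X * A).natDegree ≤ p + 1 := by
    refine natDegree_mul_le.trans ?_
    rw [natDegree_X, hAd, add_comm]
  have hNN : N = B - C (lam * z) * A + C (lam - κ) * (X * A) := by
    rw [hN, C_mul, C_sub]; ring
  have hNd : N.natDegree ≤ p + 1 := by
    rw [hNN]
    refine natDegree_add_le_of_degree_le
      ((natDegree_sub_le_of_le hB (n := p + 1) ?_).trans (max_self _).le) ?_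
    · exact (natDegree_C_mul_le _ _).trans (hAd.le.trans p.le_succ)
    · exact (natDegree_C_mul_le _ _).trans hXA
  have hNr : N = X * ((X - C z) * r) := by rw [hN', hr]
  have hrd : r.natDegree < p := by
    by_cases h0 : r = 0
    · rw [h0, natDegree_zero]; exact hpos
    · rw [hNr, natDegree_mul X_ne_zero (mul_ne_zero (X_sub_C_ne_zero z) h0),
        natDegree_mul (X_sub_C_ne_zero z) h0, natDegree_X, natDegree_X_sub_C] at hNd
      omega
  have hrc : r.coeff (p - 1) = B.coeff (p + 1) + (lam - κ) := by
    have e1 : N.coeff (p + 1) = r.coeff (p - 1) := by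
      rw [hNr, coeff_X_mul, sub_mul, coeff_sub, coeff_C_mul,
        coeff_eq_zero_of_natDegree_lt hrd, mul_zero, sub_zero]
      obtain ⟨q, hq⟩ : ∃ q, p = q + 1 := ⟨p - 1, by omega⟩
      rw [hq, coeff_X_mul, Nat.add_sub_cancel]
    have e2 : A.coeff (p + 1) = 0 := coeff_eq_zero_of_natDegree_lt (by omega)
    have e3 : A.coeff p = 1 := by rw [← hAd]; exact hAm
    rw [← e1, hNN, coeff_add, coeff_sub, coeff_C_mul, coeff_C_mul, coeff_X_mul, e2, e3]
    ring
  have key := taylorSum_congr (s := s) (x := x) (m := m) (φ := fun ζ => ζ⁻¹ * B.eval ζ * (z - ζ)⁻¹)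
    (ψ := fun ζ => (-r).eval ζ) (χ := fun ζ => lam * ζ⁻¹ + κ * (z - ζ)⁻¹) hx hm
    (fun i hi => AnalyticAt.aeval_polynomial analyticAt_id (-r))
    (fun i hi => by
      have h1 : x i ≠ 0 := hx0 i hi
      have h2 : z - x i ≠ 0 := sub_ne_zero.2 (hzx i hi).symm
      fun_prop (disch := assumption))
    (fun i hi => by
      have h1 : ∀ᶠ ζ in 𝓝 (x i), ζ ≠ 0 := continuousAt_id.eventually_ne (hx0 i hi)
      have h2 : ∀ᶠ ζ in 𝓝 (x i), ζ ≠ z := continuousAt_id.eventually_ne (hzx i hi)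
      filter_upwards [h1, h2] with ζ h1 h2
      have h3 : z - ζ ≠ 0 := sub_ne_zero.2 h2.symm
      have e : B.eval ζ = N.eval ζ + lam * (z - ζ) * A.eval ζ + κ * ζ * A.eval ζ := by
        simp only [hN, eval_sub, eval_mul, eval_C, eval_X]
        ring
      rw [e, hNr]
      simp only [eval_mul, eval_sub, eval_X, eval_C, eval_neg]
      field_simp
      ring)
  rw [key, taylorSum_polynomial hx hm ⟨i₀, hi₀⟩ (by rwa [natDegree_neg]), coeff_neg, hrc, hκ, hlam]
  field_simp
  ring

/-- The residue sum of `B(ζ) / (ζ A(ζ))`. -/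
theorem taylorSum_inv_mul (hx : Set.InjOn x s) (hm : ∀ i ∈ s, 0 < m i) (hs : s.Nonempty)
    (hx0 : ∀ i ∈ s, x i ≠ 0) {B : ℂ[X]} (hB : B.natDegree ≤ ∑ i ∈ s, m i + 1) :
    taylorSum s x m (fun ζ => ζ⁻¹ * B.eval ζ)
      = B.coeff (∑ i ∈ s, m i) - B.eval 0 / (nodePoly s x m).eval 0
        - B.coeff (∑ i ∈ s, m i + 1) * (nodePoly s x m).coeff (∑ i ∈ s, m i - 1) := by
  set A := nodePoly s x m with hA
  set p := ∑ i ∈ s, m i with hp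
  have hA0 : A.eval 0 ≠ 0 := by
    rw [hA, nodePoly, eval_prod]
    refine Finset.prod_ne_zero_iff.2 fun i hi => ?_
    simpa using fun h => absurd h (hx0 i hi)
  have hAd : A.natDegree = p := natDegree_nodePoly
  have hAm : A.Monic := nodePoly_monic
  obtain ⟨i₀, hi₀⟩ := hs
  have hpos : 0 < p := (hm i₀ hi₀).trans_le
    (Finset.single_le_sum (f := m) (fun _ _ => Nat.zero_le _) hi₀)
  -- Here `lam` removes the pole at `0`, and `κ` lowers the degree so that `r` has degree less than
  -- `p`.
  set κ := B.coeff (p + 1) with hκ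
  set lam := B.eval 0 / A.eval 0 with hlam
  set N : ℂ[X] := B - C lam * A - C κ * (X * A) with hN
  have hN0 : N.coeff 0 = 0 := by
    rw [coeff_zero_eq_eval_zero]
    simp only [hN, eval_sub, eval_mul, eval_C, eval_X, hlam]
    field_simp
    ring
  obtain ⟨r, hr⟩ := X_dvd_iff.2 hN0
  obtain ⟨q, hq⟩ : ∃ q, p = q + 1 := ⟨p - 1, by omega⟩
  have e2 : A.coeff (p + 1) = 0 := coeff_eq_zero_of_natDegree_lt (by omega)
  have e3 : A.coeff p = 1 := by rw [← hAd]; exact hAm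
  have hc : ∀ k, r.coeff k = N.coeff (k + 1) := fun k => by rw [hr, coeff_X_mul]
  have hrd : r.natDegree < p := by
    rw [hq, Nat.lt_succ_iff]
    refine natDegree_le_iff_coeff_eq_zero.2 fun k hk => ?_
    rw [hc, hN, coeff_sub, coeff_sub, coeff_C_mul, coeff_C_mul, coeff_X_mul]
    rcases (show p ≤ k by omega).eq_or_lt with h | h
    · rw [← h, e2, e3]; ring
    · rw [coeff_eq_zero_of_natDegree_lt (show B.natDegree < k + 1 by omega),
        coeff_eq_zero_of_natDegree_lt (show A.natDegree < k + 1 by omega),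
        coeff_eq_zero_of_natDegree_lt (show A.natDegree < k by omega)]
      ring
  have hrc : r.coeff (p - 1) = B.coeff p - lam - κ * A.coeff (p - 1) := by
    rw [hc, Nat.sub_add_cancel hpos, hN, coeff_sub, coeff_sub, coeff_C_mul, coeff_C_mul, e3]
    conv_lhs => rw [hq, coeff_X_mul]
    rw [hq, Nat.add_sub_cancel, mul_one]
  have key := taylorSum_congr (s := s) (x := x) (m := m) (φ := fun ζ => ζ⁻¹ * B.eval ζ)
    (ψ := fun ζ => r.eval ζ) (χ := fun ζ => lam * ζ⁻¹ + κ) hx hm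
    (fun i hi => AnalyticAt.aeval_polynomial analyticAt_id r)
    (fun i hi => by
      have h1 : x i ≠ 0 := hx0 i hi
      fun_prop (disch := assumption))
    (fun i hi => by
      have h1 : ∀ᶠ ζ in 𝓝 (x i), ζ ≠ 0 := continuousAt_id.eventually_ne (hx0 i hi)
      filter_upwards [h1] with ζ h1
      have e : B.eval ζ = N.eval ζ + lam * A.eval ζ + κ * (ζ * A.eval ζ) := by
        simp only [hN, eval_sub, eval_mul, eval_C, eval_X]
        ring
      rw [e, hr]
      simp only [eval_mul, eval_X]
      field_simp
      ring)
  rw [key, taylorSum_polynomial hx hm ⟨i₀, hi₀⟩ hrd, hrc]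

end TaylorSum

end AblowitzLadik

end

/-! ### Hermite interpolation at the points of a divisor -/

noncomputable section

open Polynomial

namespace AblowitzLadik

open Filter Topology

namespace SpectralData

variable {S : SpectralData}

/-! ### Hermite interpolation at the points of a divisor -/

/-- The polynomial `∏ (z - μ_k)^{p_k}` of a divisor. -/
def divPoly (D : Sym S.Point S.p) : ℂ[X] :=
  ((D : Multiset S.Point).map fun P => X - C P.z).prod

/-- The divisor `D` lies, with multiplicities, on the graph `y = B(z)`, away from `z = 0`. -/
structure OnGraph (D : Sym S.Point S.p) (B : ℂ[X]) : Prop where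
  point : ∀ P ∈ (D : Multiset S.Point), ∃ h, P = .aff P.z (B.eval P.z) h
  z_ne_zero : ∀ P ∈ (D : Multiset S.Point), P.z ≠ 0
  dvd : divPoly D ∣ B ^ 2 - S.curvePoly

open Classical in
theorem nodePoly_eq_divPoly (D : Sym S.Point S.p) :
    nodePoly (D : Multiset S.Point).toFinset Point.z (fun P => (D : Multiset S.Point).count P)
      = divPoly D := by
  rw [divPoly, nodePoly, Finset.prod_multiset_map_count]

open Classical in
theorem sum_count_eq (D : Sym S.Point S.p) :
    ∑ P ∈ (D : Multiset S.Point).toFinset, (D : Multiset S.Point).count P = S.p := by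
  rw [Multiset.toFinset_sum_count_eq]
  exact D.2

theorem divPoly_monic (D : Sym S.Point S.p) : (divPoly D).Monic := by
  classical
  rw [← nodePoly_eq_divPoly]; exact nodePoly_monic

theorem natDegree_divPoly (D : Sym S.Point S.p) : (divPoly D).natDegree = S.p := by
  classical
  rw [← nodePoly_eq_divPoly, natDegree_nodePoly, sum_count_eq]

theorem divPoly_roots (D : Sym S.Point S.p) :
    (divPoly D).roots = (D : Multiset S.Point).map Point.z := by
  have := roots_multiset_prod_X_sub_C ((D : Multiset S.Point).map Point.z)
  rwa [Multiset.map_map] at this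

theorem divPoly_eval (D : Sym S.Point S.p) (z : ℂ) :
    (divPoly D).eval z = ((D : Multiset S.Point).map fun P => z - P.z).prod := by
  rw [divPoly, eval_multiset_prod, Multiset.map_map]
  simp

theorem divPoly_eval_ne_zero {D : Sym S.Point S.p} {z : ℂ}
    (h : ∀ P ∈ (D : Multiset S.Point), P.z ≠ z) : (divPoly D).eval z ≠ 0 := by
  rw [divPoly_eval]
  refine Multiset.prod_ne_zero fun hw => ?_
  obtain ⟨P, hP, hw⟩ := Multiset.mem_map.1 hw
  exact h P hP (sub_eq_zero.1 hw).symm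

theorem divPoly_coeff_pred (D : Sym S.Point S.p) :
    (divPoly D).coeff (S.p - 1) = -((D : Multiset S.Point).map fun P => P.z).sum := by
  have hc : Multiset.card ((D : Multiset S.Point).map Point.z) = S.p := by
    rw [Multiset.card_map]; exact D.2
  have := multiset_prod_X_sub_C_coeff_card_pred ((D : Multiset S.Point).map Point.z)
    (by rw [hc]; exact S.one_le_p)
  rwa [hc, Multiset.map_map] at this

/-- The sign `(-1)^{p+1}` in the chosen root combines with `(-1)^p` in `∏ (0 - μ_k)`, leaving a
single minus sign. -/
theorem sqrtProdE_mul_prod {D : Sym S.Point S.p} (h : ∀ P ∈ (D : Multiset S.Point), P.z ≠ 0) :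
    S.sqrtProdE * ((D : Multiset S.Point).map fun P => P.z⁻¹).prod
      = -(S.c0 false / S.c0 true) / (divPoly D).eval 0 := by
  have h1 : (divPoly D).eval 0 = (-1) ^ S.p * ((D : Multiset S.Point).map fun P => P.z).prod := by
    rw [divPoly_eval]
    have hc : Multiset.card (D : Multiset S.Point) = S.p := D.2
    have := Multiset.prod_map_neg ((D : Multiset S.Point).map fun P => P.z)
    rw [Multiset.card_map, hc, Multiset.map_map] at this
    simpa using this
  have h2 : ((D : Multiset S.Point).map fun P => P.z⁻¹).prod
      = (((D : Multiset S.Point).map fun P => P.z).prod)⁻¹ := Multiset.prod_map_inv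
  have h3 : ((D : Multiset S.Point).map fun P => P.z).prod ≠ 0 := by
    refine Multiset.prod_ne_zero fun hw => ?_
    obtain ⟨P, hP, hw⟩ := Multiset.mem_map.1 hw
    exact h P hP hw
  have h4 : ((-1 : ℂ) ^ S.p) * (-1) ^ S.p = 1 := by
    rw [← mul_pow]; simp
  have h5 : ((-1 : ℂ) ^ S.p) ≠ 0 := pow_ne_zero _ (by norm_num)
  have hc := S.c0_ne_zero true
  rw [h1, h2, sqrtProdE, pow_succ]
  field_simp
  linear_combination -(S.c0 false) * h4

theorem OnGraph.injOn {D : Sym S.Point S.p} {B : ℂ[X]} (h : OnGraph D B) {P Q : S.Point}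
    (hP : P ∈ (D : Multiset S.Point)) (hQ : Q ∈ (D : Multiset S.Point)) (e : P.z = Q.z) :
    P = Q := by
  obtain ⟨h1, e1⟩ := h.point P hP
  obtain ⟨h2, e2⟩ := h.point Q hQ
  rw [e1, e2]
  congr

open Classical in
/-- Up to the order given by the multiplicity, `y` agrees with `B(z)` at the points of `D`. -/
theorem OnGraph.exists_yBranch_eq {D : Sym S.Point S.p} {B : ℂ[X]} (h : OnGraph D B)
    {P : S.Point} (hP : P ∈ (D : Multiset S.Point)) :
    ∃ g : ℂ → ℂ, AnalyticAt ℂ g P.z ∧ AnalyticAt ℂ (S.yBranch P.z P.y) P.z ∧ ∀ᶠ ζ in 𝓝 P.z,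
      S.yBranch P.z P.y ζ = B.eval ζ + (ζ - P.z) ^ (D : Multiset S.Point).count P * g ζ := by
  obtain ⟨hc, e⟩ := h.point P hP
  have hy : P.y = B.eval P.z := by
    conv_lhs => rw [e]
    rfl
  have hm := Multiset.count_pos.2 hP
  have hd : (X - C P.z) ^ (D : Multiset S.Point).count P ∣ B ^ 2 - S.curvePoly := by
    refine dvd_trans ?_ h.dvd
    rw [← nodePoly_eq_divPoly, nodePoly]
    exact Finset.dvd_prod_of_mem
      (fun P : S.Point => (X - C P.z) ^ (D : Multiset S.Point).count P) (Multiset.mem_toFinset.2 hP)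
  generalize (D : Multiset S.Point).count P = m at *
  generalize P.z = z₀ at *
  generalize P.y = y₀ at *
  subst hy
  -- At a branch point a multiplicity above one would give `∏ (z - E_m)` a double zero. With
  -- multiplicity one only the value matters, and `yBranch` is identically zero there because of its
  -- factor `y₀`.
  by_cases hy0 : B.eval z₀ = 0
  · have hB : (X - C z₀) ∣ B := dvd_iff_isRoot.2 hy0
    obtain ⟨B', hB'⟩ := hB
    have hm1 : m = 1 := by
      by_contra hm1
      have h2 : (X - C z₀) ^ 2 ∣ S.curvePoly := by
        have a1 : (X - C z₀) ^ 2 ∣ B ^ 2 - S.curvePoly := (pow_dvd_pow _ (by omega)).trans hd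
        have a2 : (X - C z₀) ^ 2 ∣ B ^ 2 := by rw [hB', mul_pow]; exact dvd_mul_right _ _
        exact (dvd_sub_right a2).1 a1
      have h3 : S.curvePoly.eval z₀ = 0 := by rw [curvePoly_eval, ← hc, hy0]; simp
      obtain ⟨Q, hQ, hQ0⟩ := exists_curvePoly_eq h3
      obtain ⟨T, hT⟩ := h2
      rw [hQ, sq, mul_assoc] at hT
      have := mul_left_cancel₀ (X_sub_C_ne_zero z₀) hT
      apply hQ0
      rw [this]
      simp
    subst hm1
    have hz : ∀ ζ, S.yBranch z₀ (B.eval z₀) ζ = 0 := fun ζ => by rw [yBranch, hy0, zero_mul]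
    refine ⟨fun ζ => -B'.eval ζ, (AnalyticAt.aeval_polynomial analyticAt_id B').neg, ?_,
      Eventually.of_forall fun ζ => ?_⟩
    · have : S.yBranch z₀ (B.eval z₀) = fun _ => 0 := funext hz
      rw [this]
      exact analyticAt_const
    · rw [hz]
      conv_rhs => rw [hB']
      simp only [eval_mul, eval_sub, eval_X, eval_C]
      ring
  -- Away from branch points `(y - B) (y + B) = -(ζ - z₀)^m T`, and `y + B` has the nonzero value `2
  -- y₀` at the point; division gives the contact of order `m`.
  · obtain ⟨T, hT⟩ := hd
    have hyb := analyticAt_yBranch hc hy0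
    have hBan : AnalyticAt ℂ (fun ζ => B.eval ζ) z₀ := AnalyticAt.aeval_polynomial analyticAt_id B
    have hTan : AnalyticAt ℂ (fun ζ => T.eval ζ) z₀ := AnalyticAt.aeval_polynomial analyticAt_id T
    have hs : S.yBranch z₀ (B.eval z₀) z₀ + B.eval z₀ ≠ 0 := by
      rw [yBranch_self hc hy0, ← two_mul]
      exact mul_ne_zero two_ne_zero hy0
    refine ⟨fun ζ => -T.eval ζ / (S.yBranch z₀ (B.eval z₀) ζ + B.eval ζ),
      hTan.neg.div (hyb.add hBan) hs, hyb, ?_⟩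
    have hne : ∀ᶠ ζ in 𝓝 z₀, S.yBranch z₀ (B.eval z₀) ζ + B.eval ζ ≠ 0 :=
      (hyb.add hBan).continuousAt.eventually_ne hs
    filter_upwards [hne] with ζ hζ
    have e1 := S.yBranch_sq hc hy0 ζ
    have e2 := congrArg (eval ζ) hT
    rw [← curvePoly_eval] at e1
    simp only [eval_sub, eval_pow, eval_mul, eval_X, eval_C] at e2
    field_simp
    linear_combination e1 - e2

open Classical in
theorem OnGraph.iteratedDeriv_eq {D : Sym S.Point S.p} {B : ℂ[X]} (h : OnGraph D B)
    {P : S.Point} (hP : P ∈ (D : Multiset S.Point)) {χ : ℂ → ℂ} (hχ : AnalyticAt ℂ χ P.z) {k : ℕ}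
    (hk : k < (D : Multiset S.Point).count P) :
    iteratedDeriv k (fun ζ => ζ⁻¹ * S.yBranch P.z P.y ζ * χ ζ) P.z
      = iteratedDeriv k (fun ζ => ζ⁻¹ * B.eval ζ * χ ζ) P.z := by
  obtain ⟨g, hg, hy, he⟩ := h.exists_yBranch_eq hP
  have hz := h.z_ne_zero P hP
  have hBan : AnalyticAt ℂ (fun ζ => B.eval ζ) P.z := AnalyticAt.aeval_polynomial analyticAt_id B
  have hinv : AnalyticAt ℂ (fun ζ : ℂ => ζ⁻¹) P.z := analyticAt_id.inv hz
  refine iteratedDeriv_eq_of_sub (h := fun ζ => ζ⁻¹ * g ζ * χ ζ) ((hinv.mul hy).mul hχ)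
    ((hinv.mul hBan).mul hχ) ((hinv.mul hg).mul hχ) ?_ hk
  filter_upwards [he] with ζ hζ
  rw [hζ]
  ring

/-- The Leibniz rule collapses the inner sum over `ℓ` to one Taylor coefficient. Contact to order
`p_k` allows `B` in place of `y`, and the result is the residue sum of `B(ζ) / (ζ (z - ζ) A(ζ))`. -/
theorem OnGraph.hermiteSum_eq {D : Sym S.Point S.p} {B : ℂ[X]} (h : OnGraph D B)
    (hB : B.natDegree ≤ S.p + 1) {z : ℂ} (hz : z ≠ 0)
    (hzD : ∀ P ∈ (D : Multiset S.Point), P.z ≠ z) :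
    S.hermiteSum D z = (B.eval z / (divPoly D).eval z - B.eval 0 / (divPoly D).eval 0) / z
      - B.coeff (S.p + 1) := by
  classical
  have hx : Set.InjOn Point.z ((D : Multiset S.Point).toFinset : Set S.Point) :=
    fun P hP Q hQ e => h.injOn (by simpa using hP) (by simpa using hQ) e
  have hm : ∀ P ∈ (D : Multiset S.Point).toFinset, 0 < (D : Multiset S.Point).count P :=
    fun P hP => Multiset.count_pos.2 (Multiset.mem_toFinset.1 hP)
  have hs : (D : Multiset S.Point).toFinset.Nonempty := by
    by_contra hs
    have := sum_count_eq D
    have h1 := S.one_le_p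
    rw [Finset.not_nonempty_iff_eq_empty] at hs
    simp only [hs, Finset.sum_empty] at this
    omega
  have key := taylorSum_interpolation hx hm hs
    (fun P hP => h.z_ne_zero P (Multiset.mem_toFinset.1 hP))
    (by rw [sum_count_eq]; exact hB) hz (fun P hP => hzD P (Multiset.mem_toFinset.1 hP))
  rw [nodePoly_eq_divPoly, sum_count_eq] at key
  rw [← key, hermiteSum, taylorSum]
  refine Finset.sum_congr rfl fun P hP => ?_
  have hPD := Multiset.mem_toFinset.1 hP
  have hcof := analyticAt_cofactorInv (m := fun P => (D : Multiset S.Point).count P) hx hP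
  have hzP : z - P.z ≠ 0 := sub_ne_zero.2 (hzD P hPD).symm
  have hinv : AnalyticAt ℂ (fun ζ : ℂ => (z - ζ)⁻¹) P.z :=
    (analyticAt_const.sub analyticAt_id).inv hzP
  obtain ⟨g, hg, hy, he⟩ := h.exists_yBranch_eq hPD
  have hz0 : AnalyticAt ℂ (fun ζ : ℂ => ζ⁻¹) P.z := analyticAt_id.inv (h.z_ne_zero P hPD)
  have h1 := sum_iteratedDeriv_mul (hz0.mul hy) (hinv.mul hcof) (hm P hP)
  refine h1.trans ?_
  congr 1
  refine (h.iteratedDeriv_eq hPD (hinv.mul hcof) (Nat.sub_lt (hm P hP) one_pos)).trans ?_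
  congr 1
  funext ζ
  simp only [Pi.mul_apply]
  ring

/-- The residue sum of `B / (ζ A)` contains `B(0) / A(0)` and the subleading coefficient of `A`. The
extra terms in the formula, the product of the `μ_k⁻¹` and the sum of the `μ_k`, cancel exactly
these. -/
theorem OnGraph.alphaNextBeta_eq {D : Sym S.Point S.p} {B : ℂ[X]} (h : OnGraph D B)
    (hB : B.natDegree ≤ S.p + 1) (hB1 : B.coeff (S.p + 1) = 1)
    (hB0 : B.eval 0 = S.c0 false / S.c0 true) :
    S.alphaNextBeta D = -(1 / 2) * B.coeff S.p - 1 / 4 * ∑ m, S.E m := by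
  classical
  have hx : Set.InjOn Point.z ((D : Multiset S.Point).toFinset : Set S.Point) :=
    fun P hP Q hQ e => h.injOn (by simpa using hP) (by simpa using hQ) e
  have hm : ∀ P ∈ (D : Multiset S.Point).toFinset, 0 < (D : Multiset S.Point).count P :=
    fun P hP => Multiset.count_pos.2 (Multiset.mem_toFinset.1 hP)
  have hs : (D : Multiset S.Point).toFinset.Nonempty := by
    by_contra hs
    have := sum_count_eq D
    have h1 := S.one_le_p
    rw [Finset.not_nonempty_iff_eq_empty] at hs
    simp only [hs, Finset.sum_empty] at this
    omega
  have key := taylorSum_inv_mul hx hm hs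
    (fun P hP => h.z_ne_zero P (Multiset.mem_toFinset.1 hP))
    (by rw [sum_count_eq]; exact hB)
  rw [nodePoly_eq_divPoly, sum_count_eq, hB1, hB0, divPoly_coeff_pred] at key
  have e : ∑ P ∈ (D : Multiset S.Point).toFinset,
      iteratedDeriv ((D : Multiset S.Point).count P - 1)
          (fun ζ => ζ⁻¹ * S.yBranch P.z P.y ζ
            * ∏ Q ∈ (D : Multiset S.Point).toFinset.erase P,
                ((ζ - Q.z) ^ (D : Multiset S.Point).count Q)⁻¹) P.z
        / (((D : Multiset S.Point).count P - 1).factorial : ℂ)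
      = taylorSum (D : Multiset S.Point).toFinset Point.z
          (fun P => (D : Multiset S.Point).count P) (fun ζ => ζ⁻¹ * B.eval ζ) := by
    refine Finset.sum_congr rfl fun P hP => ?_
    have hPD := Multiset.mem_toFinset.1 hP
    have hcof := analyticAt_cofactorInv (m := fun P => (D : Multiset S.Point).count P) hx hP
    congr 1
    exact h.iteratedDeriv_eq hPD hcof (Nat.sub_lt (hm P hP) one_pos)
  rw [alphaNextBeta, sqrtProdE_mul_prod h.z_ne_zero]
  refine (congrArg (fun w => -(1 / 2) * w + _) (e.trans key)).trans ?_
  ring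

end SpectralData

end AblowitzLadik

end

/-! ### Dirichlet divisors and stationary data of polynomial triples -/

noncomputable section

open Polynomial

namespace AblowitzLadik

/-! ### Values of Laurent polynomials -/

section Value

variable (z : ℂˣ)

theorem lval_add (F G : ℂ[T;T⁻¹]) : lval z (F + G) = lval z F + lval z G := map_add _ _ _

theorem lval_sub (F G : ℂ[T;T⁻¹]) : lval z (F - G) = lval z F - lval z G := map_sub _ _ _

theorem lval_mul (F G : ℂ[T;T⁻¹]) : lval z (F * G) = lval z F * lval z G := map_mul _ _ _

theorem lval_neg (F : ℂ[T;T⁻¹]) : lval z (-F) = -lval z F := map_neg _ _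

theorem lval_T (k : ℤ) : lval z (LaurentPolynomial.T k) = (z : ℂ) ^ k := by
  rw [lval, LaurentPolynomial.eval₂_T, Units.val_zpow_eq_zpow_val]

theorem lval_C (c : ℂ) : lval z (LaurentPolynomial.C c) = c := by
  rw [lval, LaurentPolynomial.eval₂_C]; rfl

theorem lval_toLaurent (P : ℂ[X]) : lval z P.toLaurent = P.eval (z : ℂ) := by
  rw [lval, LaurentPolynomial.eval₂_toLaurent]; rfl

end Value

namespace SpectralData

variable (S : SpectralData)

/-! ### Polynomial triples encoding given Laurent polynomials -/

/-- The polynomial with the coefficients of `z^k, …, z^{k+d}` of a Laurent polynomial. -/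
def polyOf (L : ℂ[T;T⁻¹]) (k : ℤ) (d : ℕ) : ℂ[X] :=
  ∑ N ∈ Finset.range (d + 1), C (L.coeff (k + N)) * X ^ N

theorem coeff_polyOf (L : ℂ[T;T⁻¹]) (k : ℤ) (d N : ℕ) :
    (polyOf L k d).coeff N = if N ≤ d then L.coeff (k + N) else 0 := by
  rw [polyOf, finsetSum_coeff]
  simp only [coeff_C_mul, coeff_X_pow, mul_ite, mul_one, mul_zero, Finset.sum_ite_eq,
    Finset.mem_range, Nat.lt_succ_iff]

theorem T_mul_polyOf {L : ℂ[T;T⁻¹]} {k : ℤ} {d : ℕ}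
    (h : ∀ j, (j < k ∨ k + d < j) → L.coeff j = 0) :
    LaurentPolynomial.T k * (polyOf L k d).toLaurent = L := by
  ext j
  rcases lt_or_ge j k with hj | hj
  · rw [coeff_shift_of_lt _ hj, h j (Or.inl hj)]
  · obtain ⟨N, rfl⟩ : ∃ N : ℕ, j = k + N := ⟨(j - k).toNat, by omega⟩
    rw [coeff_shift_of_eq _ rfl, coeff_polyOf]
    split_ifs with hN
    · rfl
    · rw [h _ (Or.inr (by omega))]

/-- The polynomial triple encoding three Laurent polynomials. -/
def polyTriple (L : ℂ[T;T⁻¹] × ℂ[T;T⁻¹] × ℂ[T;T⁻¹]) : PolyTriple where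
  F := polyOf L.1 (-(S.deg false : ℤ)) S.p
  G := polyOf L.2.1 (-(S.deg false : ℤ)) (S.p + 1)
  H := polyOf L.2.2 (1 - (S.deg false : ℤ)) S.p

/-- The sums that define `F, G, H` are supported in windows of `p + 1`, `p + 2` and `p + 1`
exponents, so no coefficient is lost. -/
theorem laurentTriple_polyTriple (f g h : Bool → ℕ → ℂ) :
    S.laurentTriple (S.polyTriple (laurentF S.deg f, laurentG S.deg g, laurentH S.deg h))
      = (laurentF S.deg f, laurentG S.deg g, laurentH S.deg h) := by
  have hd := S.deg_add_int
  refine Prod.ext (T_mul_polyOf fun j hj => ?_) (Prod.ext (T_mul_polyOf fun j hj => ?_)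
    (T_mul_polyOf fun j hj => ?_))
  · rw [coeff_laurentF]
    unfold ext0
    split_ifs <;> first | rfl | (exfalso; omega)
  · rw [coeff_laurentG]
    unfold ext0
    split_ifs <;> first | rfl | (exfalso; push_cast at hj; omega)
  · rw [coeff_laurentH]
    unfold ext0
    split_ifs <;> first | rfl | (exfalso; omega)

variable {S}

theorem lval_laurentTriple (X : PolyTriple) (z : ℂˣ) :
    lval z (S.laurentTriple X).1 = (z : ℂ) ^ (-(S.deg false : ℤ)) * X.F.eval (z : ℂ) ∧
    lval z (S.laurentTriple X).2.1 = (z : ℂ) ^ (-(S.deg false : ℤ)) * X.G.eval (z : ℂ) := by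
  constructor <;> rw [laurentTriple, lval_mul, lval_T, lval_toLaurent]

theorem T_mul_left_cancel {k : ℤ} {P Q : ℂ[T;T⁻¹]}
    (h : LaurentPolynomial.T k * P = LaurentPolynomial.T k * Q) : P = Q :=
  (LaurentPolynomial.isUnit_T k).mul_left_cancel h

theorem curve_of_laurent {X : PolyTriple}
    (h : (S.laurentTriple X).2.1 ^ 2 - (S.laurentTriple X).1 * (S.laurentTriple X).2.2 = S.R) :
    X.G ^ 2 - Polynomial.X * (X.F * X.H) = C (S.c0 true ^ 2 / 4) * S.curvePoly := by
  rw [R_eq, laurentTriple] at h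
  have h1 : (LaurentPolynomial.T (1 - (S.deg false : ℤ)) : ℂ[T;T⁻¹])
      = LaurentPolynomial.T 1 * LaurentPolynomial.T (-(S.deg false : ℤ)) := by
    rw [← LaurentPolynomial.T_add]; rfl
  apply Polynomial.toLaurent_injective
  refine ((LaurentPolynomial.isUnit_T (-(S.deg false : ℤ))).pow 2).mul_left_cancel ?_
  rw [← h]
  simp only [h1, map_sub, map_pow, map_mul, Polynomial.toLaurent_X]
  ring

/-! ### Dirichlet divisors and stationary data of polynomial triples -/

theorem toLaurent_divPoly (D : Sym S.Point S.p) : (divPoly D).toLaurent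
    = ((D : Multiset S.Point).map fun P =>
        LaurentPolynomial.T 1 - LaurentPolynomial.C P.z).prod := by
  rw [divPoly, map_multiset_prod, Multiset.map_map]
  congr 1
  refine Multiset.map_congr rfl fun P _ => ?_
  simp

theorem laurent_eq_iff {X : PolyTriple} {D : Sym S.Point S.p} (a : ℂ) :
    ((S.laurentTriple X).1 = LaurentPolynomial.C a * LaurentPolynomial.T (-(S.deg false : ℤ))
      * ((D : Multiset S.Point).map fun P =>
          LaurentPolynomial.T 1 - LaurentPolynomial.C P.z).prod) ↔ X.F = C a * divPoly D := by
  rw [← toLaurent_divPoly, laurentTriple, ← Polynomial.toLaurent_C, mul_right_comm, ← map_mul,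
    mul_comm]
  constructor
  · intro h
    rw [mul_comm, mul_comm _ (LaurentPolynomial.T _)] at h
    exact Polynomial.toLaurent_injective (T_mul_left_cancel h)
  · intro h
    rw [h]

/-- The power `μ^{p₋}` in the condition on `y` clears the denominator of `G`, so the points lie on
the graph of the polynomial `normG`. -/
theorem isDirichletDivisor_iff {X : PolyTriple} {D : Sym S.Point S.p} :
    S.IsDirichletDivisor (S.laurentTriple X).1 (S.laurentTriple X).2.1 D ↔
      (∃ a : ℂ, a ≠ 0 ∧ X.F = C a * divPoly D) ∧
      ∀ P ∈ (D : Multiset S.Point), P.z ≠ 0 ∧ ∃ h, P = .aff P.z ((S.normG X).eval P.z) h := by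
  have hG : ∀ μ : ℂˣ, 2 / S.c0 true * (μ : ℂ) ^ S.deg false * lval μ (S.laurentTriple X).2.1
      = (S.normG X).eval (μ : ℂ) := by
    intro μ
    rw [(lval_laurentTriple X μ).2, normG, eval_mul, eval_C, zpow_neg, zpow_natCast]
    field_simp [μ.ne_zero]
  unfold IsDirichletDivisor
  simp only [laurent_eq_iff, hG]
  refine and_congr_right fun _ => forall₂_congr fun P hP => ?_
  constructor
  · rintro ⟨μ, y, h, rfl, rfl⟩
    exact ⟨μ.ne_zero, h, rfl⟩
  · rintro ⟨hz, h, e⟩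
    exact ⟨Units.mk0 P.z hz, _, h, e, rfl⟩

theorem IsRegular.isDirichletDivisor {X : PolyTriple} {D : Sym S.Point S.p}
    (h : S.IsRegular X D) :
    S.IsDirichletDivisor (S.laurentTriple X).1 (S.laurentTriple X).2.1 D := by
  have hcurve : ∀ μ ∈ X.F.roots, (S.normG X).eval μ ^ 2 = ∏ m, (μ - S.E m) := fun μ hμ => by
    have h1 := congrArg (eval μ) h.triple.normG_sq
    simp only [eval_sub, eval_pow, eval_mul, (isRoot_of_mem_roots hμ).eq_zero, zero_mul, mul_zero,
      curvePoly_eval, sub_eq_zero] at h1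
    exact h1
  have hD : divPoly D = (X.F.roots.map fun μ => Polynomial.X - C μ).prod := by
    rw [divPoly, h.divisor, Multiset.map_map]
    congr 1
    refine Multiset.map_congr rfl fun μ hμ => ?_
    rw [Function.comp_apply, graphPoint_of_curve (hcurve μ hμ)]
    rfl
  refine isDirichletDivisor_iff.2 ⟨⟨X.F.leadingCoeff, leadingCoeff_ne_zero.2 h.F_ne_zero, ?_⟩, ?_⟩
  · rw [hD]
    exact (C_leadingCoeff_mul_prod_multiset_X_sub_C IsAlgClosed.card_roots_eq_natDegree).symm
  · intro P hP
    rw [h.divisor] at hP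
    obtain ⟨μ, hμ, rfl⟩ := Multiset.mem_map.1 hP
    rw [graphPoint_of_curve (hcurve μ hμ)]
    refine ⟨?_, hcurve μ hμ, rfl⟩
    rintro h0
    have h0' : μ = 0 := h0
    subst h0'
    apply h.bot
    rw [coeff_zero_eq_eval_zero]
    exact isRoot_of_mem_roots hμ

theorem onGraph_of_isDirichletDivisor {X : PolyTriple} {D : Sym S.Point S.p}
    (hc : X.G ^ 2 - Polynomial.X * (X.F * X.H) = C (S.c0 true ^ 2 / 4) * S.curvePoly)
    (h : S.IsDirichletDivisor (S.laurentTriple X).1 (S.laurentTriple X).2.1 D) :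
    OnGraph D (S.normG X) := by
  obtain ⟨⟨a, ha, hF⟩, h2⟩ := isDirichletDivisor_iff.1 h
  refine ⟨fun P hP => (h2 P hP).2, fun P hP => (h2 P hP).1, ?_⟩
  rw [normG_sq_of_curve hc, hF]
  exact ⟨C (4 / S.c0 true ^ 2) * Polynomial.X * C a * X.H, by ring⟩

theorem OnGraph.divPoly_eval_zero_ne {D : Sym S.Point S.p} {B : ℂ[X]} (h : OnGraph D B) :
    (divPoly D).eval 0 ≠ 0 := divPoly_eval_ne_zero h.z_ne_zero

theorem IsCurveTriple.isRegular {X : PolyTriple} {D : Sym S.Point S.p}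
    (hX : S.IsCurveTriple X) (hM : D ∈ S.M₀)
    (h : S.IsDirichletDivisor (S.laurentTriple X).1 (S.laurentTriple X).2.1 D) :
    S.IsRegular X D := by
  have hg := onGraph_of_isDirichletDivisor hX.curve h
  obtain ⟨⟨a, ha, hF⟩, h2⟩ := isDirichletDivisor_iff.1 h
  refine ⟨hX, ?_, ?_, hM, ?_⟩
  · rw [hF, coeff_C_mul, coeff_zero_eq_eval_zero]
    exact mul_ne_zero ha hg.divPoly_eval_zero_ne
  · rw [hF, coeff_C_mul]
    have : (divPoly D).coeff S.p = 1 := by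
      have := divPoly_monic D
      rwa [Monic, leadingCoeff, natDegree_divPoly] at this
    rw [this, mul_one]
    exact ha
  · rw [hF, roots_C_mul _ ha, divPoly_roots, Multiset.map_map]
    conv_lhs => rw [← Multiset.map_id (D : Multiset S.Point)]
    refine Multiset.map_congr rfl fun P hP => ?_
    obtain ⟨hc, e⟩ := hg.point P hP
    rw [Function.comp_apply, graphPoint_of_curve hc]
    exact e

/-- The leading coefficient of `F` is `-c_{0,+} α⁺` and its constant coefficient is `c_{0,-} α`;
their quotient is the value of the monic polynomial `divPoly` at `0`. -/
theorem IsCurveTriple.alphaNext_eq {X : PolyTriple} {D : Sym S.Point S.p}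
    (hX : S.IsCurveTriple X)
    (h : S.IsDirichletDivisor (S.laurentTriple X).1 (S.laurentTriple X).2.1 D) :
    S.alphaNext (S.tripleAlpha X) D = S.tripleAlphaNext X ∧
      X.F = C (-S.c0 true * S.tripleAlphaNext X) * divPoly D := by
  have hg := onGraph_of_isDirichletDivisor hX.curve h
  obtain ⟨⟨a, ha, hF⟩, -⟩ := isDirichletDivisor_iff.1 h
  have hm : (divPoly D).coeff S.p = 1 := by
    have := divPoly_monic D
    rwa [Monic, leadingCoeff, natDegree_divPoly] at this
  have h1 : a = -S.c0 true * S.tripleAlphaNext X := by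
    have := hX.coeffF_top
    rw [hF, coeff_C_mul, hm] at this
    rw [← mul_one a, this]; ring
  have h2 : a * (divPoly D).eval 0 = S.c0 false * S.tripleAlpha X := by
    rw [← hX.coeffF_zero, hF, coeff_C_mul, coeff_zero_eq_eval_zero]
  refine ⟨?_, h1 ▸ hF⟩
  rw [alphaNext, mul_assoc, sqrtProdE_mul_prod hg.z_ne_zero]
  have := hg.divPoly_eval_zero_ne
  have hc := S.c0_ne_zero true
  rw [h1] at h2
  field_simp
  linear_combination h2

theorem IsCurveTriple.isStationaryData {X : PolyTriple} {D : Sym S.Point S.p}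
    (hX : S.IsCurveTriple X)
    (h : S.IsDirichletDivisor (S.laurentTriple X).1 (S.laurentTriple X).2.1 D) :
    S.IsStationaryData (S.tripleAlpha X) D (S.laurentTriple X).1 (S.laurentTriple X).2.1
      (S.laurentTriple X).2.2 := by
  have hg := onGraph_of_isDirichletDivisor hX.curve h
  obtain ⟨h1, h2⟩ := hX.alphaNext_eq h
  obtain ⟨⟨a, ha, hF⟩, -⟩ := isDirichletDivisor_iff.1 h
  refine ⟨?_, fun z hz => ?_, ?_⟩
  · rw [h1]
    exact (laurent_eq_iff _).2 h2
  · have hA := divPoly_eval_ne_zero hz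
    have hA0 := hg.divPoly_eval_zero_ne
    have hz0 := z.ne_zero
    rw [hg.hermiteSum_eq hX.normG_natDegree z.ne_zero hz, hX.normG_coeff_top, hX.normG_eval_zero,
      (lval_laurentTriple X z).1, (lval_laurentTriple X z).2, h1, h2, normG]
    have hc := S.c0_ne_zero true
    have ha' : S.tripleAlphaNext X ≠ 0 := by
      intro h0
      rw [h0, mul_zero, C_0, zero_mul] at h2
      rw [h2] at hF
      have := congrArg (eval 0) hF
      rw [eval_zero, eval_mul, eval_C] at this
      exact mul_ne_zero ha hA0 this.symm
    have h4 : S.c0 false * S.tripleAlpha X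
        = -S.c0 true * S.tripleAlphaNext X * (divPoly D).eval 0 := by
      rw [← hX.coeffF_zero, h2, coeff_C_mul, coeff_zero_eq_eval_zero]
    have ha'' : S.tripleAlpha X ≠ 0 := by
      intro h0
      rw [h0, mul_zero] at h4
      exact mul_ne_zero (mul_ne_zero (neg_ne_zero.2 hc) ha') hA0 h4.symm
    -- The interpolation sum contains `B(0) / A(0)`, which equals `-α⁺ / α`; this accounts for the
    -- term `1 / α` in the formula for `G`.
    have h5 : S.c0 false / S.c0 true / (divPoly D).eval 0
        = -(S.tripleAlphaNext X / S.tripleAlpha X) := by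
      field_simp
      linear_combination h4
    rw [h5]
    simp only [eval_mul, eval_C]
    field_simp
    ring
  · rw [← hX.laurent_curve]; ring

/-- The interpolation formula for `G` fixes the normalization of the triple. -/
theorem isCurveTriple_of_isStationaryData {X : PolyTriple} {D : Sym S.Point S.p}
    (degF : ∀ N, S.p < N → X.F.coeff N = 0) (degG : ∀ N, S.p + 1 < N → X.G.coeff N = 0)
    (degH : ∀ N, S.p < N → X.H.coeff N = 0) {a : ℂ} (ha : a ≠ 0)
    (hs : S.IsStationaryData a D (S.laurentTriple X).1 (S.laurentTriple X).2.1
      (S.laurentTriple X).2.2)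
    (h : S.IsDirichletDivisor (S.laurentTriple X).1 (S.laurentTriple X).2.1 D) :
    S.IsCurveTriple X ∧ S.tripleAlpha X = a := by
  obtain ⟨s1, s2, s3⟩ := hs
  have hcurve := curve_of_laurent (X := X) (by rw [← s3]; ring)
  have hg := onGraph_of_isDirichletDivisor hcurve h
  have hB : (S.normG X).natDegree ≤ S.p + 1 :=
    natDegree_le_of_coeff fun N hN => by rw [normG, coeff_C_mul, degG N hN, mul_zero]
  have hF := (laurent_eq_iff _).1 s1
  have hA0 := hg.divPoly_eval_zero_ne
  have hc := S.c0_ne_zero true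
  have hc' := S.c0_ne_zero false
  have hsq := sqrtProdE_mul_prod hg.z_ne_zero
  have hnext : S.alphaNext a D = a * (-(S.c0 false / S.c0 true) / (divPoly D).eval 0) := by
    rw [alphaNext, mul_assoc, hsq]
  have hne : S.alphaNext a D ≠ 0 := by
    rw [hnext]
    exact mul_ne_zero ha (div_ne_zero (neg_ne_zero.2 (div_ne_zero hc' hc)) hA0)
  set b := (S.normG X).coeff (S.p + 1) with hb
  -- No normalization of `G` is known yet. Comparing the given formula with the interpolation of
  -- `normG` itself leaves the defect `κ + (b - 1) z`: `κ` measures the error in the value at `0`,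
  -- and `b - 1` the error in the leading coefficient.
  set κ := S.alphaNext a D / a + (S.normG X).eval 0 / (divPoly D).eval 0 with hκ
  -- The formula holds only off `0` and off the `μ_k`. The factor `z ∏ (z - μ_k)` extends the
  -- identity to all `z`, and it can then be cancelled in the polynomial ring.
  have hpoly : (C κ + C (b - 1) * Polynomial.X) * (Polynomial.X * divPoly D) = 0 := by
    refine Polynomial.funext fun z => ?_
    simp only [eval_mul, eval_add, eval_C, eval_X, eval_zero]
    by_cases hz0 : z = 0
    · rw [hz0]; ring
    by_cases hzD : ∀ P ∈ (D : Multiset S.Point), P.z ≠ z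
    · have hA := divPoly_eval_ne_zero hzD
      have e := s2 (Units.mk0 z hz0) hzD
      rw [Units.val_mk0, hg.hermiteSum_eq hB hz0 hzD, (lval_laurentTriple X _).1,
        (lval_laurentTriple X _).2, Units.val_mk0, hF] at e
      have hz1 : z ^ (-(S.deg false : ℤ)) ≠ 0 := zpow_ne_zero _ hz0
      have hG : X.G.eval z = S.c0 true / 2 * (S.normG X).eval z := by
        rw [normG, eval_mul, eval_C]; field_simp
      simp only [eval_mul, eval_C, hG] at e
      have e2 : S.c0 true / 2 * (S.normG X).eval z
          = 1 / 2 * (1 / a - z / S.alphaNext a D) * (-S.c0 true * S.alphaNext a D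
              * (divPoly D).eval z)
            - z / (2 * S.alphaNext a D) * (-S.c0 true * S.alphaNext a D * (divPoly D).eval z)
            * (((S.normG X).eval z / (divPoly D).eval z
              - (S.normG X).eval 0 / (divPoly D).eval 0) / z - b) := by
        apply mul_left_cancel₀ hz1
        linear_combination e
      have e3 : (κ + (b - 1) * z) = 0 := by
        have e4 : S.c0 true * (divPoly D).eval z * (κ + (b - 1) * z) = 0 := by
          have e5 : 1 / 2 * (1 / a - z / S.alphaNext a D) * (-S.c0 true * S.alphaNext a D
                * (divPoly D).eval z)
              - z / (2 * S.alphaNext a D) * (-S.c0 true * S.alphaNext a D * (divPoly D).eval z)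
              * (((S.normG X).eval z / (divPoly D).eval z
                - (S.normG X).eval 0 / (divPoly D).eval 0) / z - b)
              = S.c0 true / 2 * (S.normG X).eval z
                - S.c0 true / 2 * (divPoly D).eval z * (κ + (b - 1) * z) := by
            rw [hκ]
            field_simp
            ring
          linear_combination 2 * e2 + 2 * e5
        exact (mul_eq_zero.1 e4).resolve_left (mul_ne_zero hc hA)
      rw [e3, zero_mul]
    · push Not at hzD
      obtain ⟨P, hP, rfl⟩ := hzD
      have : (divPoly D).eval P.z = 0 := by
        rw [divPoly_eval, Multiset.prod_eq_zero_iff]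
        exact Multiset.mem_map.2 ⟨P, hP, sub_self _⟩
      rw [this]; ring
  have hlin := (mul_eq_zero.1 hpoly).resolve_right
    (mul_ne_zero X_ne_zero (divPoly_monic D).ne_zero)
  have k0 : κ = 0 := by simpa using congrArg (fun P => P.coeff 0) hlin
  have k1 : b - 1 = 0 := by simpa [coeff_C] using congrArg (fun P => P.coeff 1) hlin
  have hG0 : (S.normG X).eval 0 = S.c0 false / S.c0 true := by
    rw [hκ, hnext] at k0
    field_simp at k0 ⊢
    linear_combination k0
  refine ⟨⟨degF, degG, degH, ?_, ?_, hcurve⟩, ?_⟩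
  · rw [hb, normG, coeff_C_mul] at k1
    field_simp at k1
    linear_combination (1 / 2 : ℂ) * k1
  · rw [← coeff_zero_eq_eval_zero, normG, coeff_C_mul] at hG0
    field_simp at hG0
    linear_combination (1 / 2 : ℂ) * hG0
  · rw [tripleAlpha, hF, coeff_C_mul, coeff_zero_eq_eval_zero, hnext]
    field_simp

/-- A triple is determined by `α` and its Dirichlet divisor. -/
theorem IsCurveTriple.ext_of_isDirichletDivisor {X Y : PolyTriple} {D : Sym S.Point S.p}
    (hX : S.IsCurveTriple X) (hY : S.IsCurveTriple Y)
    (hDX : S.IsDirichletDivisor (S.laurentTriple X).1 (S.laurentTriple X).2.1 D)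
    (hDY : S.IsDirichletDivisor (S.laurentTriple Y).1 (S.laurentTriple Y).2.1 D)
    (h : S.tripleAlpha X = S.tripleAlpha Y) : X = Y := by
  obtain ⟨x1, x2⟩ := hX.alphaNext_eq hDX
  obtain ⟨y1, y2⟩ := hY.alphaNext_eq hDY
  have hF : X.F = Y.F := by rw [x2, y2, ← x1, ← y1, h]
  -- Equal `F` and equal `α` give equal interpolation formulas, hence equal values off finitely many
  -- points; `H` follows from the curve equation.
  have hG : X.G = Y.G := by
    have h0 : (X.G - Y.G) * (Polynomial.X * divPoly D) = 0 := by
      refine Polynomial.funext fun z => ?_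
      simp only [eval_mul, eval_sub, eval_X, eval_zero]
      by_cases hz0 : z = 0
      · rw [hz0]; ring
      by_cases hzD : ∀ P ∈ (D : Multiset S.Point), P.z ≠ z
      · have e1 := (hX.isStationaryData hDX).2.1 (Units.mk0 z hz0) hzD
        have e2 := (hY.isStationaryData hDY).2.1 (Units.mk0 z hz0) hzD
        rw [(lval_laurentTriple X _).1, h, hF, ← (lval_laurentTriple Y _).1] at e1
        rw [← e1, (lval_laurentTriple X _).2, (lval_laurentTriple Y _).2] at e2
        have e3 : Y.G.eval z = X.G.eval z :=
          mul_left_cancel₀ (zpow_ne_zero _ (Units.ne_zero _)) e2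
        rw [e3, sub_self, zero_mul]
      · push Not at hzD
        obtain ⟨P, hP, rfl⟩ := hzD
        have : (divPoly D).eval P.z = 0 := by
          rw [divPoly_eval, Multiset.prod_eq_zero_iff]
          exact Multiset.mem_map.2 ⟨P, hP, sub_self _⟩
        rw [this]; ring
    exact sub_eq_zero.1 ((mul_eq_zero.1 h0).resolve_right
      (mul_ne_zero X_ne_zero (divPoly_monic D).ne_zero))
  have hF0 : X.F ≠ 0 := by
    obtain ⟨⟨a, ha, e⟩, -⟩ := isDirichletDivisor_iff.1 hDX
    rw [e]
    exact mul_ne_zero (C_ne_zero.2 ha) (divPoly_monic D).ne_zero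
  have hH : X.H = Y.H := by
    have e := hX.curve.trans hY.curve.symm
    rw [hF, hG] at e
    exact mul_left_cancel₀ (hF ▸ hF0) (mul_left_cancel₀ X_ne_zero (sub_right_inj.1 e))
  exact PolyTriple.ext hF hG hH

/-- The second coefficient of the curve equation. -/
theorem IsCurveTriple.alphaNext_mul_beta {X : PolyTriple} (hX : S.IsCurveTriple X) :
    S.tripleAlphaNext X * S.tripleBeta X
      = -(1 / 2) * (S.normG X).coeff S.p - 1 / 4 * ∑ m, S.E m := by
  have hc := S.c0_ne_zero true
  have h1 : S.curvePoly.coeff (2 * S.p + 1) = -∑ m, S.E m := by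
    have := prod_X_sub_C_coeff_card_pred (Finset.univ : Finset (Fin (2 * S.p + 2))) S.E (by simp)
    simpa [curvePoly] using this
  have h2 : (X.F * X.H).coeff (S.p + S.p)
      = -(S.c0 true * S.tripleAlphaNext X) * (S.c0 true * S.tripleBeta X) := by
    rw [coeff_mul_add_eq_of_natDegree_le (natDegree_le_of_coeff hX.degF)
      (natDegree_le_of_coeff hX.degH), hX.coeffF_top, hX.coeffH_top]
  -- With the leading term split off, the coefficient `2p + 1` of `G²` is the cross term of the two
  -- highest coefficients; the square of the rest has degree at most `2p`.
  have h3 : (X.G ^ 2).coeff (2 * S.p + 1) = S.c0 true * X.G.coeff S.p := by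
    set G' : ℂ[X] := X.G - C (S.c0 true / 2) * Polynomial.X ^ (S.p + 1) with hG'
    have hd : G'.natDegree ≤ S.p := natDegree_le_of_coeff fun N hN => by
      rw [hG', coeff_sub, coeff_C_mul, coeff_X_pow]
      split_ifs with h
      · rw [h, hX.topG]; ring
      · rw [hX.degG N (by omega)]; ring
    have e : X.G ^ 2 = C (S.c0 true / 2) ^ 2 * Polynomial.X ^ (2 * S.p + 2)
        + C (S.c0 true) * (G' * Polynomial.X ^ (S.p + 1)) + G' ^ 2 := by
      have : (C (S.c0 true) : ℂ[X]) = 2 * C (S.c0 true / 2) := by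
        rw [show (2 : ℂ[X]) = C 2 from rfl, ← C_mul]; congr 1; ring
      rw [this, hG']
      ring
    have h4 : (G' ^ 2).coeff (2 * S.p + 1) = 0 :=
      coeff_eq_zero_of_natDegree_lt ((natDegree_pow_le_of_le 2 hd).trans_lt (by omega))
    rw [e, coeff_add, coeff_add, h4, ← C_pow, coeff_C_mul, coeff_C_mul, coeff_X_pow,
      if_neg (by omega), show 2 * S.p + 1 = S.p + (S.p + 1) by ring, coeff_mul_X_pow, hG',
      coeff_sub, coeff_C_mul, coeff_X_pow, if_neg (by omega)]
    ring
  have h5 := congrArg (fun P => P.coeff (2 * S.p + 1)) hX.curve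
  rw [← two_mul] at h2
  simp only [coeff_sub, h3, coeff_X_mul, h2, coeff_C_mul, h1] at h5
  rw [normG, coeff_C_mul]
  field_simp
  field_simp at h5
  linear_combination h5

theorem IsCurveTriple.alphaNextBeta_eq {X : PolyTriple} {D : Sym S.Point S.p}
    (hX : S.IsCurveTriple X)
    (h : S.IsDirichletDivisor (S.laurentTriple X).1 (S.laurentTriple X).2.1 D) :
    S.tripleAlphaNext X * S.tripleBeta X = S.alphaNextBeta D := by
  rw [(onGraph_of_isDirichletDivisor hX.curve h).alphaNextBeta_eq hX.normG_natDegree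
    hX.normG_coeff_top hX.normG_eval_zero, hX.alphaNext_mul_beta]

end SpectralData

end AblowitzLadik

end

/-! ### The zero-curvature expression on the lattice, and stationary solutions as orbits -/

noncomputable section

open Polynomial

namespace AblowitzLadik

/-! ### The zero-curvature expression on the lattice -/

theorem conv_succ (c a : ℕ → ℂ) (k : ℕ) :
    conv c a (k + 1) = conv c (fun i => a (i + 1)) k + c (k + 1) * a 0 := by
  rw [conv, conv, Finset.sum_range_succ']
  simp only [Nat.add_sub_add_right, Nat.sub_zero]

theorem conv_add (c a b : ℕ → ℂ) (k : ℕ) :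
    conv c (fun i => a i + b i) k = conv c a k + conv c b k := by
  simp only [conv, mul_add, Finset.sum_add_distrib]

theorem conv_sub (c a b : ℕ → ℂ) (k : ℕ) :
    conv c (fun i => a i - b i) k = conv c a k - conv c b k := by
  simp only [conv, mul_sub, Finset.sum_sub_distrib]

theorem conv_const_mul (c a : ℕ → ℂ) (w : ℂ) (k : ℕ) :
    conv c (fun i => w * a i) k = w * conv c a k := by
  simp only [conv, Finset.mul_sum, mul_left_comm]

theorem conv_zero (c a : ℕ → ℂ) : conv c a 0 = c 0 * a 0 := by simp [conv]

theorem ext0_natCast (a : ℕ → ℂ) (k : ℕ) : ext0 a (k : ℤ) = a k := by simp [ext0]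

theorem ext0_of_neg (a : ℕ → ℂ) {j : ℤ} (h : j < 0) : ext0 a j = 0 := if_neg (by omega)

section Lattice

variable (c : Bool → ℕ → ℂ) (α β : ℤ → ℂ)

/-- `f_{m,±}(n)` for `m ∈ ℤ`. -/
def fExt (s : Bool) (m n : ℤ) : ℂ := ext0 (fun ℓ => fCoef c α β s ℓ n) m

/-- `g_{m,±}(n)` for `m ∈ ℤ`. -/
def gExt (s : Bool) (m n : ℤ) : ℂ := ext0 (fun ℓ => gCoef c α β s ℓ n) m

/-- `h_{m,±}(n)` for `m ∈ ℤ`. -/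
def hExt (s : Bool) (m n : ℤ) : ℂ := ext0 (fun ℓ => hCoef c α β s ℓ n) m

/-- The recursion is linear, so it survives convolution with constants. Extension by zero makes it
valid for all integer indices: at index `0` it reduces to `ĝ_0 = 1/2`. -/
theorem ext_plus_recursion (m n : ℤ) :
    fExt c α β true m (n - 1) = fExt c α β true (m - 1) n
      - α n * (gExt c α β true m n + gExt c α β true m (n - 1)) ∧
    gExt c α β true m n - gExt c α β true m (n - 1)
      = α n * hExt c α β true (m - 1) (n - 1) + β n * fExt c α β true (m - 1) n ∧
    hExt c α β true m n = hExt c α β true (m - 1) (n - 1)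
      + β n * (gExt c α β true m n + gExt c α β true m (n - 1)) := by
  unfold fExt gExt hExt
  rcases lt_or_ge m 0 with hm | hm
  · simp only [ext0_of_neg _ hm, ext0_of_neg _ (show m - 1 < 0 by omega)]
    simp
  obtain ⟨k, rfl⟩ := Int.eq_ofNat_of_zero_le hm
  have hr := hat_plus_recursion α β
  rcases k with _ | k
  · simp only [ext0_natCast, ext0_of_neg _ (show ((0 : ℕ) : ℤ) - 1 < 0 by omega), fCoef, gCoef,
      hCoef, conv_zero, (hr 0 _).1, (hr 0 _).2.1, (hr 0 _).2.2.1]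
    refine ⟨?_, ?_, ?_⟩
    · rw [sub_add_cancel]; ring
    · ring
    · ring
  · rw [show ((k + 1 : ℕ) : ℤ) - 1 = (k : ℕ) by push_cast; ring]
    simp only [ext0_natCast, fCoef, gCoef, hCoef, conv_succ]
    have h0 := hr 0
    have h1 : conv (c true) (fun i => fHat α β true (i + 1) (n - 1)) k
        = conv (c true) (fun i => fHat α β true i n) k
          - α n * (conv (c true) (fun i => gHat α β true (i + 1) n) k
            + conv (c true) (fun i => gHat α β true (i + 1) (n - 1)) k) := by
      rw [← conv_add, ← conv_const_mul, ← conv_sub]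
      congr 1
      funext i
      exact (hr i n).2.2.2.2.1
    have h2 : conv (c true) (fun i => gHat α β true (i + 1) n) k
          - conv (c true) (fun i => gHat α β true (i + 1) (n - 1)) k
        = α n * conv (c true) (fun i => hHat α β true i (n - 1)) k
          + β n * conv (c true) (fun i => fHat α β true i n) k := by
      rw [← conv_const_mul, ← conv_const_mul, ← conv_add, ← conv_sub]
      congr 1
      funext i
      exact (hr i n).2.2.2.1
    have h3 : conv (c true) (fun i => hHat α β true (i + 1) n) k
        = conv (c true) (fun i => hHat α β true i (n - 1)) k
          + β n * (conv (c true) (fun i => gHat α β true (i + 1) n) k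
            + conv (c true) (fun i => gHat α β true (i + 1) (n - 1)) k) := by
      rw [← conv_add, ← conv_const_mul, ← conv_add]
      congr 1
      funext i
      exact (hr i n).2.2.2.2.2
    rw [(h0 _).1, (h0 _).2.1, (h0 _).2.1, (h0 _).2.2.1, sub_add_cancel]
    refine ⟨?_, ?_, ?_⟩
    · linear_combination h1
    · linear_combination h2
    · linear_combination h3

/-- Reduces to the `+` case by exchanging `α, β` and `f, h`; both signs then use the constants
`c_{·,-}`. -/
theorem ext_minus_recursion (m n : ℤ) :
    fExt c α β false m n = fExt c α β false (m - 1) (n - 1)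
      + α n * (gExt c α β false m n + gExt c α β false m (n - 1)) ∧
    gExt c α β false m n - gExt c α β false m (n - 1)
      = α n * hExt c α β false (m - 1) n + β n * fExt c α β false (m - 1) (n - 1) ∧
    hExt c α β false m (n - 1) = hExt c α β false (m - 1) n
      - β n * (gExt c α β false m n + gExt c α β false m (n - 1)) := by
  have key : ∀ m n, fExt c α β false m n = hExt (fun _ => c false) β α true m n ∧
      gExt c α β false m n = gExt (fun _ => c false) β α true m n ∧
      hExt c α β false m n = fExt (fun _ => c false) β α true m n := by
    intro m n
    simp [fExt, gExt, hExt, fCoef, gCoef, hCoef, fHat, gHat, hHat]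
  obtain ⟨h1, h2, h3⟩ := ext_plus_recursion (fun _ => c false) β α m n
  simp only [key]
  exact ⟨h3, by rw [h2]; ring, h1⟩

variable (d : Bool → ℕ)

theorem coeff_Fpoly (n j : ℤ) : (Fpoly c α β d n).coeff j =
    if 0 ≤ j then fExt c α β true (d true - 1 - j) n else fExt c α β false (d false + j) n := by
  rw [Fpoly, SpectralData.coeff_laurentF]; rfl

theorem coeff_Gpoly (n j : ℤ) : (Gpoly c α β d n).coeff j =
    if 0 ≤ j then gExt c α β true (d true - j) n else gExt c α β false (d false + j) n := by
  rw [Gpoly, SpectralData.coeff_laurentG]; rfl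

theorem coeff_Hpoly (n j : ℤ) : (Hpoly c α β d n).coeff j =
    if 1 ≤ j then hExt c α β true (d true - j) n else hExt c α β false (d false - 1 + j) n := by
  rw [Hpoly, SpectralData.coeff_laurentH]; rfl

theorem coeff_Kpoly (n j : ℤ) : (Kpoly c α β d n).coeff j =
    if 1 ≤ j then gExt c α β true (d true - j) n else gExt c α β false (d false + j) n := by
  rw [Kpoly, SpectralData.coeff_laurentK]; rfl

theorem laurent_coeff_add (P Q : ℂ[T;T⁻¹]) (j : ℤ) : (P + Q).coeff j = P.coeff j + Q.coeff j := rfl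

theorem laurent_coeff_sub (P Q : ℂ[T;T⁻¹]) (j : ℤ) : (P - Q).coeff j = P.coeff j - Q.coeff j := rfl

theorem laurent_coeff_C (w : ℂ) (j : ℤ) :
    (LaurentPolynomial.C w : ℂ[T;T⁻¹]).coeff j = if j = 0 then w else 0 := by
  have := SpectralData.coeff_C_mul_laurent w j 1
  rw [mul_one] at this
  rw [this]
  have h1 : (1 : ℂ[T;T⁻¹]).coeff j = if j = 0 then 1 else 0 := by
    rw [AddMonoidAlgebra.one_def, AddMonoidAlgebra.coeff_single, Finsupp.single_apply]
    simp only [eq_comm]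
  rw [h1]
  split_ifs <;> simp

-- The diagonal entries of `U Ṽ - Ṽ⁺ U` vanish for arbitrary `α, β` and arbitrary constants:
-- coefficient by coefficient they are consequences of the recursions of the `+` half and of the `-`
-- half.
open SpectralData in
theorem lattice₁₁ (n : ℤ) :
    LaurentPolynomial.T 1 * (Gpoly c α β d (n - 1) - Gpoly c α β d n)
      + LaurentPolynomial.C (α n) * Hpoly c α β d (n - 1)
      + LaurentPolynomial.T 1 * (LaurentPolynomial.C (β n) * Fpoly c α β d n) = 0 := by
  ext j
  simp only [laurent_coeff_add, laurent_coeff_sub, coeff_T_mul, coeff_C_mul_laurent, coeff_Fpoly,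
    coeff_Gpoly, coeff_Hpoly]
  change _ = (0 : ℂ)
  rcases le_or_gt 1 j with h | h
  · simp only [if_pos h, if_pos (show 0 ≤ j - 1 by omega)]
    obtain ⟨-, h2, -⟩ := ext_plus_recursion c α β (d true - (j - 1)) n
    rw [show (d true : ℤ) - (j - 1) - 1 = d true - j by ring] at h2
    rw [show (d true : ℤ) - 1 - (j - 1) = d true - j by ring]
    linear_combination -h2
  · simp only [if_neg (show ¬ 1 ≤ j by omega), if_neg (show ¬ 0 ≤ j - 1 by omega)]
    obtain ⟨h1, h2, h3⟩ := ext_minus_recursion c α β (d false + (j - 1)) n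
    rw [show (d false : ℤ) - 1 + j = d false + (j - 1) by ring]
    linear_combination α n * h3 + β n * h1 - h2

open SpectralData in
theorem lattice₂₂ (n : ℤ) :
    Kpoly c α β d n - Kpoly c α β d (n - 1) - LaurentPolynomial.C (α n) * Hpoly c α β d n
      - LaurentPolynomial.T 1 * (LaurentPolynomial.C (β n) * Fpoly c α β d (n - 1)) = 0 := by
  ext j
  simp only [laurent_coeff_sub, coeff_T_mul, coeff_C_mul_laurent, coeff_Fpoly,
    coeff_Kpoly, coeff_Hpoly]
  change _ = (0 : ℂ)
  rcases le_or_gt 1 j with h | h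
  · simp only [if_pos h, if_pos (show 0 ≤ j - 1 by omega)]
    obtain ⟨h1, h2, h3⟩ := ext_plus_recursion c α β (d true - j) n
    rw [show (d true : ℤ) - 1 - (j - 1) = d true - j by ring]
    linear_combination h2 - α n * h3 - β n * h1
  · simp only [if_neg (show ¬ 1 ≤ j by omega), if_neg (show ¬ 0 ≤ j - 1 by omega)]
    obtain ⟨-, h2, -⟩ := ext_minus_recursion c α β (d false + j) n
    rw [show (d false : ℤ) - 1 + j = d false + j - 1 by ring,
      show (d false : ℤ) + (j - 1) = d false + j - 1 by ring]
    linear_combination h2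

-- Off the diagonal the recursions cancel every coefficient except the one where the two halves
-- meet, at `z⁰`. What is left there is the Ablowitz-Ladik expression.
open SpectralData in
theorem lattice₁₂ (n : ℤ) :
    Fpoly c α β d n - LaurentPolynomial.T 1 * Fpoly c α β d (n - 1)
      - LaurentPolynomial.C (α n) * (Gpoly c α β d n + Kpoly c α β d (n - 1))
      = LaurentPolynomial.C (sAL₁ c α β d n) := by
  ext j
  simp only [laurent_coeff_add, laurent_coeff_sub, coeff_T_mul, coeff_C_mul_laurent, coeff_Fpoly,
    coeff_Kpoly, coeff_Gpoly, laurent_coeff_C]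
  rcases lt_trichotomy j 0 with h | h | h
  · simp only [if_neg (show ¬ 0 ≤ j by omega), if_neg (show ¬ 1 ≤ j by omega),
      if_neg (show ¬ 0 ≤ j - 1 by omega), if_neg h.ne]
    obtain ⟨h1, -, -⟩ := ext_minus_recursion c α β (d false + j) n
    rw [show (d false : ℤ) + (j - 1) = d false + j - 1 by ring]
    linear_combination h1
  · subst h
    simp only [sAL₁, fExt, gExt, le_refl, if_true, sub_zero, add_zero, zero_sub,
      if_neg (show ¬ (0 : ℤ) ≤ -1 by omega), if_neg (show ¬ (1 : ℤ) ≤ 0 by omega), ext0_natCast]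
    rw [show (d false : ℤ) + -1 = d false - 1 by ring]
    ring
  · simp only [if_pos (show 0 ≤ j by omega), if_pos (show 1 ≤ j by omega),
      if_pos (show 0 ≤ j - 1 by omega), if_neg h.ne']
    obtain ⟨h1, -, -⟩ := ext_plus_recursion c α β (d true - j) n
    rw [show (d true : ℤ) - 1 - (j - 1) = d true - j by ring,
      show (d true : ℤ) - 1 - j = d true - j - 1 by ring]
    linear_combination -h1

open SpectralData in
theorem lattice₂₁ (n : ℤ) :
    LaurentPolynomial.T 1 * (LaurentPolynomial.C (β n)
        * (Gpoly c α β d (n - 1) + Kpoly c α β d n))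
      + Hpoly c α β d (n - 1) - LaurentPolynomial.T 1 * Hpoly c α β d n
      = LaurentPolynomial.T 1 * LaurentPolynomial.C (sAL₂ c α β d n) := by
  ext j
  simp only [laurent_coeff_add, laurent_coeff_sub, coeff_T_mul, coeff_C_mul_laurent, coeff_Hpoly,
    coeff_Kpoly, coeff_Gpoly, laurent_coeff_C]
  rcases lt_trichotomy j 1 with h | h | h
  · simp only [if_neg (show ¬ 0 ≤ j - 1 by omega), if_neg (show ¬ 1 ≤ j by omega),
      if_neg (show ¬ 1 ≤ j - 1 by omega), if_neg (show ¬ j - 1 = 0 by omega)]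
    obtain ⟨-, -, h3⟩ := ext_minus_recursion c α β (d false + (j - 1)) n
    rw [show (d false : ℤ) - 1 + (j - 1) = d false + (j - 1) - 1 by ring,
      show (d false : ℤ) - 1 + j = d false + (j - 1) by ring]
    linear_combination h3
  · subst h
    simp only [sAL₂, hExt, gExt, le_refl, if_true, sub_self, sub_zero, add_zero,
      if_neg (show ¬ (1 : ℤ) ≤ 0 by omega), ext0_natCast]
  · simp only [if_pos (show 0 ≤ j - 1 by omega), if_pos (show 1 ≤ j by omega),
      if_pos (show 1 ≤ j - 1 by omega), if_neg (show ¬ j - 1 = 0 by omega)]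
    obtain ⟨-, -, h3⟩ := ext_plus_recursion c α β (d true - (j - 1)) n
    rw [show (d true : ℤ) - (j - 1) - 1 = d true - j by ring] at h3
    linear_combination -h3

end Lattice

namespace SpectralData

variable {S : SpectralData}

/-! ### Stationary solutions are orbits -/

theorem summ_zero (s : Bool) : S.summ s 0 = S.c0 s := by
  have h := congrArg PowerSeries.constantCoeff (S.sqrtSeries_mul_invSqrtSeries s)
  rw [map_mul, S.constantCoeff_invSqrtSeries, mul_one, map_one] at h
  rw [summ, PowerSeries.coeff_zero_eq_constantCoeff_apply, h, mul_one]

theorem gCoef_summ_zero (α β : ℤ → ℂ) (s : Bool) (n : ℤ) :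
    gCoef S.summ α β s 0 n = S.c0 s / 2 := by
  rw [gCoef, conv_zero, summ_zero]
  cases s <;> simp [gHat, hatPlus_zero, div_eq_mul_inv]

theorem coeff_polyTriple_F {L : ℂ[T;T⁻¹] × ℂ[T;T⁻¹] × ℂ[T;T⁻¹]} {N : ℕ} (h : S.p < N) :
    (S.polyTriple L).F.coeff N = 0 := by
  rw [polyTriple, coeff_polyOf, if_neg (by omega)]

theorem coeff_polyTriple_G {L : ℂ[T;T⁻¹] × ℂ[T;T⁻¹] × ℂ[T;T⁻¹]} {N : ℕ} (h : S.p + 1 < N) :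
    (S.polyTriple L).G.coeff N = 0 := by
  rw [polyTriple, coeff_polyOf, if_neg (by omega)]

theorem coeff_polyTriple_H {L : ℂ[T;T⁻¹] × ℂ[T;T⁻¹] × ℂ[T;T⁻¹]} {N : ℕ} (h : S.p < N) :
    (S.polyTriple L).H.coeff N = 0 := by
  rw [polyTriple, coeff_polyOf, if_neg (by omega)]

theorem link_of_laurent {X Y : PolyTriple} {a b : ℂ}
    (h₁₁ : LaurentPolynomial.T 1 * ((S.laurentTriple X).2.1 - (S.laurentTriple Y).2.1)
      + LaurentPolynomial.C a * (S.laurentTriple X).2.2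
      + LaurentPolynomial.T 1 * (LaurentPolynomial.C b * (S.laurentTriple Y).1) = 0)
    (h₁₂ : (S.laurentTriple Y).1 - LaurentPolynomial.T 1 * (S.laurentTriple X).1
      - LaurentPolynomial.C a * ((S.laurentTriple Y).2.1 + (S.laurentTriple X).2.1) = 0)
    (h₂₁ : LaurentPolynomial.T 1 * (LaurentPolynomial.C b
        * ((S.laurentTriple X).2.1 + (S.laurentTriple Y).2.1))
      + (S.laurentTriple X).2.2 - LaurentPolynomial.T 1 * (S.laurentTriple Y).2.2 = 0)
    (h₂₂ : (S.laurentTriple Y).2.1 - (S.laurentTriple X).2.1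
      - LaurentPolynomial.C a * (S.laurentTriple Y).2.2
      - LaurentPolynomial.T 1 * (LaurentPolynomial.C b * (S.laurentTriple X).1) = 0) :
    PolyTriple.Link a b X Y := by
  have h1 : (LaurentPolynomial.T (1 - (S.deg false : ℤ)) : ℂ[T;T⁻¹])
      = LaurentPolynomial.T 1 * LaurentPolynomial.T (-(S.deg false : ℤ)) := by
    rw [← LaurentPolynomial.T_add]; rfl
  simp only [laurentTriple, h1] at h₁₁ h₁₂ h₂₁ h₂₂
  refine ⟨?_, ?_, ?_, ?_⟩ <;> apply Polynomial.toLaurent_injective <;>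
    rw [map_zero]
  · apply T_mul_left_cancel (k := 1)
    apply T_mul_left_cancel (k := -(S.deg false : ℤ))
    simp only [map_add, map_sub, map_mul, Polynomial.toLaurent_C]
    linear_combination h₁₁
  · apply T_mul_left_cancel (k := -(S.deg false : ℤ))
    simp only [map_add, map_sub, map_mul, Polynomial.toLaurent_C, Polynomial.toLaurent_X]
    linear_combination h₁₂
  · apply T_mul_left_cancel (k := 1)
    apply T_mul_left_cancel (k := -(S.deg false : ℤ))
    simp only [map_add, map_sub, map_mul, Polynomial.toLaurent_C, Polynomial.toLaurent_X]
    linear_combination h₂₁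
  · apply T_mul_left_cancel (k := -(S.deg false : ℤ))
    simp only [map_add, map_sub, map_neg, map_mul, Polynomial.toLaurent_C, Polynomial.toLaurent_X]
    linear_combination h₂₂

/-- A stationary solution generates an orbit of curve triples. -/
theorem IsStationarySolution.exists_isOrbit {α β : ℤ → ℂ} (h : S.IsStationarySolution α β) :
    ∃ X : ℤ → PolyTriple, S.IsOrbit α β X ∧ ∀ n, S.laurentTriple (X n)
      = (Fpoly S.summ α β S.deg n, Gpoly S.summ α β S.deg n, Hpoly S.summ α β S.deg n) := by
  have hd := S.deg_add_int
  set X : ℤ → PolyTriple := fun n => S.polyTriple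
    (Fpoly S.summ α β S.deg n, Gpoly S.summ α β S.deg n, Hpoly S.summ α β S.deg n) with hXdef
  have hL : ∀ n, S.laurentTriple (X n)
      = (Fpoly S.summ α β S.deg n, Gpoly S.summ α β S.deg n, Hpoly S.summ α β S.deg n) :=
    fun n => S.laurentTriple_polyTriple _ _ _
  -- The polynomials `G` and `K` differ only in the coefficient of `z⁰`, which is `g_{p₊,+}` in one
  -- and `g_{p₋,-}` in the other.
  have hK : ∀ n, Kpoly S.summ α β S.deg n = Gpoly S.summ α β S.deg n := by
    intro n
    ext j
    rw [coeff_Gpoly, coeff_Kpoly]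
    rcases lt_trichotomy j 0 with hj | hj | hj
    · rw [if_neg (by omega), if_neg (by omega)]
    · subst hj
      rw [if_neg (by omega), if_pos le_rfl, sub_zero, add_zero, gExt, gExt, ext0_natCast,
        ext0_natCast, h.gg]
    · rw [if_pos (by omega), if_pos (by omega)]
  refine ⟨X, ⟨fun n => ⟨fun N hN => coeff_polyTriple_F hN, fun N hN => coeff_polyTriple_G hN,
    fun N hN => coeff_polyTriple_H hN, ?_, ?_, ?_⟩, fun n => ?_⟩, hL⟩
  · rw [hXdef]
    simp only [polyTriple]
    rw [coeff_polyOf, if_pos le_rfl, coeff_Gpoly, if_pos (by push_cast; omega),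
      show (S.deg true : ℤ) - (-(S.deg false : ℤ) + ((S.p + 1 : ℕ) : ℤ)) = (0 : ℕ) by
        push_cast; omega, gExt, ext0_natCast, gCoef_summ_zero]
  · rw [hXdef]
    simp only [polyTriple]
    rw [coeff_polyOf, if_pos (by omega), coeff_Gpoly]
    -- If `p₋ = 0`, the bottom coefficient of `G` belongs to the `+` half, and its value `c_{0,-} /
    -- 2` comes from the condition `g_{p₊,+} = g_{p₋,-}`.
    rcases Nat.eq_zero_or_pos (S.deg false) with h0 | h0
    · have := h.gg n
      rw [h0, gCoef_summ_zero] at this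
      rw [if_pos (by rw [h0]; simp), show (S.deg true : ℤ) - (-(S.deg false : ℤ) + ((0 : ℕ) : ℤ))
        = (S.deg true : ℕ) by rw [h0]; simp, gExt, ext0_natCast, this]
    · rw [if_neg (by push_cast; omega), show (S.deg false : ℤ) + (-(S.deg false : ℤ)
        + ((0 : ℕ) : ℤ)) = (0 : ℕ) by push_cast; ring, gExt, ext0_natCast, gCoef_summ_zero]
  · apply curve_of_laurent
    rw [hL]
    exact h.curve n
  · apply link_of_laurent (S := S) <;> rw [hL, hL]
    · exact lattice₁₁ _ _ _ _ n
    · have := lattice₁₂ S.summ α β S.deg n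
      rwa [(h.sAL n).1, hK, map_zero] at this
    · have := lattice₂₁ S.summ α β S.deg n
      rwa [(h.sAL n).2, hK, map_zero, mul_zero] at this
    · have := lattice₂₂ S.summ α β S.deg n
      rwa [hK, hK] at this

/-- Orbits are determined by one triple. -/
theorem IsOrbit.eq_orbit {α β : ℤ → ℂ} {X : ℤ → PolyTriple} (h : S.IsOrbit α β X)
    (h1 : ∀ n, α n * β n ≠ 1) (n₀ n : ℤ) : X n = S.orbit (X n₀) n₀ n := by
  have h2 : ∀ n, 1 - α n * β n ≠ 0 := fun n e => h1 n (sub_eq_zero.1 e).symm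
  induction n using Int.inductionOn' (b := n₀) with
  | zero => rw [orbit_self]
  | succ k hk ih =>
    have hl := h.link (k + 1)
    rw [add_sub_cancel_right] at hl
    rw [orbit_add_one _ hk, ← ih, (h.triple k).up_eq_of_link (h.triple (k + 1)) hl (h2 _)]
  | pred k hk ih =>
    rw [orbit_sub_one _ hk, ← ih,
      (h.triple (k - 1)).down_eq_of_link (h.triple k) (h.link k) (h2 _)]

theorem IsOrbit.tripleAlpha_eq {α β : ℤ → ℂ} {X : ℤ → PolyTriple} (h : S.IsOrbit α β X) (n : ℤ) :
    S.tripleAlpha (X n) = α n ∧ S.tripleBeta (X n) = β n :=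
  ⟨((h.triple _).link_values (h.triple n) (h.link n)).1,
    ((h.triple _).link_values (h.triple n) (h.link n)).2.1⟩

end SpectralData

end AblowitzLadik

end

/-! ### The autonomous system as Lax equations for Laurent polynomials -/

noncomputable section

open Polynomial

namespace AblowitzLadik

/-! ### The autonomous system as a Lax equation for Laurent polynomials -/

section Flow

variable (φ γ : ℕ → ℂ) (gp fp gm fm : ℕ → ℂ) (rp rm : ℕ)

/-- The right-hand side of the autonomous system for `f`. -/
def flowF (ℓ : ℕ) : ℂ :=
  Complex.I * φ ℓ * (ext0 gp rp - ext0 gm rm)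
    + 2 * Complex.I * ∑ k ∈ Finset.range (ℓ + 1),
      (φ k * (ext0 gm ((rm : ℤ) - ℓ + k) - ext0 gp ((rp : ℤ) + ℓ - k))
        + γ k * (ext0 fp ((rp : ℤ) + ℓ - k) - ext0 fm ((rm : ℤ) - 1 - ℓ + k)))

/-- The right-hand side of the autonomous system for `g`. -/
def flowG (χ : ℕ → ℂ) (hp hm : ℕ → ℂ) (ℓ : ℕ) : ℂ :=
  Complex.I * ∑ k ∈ Finset.range ℓ,
    (φ k * (ext0 hm ((rm : ℤ) - ℓ + k) - ext0 hp ((rp : ℤ) - 1 + ℓ - k))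
      + χ k * (ext0 fp ((rp : ℤ) - 1 + ℓ - k) - ext0 fm ((rm : ℤ) - ℓ + k)))

/-- The coefficients of `F̃`, counted from one end. -/
def sideF (j : ℤ) : ℂ := if 0 ≤ j then ext0 fp ((rp : ℤ) - 1 - j) else ext0 fm ((rm : ℤ) + j)

/-- The coefficients of `G̃ + K̃`, counted from one end. -/
def sideGK (j : ℤ) : ℂ :=
  (if 0 ≤ j then ext0 gp ((rp : ℤ) - j) else ext0 gm ((rm : ℤ) + j))
    + if 1 ≤ j then ext0 gp ((rp : ℤ) - j) else ext0 gm ((rm : ℤ) + j)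

variable {φ γ gp fp gm fm rp rm}

theorem sum_ext0_eq {a b : ℕ → ℂ} {M : ℕ} (ha : ∀ k, M < k → a k = 0) (N : ℕ) :
    ∑ k ∈ Finset.range (M + 1), a k * ext0 b ((N : ℤ) - k) = conv b a N := by
  have h1 : ∑ k ∈ Finset.range (M + 1), a k * ext0 b ((N : ℤ) - k)
      = ∑ k ∈ Finset.range (M + N + 1), a k * ext0 b ((N : ℤ) - k) := by
    refine Finset.sum_subset (Finset.range_mono (by omega)) fun k _ hk => ?_
    rw [ha k (by simpa using hk), zero_mul]
  have h2 : ∑ k ∈ Finset.range (N + 1), a k * ext0 b ((N : ℤ) - k)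
      = ∑ k ∈ Finset.range (M + N + 1), a k * ext0 b ((N : ℤ) - k) := by
    refine Finset.sum_subset (Finset.range_mono (by omega)) fun k _ hk => ?_
    have : N + 1 ≤ k := by simpa using hk
    rw [ext0_of_neg _ (by omega), mul_zero]
  rw [h1, ← h2, conv]
  refine Finset.sum_congr rfl fun k hk => ?_
  have : k ≤ N := Nat.lt_succ_iff.1 (Finset.mem_range.1 hk)
  rw [← Nat.cast_sub this, ext0_natCast, mul_comm]

/-- This identity expresses `g̃ F - f̃ G = 0` coefficientwise. It trades the terms with `k ≤ ℓ` of a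
convolution for those with `k > ℓ`. -/
theorem sum_ext0_sub_eq_zero {a b a' b' : ℕ → ℂ} {M : ℕ} (ha : ∀ k, M < k → a k = 0)
    (ha' : ∀ k, M < k → a' k = 0) (h : ∀ N, conv b a N = conv b' a' N) (N : ℤ) :
    ∑ k ∈ Finset.range (M + 1), (a k * ext0 b (N - k) - a' k * ext0 b' (N - k)) = 0 := by
  rcases lt_or_ge N 0 with hN | hN
  · refine Finset.sum_eq_zero fun k _ => ?_
    rw [ext0_of_neg _ (by omega), ext0_of_neg _ (by omega)]
    ring
  · obtain ⟨n, rfl⟩ := Int.eq_ofNat_of_zero_le hN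
    rw [Finset.sum_sub_distrib, sum_ext0_eq ha, sum_ext0_eq ha', h, sub_self]

/-- The coefficient of the full product has terms for all `k`, the system only those with `k ≤ ℓ`.
Their difference is `2i` times the vanishing convolution `h0`, compared term by term. At `k = ℓ` the
side coefficient is `g̃_{r±,±} + g̃_{r∓,∓}`, which produces the separate term in front of the sum.
-/
theorem flowF_eq {M : ℕ} (hφ : ∀ k, M < k → φ k = 0) (hγ : ∀ k, M < k → γ k = 0)
    (h : ∀ N, conv gp φ N = conv fp γ N) {ℓ : ℕ} (hℓ : ℓ ≤ M) :
    Complex.I * ∑ k ∈ Finset.range (M + 1), φ k * sideGK gp gm rp rm ((k : ℤ) - ℓ)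
      - 2 * Complex.I * ∑ k ∈ Finset.range (M + 1), γ k * sideF fp fm rp rm ((k : ℤ) - ℓ - 1)
      = flowF φ γ gp fp gm fm rp rm ℓ := by
  have h0 := sum_ext0_sub_eq_zero hφ hγ h ((rp : ℤ) + ℓ)
  have h1 : ∑ k ∈ Finset.range (ℓ + 1),
      (φ k * (ext0 gm ((rm : ℤ) - ℓ + k) - ext0 gp ((rp : ℤ) + ℓ - k))
        + γ k * (ext0 fp ((rp : ℤ) + ℓ - k) - ext0 fm ((rm : ℤ) - 1 - ℓ + k)))
      = ∑ k ∈ Finset.range (M + 1), if k ≤ ℓ then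
        (φ k * (ext0 gm ((rm : ℤ) - ℓ + k) - ext0 gp ((rp : ℤ) + ℓ - k))
        + γ k * (ext0 fp ((rp : ℤ) + ℓ - k) - ext0 fm ((rm : ℤ) - 1 - ℓ + k))) else 0 := by
    rw [← Finset.sum_filter]
    congr 1
    ext k
    simp only [Finset.mem_range, Finset.mem_filter]
    omega
  have h2 : φ ℓ * (ext0 gp rp - ext0 gm rm) = ∑ k ∈ Finset.range (M + 1),
      if k = ℓ then φ k * (ext0 gp rp - ext0 gm rm) else 0 := by
    rw [Finset.sum_ite_eq' , if_pos (Finset.mem_range.2 (by omega))]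
  rw [flowF, h1, mul_assoc Complex.I (φ ℓ), h2, ← sub_eq_zero]
  refine Eq.trans ?_ ((congrArg (2 * Complex.I * ·) h0).trans (mul_zero _))
  simp only [Finset.mul_sum, ← Finset.sum_sub_distrib, ← Finset.sum_add_distrib]
  refine Finset.sum_congr rfl fun k _ => ?_
  unfold sideGK sideF
  rcases lt_trichotomy k ℓ with hk | hk | hk
  · rw [if_neg (by omega), if_neg (by omega), if_neg (by omega), if_neg (by omega),
      if_pos (by omega), show (rm : ℤ) - ℓ + k = rm + (k - ℓ) by ring,
      show (rm : ℤ) - 1 - ℓ + k = rm + (k - ℓ - 1) by ring]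
    ring
  · subst hk
    rw [if_pos (by omega), if_neg (by omega), if_neg (by omega), if_pos rfl,
      if_pos le_rfl, show (rm : ℤ) - 1 - k + k = rm + (k - k - 1) by ring]
    simp only [sub_self, sub_zero, add_zero, sub_add_cancel, add_sub_cancel_right]
    ring
  · rw [if_pos (by omega), if_pos (by omega), if_pos (by omega), if_neg (by omega),
      if_neg (by omega), show (rp : ℤ) - (k - ℓ) = rp + ℓ - k by ring,
      show (rp : ℤ) - 1 - (k - ℓ - 1) = rp + ℓ - k by ring]
    ring

/-- Beyond the range only one half of the tilde coefficients is met, and the whole coefficient is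
the vanishing convolution. So the Lax right-hand side has the same support as `F`. -/
theorem flowF_of_neg {M : ℕ} (hφ : ∀ k, M < k → φ k = 0) (hγ : ∀ k, M < k → γ k = 0)
    (h : ∀ N, conv gp φ N = conv fp γ N) {ℓ : ℤ} (hℓ : ℓ < 0) :
    Complex.I * ∑ k ∈ Finset.range (M + 1), φ k * sideGK gp gm rp rm ((k : ℤ) - ℓ)
      - 2 * Complex.I * ∑ k ∈ Finset.range (M + 1), γ k * sideF fp fm rp rm ((k : ℤ) - ℓ - 1)
      = 0 := by
  have h0 := sum_ext0_sub_eq_zero hφ hγ h ((rp : ℤ) + ℓ)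
  rw [← mul_zero (2 * Complex.I), ← h0]
  simp only [Finset.mul_sum, ← Finset.sum_sub_distrib]
  refine Finset.sum_congr rfl fun k _ => ?_
  unfold sideGK sideF
  rw [if_pos (by omega), if_pos (by omega), if_pos (by omega),
    show (rp : ℤ) - (k - ℓ) = rp + ℓ - k by ring,
    show (rp : ℤ) - 1 - (k - ℓ - 1) = rp + ℓ - k by ring]
  ring

theorem flowG_eq {χ hp hm : ℕ → ℂ} {M : ℕ} (hφ : ∀ k, M < k → φ k = 0)
    (hχ : ∀ k, M < k → χ k = 0) (h : ∀ N, conv hp φ N = conv fp χ N) {ℓ : ℕ} (hℓ : ℓ ≤ M) :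
    Complex.I * (∑ k ∈ Finset.range (M + 1), φ k * sideF hp hm rp rm ((k : ℤ) - ℓ)
      - ∑ k ∈ Finset.range (M + 1), χ k * sideF fp fm rp rm ((k : ℤ) - ℓ))
      = flowG φ fp fm rp rm χ hp hm ℓ := by
  have h0 := sum_ext0_sub_eq_zero hφ hχ h ((rp : ℤ) - 1 + ℓ)
  have h1 : ∑ k ∈ Finset.range ℓ,
      (φ k * (ext0 hm ((rm : ℤ) - ℓ + k) - ext0 hp ((rp : ℤ) - 1 + ℓ - k))
        + χ k * (ext0 fp ((rp : ℤ) - 1 + ℓ - k) - ext0 fm ((rm : ℤ) - ℓ + k)))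
      = ∑ k ∈ Finset.range (M + 1), if k < ℓ then
        (φ k * (ext0 hm ((rm : ℤ) - ℓ + k) - ext0 hp ((rp : ℤ) - 1 + ℓ - k))
        + χ k * (ext0 fp ((rp : ℤ) - 1 + ℓ - k) - ext0 fm ((rm : ℤ) - ℓ + k))) else 0 := by
    rw [← Finset.sum_filter]
    congr 1
    ext k
    simp only [Finset.mem_range, Finset.mem_filter]
    omega
  rw [flowG, h1]
  congr 1
  rw [← sub_eq_zero]
  refine Eq.trans ?_ h0
  simp only [← Finset.sum_sub_distrib]
  refine Finset.sum_congr rfl fun k _ => ?_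
  unfold sideF
  rcases lt_or_ge k ℓ with hk | hk
  · rw [if_neg (by omega), if_neg (by omega), if_pos hk,
      show (rm : ℤ) - ℓ + k = rm + (k - ℓ) by ring]
    ring
  · rw [if_pos (by omega), if_pos (by omega), if_neg (by omega),
      show (rp : ℤ) - 1 - (k - ℓ) = rp - 1 + ℓ - k by ring]
    ring

theorem flowG_of_neg {χ hp hm : ℕ → ℂ} {M : ℕ} (hφ : ∀ k, M < k → φ k = 0)
    (hχ : ∀ k, M < k → χ k = 0) (h : ∀ N, conv hp φ N = conv fp χ N) {ℓ : ℤ} (hℓ : ℓ < 0) :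
    Complex.I * (∑ k ∈ Finset.range (M + 1), φ k * sideF hp hm rp rm ((k : ℤ) - ℓ)
      - ∑ k ∈ Finset.range (M + 1), χ k * sideF fp fm rp rm ((k : ℤ) - ℓ)) = 0 := by
  have h0 := sum_ext0_sub_eq_zero hφ hχ h ((rp : ℤ) - 1 + ℓ)
  rw [← mul_zero Complex.I, ← h0]
  simp only [← Finset.sum_sub_distrib]
  congr 1
  refine Finset.sum_congr rfl fun k _ => ?_
  unfold sideF
  rw [if_pos (by omega), if_pos (by omega),
    show (rp : ℤ) - 1 - (k - ℓ) = rp - 1 + ℓ - k by ring]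

theorem flowF_congr {φ' γ' : ℕ → ℂ} {ℓ : ℕ} (hφ : ∀ k ≤ ℓ, φ k = φ' k)
    (hγ : ∀ k ≤ ℓ, γ k = γ' k) :
    flowF φ γ gp fp gm fm rp rm ℓ = flowF φ' γ' gp fp gm fm rp rm ℓ := by
  unfold flowF
  rw [hφ ℓ le_rfl]
  congr 2
  refine Finset.sum_congr rfl fun k hk => ?_
  have : k ≤ ℓ := Nat.lt_succ_iff.1 (Finset.mem_range.1 hk)
  rw [hφ k this, hγ k this]

theorem flowG_congr {φ' χ χ' hp hm : ℕ → ℂ} {ℓ : ℕ} (hφ : ∀ k < ℓ, φ k = φ' k)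
    (hχ : ∀ k < ℓ, χ k = χ' k) :
    flowG φ fp fm rp rm χ hp hm ℓ = flowG φ' fp fm rp rm χ' hp hm ℓ := by
  unfold flowG
  congr 1
  refine Finset.sum_congr rfl fun k hk => ?_
  rw [hφ k (Finset.mem_range.1 hk), hχ k (Finset.mem_range.1 hk)]

end Flow

namespace SpectralData

variable (S : SpectralData)

theorem eq_sum_top {A : ℂ[T;T⁻¹]} {top : ℤ} {M : ℕ} (h : ∀ j, (j < top - M ∨ top < j) → A.coeff j = 0) :
    A = ∑ k ∈ Finset.range (M + 1),
      LaurentPolynomial.C (A.coeff (top - k)) * LaurentPolynomial.T (top - k) := by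
  have hs : ∀ s : Finset ℕ, ∀ j, (∑ k ∈ s,
      LaurentPolynomial.C (A.coeff (top - k)) * LaurentPolynomial.T (top - k) : ℂ[T;T⁻¹]).coeff j
      = ∑ k ∈ s, A.coeff (top - k) * if j = top - k then 1 else 0 := by
    intro s j
    induction s using Finset.cons_induction with
    | empty => rfl
    | cons k s hk ih =>
      rw [Finset.sum_cons, Finset.sum_cons, laurent_coeff_add, ih, coeff_C_mul_laurent]
      congr 2
      have := coeff_T_mul (top - k) j 1
      rw [mul_one] at this
      have h1 := laurent_coeff_C 1 (j - (top - k))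
      rw [map_one] at h1
      rw [this, h1]
      simp only [sub_eq_zero]
  ext j
  rw [hs]
  by_cases hj : j < top - M ∨ top < j
  · rw [h j hj, Finset.sum_eq_zero]
    intro k hk
    have := Finset.mem_range.1 hk
    rw [if_neg (by omega), mul_zero]
  · obtain ⟨k, rfl⟩ : ∃ k : ℕ, j = top - k := ⟨(top - j).toNat, by omega⟩
    rw [Finset.sum_eq_single k]
    · rw [if_pos rfl, mul_one]
    · intro k' _ hk'
      rw [if_neg (by omega), mul_zero]
    · intro hk
      exact absurd (Finset.mem_range.2 (by omega)) hk

theorem laurent_coeff_sum {ι : Type*} (s : Finset ι) (A : ι → ℂ[T;T⁻¹]) (j : ℤ) :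
    (∑ k ∈ s, A k).coeff j = ∑ k ∈ s, (A k).coeff j := by
  induction s using Finset.cons_induction with
  | empty => rfl
  | cons k s hk ih => rw [Finset.sum_cons, Finset.sum_cons, laurent_coeff_add, ih]

theorem coeff_mul_top {A : ℂ[T;T⁻¹]} {top : ℤ} {M : ℕ}
    (h : ∀ j, (j < top - M ∨ top < j) → A.coeff j = 0) (B : ℂ[T;T⁻¹]) (j : ℤ) :
    (A * B).coeff j = ∑ k ∈ Finset.range (M + 1), A.coeff (top - k) * B.coeff (j - top + k) := by
  conv_lhs => rw [eq_sum_top h, Finset.sum_mul]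
  rw [laurent_coeff_sum]
  refine Finset.sum_congr rfl fun k _ => ?_
  rw [mul_assoc, coeff_C_mul_laurent, coeff_T_mul]
  congr 2
  ring

theorem coeff_mul_bot {A : ℂ[T;T⁻¹]} {bot : ℤ} {M : ℕ}
    (h : ∀ j, (j < bot ∨ bot + M < j) → A.coeff j = 0) (B : ℂ[T;T⁻¹]) (j : ℤ) :
    (A * B).coeff j = ∑ k ∈ Finset.range (M + 1), A.coeff (bot + k) * B.coeff (j - bot - k) := by
  rw [coeff_mul_top (top := bot + M) (M := M) (fun j hj => h j (by omega)),
    ← Finset.sum_range_reflect]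
  refine Finset.sum_congr rfl fun k hk => ?_
  have : k ≤ M := Nat.lt_succ_iff.1 (Finset.mem_range.1 hk)
  have e : ((M + 1 - 1 - k : ℕ) : ℤ) = M - k := by omega
  rw [e]
  congr 2 <;> ring

/-- Three Laurent polynomials with the supports of `F, G, H`. -/
structure InRange (F G H : ℂ[T;T⁻¹]) : Prop where
  F : ∀ j, (j < -(S.deg false : ℤ) ∨ (S.deg true : ℤ) - 1 < j) → F.coeff j = 0
  G : ∀ j, (j < -(S.deg false : ℤ) ∨ (S.deg true : ℤ) < j) → G.coeff j = 0
  H : ∀ j, (j < 1 - (S.deg false : ℤ) ∨ (S.deg true : ℤ) < j) → H.coeff j = 0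

theorem inRange_laurent (f g h : Bool → ℕ → ℂ) :
    S.InRange (laurentF S.deg f) (laurentG S.deg g) (laurentH S.deg h) := by
  refine ⟨fun j hj => ?_, fun j hj => ?_, fun j hj => ?_⟩
  · rw [coeff_laurentF]; unfold ext0
    split_ifs <;> first | rfl | (exfalso; omega)
  · rw [coeff_laurentG]; unfold ext0
    split_ifs <;> first | rfl | (exfalso; omega)
  · rw [coeff_laurentH]; unfold ext0
    split_ifs <;> first | rfl | (exfalso; omega)

/-- The coefficients of `F`, counted from one end. -/
def seqF (F : ℂ[T;T⁻¹]) (s : Bool) (k : ℕ) : ℂ :=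
  if s then F.coeff ((S.deg true : ℤ) - 1 - k) else F.coeff (-(S.deg false : ℤ) + k)

/-- The coefficients of `G`, counted from one end. -/
def seqG (G : ℂ[T;T⁻¹]) (s : Bool) (k : ℕ) : ℂ :=
  if s then G.coeff ((S.deg true : ℤ) - k) else G.coeff (-(S.deg false : ℤ) + k)

/-- The coefficients of `H`, counted from one end. -/
def seqH (H : ℂ[T;T⁻¹]) (s : Bool) (k : ℕ) : ℂ :=
  if s then H.coeff ((S.deg true : ℤ) - k) else H.coeff (-(S.deg false : ℤ) + 1 + k)

variable (r : Bool → ℕ) (ct : Bool → ℕ → ℂ)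

/-- The coefficients `f̃` of a state. -/
def seqFt (F : ℂ[T;T⁻¹]) (s : Bool) : ℕ → ℂ := conv (ct s) (S.fHatOf F s)

/-- The coefficients `g̃` of a state. -/
def seqGt (G : ℂ[T;T⁻¹]) (s : Bool) : ℕ → ℂ := conv (ct s) (S.gHatOf G s)

/-- The coefficients `h̃` of a state. -/
def seqHt (H : ℂ[T;T⁻¹]) (s : Bool) : ℕ → ℂ := conv (ct s) (S.hHatOf H s)

/-- The right-hand side of the Lax equation for `F`. -/
def laxF (F G : ℂ[T;T⁻¹]) : ℂ[T;T⁻¹] :=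
  LaurentPolynomial.C Complex.I
      * (F * (laurentG r (S.seqGt ct G) + laurentK r (S.seqGt ct G)))
    - LaurentPolynomial.C (2 * Complex.I) * (G * laurentF r (S.seqFt ct F))

/-- The right-hand side of the Lax equation for `G`. -/
def laxG (F H : ℂ[T;T⁻¹]) : ℂ[T;T⁻¹] :=
  LaurentPolynomial.C Complex.I
    * (F * laurentH r (S.seqHt ct H) - H * laurentF r (S.seqFt ct F))

/-- The right-hand side of the Lax equation for `H`. -/
def laxH (G H : ℂ[T;T⁻¹]) : ℂ[T;T⁻¹] :=
  -(LaurentPolynomial.C Complex.I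
      * (H * (laurentG r (S.seqGt ct G) + laurentK r (S.seqGt ct G)))
    - LaurentPolynomial.C (2 * Complex.I) * (G * laurentH r (S.seqHt ct H)))

/-- All tilde sequences arise from the coefficient sequences by multiplication with one and the same
series, so the products with the untransformed sequences commute. -/
theorem conv_conv_comm (c i a b : ℕ → ℂ) (w : ℂ) (N : ℕ) :
    conv (conv c (fun ℓ => w * conv i a ℓ)) b N = conv (conv c (fun ℓ => w * conv i b ℓ)) a N := by
  have h : ∀ a, PowerSeries.mk (conv c (fun ℓ => w * conv i a ℓ))
      = PowerSeries.mk c * (PowerSeries.C w * (PowerSeries.mk i * PowerSeries.mk a)) := by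
    intro a
    rw [mk_conv]
    congr 1
    ext k
    rw [PowerSeries.coeff_mk, PowerSeries.coeff_C_mul, ← conv_eq_coeff]
  rw [conv_eq_coeff, conv_eq_coeff, h, h]
  congr 1
  ring

theorem conv_seq_FG (F G : ℂ[T;T⁻¹]) (s : Bool) (N : ℕ) :
    conv (S.seqGt ct G s) (S.seqF F s) N = conv (S.seqFt ct F s) (S.seqG G s) N :=
  conv_conv_comm _ _ _ _ _ _

theorem conv_seq_HG (G H : ℂ[T;T⁻¹]) (s : Bool) (N : ℕ) :
    conv (S.seqGt ct G s) (S.seqH H s) N = conv (S.seqHt ct H s) (S.seqG G s) N :=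
  conv_conv_comm _ _ _ _ _ _

theorem conv_seq_FH (F H : ℂ[T;T⁻¹]) (s : Bool) (N : ℕ) :
    conv (S.seqHt ct H s) (S.seqF F s) N = conv (S.seqFt ct F s) (S.seqH H s) N :=
  conv_conv_comm _ _ _ _ _ _

variable {S}

theorem InRange.seqF_eq_zero {F G H : ℂ[T;T⁻¹]} (hR : S.InRange F G H) (s : Bool) {k : ℕ}
    (hk : S.p < k) : S.seqF F s k = 0 := by
  have hd := S.deg_add_int
  unfold seqF
  cases s
  · exact hR.F _ (Or.inr (by omega))
  · exact hR.F _ (Or.inl (by omega))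

theorem InRange.seqG_eq_zero {F G H : ℂ[T;T⁻¹]} (hR : S.InRange F G H) (s : Bool) {k : ℕ}
    (hk : S.p + 1 < k) : S.seqG G s k = 0 := by
  have hd := S.deg_add_int
  unfold seqG
  cases s
  · exact hR.G _ (Or.inr (by omega))
  · exact hR.G _ (Or.inl (by omega))

theorem InRange.seqH_eq_zero {F G H : ℂ[T;T⁻¹]} (hR : S.InRange F G H) (s : Bool) {k : ℕ}
    (hk : S.p < k) : S.seqH H s k = 0 := by
  have hd := S.deg_add_int
  unfold seqH
  cases s
  · exact hR.H _ (Or.inr (by omega))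
  · exact hR.H _ (Or.inl (by omega))

/-- The product with `F`, with coefficients counted from one end. -/
theorem InRange.coeff_F_mul {F G H : ℂ[T;T⁻¹]} (hR : S.InRange F G H) (s : Bool) (B : ℂ[T;T⁻¹])
    {M : ℕ} (hM : S.p ≤ M) (j : ℤ) :
    (F * B).coeff j = ∑ k ∈ Finset.range (M + 1), S.seqF F s k *
      B.coeff (if s then j - (S.deg true - 1) + k else j + S.deg false - k) := by
  have hd := S.deg_add_int
  cases s
  · rw [coeff_mul_bot (bot := -(S.deg false : ℤ)) (M := M) (fun j hj => hR.F j (by omega))]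
    refine Finset.sum_congr rfl fun k _ => ?_
    simp only [seqF, Bool.false_eq_true, if_false, sub_neg_eq_add]
  · rw [coeff_mul_top (top := (S.deg true : ℤ) - 1) (M := M) (fun j hj => hR.F j (by omega))]
    refine Finset.sum_congr rfl fun k _ => ?_
    simp only [seqF, if_true]

/-- The product with `G`, with coefficients counted from one end. -/
theorem InRange.coeff_G_mul {F G H : ℂ[T;T⁻¹]} (hR : S.InRange F G H) (s : Bool) (B : ℂ[T;T⁻¹])
    {M : ℕ} (hM : S.p + 1 ≤ M) (j : ℤ) :
    (G * B).coeff j = ∑ k ∈ Finset.range (M + 1), S.seqG G s k *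
      B.coeff (if s then j - S.deg true + k else j + S.deg false - k) := by
  have hd := S.deg_add_int
  cases s
  · rw [coeff_mul_bot (bot := -(S.deg false : ℤ)) (M := M) (fun j hj => hR.G j (by omega))]
    refine Finset.sum_congr rfl fun k _ => ?_
    simp only [seqG, Bool.false_eq_true, if_false, sub_neg_eq_add]
  · rw [coeff_mul_top (top := (S.deg true : ℤ)) (M := M) (fun j hj => hR.G j (by omega))]
    refine Finset.sum_congr rfl fun k _ => ?_
    simp only [seqG, if_true]

/-- The product with `H`, with coefficients counted from one end. -/
theorem InRange.coeff_H_mul {F G H : ℂ[T;T⁻¹]} (hR : S.InRange F G H) (s : Bool) (B : ℂ[T;T⁻¹])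
    {M : ℕ} (hM : S.p ≤ M) (j : ℤ) :
    (H * B).coeff j = ∑ k ∈ Finset.range (M + 1), S.seqH H s k *
      B.coeff (if s then j - S.deg true + k else j + S.deg false - 1 - k) := by
  have hd := S.deg_add_int
  cases s
  · rw [coeff_mul_bot (bot := -(S.deg false : ℤ) + 1) (M := M) (fun j hj => hR.H j (by omega))]
    refine Finset.sum_congr rfl fun k _ => ?_
    simp only [seqH, Bool.false_eq_true, if_false]
    congr 2
    ring
  · rw [coeff_mul_top (top := (S.deg true : ℤ)) (M := M) (fun j hj => hR.H j (by omega))]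
    refine Finset.sum_congr rfl fun k _ => ?_
    simp only [seqH, if_true]

/-- Counting exponents from the other end exchanges the two halves. With `s` and `!s` one formula
serves both signs. -/
theorem coeff_laurentF_side (a : Bool → ℕ → ℂ) (s : Bool) (j : ℤ) :
    (laurentF r a).coeff (if s then j else -j - 1)
      = sideF (a s) (a !s) (r s) (r !s) j := by
  rw [coeff_laurentF]
  unfold sideF
  cases s
  · simp only [Bool.false_eq_true, if_false, Bool.not_false]
    rcases le_or_gt 0 j with h | h
    · rw [if_neg (by omega), if_pos h]; congr 1; ring
    · rw [if_pos (by omega), if_neg (by omega)]; congr 1; ring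
  · rfl

theorem coeff_laurentH_side (a : Bool → ℕ → ℂ) (s : Bool) (j : ℤ) :
    (laurentH r a).coeff (if s then j + 1 else -j)
      = sideF (a s) (a !s) (r s) (r !s) j := by
  rw [coeff_laurentH]
  unfold sideF
  cases s
  · simp only [Bool.false_eq_true, if_false, Bool.not_false]
    rcases le_or_gt 0 j with h | h
    · rw [if_neg (by omega), if_pos h]; congr 1
    · rw [if_pos (by omega), if_neg (by omega)]; congr 1; ring
  · simp only [if_true, Bool.not_true]
    rcases le_or_gt 0 j with h | h
    · rw [if_pos (by omega), if_pos h]; congr 1; ring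
    · rw [if_neg (by omega), if_neg (by omega)]; congr 1; ring

theorem coeff_laurentGK_side (a : Bool → ℕ → ℂ) (s : Bool) (j : ℤ) :
    (laurentG r a + laurentK r a).coeff (if s then j else -j)
      = sideGK (a s) (a !s) (r s) (r !s) j := by
  rw [laurent_coeff_add, coeff_laurentG, coeff_laurentK]
  unfold sideGK
  cases s
  · simp only [Bool.false_eq_true, if_false, Bool.not_false]
    rcases lt_trichotomy j 0 with h | h | h
    · rw [if_pos (by omega), if_pos (by omega), if_neg (by omega), if_neg (by omega)]
      congr 2 <;> ring
    · subst h
      rw [if_pos (by omega), if_neg (by omega), if_pos (by omega), if_neg (by omega), add_comm]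
      congr 2
    · rw [if_neg (by omega), if_neg (by omega), if_pos (by omega), if_pos (by omega)]
      congr 2
  · rfl

/-- The position of the `ℓ`-th coefficient of `F`. -/
def posF (S : SpectralData) (s : Bool) (ℓ : ℤ) : ℤ :=
  if s then (S.deg true : ℤ) - 1 - ℓ else -(S.deg false : ℤ) + ℓ

/-- The position of the `ℓ`-th coefficient of `G`. -/
def posG (S : SpectralData) (s : Bool) (ℓ : ℤ) : ℤ :=
  if s then (S.deg true : ℤ) - ℓ else -(S.deg false : ℤ) + ℓ

/-- The position of the `ℓ`-th coefficient of `H`. -/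
def posH (S : SpectralData) (s : Bool) (ℓ : ℤ) : ℤ :=
  if s then (S.deg true : ℤ) - ℓ else -(S.deg false : ℤ) + 1 + ℓ

theorem InRange.coeff_laxF_side {F G H : ℂ[T;T⁻¹]} (hR : S.InRange F G H) (s : Bool) (ℓ : ℤ)
    {M : ℕ} (hM : S.p + 1 ≤ M) :
    (S.laxF r ct F G).coeff (S.posF s ℓ)
      = Complex.I * ∑ k ∈ Finset.range (M + 1), S.seqF F s k
          * sideGK (S.seqGt ct G s) (S.seqGt ct G !s) (r s) (r !s) ((k : ℤ) - ℓ)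
        - 2 * Complex.I * ∑ k ∈ Finset.range (M + 1), S.seqG G s k
          * sideF (S.seqFt ct F s) (S.seqFt ct F !s) (r s) (r !s) ((k : ℤ) - ℓ - 1) := by
  rw [laxF, laurent_coeff_sub, coeff_C_mul_laurent, coeff_C_mul_laurent,
    hR.coeff_F_mul s _ (by omega : S.p ≤ M), hR.coeff_G_mul s _ hM]
  congr 2
  · refine Finset.sum_congr rfl fun k _ => ?_
    rw [← coeff_laurentGK_side]
    congr 2
    unfold posF
    cases s
    · simp only [Bool.false_eq_true, if_false]; ring
    · simp only [if_true]; ring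
  · refine Finset.sum_congr rfl fun k _ => ?_
    rw [← coeff_laurentF_side]
    congr 2
    unfold posF
    cases s
    · simp only [Bool.false_eq_true, if_false]; ring
    · simp only [if_true]; ring

theorem InRange.coeff_laxH_side {F G H : ℂ[T;T⁻¹]} (hR : S.InRange F G H) (s : Bool) (ℓ : ℤ)
    {M : ℕ} (hM : S.p + 1 ≤ M) :
    (S.laxH r ct G H).coeff (S.posH s ℓ)
      = -(Complex.I * ∑ k ∈ Finset.range (M + 1), S.seqH H s k
          * sideGK (S.seqGt ct G s) (S.seqGt ct G !s) (r s) (r !s) ((k : ℤ) - ℓ)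
        - 2 * Complex.I * ∑ k ∈ Finset.range (M + 1), S.seqG G s k
          * sideF (S.seqHt ct H s) (S.seqHt ct H !s) (r s) (r !s) ((k : ℤ) - ℓ - 1)) := by
  have hneg : ∀ (P : ℂ[T;T⁻¹]) (j : ℤ), (-P).coeff j = -P.coeff j := fun _ _ => rfl
  rw [laxH, hneg, laurent_coeff_sub, coeff_C_mul_laurent, coeff_C_mul_laurent,
    hR.coeff_H_mul s _ (by omega : S.p ≤ M), hR.coeff_G_mul s _ hM]
  congr 3
  · refine Finset.sum_congr rfl fun k _ => ?_
    rw [← coeff_laurentGK_side]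
    congr 2
    unfold posH
    cases s
    · simp only [Bool.false_eq_true, if_false]; ring
    · simp only [if_true]; ring
  · refine Finset.sum_congr rfl fun k _ => ?_
    rw [← coeff_laurentH_side]
    congr 2
    unfold posH
    cases s
    · simp only [Bool.false_eq_true, if_false]; ring
    · simp only [if_true]; ring

theorem InRange.coeff_laxG_side {F G H : ℂ[T;T⁻¹]} (hR : S.InRange F G H) (s : Bool) (ℓ : ℤ)
    {M : ℕ} (hM : S.p + 1 ≤ M) :
    (S.laxG r ct F H).coeff (S.posG s ℓ)
      = Complex.I * (∑ k ∈ Finset.range (M + 1), S.seqF F s k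
          * sideF (S.seqHt ct H s) (S.seqHt ct H !s) (r s) (r !s) ((k : ℤ) - ℓ)
        - ∑ k ∈ Finset.range (M + 1), S.seqH H s k
          * sideF (S.seqFt ct F s) (S.seqFt ct F !s) (r s) (r !s) ((k : ℤ) - ℓ)) := by
  rw [laxG, coeff_C_mul_laurent, laurent_coeff_sub,
    hR.coeff_F_mul s _ (by omega : S.p ≤ M), hR.coeff_H_mul s _ (by omega : S.p ≤ M)]
  congr 2
  · refine Finset.sum_congr rfl fun k _ => ?_
    rw [← coeff_laurentH_side]
    congr 2
    unfold posG
    cases s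
    · simp only [Bool.false_eq_true, if_false]; ring
    · simp only [if_true]; ring
  · refine Finset.sum_congr rfl fun k _ => ?_
    rw [← coeff_laurentF_side]
    congr 2
    unfold posG
    cases s
    · simp only [Bool.false_eq_true, if_false]; ring
    · simp only [if_true]; ring

variable {r ct}

theorem InRange.coeff_laxF {F G H : ℂ[T;T⁻¹]} (hR : S.InRange F G H) (s : Bool) (ℓ : ℕ) :
    (S.laxF r ct F G).coeff (S.posF s ℓ)
      = flowF (S.seqF F s) (S.seqG G s) (S.seqGt ct G s) (S.seqFt ct F s) (S.seqGt ct G !s)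
          (S.seqFt ct F !s) (r s) (r !s) ℓ := by
  rw [hR.coeff_laxF_side r ct s ℓ (M := S.p + 1 + ℓ) (by omega)]
  exact flowF_eq (fun k hk => hR.seqF_eq_zero s (by omega))
    (fun k hk => hR.seqG_eq_zero s (by omega)) (S.conv_seq_FG ct F G s) (by omega)

theorem InRange.coeff_laxF_of_neg {F G H : ℂ[T;T⁻¹]} (hR : S.InRange F G H) (s : Bool) {ℓ : ℤ}
    (hℓ : ℓ < 0) : (S.laxF r ct F G).coeff (S.posF s ℓ) = 0 := by
  rw [hR.coeff_laxF_side r ct s ℓ (M := S.p + 1) le_rfl]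
  exact flowF_of_neg (fun k hk => hR.seqF_eq_zero s (by omega))
    (fun k hk => hR.seqG_eq_zero s (by omega)) (S.conv_seq_FG ct F G s) hℓ

theorem InRange.coeff_laxH {F G H : ℂ[T;T⁻¹]} (hR : S.InRange F G H) (s : Bool) (ℓ : ℕ) :
    (S.laxH r ct G H).coeff (S.posH s ℓ)
      = -flowF (S.seqH H s) (S.seqG G s) (S.seqGt ct G s) (S.seqHt ct H s) (S.seqGt ct G !s)
          (S.seqHt ct H !s) (r s) (r !s) ℓ := by
  rw [hR.coeff_laxH_side r ct s ℓ (M := S.p + 1 + ℓ) (by omega)]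
  congr 1
  exact flowF_eq (fun k hk => hR.seqH_eq_zero s (by omega))
    (fun k hk => hR.seqG_eq_zero s (by omega)) (S.conv_seq_HG ct G H s) (by omega)

theorem InRange.coeff_laxH_of_neg {F G H : ℂ[T;T⁻¹]} (hR : S.InRange F G H) (s : Bool) {ℓ : ℤ}
    (hℓ : ℓ < 0) : (S.laxH r ct G H).coeff (S.posH s ℓ) = 0 := by
  rw [hR.coeff_laxH_side r ct s ℓ (M := S.p + 1) le_rfl, neg_eq_zero]
  exact flowF_of_neg (fun k hk => hR.seqH_eq_zero s (by omega))
    (fun k hk => hR.seqG_eq_zero s (by omega)) (S.conv_seq_HG ct G H s) hℓ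

theorem InRange.coeff_laxG {F G H : ℂ[T;T⁻¹]} (hR : S.InRange F G H) (s : Bool) (ℓ : ℕ) :
    (S.laxG r ct F H).coeff (S.posG s ℓ)
      = flowG (S.seqF F s) (S.seqFt ct F s) (S.seqFt ct F !s) (r s) (r !s) (S.seqH H s)
          (S.seqHt ct H s) (S.seqHt ct H !s) ℓ := by
  rw [hR.coeff_laxG_side r ct s ℓ (M := S.p + 1 + ℓ) (by omega)]
  exact flowG_eq (fun k hk => hR.seqF_eq_zero s (by omega))
    (fun k hk => hR.seqH_eq_zero s (by omega)) (S.conv_seq_FH ct F H s) (by omega)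

theorem InRange.coeff_laxG_of_neg {F G H : ℂ[T;T⁻¹]} (hR : S.InRange F G H) (s : Bool) {ℓ : ℤ}
    (hℓ : ℓ < 0) : (S.laxG r ct F H).coeff (S.posG s ℓ) = 0 := by
  rw [hR.coeff_laxG_side r ct s ℓ (M := S.p + 1) le_rfl]
  exact flowG_of_neg (fun k hk => hR.seqF_eq_zero s (by omega))
    (fun k hk => hR.seqH_eq_zero s (by omega)) (S.conv_seq_FH ct F H s) hℓ

section Ode

variable (f g h : Bool → ℕ → ℂ)

/-- The bound on `k` is essential: beyond `deg s` the enumeration of the coefficients runs into the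
other half, whereas `f s k` is an unrelated function. -/
theorem seqF_laurentF (s : Bool) {k : ℕ} (hk : k < S.deg s) :
    S.seqF (laurentF S.deg f) s k = f s k := by
  unfold seqF
  cases s
  · simp only [Bool.false_eq_true, if_false]
    rw [coeff_laurentF, if_neg (by omega), show (S.deg false : ℤ) + (-(S.deg false : ℤ) + k) = k by
      ring, ext0_natCast]
  · simp only [if_true]
    rw [coeff_laurentF, if_pos (by omega), show (S.deg true : ℤ) - 1 - (S.deg true - 1 - k) = k by
      ring, ext0_natCast]

theorem seqG_laurentG (s : Bool) {k : ℕ} (hk : k < S.deg s) :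
    S.seqG (laurentG S.deg g) s k = g s k := by
  unfold seqG
  cases s
  · simp only [Bool.false_eq_true, if_false]
    rw [coeff_laurentG, if_neg (by omega), show (S.deg false : ℤ) + (-(S.deg false : ℤ) + k) = k by
      ring, ext0_natCast]
  · simp only [if_true]
    rw [coeff_laurentG, if_pos (by omega), show (S.deg true : ℤ) - (S.deg true - k) = k by
      ring, ext0_natCast]

theorem seqH_laurentH (s : Bool) {k : ℕ} (hk : k < S.deg s) :
    S.seqH (laurentH S.deg h) s k = h s k := by
  unfold seqH
  cases s
  · simp only [Bool.false_eq_true, if_false]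
    rw [coeff_laurentH, if_neg (by omega),
      show (S.deg false : ℤ) - 1 + (-(S.deg false : ℤ) + 1 + k) = k by ring, ext0_natCast]
  · simp only [if_true]
    rw [coeff_laurentH, if_pos (by omega), show (S.deg true : ℤ) - (S.deg true - k) = k by
      ring, ext0_natCast]

/-- The equation for index `ℓ` only involves coefficients with `k ≤ ℓ`, which all belong to the half
`s`. -/
theorem odeF_eq (s : Bool) {ℓ : ℕ} (hℓ : ℓ < S.deg s) :
    S.odeF r ct f g s ℓ
      = (S.laxF r ct (laurentF S.deg f) (laurentG S.deg g)).coeff (S.posF s ℓ) := by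
  rw [(S.inRange_laurent f g g).coeff_laxF]
  rw [flowF_congr (φ' := f s) (γ' := g s) (fun k hk => seqF_laurentF f s (by omega))
    (fun k hk => seqG_laurentG g s (by omega))]
  rfl

theorem odeH_eq (s : Bool) {ℓ : ℕ} (hℓ : ℓ < S.deg s) :
    S.odeH r ct g h s ℓ
      = (S.laxH r ct (laurentG S.deg g) (laurentH S.deg h)).coeff (S.posH s ℓ) := by
  rw [(S.inRange_laurent h g h).coeff_laxH]
  rw [flowF_congr (φ' := h s) (γ' := g s) (fun k hk => seqH_laurentH h s (by omega))
    (fun k hk => seqG_laurentG g s (by omega))]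
  unfold flowF odeH
  rw [neg_add, ← mul_neg, ← mul_neg, neg_sub, ← Finset.sum_neg_distrib]
  congr 2
  refine Finset.sum_congr rfl fun k _ => ?_
  unfold gTilde hTilde seqGt seqHt
  ring

/-- The sum stops before `ℓ`, so `ℓ = deg s` is still allowed, although the coefficients of `F` and
`H` in the half `s` end at `deg s - 1`. -/
theorem odeG_eq (s : Bool) {ℓ : ℕ} (hℓ : ℓ ≤ S.deg s) :
    S.odeG r ct f h s ℓ
      = (S.laxG r ct (laurentF S.deg f) (laurentH S.deg h)).coeff (S.posG s ℓ) := by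
  rw [(S.inRange_laurent f f h).coeff_laxG]
  rw [flowG_congr (φ' := f s) (χ' := h s) (fun k hk => seqF_laurentF f s (by omega))
    (fun k hk => seqH_laurentH h s (by omega))]
  rfl

end Ode

end SpectralData

end AblowitzLadik

end

/-! ### Time derivatives of Laurent polynomials and conservation laws at the initial point -/

noncomputable section

open Polynomial

namespace AblowitzLadik

open Filter Topology

/-! ### Derivatives of Laurent polynomials depending on a parameter -/

/-- `L` is near `t` a Laurent polynomial of bounded degree with differentiable coefficients, and
`L'` is its derivative at `t`. -/
structure HasLDerivAt (L : ℝ → ℂ[T;T⁻¹]) (L' : ℂ[T;T⁻¹]) (t : ℝ) : Prop where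
  bdd : ∃ N : ℕ, ∀ᶠ τ in 𝓝 t, ∀ j : ℤ, (j < -(N : ℤ) ∨ (N : ℤ) < j) → (L τ).coeff j = 0
  coeff : ∀ j, HasDerivAt (fun τ => (L τ).coeff j) (L'.coeff j) t

namespace HasLDerivAt

variable {A B : ℝ → ℂ[T;T⁻¹]} {A' B' : ℂ[T;T⁻¹]} {t : ℝ}

theorem unique {A'' : ℂ[T;T⁻¹]} (h : HasLDerivAt A A' t) (h' : HasLDerivAt A A'' t) : A' = A'' := by
  ext j
  exact (h.coeff j).unique (h'.coeff j)

theorem congr (h : HasLDerivAt A A' t) (e : B =ᶠ[𝓝 t] A) : HasLDerivAt B A' t := by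
  obtain ⟨N, hN⟩ := h.bdd
  refine ⟨⟨N, ?_⟩, fun j => (h.coeff j).congr_of_eventuallyEq ?_⟩
  · filter_upwards [hN, e] with τ h1 h2
    rwa [h2]
  · filter_upwards [e] with τ h2
    rw [h2]

theorem exists_support (L : ℂ[T;T⁻¹]) :
    ∃ N : ℕ, ∀ j : ℤ, (j < -(N : ℤ) ∨ (N : ℤ) < j) → L.coeff j = 0 := by
  refine ⟨L.coeff.support.sup Int.natAbs, fun j hj => ?_⟩
  by_contra h
  have := Finset.le_sup (f := Int.natAbs) (Finsupp.mem_support_iff.2 h)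
  omega

theorem const (L : ℂ[T;T⁻¹]) : HasLDerivAt (fun _ => L) 0 t := by
  obtain ⟨N, hN⟩ := exists_support L
  exact ⟨⟨N, Eventually.of_forall fun _ => hN⟩, fun j => hasDerivAt_const _ _⟩

theorem add (hA : HasLDerivAt A A' t) (hB : HasLDerivAt B B' t) :
    HasLDerivAt (fun τ => A τ + B τ) (A' + B') t := by
  obtain ⟨N, hN⟩ := hA.bdd
  obtain ⟨M, hM⟩ := hB.bdd
  refine ⟨⟨N + M, ?_⟩, fun j => (hA.coeff j).add (hB.coeff j)⟩
  filter_upwards [hN, hM] with τ h1 h2 j hj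
  rw [laurent_coeff_add, h1 j (by push_cast at hj; omega), h2 j (by push_cast at hj; omega),
    add_zero]

theorem sub (hA : HasLDerivAt A A' t) (hB : HasLDerivAt B B' t) :
    HasLDerivAt (fun τ => A τ - B τ) (A' - B') t := by
  obtain ⟨N, hN⟩ := hA.bdd
  obtain ⟨M, hM⟩ := hB.bdd
  refine ⟨⟨N + M, ?_⟩, fun j => (hA.coeff j).sub (hB.coeff j)⟩
  filter_upwards [hN, hM] with τ h1 h2 j hj
  rw [laurent_coeff_sub, h1 j (by push_cast at hj; omega), h2 j (by push_cast at hj; omega),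
    sub_zero]

theorem C {c : ℝ → ℂ} {c' : ℂ} (hc : HasDerivAt c c' t) :
    HasLDerivAt (fun τ => LaurentPolynomial.C (c τ)) (LaurentPolynomial.C c') t := by
  refine ⟨⟨0, Eventually.of_forall fun τ j hj => ?_⟩, fun j => ?_⟩
  · rw [laurent_coeff_C, if_neg (by push_cast at hj; omega)]
  · simp only [laurent_coeff_C]
    split_ifs
    · exact hc
    · exact hasDerivAt_const _ _

theorem coeff_eq_zero {N : ℕ} (hA : HasLDerivAt A A' t)
    (hN : ∀ᶠ τ in 𝓝 t, ∀ j : ℤ, (j < -(N : ℤ) ∨ (N : ℤ) < j) → (A τ).coeff j = 0) (j : ℤ)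
    (hj : j < -(N : ℤ) ∨ (N : ℤ) < j) : A'.coeff j = 0 := by
  refine (hA.coeff j).unique ((hasDerivAt_const t (0 : ℂ)).congr_of_eventuallyEq ?_)
  filter_upwards [hN] with τ h using h j hj

/-- The uniform degree bound near `t` makes each coefficient of the product a finite sum with a
fixed index set, which can be differentiated termwise. -/
theorem mul (hA : HasLDerivAt A A' t) (hB : HasLDerivAt B B' t) :
    HasLDerivAt (fun τ => A τ * B τ) (A' * B t + A t * B') t := by
  obtain ⟨N, hN⟩ := hA.bdd
  obtain ⟨M, hM⟩ := hB.bdd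
  have hmul : ∀ P Q : ℂ[T;T⁻¹], (∀ j : ℤ, (j < -(N : ℤ) ∨ (N : ℤ) < j) → P.coeff j = 0) →
      ∀ j, (P * Q).coeff j = ∑ k ∈ Finset.range (2 * N + 1),
        P.coeff (-(N : ℤ) + k) * Q.coeff (j - -(N : ℤ) - k) := fun P Q h j =>
    SpectralData.coeff_mul_bot (fun j hj => h j (by push_cast at hj; omega)) Q j
  refine ⟨⟨N + M, ?_⟩, fun j => ?_⟩
  · filter_upwards [hN, hM] with τ h1 h2 j hj
    rw [hmul _ _ h1]
    refine Finset.sum_eq_zero fun k hk => ?_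
    have := Finset.mem_range.1 hk
    rw [h2 _ (by push_cast at hj; omega), mul_zero]
  · rw [laurent_coeff_add, hmul _ _ (hA.coeff_eq_zero hN), hmul _ _ hN.self_of_nhds,
      ← Finset.sum_add_distrib]
    have h1 := HasDerivAt.fun_sum (u := Finset.range (2 * N + 1)) fun k _ =>
      (hA.coeff (-(N : ℤ) + k)).mul (hB.coeff (j - -(N : ℤ) - k))
    refine h1.congr_of_eventuallyEq ?_
    filter_upwards [hN] with τ h2 using hmul _ _ h2 j

theorem const_mul (L : ℂ[T;T⁻¹]) (hA : HasLDerivAt A A' t) :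
    HasLDerivAt (fun τ => L * A τ) (L * A') t := by
  simpa using (const L).mul hA

theorem lval_eq_sum {L : ℂ[T;T⁻¹]} {N : ℕ}
    (h : ∀ j : ℤ, (j < -(N : ℤ) ∨ (N : ℤ) < j) → L.coeff j = 0) (z : ℂˣ) :
    lval z L = ∑ k ∈ Finset.range (2 * N + 1), L.coeff (N - k) * (z : ℂ) ^ ((N : ℤ) - k) := by
  conv_lhs => rw [SpectralData.eq_sum_top (top := (N : ℤ)) (M := 2 * N)
    (fun j hj => h j (by push_cast at hj; omega))]
  rw [lval, LaurentPolynomial.eval₂, map_sum]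
  exact Finset.sum_congr rfl fun k _ => by
    change lval z _ = _
    rw [lval_mul, lval_C, lval_T]

theorem lval (hA : HasLDerivAt A A' t) (z : ℂˣ) :
    HasDerivAt (fun τ => AblowitzLadik.lval z (A τ)) (AblowitzLadik.lval z A') t := by
  obtain ⟨N, hN⟩ := hA.bdd
  rw [lval_eq_sum (hA.coeff_eq_zero hN)]
  have h1 := HasDerivAt.fun_sum (u := Finset.range (2 * N + 1)) fun k _ =>
      (hA.coeff ((N : ℤ) - k)).mul_const ((z : ℂ) ^ ((N : ℤ) - k))
  have h2 : (fun τ => AblowitzLadik.lval z (A τ)) =ᶠ[𝓝 t] fun τ =>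
      ∑ k ∈ Finset.range (2 * N + 1), (A τ).coeff ((N : ℤ) - k) * (z : ℂ) ^ ((N : ℤ) - k) := by
    filter_upwards [hN] with τ h2
    have h3 := lval_eq_sum (L := A τ) (N := N) h2 z
    exact h3
  exact h1.congr_of_eventuallyEq h2

end HasLDerivAt

namespace SpectralData

variable {S : SpectralData} {r : Bool → ℕ} {ct : Bool → ℕ → ℂ}

/-! ### The flow at the initial lattice point -/

section Initial

variable {f g h : Bool → ℕ → ℝ → ℂ} {t : ℝ}

/-- The system only prescribes the coefficients in range. Outside, the state vanishes identically
and so does the Lax right-hand side, by `coeff_laxF_of_neg`. -/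
theorem hasLDerivAt_initF (hf : ∀ s, ∀ ℓ < S.deg s,
      HasDerivAt (f s ℓ) (S.odeF r ct (fun s k => f s k t) (fun s k => g s k t) s ℓ) t) :
    HasLDerivAt (S.initF f) (S.laxF r ct (S.initF f t) (S.initG g t)) t := by
  have hR : ∀ τ, S.InRange (S.initF f τ) (S.initG g t) (laurentH S.deg fun s k => g s k t) :=
    fun τ => S.inRange_laurent _ _ _
  refine ⟨⟨S.deg false + S.deg true, Eventually.of_forall fun τ j hj => (hR τ).F j ?_⟩, fun j => ?_⟩
  · push_cast at hj; omega
  have hz : (j < -(S.deg false : ℤ) ∨ (S.deg true : ℤ) - 1 < j) →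
      HasDerivAt (fun τ => (S.initF f τ).coeff j)
        ((S.laxF r ct (S.initF f t) (S.initG g t)).coeff j) t := by
    intro hj
    have e : (S.laxF r ct (S.initF f t) (S.initG g t)).coeff j = 0 := by
      rcases hj with hj | hj
      · have := (hR t).coeff_laxF_of_neg (r := r) (ct := ct) false
          (show (S.deg false : ℤ) + j < 0 by omega)
        rwa [posF, if_neg (by simp), neg_add_cancel_left] at this
      · have := (hR t).coeff_laxF_of_neg (r := r) (ct := ct) true
          (show (S.deg true : ℤ) - 1 - j < 0 by omega)
        rwa [posF, if_pos rfl, sub_sub_cancel] at this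
    rw [e]
    exact (hasDerivAt_const t (0 : ℂ)).congr_of_eventuallyEq
      (Eventually.of_forall fun τ => (hR τ).F j hj)
  have hs : ∀ s, ∀ ℓ < S.deg s, j = S.posF s ℓ → HasDerivAt (fun τ => (S.initF f τ).coeff j)
        ((S.laxF r ct (S.initF f t) (S.initG g t)).coeff j) t := by
    rintro s ℓ hℓ rfl
    have h1 := hf s ℓ hℓ
    rw [odeF_eq _ _ _ hℓ] at h1
    refine h1.congr_of_eventuallyEq (Eventually.of_forall fun τ => ?_)
    have h2 := seqF_laurentF (S := S) (fun s k => f s k τ) s hℓ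
    rw [← h2]
    cases s <;> rfl
  by_cases hj : j < -(S.deg false : ℤ) ∨ (S.deg true : ℤ) - 1 < j
  · exact hz hj
  rcases lt_or_ge j 0 with h0 | h0
  · exact hs false (S.deg false + j).toNat (by omega) (by simp only [posF, Bool.false_eq_true, if_false]; omega)
  · exact hs true (S.deg true - 1 - j).toNat (by omega) (by simp only [posF, if_true]; omega)

theorem hasLDerivAt_initG (hg : ∀ s, ∀ ℓ ≤ S.deg s,
      HasDerivAt (g s ℓ) (S.odeG r ct (fun s k => f s k t) (fun s k => h s k t) s ℓ) t) :
    HasLDerivAt (S.initG g) (S.laxG r ct (S.initF f t) (S.initH h t)) t := by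
  have hR : ∀ τ, S.InRange (S.initF f t) (S.initG g τ) (S.initH h t) :=
    fun τ => S.inRange_laurent _ _ _
  refine ⟨⟨S.deg false + S.deg true, Eventually.of_forall fun τ j hj => (hR τ).G j ?_⟩, fun j => ?_⟩
  · push_cast at hj; omega
  have hz : (j < -(S.deg false : ℤ) ∨ (S.deg true : ℤ) < j) →
      HasDerivAt (fun τ => (S.initG g τ).coeff j)
        ((S.laxG r ct (S.initF f t) (S.initH h t)).coeff j) t := by
    intro hj
    have e : (S.laxG r ct (S.initF f t) (S.initH h t)).coeff j = 0 := by
      rcases hj with hj | hj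
      · have := (hR t).coeff_laxG_of_neg (r := r) (ct := ct) false
          (show (S.deg false : ℤ) + j < 0 by omega)
        rwa [posG, if_neg (by simp), neg_add_cancel_left] at this
      · have := (hR t).coeff_laxG_of_neg (r := r) (ct := ct) true
          (show (S.deg true : ℤ) - j < 0 by omega)
        rwa [posG, if_pos rfl, sub_sub_cancel] at this
    rw [e]
    exact (hasDerivAt_const t (0 : ℂ)).congr_of_eventuallyEq
      (Eventually.of_forall fun τ => (hR τ).G j hj)
  by_cases hj : j < -(S.deg false : ℤ) ∨ (S.deg true : ℤ) < j
  · exact hz hj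
  rcases lt_or_ge j 0 with h0 | h0
  · obtain ⟨ℓ, hℓ⟩ : ∃ ℓ : ℕ, (ℓ : ℤ) = S.deg false + j := ⟨(S.deg false + j).toNat, by omega⟩
    have h1 := hg false ℓ (by omega)
    rw [odeG_eq _ _ _ (by omega : ℓ ≤ S.deg false)] at h1
    rw [posG, if_neg (by simp), hℓ, neg_add_cancel_left] at h1
    refine h1.congr_of_eventuallyEq (Eventually.of_forall fun τ => ?_)
    change (initG S g τ).coeff j = _
    rw [initG, coeff_laurentG, if_neg (by omega), ← hℓ, ext0_natCast]
  · obtain ⟨ℓ, hℓ⟩ : ∃ ℓ : ℕ, (ℓ : ℤ) = S.deg true - j := ⟨(S.deg true - j).toNat, by omega⟩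
    have h1 := hg true ℓ (by omega)
    rw [odeG_eq _ _ _ (by omega : ℓ ≤ S.deg true)] at h1
    rw [posG, if_pos rfl, hℓ, sub_sub_cancel] at h1
    refine h1.congr_of_eventuallyEq (Eventually.of_forall fun τ => ?_)
    change (initG S g τ).coeff j = _
    rw [initG, coeff_laurentG, if_pos (by omega), ← hℓ, ext0_natCast]

theorem hasLDerivAt_initH (hh : ∀ s, ∀ ℓ < S.deg s,
      HasDerivAt (h s ℓ) (S.odeH r ct (fun s k => g s k t) (fun s k => h s k t) s ℓ) t) :
    HasLDerivAt (S.initH h) (S.laxH r ct (S.initG g t) (S.initH h t)) t := by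
  have hR : ∀ τ, S.InRange (laurentF S.deg fun s k => h s k t) (S.initG g t) (S.initH h τ) :=
    fun τ => S.inRange_laurent _ _ _
  refine ⟨⟨S.deg false + S.deg true, Eventually.of_forall fun τ j hj => (hR τ).H j ?_⟩, fun j => ?_⟩
  · push_cast at hj; omega
  have hz : (j < 1 - (S.deg false : ℤ) ∨ (S.deg true : ℤ) < j) →
      HasDerivAt (fun τ => (S.initH h τ).coeff j)
        ((S.laxH r ct (S.initG g t) (S.initH h t)).coeff j) t := by
    intro hj
    have e : (S.laxH r ct (S.initG g t) (S.initH h t)).coeff j = 0 := by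
      rcases hj with hj | hj
      · have := (hR t).coeff_laxH_of_neg (r := r) (ct := ct) false
          (show (S.deg false : ℤ) - 1 + j < 0 by omega)
        rwa [posH, if_neg (by simp), show -(S.deg false : ℤ) + 1 + (S.deg false - 1 + j) = j by ring]
          at this
      · have := (hR t).coeff_laxH_of_neg (r := r) (ct := ct) true
          (show (S.deg true : ℤ) - j < 0 by omega)
        rwa [posH, if_pos rfl, sub_sub_cancel] at this
    rw [e]
    exact (hasDerivAt_const t (0 : ℂ)).congr_of_eventuallyEq
      (Eventually.of_forall fun τ => (hR τ).H j hj)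
  have hs : ∀ s, ∀ ℓ < S.deg s, j = S.posH s ℓ → HasDerivAt (fun τ => (S.initH h τ).coeff j)
        ((S.laxH r ct (S.initG g t) (S.initH h t)).coeff j) t := by
    rintro s ℓ hℓ rfl
    have h1 := hh s ℓ hℓ
    rw [odeH_eq _ _ _ hℓ] at h1
    refine h1.congr_of_eventuallyEq (Eventually.of_forall fun τ => ?_)
    have h2 := seqH_laurentH (S := S) (fun s k => h s k τ) s hℓ
    rw [← h2]
    cases s <;> rfl
  by_cases hj : j < 1 - (S.deg false : ℤ) ∨ (S.deg true : ℤ) < j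
  · exact hz hj
  rcases lt_or_ge j 1 with h0 | h0
  · exact hs false (S.deg false - 1 + j).toNat (by omega)
      (by simp only [posH, Bool.false_eq_true, if_false]; omega)
  · exact hs true (S.deg true - j).toNat (by omega) (by simp only [posH, if_true]; omega)

end Initial

/-- The Lax equations preserve `G² - F H`. -/
theorem lax_discriminant (F G H : ℂ[T;T⁻¹]) :
    (S.laxG r ct F H * G + G * S.laxG r ct F H)
      - (S.laxF r ct F G * H + F * S.laxH r ct G H) = 0 := by
  -- In `F_t H + F H_t` the terms with `G̃ + K̃` cancel, and the rest is `2 i G (F H̃ - H F̃) = 2 G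
  -- G_t`.
  unfold laxF laxG laxH
  rw [map_mul, show LaurentPolynomial.C (2 : ℂ) = (2 : ℂ[T;T⁻¹]) from map_ofNat _ _]
  ring

theorem eq_of_hasLDerivAt_zero {L : ℝ → ℂ[T;T⁻¹]} {a b : ℝ}
    (h : ∀ t ∈ Set.Ioo a b, ∀ j, HasDerivAt (fun τ => (L τ).coeff j) 0 t) {t t' : ℝ}
    (ht : t ∈ Set.Ioo a b) (ht' : t' ∈ Set.Ioo a b) : L t = L t' := by
  ext j
  exact isOpen_Ioo.is_const_of_deriv_eq_zero isPreconnected_Ioo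
    (fun τ hτ => (h τ hτ j).differentiableAt.differentiableWithinAt)
    (fun τ hτ => (h τ hτ j).deriv) ht ht'

/-- The coefficients of `G` at both ends are preserved by the flow. -/
theorem InRange.coeff_laxG_end {F G H : ℂ[T;T⁻¹]} (hR : S.InRange F G H) :
    (S.laxG r ct F H).coeff (S.deg true) = 0 ∧
      (S.laxG r ct F H).coeff (-(S.deg false : ℤ)) = 0 := by
  have h1 := hR.coeff_laxG (r := r) (ct := ct) true 0
  have h2 := hR.coeff_laxG (r := r) (ct := ct) false 0
  -- For `ℓ = 0` the sum in the equation for `g` is empty.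
  rw [flowG, Finset.range_zero, Finset.sum_empty, mul_zero] at h1 h2
  constructor
  · rw [← h1, posG, if_pos rfl, Nat.cast_zero, sub_zero]
  · rw [← h2, posG, if_neg (by simp), Nat.cast_zero, add_zero]

/-- The Lax equations preserve curve triples. -/
theorem isCurveTriple_of_lax {F G H : ℝ → ℂ[T;T⁻¹]} {X : ℝ → PolyTriple} {a b t₀ t : ℝ}
    (hX : ∀ τ, X τ = S.polyTriple (F τ, G τ, H τ))
    (hL : ∀ τ, S.laurentTriple (X τ) = (F τ, G τ, H τ))
    (hR : ∀ τ, S.InRange (F τ) (G τ) (H τ))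
    (hF : ∀ t ∈ Set.Ioo a b, HasLDerivAt F (S.laxF r ct (F t) (G t)) t)
    (hG : ∀ t ∈ Set.Ioo a b, HasLDerivAt G (S.laxG r ct (F t) (H t)) t)
    (hH : ∀ t ∈ Set.Ioo a b, HasLDerivAt H (S.laxH r ct (G t) (H t)) t)
    (ht₀ : t₀ ∈ Set.Ioo a b) (h₀ : S.IsCurveTriple (X t₀)) (ht : t ∈ Set.Ioo a b) :
    S.IsCurveTriple (X t) := by
  -- The curve equation and the end coefficients of `G` are constant in time, so they are inherited
  -- from `t₀`. The degree bounds are built into `polyTriple`.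
  have hcurve : G t * G t - F t * H t = G t₀ * G t₀ - F t₀ * H t₀ := by
    refine eq_of_hasLDerivAt_zero (L := fun τ => G τ * G τ - F τ * H τ) (fun τ hτ j => ?_) ht ht₀
    have := (((hG τ hτ).mul (hG τ hτ)).sub ((hF τ hτ).mul (hH τ hτ))).coeff j
    rwa [lax_discriminant] at this
  have hend : ∀ j, (∀ τ, (S.laxG r ct (F τ) (H τ)).coeff j = 0) →
      (G t).coeff j = (G t₀).coeff j := by
    intro j hj
    refine isOpen_Ioo.is_const_of_deriv_eq_zero (f := fun τ => (G τ).coeff j) isPreconnected_Ioo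
      (fun τ hτ => ((hG τ hτ).coeff j).differentiableAt.differentiableWithinAt)
      (fun τ hτ => (((hG τ hτ).coeff j).deriv).trans (hj τ)) ht ht₀
  have hd := S.deg_add_int
  have hc : ∀ τ (N : ℕ), N ≤ S.p + 1 → (X τ).G.coeff N = (G τ).coeff (-(S.deg false : ℤ) + N) := by
    intro τ N hN
    rw [hX, polyTriple, coeff_polyOf, if_pos hN]
  refine ⟨fun N hN => ?_, fun N hN => ?_, fun N hN => ?_, ?_, ?_, curve_of_laurent ?_⟩
  · rw [hX]; exact coeff_polyTriple_F hN
  · rw [hX]; exact coeff_polyTriple_G hN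
  · rw [hX]; exact coeff_polyTriple_H hN
  · rw [← h₀.topG, hc _ _ le_rfl, hc _ _ le_rfl, show -(S.deg false : ℤ) + ((S.p + 1 : ℕ) : ℤ)
      = S.deg true by push_cast; omega]
    exact hend _ fun τ => (hR τ).coeff_laxG_end.1
  · rw [← h₀.botG, hc _ _ (by omega), hc _ _ (by omega), Nat.cast_zero, add_zero]
    exact hend _ fun τ => (hR τ).coeff_laxG_end.2
  · rw [← h₀.laurent_curve, hL, hL, sq, sq]
    exact hcurve

end SpectralData

end AblowitzLadik

end

/-! ### Linearized link relations and propagation of the Lax equations along the lattice -/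

noncomputable section

open Polynomial

namespace AblowitzLadik

open Filter Topology

/-! ### The linearized link relations -/

/-- The derivative of the link relations between two neighbouring triples. -/
structure LinkDeriv {A : Type*} [CommRing A] (z a b a' b' F₀ G₀ H₀ F₁ G₁ H₁ F₀' G₀' H₀' F₁' G₁' H₁' : A) :
    Prop where
  rel₁₁ : z * (G₀' - G₁') + (a' * H₀ + a * H₀') + z * (b' * F₁ + b * F₁') = 0
  rel₁₂ : F₁' - z * F₀' - (a' * (G₁ + G₀) + a * (G₁' + G₀')) = 0
  rel₂₁ : z * (b' * (G₀ + G₁) + b * (G₀' + G₁')) + H₀' - z * H₁' = 0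
  rel₂₂ : G₁' - G₀' - (a' * H₁ + a * H₁') - z * (b' * F₀ + b * F₀') = 0

namespace LinkDeriv

variable {A : Type*} [CommRing A] {z a b a' b' F₀ G₀ H₀ F₁ G₁ H₁ F₀' G₀' H₀' F₁' G₁' H₁' : A}

/-- The right-hand sides of the Lax equations at two neighbouring lattice points satisfy the
linearized link relations. -/
theorem of_lax {i s₁ s₂ f₀ g₀ h₀ k₀ f₁ g₁ h₁ k₁ : A}
    (R₁₁ : z * (G₀ - G₁) + a * H₀ + z * (b * F₁) = 0)
    (R₁₂ : F₁ - z * F₀ - a * (G₁ + G₀) = 0)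
    (R₂₁ : z * (b * (G₀ + G₁)) + H₀ - z * H₁ = 0)
    (R₂₂ : G₁ - G₀ - a * H₁ - z * (b * F₀) = 0)
    (N₁₁ : z * (g₀ - g₁) + a * h₀ + z * (b * f₁) = 0)
    (N₁₂ : f₁ - z * f₀ - a * (g₁ + k₀) = s₁)
    (N₂₁ : z * (b * (g₀ + k₁)) + h₀ - z * h₁ = z * s₂)
    (N₂₂ : k₁ - k₀ - a * h₁ - z * (b * f₀) = 0) :
    LinkDeriv z a b (-i * s₁) (-i * s₂) F₀ G₀ H₀ F₁ G₁ H₁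
      (i * (F₀ * (g₀ + k₀)) - 2 * i * (G₀ * f₀)) (i * (F₀ * h₀ - H₀ * f₀))
      (-(i * (H₀ * (g₀ + k₀)) - 2 * i * (G₀ * h₀)))
      (i * (F₁ * (g₁ + k₁)) - 2 * i * (G₁ * f₁)) (i * (F₁ * h₁ - H₁ * f₁))
      (-(i * (H₁ * (g₁ + k₁)) - 2 * i * (G₁ * h₁))) where
  -- Put `W = U V - V⁺ U` and let `U_t = Ṽ⁺ U - U Ṽ`. If both `V` and `V⁺` satisfy the Lax equation,
  -- then the derivative of `W` is `Ṽ⁺ W - W Ṽ`, which vanishes with `W`. The four combinations are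
  -- its entries, with `N` used to express `U_t`.
  rel₁₁ := by
    linear_combination i * (g₁ * R₁₁ - f₁ * R₂₁ - g₀ * R₁₁ - h₀ * R₁₂ + G₀ * N₁₁ + H₀ * N₁₂
      - G₁ * N₁₁ + F₁ * N₂₁)
  rel₁₂ := by
    linear_combination i * (g₁ * R₁₂ - f₁ * R₂₂ + f₀ * R₁₁ + k₀ * R₁₂ - F₀ * N₁₁ - G₀ * N₁₂
      - G₁ * N₁₂ + F₁ * N₂₂)
  rel₂₁ := by
    linear_combination i * (h₁ * R₁₁ - k₁ * R₂₁ - g₀ * R₂₁ - h₀ * R₂₂ + G₀ * N₂₁ + H₀ * N₂₂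
      - H₁ * N₁₁ + G₁ * N₂₁)
  rel₂₂ := by
    linear_combination i * (h₁ * R₁₂ - k₁ * R₂₂ + f₀ * R₂₁ + k₀ * R₂₂ - F₀ * N₂₁ - G₀ * N₂₂
      - H₁ * N₁₂ + G₁ * N₂₂)

variable {F₀'' G₀'' H₀'' F₁'' G₁'' H₁'' : A}

/-- For given data on the left, the difference of two solutions satisfies a homogeneous linear
system that is invertible because `z` and `1 - a b` are units. So the derivatives at the right
neighbour are determined. -/
theorem unique_up (hz : IsUnit z) (hab : IsUnit (1 - a * b))
    (h : LinkDeriv z a b a' b' F₀ G₀ H₀ F₁ G₁ H₁ F₀' G₀' H₀' F₁' G₁' H₁')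
    (h' : LinkDeriv z a b a' b' F₀ G₀ H₀ F₁ G₁ H₁ F₀' G₀' H₀' F₁'' G₁'' H₁'') :
    F₁' = F₁'' ∧ G₁' = G₁'' ∧ H₁' = H₁'' := by
  have e1 : G₁' - G₁'' = b * (F₁' - F₁'') :=
    hz.mul_left_cancel (by linear_combination h'.rel₁₁ - h.rel₁₁)
  have e2 : F₁' = F₁'' := hab.mul_left_cancel (by
    linear_combination h.rel₁₂ - h'.rel₁₂ + a * e1)
  have e3 : G₁' = G₁'' := by linear_combination e1 + b * e2
  exact ⟨e2, e3, hz.mul_left_cancel (by linear_combination h'.rel₂₁ - h.rel₂₁ + z * b * e3)⟩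

theorem unique_down (hz : IsUnit z) (hab : IsUnit (1 - a * b))
    (h : LinkDeriv z a b a' b' F₀ G₀ H₀ F₁ G₁ H₁ F₀' G₀' H₀' F₁' G₁' H₁')
    (h' : LinkDeriv z a b a' b' F₀ G₀ H₀ F₁ G₁ H₁ F₀'' G₀'' H₀'' F₁' G₁' H₁') :
    F₀' = F₀'' ∧ G₀' = G₀'' ∧ H₀' = H₀'' := by
  have e1 : G₀' = G₀'' := hz.mul_left_cancel (hab.mul_left_cancel (by
    linear_combination h.rel₁₁ - h'.rel₁₁ - a * (h.rel₂₁ - h'.rel₂₁)))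
  exact ⟨hz.mul_left_cancel (by linear_combination h'.rel₁₂ - h.rel₁₂ - a * e1), e1,
    by linear_combination h.rel₂₁ - h'.rel₂₁ - z * b * e1⟩

end LinkDeriv

namespace SpectralData

variable {S : SpectralData} {r : Bool → ℕ} {ct : Bool → ℕ → ℂ}

/-! ### The Lax equations on the lattice -/

section Static

variable {α β : ℤ → ℂ} {X : ℤ → PolyTriple}

/-- By `IsOrbit.hats` the right-hand side computed from the state at one point is the one built from
`α, β`; this makes the Lax equation meaningful at every lattice point. -/
theorem IsOrbit.seqFt_eq (h : S.IsOrbit α β X) (n : ℤ) :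
    S.seqFt ct (S.laurentTriple (X n)).1 = fun s ℓ => fCoef ct α β s ℓ n := by
  funext s ℓ
  rw [seqFt, h.fHatOf_eq]
  rfl

theorem IsOrbit.seqGt_eq (h : S.IsOrbit α β X) (n : ℤ) :
    S.seqGt ct (S.laurentTriple (X n)).2.1 = fun s ℓ => gCoef ct α β s ℓ n := by
  funext s ℓ
  rw [seqGt, h.gHatOf_eq]
  rfl

theorem IsOrbit.seqHt_eq (h : S.IsOrbit α β X) (n : ℤ) :
    S.seqHt ct (S.laurentTriple (X n)).2.2 = fun s ℓ => hCoef ct α β s ℓ n := by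
  funext s ℓ
  rw [seqHt, h.hHatOf_eq]
  rfl

theorem IsOrbit.laxF_eq (h : S.IsOrbit α β X) (n : ℤ) :
    S.laxF r ct (S.laurentTriple (X n)).1 (S.laurentTriple (X n)).2.1
      = LaurentPolynomial.C Complex.I * ((S.laurentTriple (X n)).1
          * (Gpoly ct α β r n + Kpoly ct α β r n))
        - 2 * LaurentPolynomial.C Complex.I
          * ((S.laurentTriple (X n)).2.1 * Fpoly ct α β r n) := by
  rw [laxF, h.seqFt_eq, h.seqGt_eq, map_mul,
    show LaurentPolynomial.C (2 : ℂ) = (2 : ℂ[T;T⁻¹]) from map_ofNat _ _]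
  rfl

theorem IsOrbit.laxG_eq (h : S.IsOrbit α β X) (n : ℤ) :
    S.laxG r ct (S.laurentTriple (X n)).1 (S.laurentTriple (X n)).2.2
      = LaurentPolynomial.C Complex.I * ((S.laurentTriple (X n)).1 * Hpoly ct α β r n
        - (S.laurentTriple (X n)).2.2 * Fpoly ct α β r n) := by
  rw [laxG, h.seqFt_eq, h.seqHt_eq]
  rfl

theorem IsOrbit.laxH_eq (h : S.IsOrbit α β X) (n : ℤ) :
    S.laxH r ct (S.laurentTriple (X n)).2.1 (S.laurentTriple (X n)).2.2
      = -(LaurentPolynomial.C Complex.I * ((S.laurentTriple (X n)).2.2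
          * (Gpoly ct α β r n + Kpoly ct α β r n))
        - 2 * LaurentPolynomial.C Complex.I
          * ((S.laurentTriple (X n)).2.1 * Hpoly ct α β r n)) := by
  rw [laxH, h.seqHt_eq, h.seqGt_eq, map_mul,
    show LaurentPolynomial.C (2 : ℂ) = (2 : ℂ[T;T⁻¹]) from map_ofNat _ _]
  rfl

/-- The link relations for Laurent polynomials. -/
theorem _root_.AblowitzLadik.PolyTriple.Link.laurent {X Y : PolyTriple} {a b : ℂ}
    (h : PolyTriple.Link a b X Y) :
    (LaurentPolynomial.T 1 * ((S.laurentTriple X).2.1 - (S.laurentTriple Y).2.1)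
      + LaurentPolynomial.C a * (S.laurentTriple X).2.2
      + LaurentPolynomial.T 1 * (LaurentPolynomial.C b * (S.laurentTriple Y).1) = 0) ∧
    ((S.laurentTriple Y).1 - LaurentPolynomial.T 1 * (S.laurentTriple X).1
      - LaurentPolynomial.C a * ((S.laurentTriple Y).2.1 + (S.laurentTriple X).2.1) = 0) ∧
    (LaurentPolynomial.T 1 * (LaurentPolynomial.C b
        * ((S.laurentTriple X).2.1 + (S.laurentTriple Y).2.1))
      + (S.laurentTriple X).2.2 - LaurentPolynomial.T 1 * (S.laurentTriple Y).2.2 = 0) ∧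
    ((S.laurentTriple Y).2.1 - (S.laurentTriple X).2.1
      - LaurentPolynomial.C a * (S.laurentTriple Y).2.2
      - LaurentPolynomial.T 1 * (LaurentPolynomial.C b * (S.laurentTriple X).1) = 0) := by
  have h1 : (LaurentPolynomial.T (1 - (S.deg false : ℤ)) : ℂ[T;T⁻¹])
      = LaurentPolynomial.T 1 * LaurentPolynomial.T (-(S.deg false : ℤ)) := by
    rw [← LaurentPolynomial.T_add]; rfl
  obtain ⟨r1, r2, r3, r4⟩ := h
  replace r1 := congrArg Polynomial.toLaurent r1
  replace r2 := congrArg Polynomial.toLaurent r2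
  replace r3 := congrArg Polynomial.toLaurent r3
  replace r4 := congrArg Polynomial.toLaurent r4
  simp only [map_add, map_sub, map_neg, map_mul, map_zero, Polynomial.toLaurent_C,
    Polynomial.toLaurent_X] at r1 r2 r3 r4
  simp only [laurentTriple, h1]
  refine ⟨?_, ?_, ?_, ?_⟩
  · linear_combination LaurentPolynomial.T 1 * LaurentPolynomial.T (-(S.deg false : ℤ)) * r1
  · linear_combination LaurentPolynomial.T (-(S.deg false : ℤ)) * r2
  · linear_combination LaurentPolynomial.T 1 * LaurentPolynomial.T (-(S.deg false : ℤ)) * r3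
  · linear_combination LaurentPolynomial.T (-(S.deg false : ℤ)) * r4

/-- No time derivative occurs here: this is an algebraic property of a single orbit, which says that
the Lax right-hand sides at neighbouring points are compatible with the links. -/
theorem IsOrbit.linkDeriv (h : S.IsOrbit α β X) (n : ℤ) :
    LinkDeriv (LaurentPolynomial.T 1 : ℂ[T;T⁻¹]) (LaurentPolynomial.C (α n))
      (LaurentPolynomial.C (β n)) (LaurentPolynomial.C (-Complex.I * sAL₁ ct α β r n))
      (LaurentPolynomial.C (-Complex.I * sAL₂ ct α β r n))
      (S.laurentTriple (X (n - 1))).1 (S.laurentTriple (X (n - 1))).2.1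
      (S.laurentTriple (X (n - 1))).2.2
      (S.laurentTriple (X n)).1 (S.laurentTriple (X n)).2.1 (S.laurentTriple (X n)).2.2
      (S.laxF r ct (S.laurentTriple (X (n - 1))).1 (S.laurentTriple (X (n - 1))).2.1)
      (S.laxG r ct (S.laurentTriple (X (n - 1))).1 (S.laurentTriple (X (n - 1))).2.2)
      (S.laxH r ct (S.laurentTriple (X (n - 1))).2.1 (S.laurentTriple (X (n - 1))).2.2)
      (S.laxF r ct (S.laurentTriple (X n)).1 (S.laurentTriple (X n)).2.1)
      (S.laxG r ct (S.laurentTriple (X n)).1 (S.laurentTriple (X n)).2.2)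
      (S.laxH r ct (S.laurentTriple (X n)).2.1 (S.laurentTriple (X n)).2.2) := by
  obtain ⟨r1, r2, r3, r4⟩ := (h.link n).laurent (S := S)
  rw [h.laxF_eq, h.laxG_eq, h.laxH_eq, h.laxF_eq, h.laxG_eq, h.laxH_eq, map_mul, map_mul, map_neg]
  exact LinkDeriv.of_lax r1 r2 r3 r4 (lattice₁₁ ct α β r n) (lattice₁₂ ct α β r n)
    (lattice₂₁ ct α β r n) (lattice₂₂ ct α β r n)

theorem IsCurveTriple.inRange {X : PolyTriple} (hX : S.IsCurveTriple X) :
    S.InRange (S.laurentTriple X).1 (S.laurentTriple X).2.1 (S.laurentTriple X).2.2 :=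
  ⟨fun j => (hX.coeff_laurent S j).1, fun j => (hX.coeff_laurent S j).2.1,
    fun j => (hX.coeff_laurent S j).2.2⟩

theorem IsCurveTriple.seq_zero {X : PolyTriple} (hX : S.IsCurveTriple X) :
    (S.seqF (S.laurentTriple X).1 true 0 = -(S.c0 true * S.tripleAlphaNext X) ∧
      S.seqF (S.laurentTriple X).1 false 0 = S.c0 false * S.tripleAlpha X) ∧
    (S.seqG (S.laurentTriple X).2.1 true 0 = S.c0 true / 2 ∧
      S.seqG (S.laurentTriple X).2.1 false 0 = S.c0 false / 2) ∧
    (S.seqH (S.laurentTriple X).2.2 true 0 = S.c0 true * S.tripleBeta X ∧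
      S.seqH (S.laurentTriple X).2.2 false 0 = -(S.c0 false * S.tripleBetaNext X)) := by
  have hd := S.deg_add_int
  refine ⟨⟨?_, ?_⟩, ⟨?_, ?_⟩, ?_, ?_⟩
  · rw [← hX.coeffF_top]; exact coeff_shift_of_eq _ (by push_cast; omega)
  · rw [← hX.coeffF_zero]; exact coeff_shift_of_eq _ rfl
  · rw [← hX.topG]; exact coeff_shift_of_eq _ (by push_cast; omega)
  · rw [← hX.botG]; exact coeff_shift_of_eq _ rfl
  · rw [← hX.coeffH_top]; exact coeff_shift_of_eq _ (by push_cast; omega)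
  · rw [← hX.coeffH_zero]; exact coeff_shift_of_eq _ (by push_cast; omega)

/-- The end coefficients of the Lax equations are the Ablowitz-Ladik expressions. -/
theorem IsOrbit.coeff_lax_end (h : S.IsOrbit α β X) (n : ℤ) :
    ((S.c0 false)⁻¹ * (S.laxF r ct (S.laurentTriple (X n)).1 (S.laurentTriple (X n)).2.1).coeff
        (-(S.deg false : ℤ)) = -Complex.I * sAL₁ ct α β r n ∧
      (S.c0 true)⁻¹ * (S.laxH r ct (S.laurentTriple (X n)).2.1 (S.laurentTriple (X n)).2.2).coeff
        (S.deg true : ℤ) = -Complex.I * sAL₂ ct α β r n) ∧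
    -(S.c0 true)⁻¹ * (S.laxF r ct (S.laurentTriple (X n)).1 (S.laurentTriple (X n)).2.1).coeff
        ((S.deg true : ℤ) - 1) = -Complex.I * sAL₁ ct α β r (n + 1) ∧
      -(S.c0 false)⁻¹ * (S.laxH r ct (S.laurentTriple (X n)).2.1 (S.laurentTriple (X n)).2.2).coeff
        (-(S.deg false : ℤ) + 1) = -Complex.I * sAL₂ ct α β r (n + 1) := by
  have hR := (h.triple n).inRange
  obtain ⟨⟨f1, f2⟩, ⟨g1, g2⟩, h1, h2⟩ := (h.triple n).seq_zero
  have hn := h.link (n + 1)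
  rw [add_sub_cancel_right] at hn
  obtain ⟨-, -, e1, e2⟩ := (h.triple n).link_values (h.triple (n + 1)) hn
  obtain ⟨e3, e4⟩ := h.tripleAlpha_eq n
  rw [e1] at f1; rw [e2] at h2; rw [e3] at f2; rw [e4] at h1
  have c1 : (S.c0 true)⁻¹ * S.c0 true = 1 := inv_mul_cancel₀ (S.c0_ne_zero _)
  have c2 : (S.c0 false)⁻¹ * S.c0 false = 1 := inv_mul_cancel₀ (S.c0_ne_zero _)
  have p1 := hR.coeff_laxF (r := r) (ct := ct) false 0
  have p2 := hR.coeff_laxH (r := r) (ct := ct) true 0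
  have p3 := hR.coeff_laxF (r := r) (ct := ct) true 0
  have p4 := hR.coeff_laxH (r := r) (ct := ct) false 0
  rw [show S.posF false (0 : ℕ) = -(S.deg false : ℤ) by simp [posF], h.seqFt_eq, h.seqGt_eq, flowF,
    Finset.sum_range_one, f2, g2] at p1
  rw [show S.posH true (0 : ℕ) = S.deg true by simp [posH], h.seqHt_eq, h.seqGt_eq, flowF,
    Finset.sum_range_one, h1, g1] at p2
  rw [show S.posF true (0 : ℕ) = S.deg true - 1 by simp [posF], h.seqFt_eq, h.seqGt_eq, flowF,
    Finset.sum_range_one, f1, g1] at p3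
  rw [show S.posH false (0 : ℕ) = -(S.deg false : ℤ) + 1 by simp [posH], h.seqHt_eq, h.seqGt_eq,
    flowF, Finset.sum_range_one, h2, g2] at p4
  simp only [Nat.cast_zero, sub_zero, add_zero, Bool.not_false, Bool.not_true] at p1 p2 p3 p4
  rw [p1, p2, p3, p4]
  -- The equations with `ℓ = 0` involve the coefficients of index `r_±` at one point. One step of
  -- the recursion replaces them by coefficients of index `r_± - 1` and by shifted `g̃`, as in the
  -- Ablowitz-Ladik expression.
  obtain ⟨a1, -, -⟩ := ext_minus_recursion ct α β (r false) n
  obtain ⟨-, -, a2⟩ := ext_plus_recursion ct α β (r true) n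
  obtain ⟨a3, -, -⟩ := ext_plus_recursion ct α β (r true) (n + 1)
  obtain ⟨-, -, a4⟩ := ext_minus_recursion ct α β (r false) (n + 1)
  rw [add_sub_cancel_right] at a3 a4
  simp only [fExt, gExt, hExt] at a1 a2 a3 a4
  simp only [sAL₁, sAL₂, ext0_natCast, add_sub_cancel_right] at a1 a2 a3 a4 ⊢
  refine ⟨⟨?_, ?_⟩, ?_, ?_⟩
  · linear_combination Complex.I * (α n * (gCoef ct α β true (r true) n
        - gCoef ct α β false (r false) n) + fCoef ct α β false (r false) n
        - ext0 (fun ℓ => fCoef ct α β true ℓ n) ((r true : ℤ) - 1)) * c2 + Complex.I * a1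
  · linear_combination -Complex.I * (β n * (gCoef ct α β false (r false) n
        - gCoef ct α β true (r true) n) + hCoef ct α β true (r true) n
        - ext0 (fun ℓ => hCoef ct α β false ℓ n) ((r false : ℤ) - 1)) * c1 - Complex.I * a2
  · linear_combination -Complex.I * (α (n + 1) * (gCoef ct α β true (r true) n
        - gCoef ct α β false (r false) n) + fCoef ct α β true (r true) n
        - ext0 (fun ℓ => fCoef ct α β false ℓ n) ((r false : ℤ) - 1)) * c1 - Complex.I * a3
  · linear_combination Complex.I * (β (n + 1) * (gCoef ct α β false (r false) n
        - gCoef ct α β true (r true) n) + hCoef ct α β false (r false) n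
        - ext0 (fun ℓ => hCoef ct α β true ℓ n) ((r true : ℤ) - 1)) * c2 + Complex.I * a4

end Static

section Dynamic

variable {α β : ℝ → ℤ → ℂ} {X : ℝ → ℤ → PolyTriple} {t : ℝ}

variable (S r ct X t) in
/-- The Laurent polynomials of the triples `X τ n` satisfy the Lax equations at `t`. -/
structure IsLax (n : ℤ) : Prop where
  F : HasLDerivAt (fun τ => (S.laurentTriple (X τ n)).1)
    (S.laxF r ct (S.laurentTriple (X t n)).1 (S.laurentTriple (X t n)).2.1) t
  G : HasLDerivAt (fun τ => (S.laurentTriple (X τ n)).2.1)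
    (S.laxG r ct (S.laurentTriple (X t n)).1 (S.laurentTriple (X t n)).2.2) t
  H : HasLDerivAt (fun τ => (S.laurentTriple (X τ n)).2.2)
    (S.laxH r ct (S.laurentTriple (X t n)).2.1 (S.laurentTriple (X t n)).2.2) t

/-- The Lax equations at one lattice point imply the Ablowitz-Ladik equations there. -/
theorem IsLax.hasDerivAt {n : ℤ} (h : S.IsLax r ct X t n)
    (hO : ∀ᶠ τ in 𝓝 t, S.IsOrbit (α τ) (β τ) (X τ)) :
    HasDerivAt (fun τ => α τ n) (-Complex.I * sAL₁ ct (α t) (β t) r n) t ∧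
      HasDerivAt (fun τ => β τ n) (-Complex.I * sAL₂ ct (α t) (β t) r n) t := by
  obtain ⟨⟨e1, e2⟩, -⟩ := (hO.self_of_nhds).coeff_lax_end (r := r) (ct := ct) n
  rw [← e1, ← e2]
  refine ⟨((h.F.coeff _).const_mul _).congr_of_eventuallyEq ?_,
    ((h.H.coeff _).const_mul _).congr_of_eventuallyEq ?_⟩
  · filter_upwards [hO] with τ hτ
    rw [← (hτ.tripleAlpha_eq n).1, ← alphaOf_laurentTriple]
    rfl
  · filter_upwards [hO] with τ hτ
    rw [← (hτ.tripleAlpha_eq n).2, ← betaOf_laurentTriple]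
    rfl

/-- The Lax equations at one lattice point imply the Ablowitz-Ladik equations at the next one. -/
theorem IsLax.hasDerivAt_next {n : ℤ} (h : S.IsLax r ct X t n)
    (hO : ∀ᶠ τ in 𝓝 t, S.IsOrbit (α τ) (β τ) (X τ)) :
    HasDerivAt (fun τ => α τ (n + 1)) (-Complex.I * sAL₁ ct (α t) (β t) r (n + 1)) t ∧
      HasDerivAt (fun τ => β τ (n + 1)) (-Complex.I * sAL₂ ct (α t) (β t) r (n + 1)) t := by
  obtain ⟨-, e1, e2⟩ := (hO.self_of_nhds).coeff_lax_end (r := r) (ct := ct) n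
  have hv : ∀ᶠ τ in 𝓝 t, S.tripleAlphaNext (X τ n) = α τ (n + 1) ∧
      S.tripleBetaNext (X τ n) = β τ (n + 1) := by
    filter_upwards [hO] with τ hτ
    have hn := hτ.link (n + 1)
    rw [add_sub_cancel_right] at hn
    exact ((hτ.triple n).link_values (hτ.triple (n + 1)) hn).2.2
  rw [← e1, ← e2]
  refine ⟨((h.F.coeff _).const_mul _).congr_of_eventuallyEq ?_,
    ((h.H.coeff _).const_mul _).congr_of_eventuallyEq ?_⟩
  · filter_upwards [hv] with τ hτ
    rw [← hτ.1, ← alphaPlusOf_laurentTriple]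
    rfl
  · filter_upwards [hv] with τ hτ
    rw [← hτ.2, ← betaPlusOf_laurentTriple]
    rfl

/-- Differentiating the link relations. -/
theorem linkDeriv_of_hasLDerivAt {a b : ℝ → ℂ} {X Y : ℝ → PolyTriple} {a' b' : ℂ}
    {F₀' G₀' H₀' F₁' G₁' H₁' : ℂ[T;T⁻¹]}
    (h : ∀ᶠ τ in 𝓝 t, PolyTriple.Link (a τ) (b τ) (X τ) (Y τ))
    (ha : HasDerivAt a a' t) (hb : HasDerivAt b b' t)
    (hF₀ : HasLDerivAt (fun τ => (S.laurentTriple (X τ)).1) F₀' t)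
    (hG₀ : HasLDerivAt (fun τ => (S.laurentTriple (X τ)).2.1) G₀' t)
    (hH₀ : HasLDerivAt (fun τ => (S.laurentTriple (X τ)).2.2) H₀' t)
    (hF₁ : HasLDerivAt (fun τ => (S.laurentTriple (Y τ)).1) F₁' t)
    (hG₁ : HasLDerivAt (fun τ => (S.laurentTriple (Y τ)).2.1) G₁' t)
    (hH₁ : HasLDerivAt (fun τ => (S.laurentTriple (Y τ)).2.2) H₁' t) :
    LinkDeriv (LaurentPolynomial.T 1 : ℂ[T;T⁻¹]) (LaurentPolynomial.C (a t))
      (LaurentPolynomial.C (b t)) (LaurentPolynomial.C a') (LaurentPolynomial.C b')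
      (S.laurentTriple (X t)).1 (S.laurentTriple (X t)).2.1 (S.laurentTriple (X t)).2.2
      (S.laurentTriple (Y t)).1 (S.laurentTriple (Y t)).2.1 (S.laurentTriple (Y t)).2.2
      F₀' G₀' H₀' F₁' G₁' H₁' where
  rel₁₁ := ((((hG₀.sub hG₁).const_mul (LaurentPolynomial.T 1)).add
    ((HasLDerivAt.C ha).mul hH₀)).add (((HasLDerivAt.C hb).mul hF₁).const_mul
    (LaurentPolynomial.T 1))).unique ((HasLDerivAt.const 0).congr
      (h.mono fun _ hτ => (hτ.laurent (S := S)).1))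
  rel₁₂ := ((hF₁.sub (hF₀.const_mul (LaurentPolynomial.T 1))).sub
    ((HasLDerivAt.C ha).mul (hG₁.add hG₀))).unique ((HasLDerivAt.const 0).congr
      (h.mono fun _ hτ => (hτ.laurent (S := S)).2.1))
  rel₂₁ := (((((HasLDerivAt.C hb).mul (hG₀.add hG₁)).const_mul (LaurentPolynomial.T 1)).add
    hH₀).sub (hH₁.const_mul (LaurentPolynomial.T 1))).unique ((HasLDerivAt.const 0).congr
      (h.mono fun _ hτ => (hτ.laurent (S := S)).2.2.1))
  rel₂₂ := (((hG₁.sub hG₀).sub ((HasLDerivAt.C ha).mul hH₁)).sub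
    (((HasLDerivAt.C hb).mul hF₀).const_mul (LaurentPolynomial.T 1))).unique
      ((HasLDerivAt.const 0).congr (h.mono fun _ hτ => (hτ.laurent (S := S)).2.2.2))

theorem isUnit_one_sub_C_mul {a b : ℂ} (h : 1 - a * b ≠ 0) :
    IsUnit (1 - LaurentPolynomial.C a * LaurentPolynomial.C b : ℂ[T;T⁻¹]) := by
  rw [← map_mul, ← map_one LaurentPolynomial.C, ← map_sub]
  exact (isUnit_iff_ne_zero.2 h).map _

/-- The step is rational in the coefficients with denominator `1 - a b`. Only the existence of
derivatives is recorded; their values are identified afterwards from the linearized link. -/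
theorem exists_hasLDerivAt_stepUp {a b : ℝ → ℂ} {a' b' : ℂ}
    {L : ℝ → ℂ[T;T⁻¹] × ℂ[T;T⁻¹] × ℂ[T;T⁻¹]} {F' G' H' : ℂ[T;T⁻¹]}
    (ha : HasDerivAt a a' t) (hb : HasDerivAt b b' t) (hab : 1 - a t * b t ≠ 0)
    (hF : HasLDerivAt (fun τ => (L τ).1) F' t) (hG : HasLDerivAt (fun τ => (L τ).2.1) G' t)
    (hH : HasLDerivAt (fun τ => (L τ).2.2) H' t)
    (hL : ∀ᶠ τ in 𝓝 t, S.alphaPlusOf (L τ) = a τ ∧ S.betaPlusOf (L τ) = b τ) :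
    ∃ F' G' H', HasLDerivAt (fun τ => (S.stepUp (L τ)).1) F' t ∧
      HasLDerivAt (fun τ => (S.stepUp (L τ)).2.1) G' t ∧
      HasLDerivAt (fun τ => (S.stepUp (L τ)).2.2) H' t := by
  have hz := HasLDerivAt.const (t := t) (LaurentPolynomial.T 1)
  have hz2 := HasLDerivAt.const (t := t) (LaurentPolynomial.T 1 ^ 2)
  have hw := (HasLDerivAt.C (((ha.mul hb).const_sub 1).inv hab)).mul
    (HasLDerivAt.const (t := t) (LaurentPolynomial.T (-1)))
  refine ⟨_, _, _, (hw.mul ((((HasLDerivAt.C (ha.pow 2)).mul hH).add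
      (((HasLDerivAt.C (ha.const_mul 2)).mul hz).mul hG)).add (hz2.mul hF))).congr ?_,
    (hw.mul (((((HasLDerivAt.C ((ha.mul hb).const_add 1)).mul hz).mul hG).add
      ((HasLDerivAt.C ha).mul hH)).add (((HasLDerivAt.C hb).mul hz2).mul hF))).congr ?_,
    (hw.mul (((((HasLDerivAt.C (hb.pow 2)).mul hz2).mul hF).add
      (((HasLDerivAt.C (hb.const_mul 2)).mul hz).mul hG)).add hH)).congr ?_⟩ <;>
  · filter_upwards [hL] with τ hτ
    rw [stepUp, hτ.1, hτ.2]
    rfl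

theorem exists_hasLDerivAt_stepDown {a b : ℝ → ℂ} {a' b' : ℂ}
    {L : ℝ → ℂ[T;T⁻¹] × ℂ[T;T⁻¹] × ℂ[T;T⁻¹]} {F' G' H' : ℂ[T;T⁻¹]}
    (ha : HasDerivAt a a' t) (hb : HasDerivAt b b' t) (hab : 1 - a t * b t ≠ 0)
    (hF : HasLDerivAt (fun τ => (L τ).1) F' t) (hG : HasLDerivAt (fun τ => (L τ).2.1) G' t)
    (hH : HasLDerivAt (fun τ => (L τ).2.2) H' t)
    (hL : ∀ᶠ τ in 𝓝 t, S.alphaOf (L τ) = a τ ∧ S.betaOf (L τ) = b τ) :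
    ∃ F' G' H', HasLDerivAt (fun τ => (S.stepDown (L τ)).1) F' t ∧
      HasLDerivAt (fun τ => (S.stepDown (L τ)).2.1) G' t ∧
      HasLDerivAt (fun τ => (S.stepDown (L τ)).2.2) H' t := by
  have hz := HasLDerivAt.const (t := t) (LaurentPolynomial.T 1)
  have hzi := HasLDerivAt.const (t := t) (LaurentPolynomial.T (-1))
  have hw := HasLDerivAt.C (((ha.mul hb).const_sub 1).inv hab)
  refine ⟨_, _, _, ((hw.mul hzi).mul ((((HasLDerivAt.C (ha.pow 2)).mul hH).sub
      ((HasLDerivAt.C (ha.const_mul 2)).mul hG)).add hF)).congr ?_,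
    (hw.mul ((((HasLDerivAt.C ((ha.mul hb).const_add 1)).mul hG).sub
      ((HasLDerivAt.C ha).mul hH)).sub ((HasLDerivAt.C hb).mul hF))).congr ?_,
    ((hw.mul hz).mul ((((HasLDerivAt.C (hb.pow 2)).mul hF).sub
      ((HasLDerivAt.C (hb.const_mul 2)).mul hG)).add hH)).congr ?_⟩ <;>
  · filter_upwards [hL] with τ hτ
    rw [stepDown, hτ.1, hτ.2]
    rfl

/-- The Lax equations propagate to the next lattice point. -/
theorem IsLax.succ {n : ℤ} (h : S.IsLax r ct X t n)
    (hO : ∀ᶠ τ in 𝓝 t, S.IsOrbit (α τ) (β τ) (X τ))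
    (h1 : ∀ᶠ τ in 𝓝 t, ∀ n, 1 - α τ n * β τ n ≠ 0) : S.IsLax r ct X t (n + 1) := by
  have hl : ∀ᶠ τ in 𝓝 t, PolyTriple.Link (α τ (n + 1)) (β τ (n + 1)) (X τ n) (X τ (n + 1)) := by
    filter_upwards [hO] with τ hτ
    have hn := hτ.link (n + 1)
    rwa [add_sub_cancel_right] at hn
  -- The Lax equations at `n` already contain the equations for `α, β` at `n + 1`, as end
  -- coefficients. Hence the coefficients of the step are differentiable.
  obtain ⟨da, db⟩ := h.hasDerivAt_next hO
  have hab := h1.self_of_nhds (n + 1)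
  obtain ⟨F', G', H', hF, hG, hH⟩ := exists_hasLDerivAt_stepUp (S := S) (a := fun τ => α τ (n + 1))
    (b := fun τ => β τ (n + 1)) (L := fun τ => S.laurentTriple (X τ n)) da db hab h.F h.G h.H (by
      filter_upwards [hO, hl] with τ hτ hlτ
      rw [alphaPlusOf_laurentTriple, betaPlusOf_laurentTriple]
      exact ((hτ.triple n).link_values (hτ.triple (n + 1)) hlτ).2.2)
  have hstep : ∀ᶠ τ in 𝓝 t, S.laurentTriple (X τ (n + 1)) = S.stepUp (S.laurentTriple (X τ n)) := by
    filter_upwards [hO, hl, h1] with τ hτ hlτ h1τ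
    rw [(hτ.triple n).stepUp_laurentTriple,
      (hτ.triple n).up_eq_of_link (hτ.triple (n + 1)) hlτ (h1τ _)]
  replace hF := hF.congr (hstep.mono fun τ e => congrArg (·.1) e)
  replace hG := hG.congr (hstep.mono fun τ e => congrArg (·.2.1) e)
  replace hH := hH.congr (hstep.mono fun τ e => congrArg (·.2.2) e)
  -- The actual derivatives and the Lax right-hand sides solve the same linearized relations with
  -- the same data at `n`; by uniqueness they agree at `n + 1`.
  have e1 := linkDeriv_of_hasLDerivAt hl da db h.F h.G h.H hF hG hH
  have e2 := hO.self_of_nhds.linkDeriv (r := r) (ct := ct) (n + 1)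
  rw [add_sub_cancel_right] at e2
  obtain ⟨rfl, rfl, rfl⟩ := e1.unique_up (LaurentPolynomial.isUnit_T 1) (isUnit_one_sub_C_mul hab) e2
  exact ⟨hF, hG, hH⟩

/-- The Lax equations propagate to the previous lattice point. -/
theorem IsLax.pred {n : ℤ} (h : S.IsLax r ct X t n)
    (hO : ∀ᶠ τ in 𝓝 t, S.IsOrbit (α τ) (β τ) (X τ))
    (h1 : ∀ᶠ τ in 𝓝 t, ∀ n, 1 - α τ n * β τ n ≠ 0) : S.IsLax r ct X t (n - 1) := by
  have hl : ∀ᶠ τ in 𝓝 t, PolyTriple.Link (α τ n) (β τ n) (X τ (n - 1)) (X τ n) :=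
    hO.mono fun τ hτ => hτ.link n
  obtain ⟨da, db⟩ := h.hasDerivAt hO
  have hab := h1.self_of_nhds n
  obtain ⟨F', G', H', hF, hG, hH⟩ := exists_hasLDerivAt_stepDown (S := S) (a := fun τ => α τ n)
    (b := fun τ => β τ n) (L := fun τ => S.laurentTriple (X τ n)) da db hab h.F h.G h.H (by
      filter_upwards [hO] with τ hτ
      rw [alphaOf_laurentTriple, betaOf_laurentTriple]
      exact hτ.tripleAlpha_eq n)
  have hstep : ∀ᶠ τ in 𝓝 t,
      S.laurentTriple (X τ (n - 1)) = S.stepDown (S.laurentTriple (X τ n)) := by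
    filter_upwards [hO, hl, h1] with τ hτ hlτ h1τ
    rw [(hτ.triple n).stepDown_laurentTriple,
      (hτ.triple (n - 1)).down_eq_of_link (hτ.triple n) hlτ (h1τ _)]
  replace hF := hF.congr (hstep.mono fun τ e => congrArg (·.1) e)
  replace hG := hG.congr (hstep.mono fun τ e => congrArg (·.2.1) e)
  replace hH := hH.congr (hstep.mono fun τ e => congrArg (·.2.2) e)
  -- The same argument with the right neighbour known, using uniqueness for the left one.
  have e1 := linkDeriv_of_hasLDerivAt hl da db hF hG hH h.F h.G h.H
  have e2 := hO.self_of_nhds.linkDeriv (r := r) (ct := ct) n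
  obtain ⟨rfl, rfl, rfl⟩ := e1.unique_down (LaurentPolynomial.isUnit_T 1)
    (isUnit_one_sub_C_mul hab) e2
  exact ⟨hF, hG, hH⟩

theorem IsLax.all {n₀ : ℤ} (h : S.IsLax r ct X t n₀)
    (hO : ∀ᶠ τ in 𝓝 t, S.IsOrbit (α τ) (β τ) (X τ))
    (h1 : ∀ᶠ τ in 𝓝 t, ∀ n, 1 - α τ n * β τ n ≠ 0) (n : ℤ) : S.IsLax r ct X t n := by
  induction n using Int.inductionOn' (b := n₀) with
  | zero => exact h
  | succ k hk ih => exact ih.succ hO h1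
  | pred k hk ih => exact ih.pred hO h1

end Dynamic

end SpectralData

end AblowitzLadik

end

/-! ### Zero-curvature matrices, continuity, and the constructed solution -/

noncomputable section

open Polynomial

namespace AblowitzLadik

open Filter Topology

/-! ### Zero-curvature matrices -/

theorem Umat_mul_Vmat (z : ℂˣ) (a b : ℂ) (F G H K : ℤ → ℂ[T;T⁻¹]) (n : ℤ) :
    Umat z a b * Vmat z F G H K n - Vmat z F G H K (n + 1) * Umat z a b = Complex.I •
      !![(z : ℂ) * (lval z (G (n - 1)) - lval z (G n)) + a * lval z (H (n - 1))
          + z * (b * lval z (F n)),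
        lval z (F n) - z * lval z (F (n - 1)) - a * (lval z (G n) + lval z (K (n - 1)));
        z * (b * (lval z (G (n - 1)) + lval z (K n))) + lval z (H (n - 1)) - z * lval z (H n),
        lval z (K n) - lval z (K (n - 1)) - a * lval z (H n) - z * (b * lval z (F (n - 1)))] := by
  rw [Umat, Vmat, Vmat, add_sub_cancel_right]
  ext i j
  fin_cases i <;> fin_cases j <;> simp [Matrix.mul_apply, Fin.sum_univ_two] <;> ring

theorem lval_one_T (z : ℂˣ) : lval z (LaurentPolynomial.T 1) = z := by rw [lval_T, zpow_one]

/-- Since only the off-diagonal entries survive, the matrix zero-curvature equation is equivalent to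
the two scalar Ablowitz-Ladik equations. -/
theorem Umat_mul_Vmat_lattice (c : Bool → ℕ → ℂ) (α β : ℤ → ℂ) (d : Bool → ℕ) (z : ℂˣ) (n : ℤ) :
    Umat z (α n) (β n) * Vmat z (Fpoly c α β d) (Gpoly c α β d) (Hpoly c α β d) (Kpoly c α β d) n
      - Vmat z (Fpoly c α β d) (Gpoly c α β d) (Hpoly c α β d) (Kpoly c α β d) (n + 1)
        * Umat z (α n) (β n)
      = Complex.I • !![0, sAL₁ c α β d n; z * sAL₂ c α β d n, 0] := by
  have e1 := congrArg (lval z) (lattice₁₁ c α β d n)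
  have e2 := congrArg (lval z) (lattice₁₂ c α β d n)
  have e3 := congrArg (lval z) (lattice₂₁ c α β d n)
  have e4 := congrArg (lval z) (lattice₂₂ c α β d n)
  have h0 : lval z 0 = 0 := map_zero _
  simp only [lval_add, lval_sub, lval_mul, lval_C, lval_one_T, h0] at e1 e2 e3 e4
  rw [Umat_mul_Vmat, e1, e2, e3, e4]

namespace SpectralData

variable {S : SpectralData} {r : Bool → ℕ} {ct : Bool → ℕ → ℂ}

theorem _root_.AblowitzLadik.PolyTriple.Link.Umat_mul_Vmat {X : ℤ → PolyTriple} {a b : ℂ} {n : ℤ}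
    (h : PolyTriple.Link a b (X (n - 1)) (X n)) (z : ℂˣ) :
    Umat z a b * Vmat z (fun n => (S.laurentTriple (X n)).1) (fun n => (S.laurentTriple (X n)).2.1)
        (fun n => (S.laurentTriple (X n)).2.2) (fun n => (S.laurentTriple (X n)).2.1) n
      - Vmat z (fun n => (S.laurentTriple (X n)).1) (fun n => (S.laurentTriple (X n)).2.1)
        (fun n => (S.laurentTriple (X n)).2.2) (fun n => (S.laurentTriple (X n)).2.1) (n + 1)
        * Umat z a b = 0 := by
  obtain ⟨e1, e2, e3, e4⟩ := h.laurent (S := S)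
  replace e1 := congrArg (lval z) e1
  replace e2 := congrArg (lval z) e2
  replace e3 := congrArg (lval z) e3
  replace e4 := congrArg (lval z) e4
  have h0 : lval z 0 = 0 := map_zero _
  simp only [lval_add, lval_sub, lval_mul, lval_C, lval_one_T, h0] at e1 e2 e3 e4
  rw [AblowitzLadik.Umat_mul_Vmat, e1, e2, e3, e4]
  ext i j
  fin_cases i <;> fin_cases j <;> simp

/-- The matrix `i (G', -F'; H', -G')` of the derivatives solves the Lax equation. -/
theorem IsOrbit.lax_matrix {α β : ℤ → ℂ} {X : ℤ → PolyTriple} (h : S.IsOrbit α β X) (z : ℂˣ)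
    (n : ℤ) :
    Vmat z (fun n => S.laxF r ct (S.laurentTriple (X n)).1 (S.laurentTriple (X n)).2.1)
        (fun n => S.laxG r ct (S.laurentTriple (X n)).1 (S.laurentTriple (X n)).2.2)
        (fun n => S.laxH r ct (S.laurentTriple (X n)).2.1 (S.laurentTriple (X n)).2.2)
        (fun n => S.laxG r ct (S.laurentTriple (X n)).1 (S.laurentTriple (X n)).2.2) n
      - (Vmat z (Fpoly ct α β r) (Gpoly ct α β r) (Hpoly ct α β r) (Kpoly ct α β r) n
          * Vmat z (fun n => (S.laurentTriple (X n)).1) (fun n => (S.laurentTriple (X n)).2.1)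
            (fun n => (S.laurentTriple (X n)).2.2) (fun n => (S.laurentTriple (X n)).2.1) n
        - Vmat z (fun n => (S.laurentTriple (X n)).1) (fun n => (S.laurentTriple (X n)).2.1)
            (fun n => (S.laurentTriple (X n)).2.2) (fun n => (S.laurentTriple (X n)).2.1) n
          * Vmat z (Fpoly ct α β r) (Gpoly ct α β r) (Hpoly ct α β r) (Kpoly ct α β r) n) = 0 := by
  have h2 : lval z 2 = 2 := map_ofNat (LaurentPolynomial.eval₂ (RingHom.id ℂ) z) 2
  simp only [Vmat, h.laxF_eq, h.laxG_eq, h.laxH_eq, lval_add, lval_sub, lval_mul, lval_neg, lval_C, h2]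
  ext i j
  fin_cases i <;> fin_cases j <;> simp [Matrix.mul_apply, Fin.sum_univ_two] <;> ring

theorem hasDerivAt_Vmat {F G H : ℝ → ℤ → ℂ[T;T⁻¹]} {F' G' H' : ℤ → ℂ[T;T⁻¹]} {t : ℝ} {n : ℤ}
    (hF : HasLDerivAt (fun τ => F τ (n - 1)) (F' (n - 1)) t)
    (hG : HasLDerivAt (fun τ => G τ (n - 1)) (G' (n - 1)) t)
    (hH : HasLDerivAt (fun τ => H τ (n - 1)) (H' (n - 1)) t) (z : ℂˣ) (i j : Fin 2) :
    HasDerivAt (fun τ => Vmat z (F τ) (G τ) (H τ) (G τ) n i j) (Vmat z F' G' H' G' n i j) t := by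
  have dF := (hF.lval z).neg.const_mul Complex.I
  have dG := (hG.lval z).const_mul Complex.I
  have dG' := (hG.lval z).neg.const_mul Complex.I
  have dH := (hH.lval z).const_mul Complex.I
  fin_cases i <;> fin_cases j
  · exact dG
  · exact dF
  · exact dH
  · exact dG'

theorem hasDerivAt_Umat {a b : ℝ → ℂ} {a' b' : ℂ} {t : ℝ} (ha : HasDerivAt a a' t)
    (hb : HasDerivAt b b' t) (z : ℂˣ) (i j : Fin 2) :
    HasDerivAt (fun τ => Umat z (a τ) (b τ) i j)
      ((!![0, a'; (z : ℂ) * b', 0] : Matrix (Fin 2) (Fin 2) ℂ) i j) t := by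
  have hb' := hb.const_mul (z : ℂ)
  fin_cases i <;> fin_cases j
  · exact hasDerivAt_const t (z : ℂ)
  · exact ha
  · exact hb'
  · exact hasDerivAt_const t (1 : ℂ)

/-! ### Continuity of the Ablowitz-Ladik expressions -/

section Continuity

variable {α β : ℝ → ℤ → ℂ} {s : Set ℝ}

/-- Each homogeneous coefficient is a polynomial in finitely many shifts of `α, β`. This gives
continuity of the right-hand sides, and so `α, β` are of class `C¹`. -/
theorem continuousOn_hatPlus (hα : ∀ n, ContinuousOn (fun τ => α τ n) s)
    (hβ : ∀ n, ContinuousOn (fun τ => β τ n) s) (ℓ : ℕ) : ∀ n,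
    ContinuousOn (fun τ => (hatPlus (α τ) (β τ) ℓ).1 n) s ∧
    ContinuousOn (fun τ => (hatPlus (α τ) (β τ) ℓ).2.1 n) s ∧
    ContinuousOn (fun τ => (hatPlus (α τ) (β τ) ℓ).2.2 n) s := by
  induction ℓ using Nat.strong_induction_on with
  | _ ℓ ih =>
    rcases ℓ with _ | ℓ
    · intro n
      have e := fun τ => hatPlus_zero (α τ) (β τ)
      exact ⟨(hα (n + 1)).neg.congr fun τ _ => by rw [e]; rfl,
        (continuousOn_const (c := (1 / 2 : ℂ))).congr fun τ _ => by rw [e],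
        (hβ n).congr fun τ _ => by rw [e]⟩
    · have hG : ∀ n, ContinuousOn (fun τ => (hatPlus (α τ) (β τ) (ℓ + 1)).2.1 n) s := by
        intro n
        refine ContinuousOn.congr ?_ fun τ _ => hatPlus_g_succ (α τ) (β τ) ℓ n
        refine (continuousOn_finsetSum _ fun k hk => ?_).sub (continuousOn_finsetSum _ fun k hk => ?_)
        · have := Finset.mem_range.1 hk
          exact (ih (ℓ - k) (by omega) n).1.mul (ih k (by omega) n).2.2
        · have := Finset.mem_range.1 hk
          exact (ih (ℓ - k) (by omega) n).2.1.mul (ih (k + 1) (by omega) n).2.1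
      intro n
      refine ⟨?_, hG n, ?_⟩
      · refine ContinuousOn.congr ?_ fun τ _ => hatPlus_f_succ (α τ) (β τ) ℓ n
        exact (ih ℓ (by omega) (n + 1)).1.sub ((hα _).mul ((hG _).add (hG _)))
      · refine ContinuousOn.congr ?_ fun τ _ => hatPlus_h_succ (α τ) (β τ) ℓ n
        exact (ih ℓ (by omega) (n - 1)).2.2.add ((hβ _).mul ((hG _).add (hG _)))

theorem continuousOn_coef (hα : ∀ n, ContinuousOn (fun τ => α τ n) s)
    (hβ : ∀ n, ContinuousOn (fun τ => β τ n) s)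
    (c : Bool → ℕ → ℂ) (b : Bool) (ℓ : ℕ) (n : ℤ) :
    ContinuousOn (fun τ => fCoef c (α τ) (β τ) b ℓ n) s ∧
    ContinuousOn (fun τ => gCoef c (α τ) (β τ) b ℓ n) s ∧
    ContinuousOn (fun τ => hCoef c (α τ) (β τ) b ℓ n) s := by
  have h1 := fun k => continuousOn_hatPlus hα hβ k n
  have h2 := fun k => continuousOn_hatPlus hβ hα k n
  unfold fCoef gCoef hCoef conv
  refine ⟨continuousOn_finsetSum _ fun k _ => continuousOn_const.mul ?_,
    continuousOn_finsetSum _ fun k _ => continuousOn_const.mul ?_,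
    continuousOn_finsetSum _ fun k _ => continuousOn_const.mul ?_⟩ <;> cases b
  · exact (h2 k).2.2
  · exact (h1 k).1
  · exact (h2 k).2.1
  · exact (h1 k).2.1
  · exact (h2 k).1
  · exact (h1 k).2.2

theorem continuousOn_ext (hα : ∀ n, ContinuousOn (fun τ => α τ n) s)
    (hβ : ∀ n, ContinuousOn (fun τ => β τ n) s)
    (c : Bool → ℕ → ℂ) (b : Bool) (m n : ℤ) :
    ContinuousOn (fun τ => ext0 (fun ℓ => fCoef c (α τ) (β τ) b ℓ n) m) s ∧
    ContinuousOn (fun τ => ext0 (fun ℓ => hCoef c (α τ) (β τ) b ℓ n) m) s := by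
  unfold ext0
  split_ifs
  · exact ⟨(continuousOn_coef hα hβ c b _ n).1, (continuousOn_coef hα hβ c b _ n).2.2⟩
  · exact ⟨continuousOn_const, continuousOn_const⟩

theorem continuousOn_sAL (hα : ∀ n, ContinuousOn (fun τ => α τ n) s)
    (hβ : ∀ n, ContinuousOn (fun τ => β τ n) s)
    (c : Bool → ℕ → ℂ) (d : Bool → ℕ) (n : ℤ) :
    ContinuousOn (fun τ => sAL₁ c (α τ) (β τ) d n) s ∧
    ContinuousOn (fun τ => sAL₂ c (α τ) (β τ) d n) s := by
  have hG := fun b ℓ n => (continuousOn_coef hα hβ c b ℓ n).2.1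
  have hE := continuousOn_ext hα hβ c
  exact ⟨((((hα n).neg).mul ((hG _ _ _).add (hG _ _ _))).add (hE _ _ _).1).sub (hE _ _ _).1,
    (((hβ n).mul ((hG _ _ _).add (hG _ _ _))).add (hE _ _ _).2).sub (hE _ _ _).2⟩

end Continuity

theorem contDiffOn_one_of_hasDerivAt {φ φ' : ℝ → ℂ} {s : Set ℝ} (hs : IsOpen s)
    (h : ∀ t ∈ s, HasDerivAt φ (φ' t) t) (hc : ContinuousOn φ' s) : ContDiffOn ℝ 1 φ s := by
  have h1 := (contDiffOn_succ_iff_deriv_of_isOpen (𝕜 := ℝ) (n := 0) (f := φ) hs).2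
    ⟨fun t ht => (h t ht).differentiableAt.differentiableWithinAt, by simp,
      contDiffOn_zero.2 (hc.congr fun t ht => (h t ht).deriv)⟩
  simpa using h1

/-! ### The constructed solution -/

section Solution

variable {f g h : Bool → ℕ → ℝ → ℂ} {n₀ : ℤ} {a b : ℝ}

variable (S f g h n₀) in
/-- The orbits of the triples that encode the state of the flow at the initial lattice point. -/
def flowOrbit (t : ℝ) (n : ℤ) : PolyTriple :=
  S.orbit (S.polyTriple (S.initF f t, S.initG g t, S.initH h t)) n₀ n

theorem flowOrbit_self (t : ℝ) : S.flowOrbit f g h n₀ t n₀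
    = S.polyTriple (S.initF f t, S.initG g t, S.initH h t) := orbit_self _ _

theorem laurentTriple_flowOrbit_self (t : ℝ) : S.laurentTriple (S.flowOrbit f g h n₀ t n₀)
    = (S.initF f t, S.initG g t, S.initH h t) := by
  rw [flowOrbit_self]
  exact S.laurentTriple_polyTriple _ _ _

/-- A state of the flow at which the initial triple is regular. -/
structure IsRegularState (S : SpectralData) (f g h : Bool → ℕ → ℝ → ℂ) (n₀ : ℤ) (t : ℝ) : Prop where
  ext : ∀ n, S.extFGH f g h n₀ t n = S.laurentTriple (S.flowOrbit f g h n₀ t n)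
  regular : ∀ n, ∃ D, S.IsRegular (S.flowOrbit f g h n₀ t n) D
  orbit : S.IsOrbit (S.solA f g h n₀ t) (S.solB f g h n₀ t) (S.flowOrbit f g h n₀ t)

/-- Regularity of the initial triple alone suffices: it propagates along the lattice and identifies
the Laurent algorithm with the polynomial orbit. -/
theorem isRegularState {t : ℝ} {D : Sym S.Point S.p}
    (hD : S.IsRegular (S.polyTriple (S.initF f t, S.initG g t, S.initH h t)) D) :
    S.IsRegularState f g h n₀ t := by
  have e : ∀ n, S.extFGH f g h n₀ t n = S.laurentTriple (S.flowOrbit f g h n₀ t n) := by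
    intro n
    rw [flowOrbit, hD.laurentTriple_orbit, extFGH]
    congr 1
    exact (S.laurentTriple_polyTriple _ _ _).symm
  refine ⟨e, hD.orbit n₀, ?_⟩
  have h1 := hD.isOrbit n₀
  have hα : S.solA f g h n₀ t = fun n => S.tripleAlpha (S.flowOrbit f g h n₀ t n) := by
    funext n
    rw [solA, e, alphaOf_laurentTriple]
  have hβ : S.solB f g h n₀ t = fun n => S.tripleBeta (S.flowOrbit f g h n₀ t n) := by
    funext n
    rw [solB, e, betaOf_laurentTriple]
  rw [hα, hβ]
  exact h1

variable {t : ℝ}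

theorem IsRegularState.one_sub_ne_zero (hS : S.IsRegularState f g h n₀ t) (n : ℤ) :
    1 - S.solA f g h n₀ t n * S.solB f g h n₀ t n ≠ 0 := by
  obtain ⟨D, hD⟩ := hS.regular n
  obtain ⟨e1, e2⟩ := hS.orbit.tripleAlpha_eq n
  rw [← e1, ← e2]
  exact hD.down.1

theorem IsRegularState.nondegenerate (hS : S.IsRegularState f g h n₀ t) (n : ℤ) :
    S.solA f g h n₀ t n * S.solB f g h n₀ t n ≠ 0 ∧
      S.solA f g h n₀ t n * S.solB f g h n₀ t n ≠ 1 := by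
  refine ⟨?_, fun e => hS.one_sub_ne_zero n (by rw [e, sub_self])⟩
  obtain ⟨D, hD⟩ := hS.regular n
  obtain ⟨e1, e2⟩ := hS.orbit.tripleAlpha_eq n
  rw [← e1, ← e2]
  exact mul_ne_zero hD.tripleAlpha_ne_zero hD.tripleBeta_ne_zero

theorem IsRegularState.stationary (hS : S.IsRegularState f g h n₀ t) :
    S.IsStationarySolution (S.solA f g h n₀ t) (S.solB f g h n₀ t) ∧
      ∀ n : ℤ,
        S.extF f g h n₀ t n = Fpoly S.summ (S.solA f g h n₀ t) (S.solB f g h n₀ t) S.deg n ∧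
        S.extG f g h n₀ t n = Gpoly S.summ (S.solA f g h n₀ t) (S.solB f g h n₀ t) S.deg n ∧
        S.extH f g h n₀ t n = Hpoly S.summ (S.solA f g h n₀ t) (S.solB f g h n₀ t) S.deg n := by
  refine ⟨hS.orbit.isStationarySolution (fun n => (hS.nondegenerate n).1)
    fun n => (hS.nondegenerate n).2, fun n => ?_⟩
  rw [hS.orbit.Fpoly_eq, hS.orbit.Gpoly_eq, hS.orbit.Hpoly_eq, extF, extG, extH, hS.ext]
  exact ⟨rfl, rfl, rfl⟩

theorem IsRegularState.dirichlet (hS : S.IsRegularState f g h n₀ t) (n : ℤ) :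
    ∃ D : Sym S.Point S.p,
      S.IsDirichletDivisor (S.extF f g h n₀ t n) (S.extG f g h n₀ t n) D ∧
      S.IsStationaryData (S.solA f g h n₀ t n) D (S.extF f g h n₀ t n) (S.extG f g h n₀ t n)
        (S.extH f g h n₀ t n) ∧
      S.solA f g h n₀ t (n + 1) = S.solA f g h n₀ t n * S.sqrtProdE
        * ((D : Multiset S.Point).map fun P => P.z⁻¹).prod ∧
      S.solA f g h n₀ t (n + 1) * S.solB f g h n₀ t n = S.alphaNextBeta D := by
  obtain ⟨D, hD⟩ := hS.regular n
  have hX := hD.triple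
  have hd := hD.isDirichletDivisor
  obtain ⟨e1, e2⟩ := hS.orbit.tripleAlpha_eq n
  have hl := hS.orbit.link (n + 1)
  rw [add_sub_cancel_right] at hl
  have e3 := (hX.link_values (hS.orbit.triple (n + 1)) hl).2.2.1
  refine ⟨D, ?_, ?_, ?_, ?_⟩
  · rw [extF, extG, hS.ext]
    exact hd
  · rw [extF, extG, extH, hS.ext, ← e1]
    exact hX.isStationaryData hd
  · rw [← e3, ← e1, ← (hX.alphaNext_eq hd).1, alphaNext]
  · rw [← e3, ← e2, hX.alphaNextBeta_eq hd]

/-- A stationary solution generates an orbit of triples. At `n₀` its triple has the same `α` and the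
same Dirichlet divisor, hence is the same triple, and the links determine the rest. -/
theorem IsRegularState.unique (hS : S.IsRegularState f g h n₀ t) {D : Sym S.Point S.p}
    (hD : S.IsDirichletDivisor (S.initF f t) (S.initG g t) D) {α β : ℤ → ℂ}
    (hs : S.IsStationarySolution α β) (hα : α n₀ = S.solA f g h n₀ t n₀)
    (hd : S.IsDirichletDivisor (Fpoly S.summ α β S.deg n₀) (Gpoly S.summ α β S.deg n₀) D) :
    S.solA f g h n₀ t = α ∧ S.solB f g h n₀ t = β := by
  obtain ⟨Y, hY, hL⟩ := hs.exists_isOrbit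
  have h0 : Y n₀ = S.flowOrbit f g h n₀ t n₀ := by
    refine (hY.triple n₀).ext_of_isDirichletDivisor (hS.orbit.triple n₀) (D := D) ?_ ?_ ?_
    · rw [hL]; exact hd
    · rw [laurentTriple_flowOrbit_self]; exact hD
    · rw [(hY.tripleAlpha_eq n₀).1, (hS.orbit.tripleAlpha_eq n₀).1, hα]
  have h1 : ∀ n, Y n = S.flowOrbit f g h n₀ t n := by
    intro n
    rw [hY.eq_orbit hs.ne_one n₀ n, h0,
      hS.orbit.eq_orbit (fun n => (hS.nondegenerate n).2) n₀ n]
  constructor <;> funext n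
  · rw [← (hS.orbit.tripleAlpha_eq n).1, ← h1, (hY.tripleAlpha_eq n).1]
  · rw [← (hS.orbit.tripleAlpha_eq n).2, ← h1, (hY.tripleAlpha_eq n).2]

theorem IsRegularState.matV_eq (hS : S.IsRegularState f g h n₀ t) (z : ℂˣ) (n : ℤ) :
    S.matV f g h n₀ z n t
      = Vmat z (fun n => (S.laurentTriple (S.flowOrbit f g h n₀ t n)).1)
        (fun n => (S.laurentTriple (S.flowOrbit f g h n₀ t n)).2.1)
        (fun n => (S.laurentTriple (S.flowOrbit f g h n₀ t n)).2.2)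
        (fun n => (S.laurentTriple (S.flowOrbit f g h n₀ t n)).2.1) n := by
  have e1 : S.extF f g h n₀ t = fun n => (S.laurentTriple (S.flowOrbit f g h n₀ t n)).1 :=
    funext fun n => by rw [extF, hS.ext]
  have e2 : S.extG f g h n₀ t = fun n => (S.laurentTriple (S.flowOrbit f g h n₀ t n)).2.1 :=
    funext fun n => by rw [extG, hS.ext]
  have e3 : S.extH f g h n₀ t = fun n => (S.laurentTriple (S.flowOrbit f g h n₀ t n)).2.2 :=
    funext fun n => by rw [extH, hS.ext]
  rw [matV, e1, e2, e3]

theorem IsLax.ablowitzLadik {n : ℤ} (hL : S.IsLax r ct (S.flowOrbit f g h n₀) t n)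
    (hS : ∀ᶠ τ in 𝓝 t, S.IsRegularState f g h n₀ τ) :
    HasDerivAt (fun τ => S.solA f g h n₀ τ n)
        (-Complex.I * sAL₁ ct (S.solA f g h n₀ t) (S.solB f g h n₀ t) r n) t ∧
      HasDerivAt (fun τ => S.solB f g h n₀ τ n)
        (-Complex.I * sAL₂ ct (S.solA f g h n₀ t) (S.solB f g h n₀ t) r n) t :=
  hL.hasDerivAt (hS.mono fun _ hτ => hτ.orbit)

/-- The equation for `U` reduces to the Ablowitz-Ladik equations, that for `U V` to the links, and
that for `V` to the Lax equations at `n - 1`, since `V` at `n` is built from the triple at `n - 1`.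
-/
theorem zero_curvature (hL : ∀ n, S.IsLax r ct (S.flowOrbit f g h n₀) t n)
    (hS : ∀ᶠ τ in 𝓝 t, S.IsRegularState f g h n₀ τ) (n : ℤ) (z : ℂˣ) :
    (∃ U' : Matrix (Fin 2) (Fin 2) ℂ,
      (∀ i j, HasDerivAt (fun τ => S.matU f g h n₀ z n τ i j) (U' i j) t) ∧
      U' + S.matU f g h n₀ z n t * S.matVt f g h n₀ r ct z n t
        - S.matVt f g h n₀ r ct z (n + 1) t * S.matU f g h n₀ z n t = 0) ∧
    S.matU f g h n₀ z n t * S.matV f g h n₀ z n t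
      - S.matV f g h n₀ z (n + 1) t * S.matU f g h n₀ z n t = 0 ∧
    (∃ V' : Matrix (Fin 2) (Fin 2) ℂ,
      (∀ i j, HasDerivAt (fun τ => S.matV f g h n₀ z n τ i j) (V' i j) t) ∧
      V' - (S.matVt f g h n₀ r ct z n t * S.matV f g h n₀ z n t
        - S.matV f g h n₀ z n t * S.matVt f g h n₀ r ct z n t) = 0) := by
  have hSt := hS.self_of_nhds
  obtain ⟨da, db⟩ := (hL n).ablowitzLadik hS
  refine ⟨⟨_, hasDerivAt_Umat da db z, ?_⟩, ?_, ⟨Vmat z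
    (fun n => S.laxF r ct (S.laurentTriple (S.flowOrbit f g h n₀ t n)).1
      (S.laurentTriple (S.flowOrbit f g h n₀ t n)).2.1)
    (fun n => S.laxG r ct (S.laurentTriple (S.flowOrbit f g h n₀ t n)).1
      (S.laurentTriple (S.flowOrbit f g h n₀ t n)).2.2)
    (fun n => S.laxH r ct (S.laurentTriple (S.flowOrbit f g h n₀ t n)).2.1
      (S.laurentTriple (S.flowOrbit f g h n₀ t n)).2.2)
    (fun n => S.laxG r ct (S.laurentTriple (S.flowOrbit f g h n₀ t n)).1
      (S.laurentTriple (S.flowOrbit f g h n₀ t n)).2.2) n, fun i j => ?_, ?_⟩⟩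
  · rw [add_sub_assoc, matU, matVt, matVt, Umat_mul_Vmat_lattice]
    ext i j
    fin_cases i <;> fin_cases j <;> simp
    ring
  · rw [hSt.matV_eq, hSt.matV_eq]
    exact (hSt.orbit.link n).Umat_mul_Vmat z
  · refine (hasDerivAt_Vmat
      (F := fun τ n => (S.laurentTriple (S.flowOrbit f g h n₀ τ n)).1)
      (G := fun τ n => (S.laurentTriple (S.flowOrbit f g h n₀ τ n)).2.1)
      (H := fun τ n => (S.laurentTriple (S.flowOrbit f g h n₀ τ n)).2.2)
      (F' := fun n => S.laxF r ct (S.laurentTriple (S.flowOrbit f g h n₀ t n)).1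
        (S.laurentTriple (S.flowOrbit f g h n₀ t n)).2.1)
      (G' := fun n => S.laxG r ct (S.laurentTriple (S.flowOrbit f g h n₀ t n)).1
        (S.laurentTriple (S.flowOrbit f g h n₀ t n)).2.2)
      (H' := fun n => S.laxH r ct (S.laurentTriple (S.flowOrbit f g h n₀ t n)).2.1
        (S.laurentTriple (S.flowOrbit f g h n₀ t n)).2.2) (hL (n - 1)).F (hL (n - 1)).G (hL (n - 1)).H z i j).congr_of_eventuallyEq
      ?_
    filter_upwards [hS] with τ hτ
    rw [hτ.matV_eq]
  · rw [hSt.matV_eq]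
    exact hSt.orbit.lax_matrix z n

end Solution

end SpectralData

end AblowitzLadik

end

/-! ### Regularity and Lax equations for the given flow -/

noncomputable section

open Polynomial

namespace AblowitzLadik

open Filter Topology

namespace SpectralData

variable {S : SpectralData} {r : Bool → ℕ} {ct : Bool → ℕ → ℂ}

section Existence

variable {f g h : Bool → ℕ → ℝ → ℂ} {n₀ : ℤ} {a b t₀ : ℝ}

/-- The initial triple is a curve triple with the prescribed value of `α`. -/
theorem initial_isCurveTriple {D : ℝ → Sym S.Point S.p} {a₀ : ℂ}
    (hD : S.IsDirichletDivisor (S.initF f t₀) (S.initG g t₀) (D t₀)) (ha₀ : a₀ ≠ 0)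
    (hinit : S.IsStationaryData a₀ (D t₀) (S.initF f t₀) (S.initG g t₀) (S.initH h t₀)) :
    S.IsCurveTriple (S.polyTriple (S.initF f t₀, S.initG g t₀, S.initH h t₀)) ∧
      S.tripleAlpha (S.polyTriple (S.initF f t₀, S.initG g t₀, S.initH h t₀)) = a₀ := by
  have hL : S.laurentTriple (S.polyTriple (S.initF f t₀, S.initG g t₀, S.initH h t₀))
      = (S.initF f t₀, S.initG g t₀, S.initH h t₀) := S.laurentTriple_polyTriple _ _ _
  refine isCurveTriple_of_isStationaryData (D := D t₀) (fun N hN => coeff_polyTriple_F hN)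
    (fun N hN => coeff_polyTriple_G hN) (fun N hN => coeff_polyTriple_H hN) ha₀ ?_ ?_
  · rw [hL]; exact hinit
  · rw [hL]; exact hD

/-- The triples of the flow are regular at all times. -/
theorem isRegularState_of_flow
    (hf : ∀ t ∈ Set.Ioo a b, ∀ s, ∀ ℓ < S.deg s,
      HasDerivAt (f s ℓ) (S.odeF r ct (fun s k => f s k t) (fun s k => g s k t) s ℓ) t)
    (hg : ∀ t ∈ Set.Ioo a b, ∀ s, ∀ ℓ ≤ S.deg s,
      HasDerivAt (g s ℓ) (S.odeG r ct (fun s k => f s k t) (fun s k => h s k t) s ℓ) t)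
    (hh : ∀ t ∈ Set.Ioo a b, ∀ s, ∀ ℓ < S.deg s,
      HasDerivAt (h s ℓ) (S.odeH r ct (fun s k => g s k t) (fun s k => h s k t) s ℓ) t)
    {D : ℝ → Sym S.Point S.p}
    (hD : ∀ t ∈ Set.Ioo a b, D t ∈ S.M₀ ∧ S.IsDirichletDivisor (S.initF f t) (S.initG g t) (D t))
    (ht₀ : t₀ ∈ Set.Ioo a b) {a₀ : ℂ} (ha₀ : a₀ ≠ 0)
    (hinit : S.IsStationaryData a₀ (D t₀) (S.initF f t₀) (S.initG g t₀) (S.initH h t₀))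
    {t : ℝ} (ht : t ∈ Set.Ioo a b) : S.IsRegularState f g h n₀ t := by
  have hL : ∀ τ, S.laurentTriple (S.polyTriple (S.initF f τ, S.initG g τ, S.initH h τ))
      = (S.initF f τ, S.initG g τ, S.initH h τ) := fun τ => S.laurentTriple_polyTriple _ _ _
  -- The curve equation and the normalization are carried over from `t₀` by the flow; at time `t`
  -- the condition `D t ∈ M₀` then gives regularity.
  have hX : S.IsCurveTriple (S.polyTriple (S.initF f t, S.initG g t, S.initH h t)) :=
    isCurveTriple_of_lax (F := S.initF f) (G := S.initG g) (H := S.initH h)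
      (X := fun τ => S.polyTriple (S.initF f τ, S.initG g τ, S.initH h τ)) (fun _ => rfl) hL
      (fun τ => S.inRange_laurent _ _ _) (fun τ hτ => hasLDerivAt_initF (hf τ hτ))
      (fun τ hτ => hasLDerivAt_initG (hg τ hτ)) (fun τ hτ => hasLDerivAt_initH (hh τ hτ)) ht₀
      (initial_isCurveTriple (hD t₀ ht₀).2 ha₀ hinit).1 ht
  refine isRegularState (D := D t) (hX.isRegular (hD t ht).1 ?_)
  rw [hL]
  exact (hD t ht).2

/-- The triples of the flow satisfy the Lax equations at all lattice points. -/
theorem isLax_of_flow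
    (hf : ∀ t ∈ Set.Ioo a b, ∀ s, ∀ ℓ < S.deg s,
      HasDerivAt (f s ℓ) (S.odeF r ct (fun s k => f s k t) (fun s k => g s k t) s ℓ) t)
    (hg : ∀ t ∈ Set.Ioo a b, ∀ s, ∀ ℓ ≤ S.deg s,
      HasDerivAt (g s ℓ) (S.odeG r ct (fun s k => f s k t) (fun s k => h s k t) s ℓ) t)
    (hh : ∀ t ∈ Set.Ioo a b, ∀ s, ∀ ℓ < S.deg s,
      HasDerivAt (h s ℓ) (S.odeH r ct (fun s k => g s k t) (fun s k => h s k t) s ℓ) t)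
    {D : ℝ → Sym S.Point S.p}
    (hD : ∀ t ∈ Set.Ioo a b, D t ∈ S.M₀ ∧ S.IsDirichletDivisor (S.initF f t) (S.initG g t) (D t))
    (ht₀ : t₀ ∈ Set.Ioo a b) {a₀ : ℂ} (ha₀ : a₀ ≠ 0)
    (hinit : S.IsStationaryData a₀ (D t₀) (S.initF f t₀) (S.initG g t₀) (S.initH h t₀))
    {t : ℝ} (ht : t ∈ Set.Ioo a b) (n : ℤ) :
    S.IsLax r ct (S.flowOrbit f g h n₀) t n := by
  -- The propagation step differentiates the link relations, so these must hold in a neighbourhood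
  -- of `t`; the interval is open.
  have hS : ∀ᶠ τ in 𝓝 t, S.IsRegularState f g h n₀ τ := by
    filter_upwards [isOpen_Ioo.mem_nhds ht] with τ hτ using
      isRegularState_of_flow hf hg hh hD ht₀ ha₀ hinit hτ
  refine IsLax.all (n₀ := n₀) ?_ (hS.mono fun _ hτ => hτ.orbit)
    (hS.mono fun _ hτ => hτ.one_sub_ne_zero) n
  have e : ∀ τ, S.laurentTriple (S.flowOrbit f g h n₀ τ n₀)
      = (S.initF f τ, S.initG g τ, S.initH h τ) := laurentTriple_flowOrbit_self
  constructor <;> simp only [e]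
  · exact hasLDerivAt_initF (hf t ht)
  · exact hasLDerivAt_initG (hg t ht)
  · exact hasLDerivAt_initH (hh t ht)

end Existence

end SpectralData

end AblowitzLadik

end

/-! ### Assembly of the theorem -/

theorem theorem6p4
    -- curve, degrees and constants of the stationary hierarchy; index and constants of the flow
    (S : SpectralData) (r : Bool → ℕ) (ct : Bool → ℕ → ℂ)
    (n₀ : ℤ) (t₀ T₀ : ℝ) (hT₀ : 0 < T₀)
    -- the coefficients at `n₀` as functions of time
    (f g h : Bool → ℕ → ℝ → ℂ)
    -- the autonomous system
    (hf : ∀ t ∈ Set.Ioo (t₀ - T₀) (t₀ + T₀), ∀ s, ∀ ℓ < S.deg s,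
      HasDerivAt (f s ℓ) (S.odeF r ct (fun s k => f s k t) (fun s k => g s k t) s ℓ) t)
    (hg : ∀ t ∈ Set.Ioo (t₀ - T₀) (t₀ + T₀), ∀ s, ∀ ℓ ≤ S.deg s,
      HasDerivAt (g s ℓ) (S.odeG r ct (fun s k => f s k t) (fun s k => h s k t) s ℓ) t)
    (hh : ∀ t ∈ Set.Ioo (t₀ - T₀) (t₀ + T₀), ∀ s, ∀ ℓ < S.deg s,
      HasDerivAt (h s ℓ) (S.odeH r ct (fun s k => g s k t) (fun s k => h s k t) s ℓ) t)
    -- the Dirichlet divisors at `n₀` exist and belong to `M₀`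
    (D : ℝ → Sym S.Point S.p)
    (hD : ∀ t ∈ Set.Ioo (t₀ - T₀) (t₀ + T₀), D t ∈ S.M₀ ∧
      S.IsDirichletDivisor (S.initF f t) (S.initG g t) (D t))
    -- the initial values are those determined by the initial divisor and `α(n₀, t₀) = a₀`
    (a₀ : ℂ) (ha₀ : a₀ ≠ 0)
    (hinit : S.IsStationaryData a₀ (D t₀) (S.initF f t₀) (S.initG g t₀) (S.initH h t₀))
    (hinit_g : g false (S.deg false) t₀ = g true (S.deg true) t₀) :
    -- zero-curvature equations
    (∀ t ∈ Set.Ioo (t₀ - T₀) (t₀ + T₀), ∀ (n : ℤ) (z : ℂˣ),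
      (∃ U' : Matrix (Fin 2) (Fin 2) ℂ,
        (∀ i j, HasDerivAt (fun τ => S.matU f g h n₀ z n τ i j) (U' i j) t) ∧
        U' + S.matU f g h n₀ z n t * S.matVt f g h n₀ r ct z n t
          - S.matVt f g h n₀ r ct z (n + 1) t * S.matU f g h n₀ z n t = 0) ∧
      S.matU f g h n₀ z n t * S.matV f g h n₀ z n t
        - S.matV f g h n₀ z (n + 1) t * S.matU f g h n₀ z n t = 0 ∧
      (∃ V' : Matrix (Fin 2) (Fin 2) ℂ,
        (∀ i j, HasDerivAt (fun τ => S.matV f g h n₀ z n τ i j) (V' i j) t) ∧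
        V' - (S.matVt f g h n₀ r ct z n t * S.matV f g h n₀ z n t
          - S.matV f g h n₀ z n t * S.matVt f g h n₀ r ct z n t) = 0)) ∧
    -- regularity and nondegeneracy of `α, β`
    (∀ n : ℤ,
      ContDiffOn ℝ 1 (fun t => S.solA f g h n₀ t n) (Set.Ioo (t₀ - T₀) (t₀ + T₀)) ∧
      ContDiffOn ℝ 1 (fun t => S.solB f g h n₀ t n) (Set.Ioo (t₀ - T₀) (t₀ + T₀))) ∧
    (∀ t ∈ Set.Ioo (t₀ - T₀) (t₀ + T₀), ∀ n : ℤ,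
      S.solA f g h n₀ t n * S.solB f g h n₀ t n ≠ 0 ∧
      S.solA f g h n₀ t n * S.solB f g h n₀ t n ≠ 1) ∧
    -- the time-dependent Ablowitz-Ladik system
    (∀ t ∈ Set.Ioo (t₀ - T₀) (t₀ + T₀), ∀ n : ℤ,
      -Complex.I * deriv (fun τ => S.solA f g h n₀ τ n) t
        + sAL₁ ct (S.solA f g h n₀ t) (S.solB f g h n₀ t) r n = 0 ∧
      -Complex.I * deriv (fun τ => S.solB f g h n₀ τ n) t
        + sAL₂ ct (S.solA f g h n₀ t) (S.solB f g h n₀ t) r n = 0) ∧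
    -- the stationary system (at all times, in particular at `t₀`), with `F, G, H` as its polynomials
    (∀ t ∈ Set.Ioo (t₀ - T₀) (t₀ + T₀),
      S.IsStationarySolution (S.solA f g h n₀ t) (S.solB f g h n₀ t) ∧
      ∀ n : ℤ,
        S.extF f g h n₀ t n = Fpoly S.summ (S.solA f g h n₀ t) (S.solB f g h n₀ t) S.deg n ∧
        S.extG f g h n₀ t n = Gpoly S.summ (S.solA f g h n₀ t) (S.solB f g h n₀ t) S.deg n ∧
        S.extH f g h n₀ t n = Hpoly S.summ (S.solA f g h n₀ t) (S.solB f g h n₀ t) S.deg n) ∧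
    -- the initial condition: any stationary solution with the given initial data is attained at `t₀`
    S.solA f g h n₀ t₀ n₀ = a₀ ∧
    (∀ α₀ β₀ : ℤ → ℂ, S.IsStationarySolution α₀ β₀ → α₀ n₀ = a₀ →
      S.IsDirichletDivisor (Fpoly S.summ α₀ β₀ S.deg n₀) (Gpoly S.summ α₀ β₀ S.deg n₀) (D t₀) →
      S.solA f g h n₀ t₀ = α₀ ∧ S.solB f g h n₀ t₀ = β₀) ∧
    -- the Dirichlet divisors at all lattice points and the formulas for `α⁺` and `α⁺ β`
    (∀ t ∈ Set.Ioo (t₀ - T₀) (t₀ + T₀), ∀ n : ℤ, ∃ Dn : Sym S.Point S.p,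
      S.IsDirichletDivisor (S.extF f g h n₀ t n) (S.extG f g h n₀ t n) Dn ∧
      S.IsStationaryData (S.solA f g h n₀ t n) Dn (S.extF f g h n₀ t n) (S.extG f g h n₀ t n)
        (S.extH f g h n₀ t n) ∧
      S.solA f g h n₀ t (n + 1) = S.solA f g h n₀ t n * S.sqrtProdE
        * ((Dn : Multiset S.Point).map fun P => P.z⁻¹).prod ∧
      S.solA f g h n₀ t (n + 1) * S.solB f g h n₀ t n = S.alphaNextBeta Dn) := by
  have ht₀ : t₀ ∈ Set.Ioo (t₀ - T₀) (t₀ + T₀) := ⟨by linarith, by linarith⟩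
  have hS : ∀ t ∈ Set.Ioo (t₀ - T₀) (t₀ + T₀), S.IsRegularState f g h n₀ t := fun t ht =>
    SpectralData.isRegularState_of_flow hf hg hh hD ht₀ ha₀ hinit ht
  have hL : ∀ t ∈ Set.Ioo (t₀ - T₀) (t₀ + T₀), ∀ n, S.IsLax r ct (S.flowOrbit f g h n₀) t n :=
    fun t ht => SpectralData.isLax_of_flow hf hg hh hD ht₀ ha₀ hinit ht
  have hSn : ∀ t ∈ Set.Ioo (t₀ - T₀) (t₀ + T₀),
      ∀ᶠ τ in nhds t, S.IsRegularState f g h n₀ τ := fun t ht =>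
    Filter.mem_of_superset (isOpen_Ioo.mem_nhds ht) hS
  have hAL := fun t (ht : t ∈ Set.Ioo (t₀ - T₀) (t₀ + T₀)) (n : ℤ) =>
    (hL t ht n).ablowitzLadik (hSn t ht)
  have hα : S.solA f g h n₀ t₀ n₀ = a₀ := by
    rw [← ((hS t₀ ht₀).orbit.tripleAlpha_eq n₀).1, SpectralData.flowOrbit_self]
    exact (SpectralData.initial_isCurveTriple (hD t₀ ht₀).2 ha₀ hinit).2
  -- Differentiability gives continuity of `α` and `β`, hence of the right-hand sides of their
  -- equations, hence continuous differentiability.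
  have hcα : ∀ n, ContinuousOn (fun τ => S.solA f g h n₀ τ n) (Set.Ioo (t₀ - T₀) (t₀ + T₀)) :=
    fun n t ht => (hAL t ht n).1.continuousAt.continuousWithinAt
  have hcβ : ∀ n, ContinuousOn (fun τ => S.solB f g h n₀ τ n) (Set.Ioo (t₀ - T₀) (t₀ + T₀)) :=
    fun n t ht => (hAL t ht n).2.continuousAt.continuousWithinAt
  refine ⟨fun t ht n z => SpectralData.zero_curvature (hL t ht) (hSn t ht) n z, fun n => ⟨?_, ?_⟩,
    fun t ht => (hS t ht).nondegenerate, fun t ht n => ?_, fun t ht => (hS t ht).stationary, hα,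
    fun α₀ β₀ hs h1 h2 => (hS t₀ ht₀).unique (hD t₀ ht₀).2 hs (h1.trans hα.symm) h2,
    fun t ht => (hS t ht).dirichlet⟩
  · exact SpectralData.contDiffOn_one_of_hasDerivAt isOpen_Ioo (fun t ht => (hAL t ht n).1)
      (continuousOn_const.mul (SpectralData.continuousOn_sAL hcα hcβ ct r n).1)
  · exact SpectralData.contDiffOn_one_of_hasDerivAt isOpen_Ioo (fun t ht => (hAL t ht n).2)
      (continuousOn_const.mul (SpectralData.continuousOn_sAL hcα hcβ ct r n).2)
  -- The derivatives are `-i` times the Ablowitz-Ladik expressions, so the claim is `(-i)² = -1`.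
  · rw [(hAL t ht n).1.deriv, (hAL t ht n).2.deriv]
    constructor
    · linear_combination sAL₁ ct (S.solA f g h n₀ t) (S.solB f g h n₀ t) r n * Complex.I_mul_I
    · linear_combination sAL₂ ct (S.solA f g h n₀ t) (S.solB f g h n₀ t) r n * Complex.I_mul_I
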